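/- **Setting.** Let $\mathcal T$ be the vertex set of the rooted tree in which every vertex has exactly $K>1$ children, with root $0$, and $|x|:=\mathrm{dist}(0,x)$. For $\lambda\ge 0$ let $H_\lambda=T+\lambda V$ on $\ell^2(\mathcal T)$, where $T$ is the adjacency operator, $(T\psi)(x)=\sum_{\mathrm{dist}(x,y)=1}\psi(y)$, and $V$ is multiplication by i.i.d. real random variables $V(x)$, $x\in\mathcal T$, with law $\varrho(v)\,dv$. Assume that $\varrho\in L^\infty(\mathbb R)$, that $\int|v|^{\varsigma}\varrho(v)\,dv<\infty$ for some fixed $\varsigma\in(0,1)$, and that for some $c<\infty$, for almost every $v$, $$\varrho(v)\le c\,\inf_{\nu\in(0,1]}\frac1{2\nu}\int_{|u-v|\le\nu}\varrho(u)\,du .$$ For $\zeta\in\mathbb C^+=\{\mathrm{Im}\,\zeta>0\}$ let $G_\lambda(x,y;\zeta)=\langle\delta_x,(H_\lambda-\zeta)^{-1}\delta_y\rangle$. For real $E$ let $G_\lambda(x,y;E)$ denote the boundary value $G_\lambda(x,y;E+i0)=\lim_{\eta\downarrow0}G_\lambda(x,y;E+i\eta)$. For $\zeta$ in $\mathbb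 C^+$ or real put $$L_\lambda(\zeta):=-\mathbb E\big[\log|G_\lambda(0,0;\zeta)|\big],\qquad \varphi_\lambda(s;\zeta):=\lim_{|x|\to\infty}\frac1{|x|}\log\mathbb E\big[|G_\lambda(0,x;\zeta)|^s\big].$$ **Theorem.** There are constants $C_\pm(s;\zeta)\in(0,\infty)$, not depending on $x$, which for each fixed $s\in[-\varsigma,1)$ and each compact $A\subset\mathbb R$ are bounded uniformly in $\zeta\in A+i[0,1]$, such that the following holds. 1. For every $\zeta\in\mathbb C^+$ and every $s\in[-\varsigma,\infty)$ the limit $\varphi_\lambda(s;\zeta)$ exists and is finite, $\log|G_\lambda(0,0;\zeta)|$ is integrable, and - (a) $s\mapsto\varphi_\lambda(s;\zeta)$ is convex and non-increasing on $[-\varsigma,\infty)$; - (b) $-s\,L_\lambda(\zeta)\le\varphi_\lambda(s;\zeta)\le-s\log\sqrt K$ for all $s\in[0,2]$; - (c) for all $s\in[-\varsigma,\infty)$ and all $x\in\mathcal T$, $$C_\pm(s;\zeta)^{-2}\,e^{|x|\varphi_\lambda(s;\zeta)}\le\mathbb E\big[|G_\lambda(0,x;\zeta)|^s\big]\le C_\pm(s;\zeta)^{2}\,e^{|x|\varphi_\lambda(s;\zeta)};$$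 - (d) $\dfrac{\partial\varphi_\lambda}{\partial s}(0;\zeta)=-L_\lambda(\zeta)$. 2. For Lebesgue-almost every $E\in\mathbb R$: almost surely the boundary values $G_\lambda(0,x;E+i0)$ exist for all $x\in\mathcal T$; for all $s\in[-\varsigma,1)$ the limit $\varphi_\lambda(s;E)$ exists and is finite; and $$\varphi_\lambda(s;E)=\lim_{\eta\downarrow0}\varphi_\lambda(s;E+i\eta)=\lim_{\substack{|x|\to\infty\\ \eta\downarrow0}}\frac1{|x|}\log\mathbb E\big[|G_\lambda(0,x;E+i\eta)|^s\big],$$ where the last limit is a joint limit. Moreover $\lim_{\eta\downarrow0}\mathbb E[|G_\lambda(0,x;E+i\eta)|^s]=\mathbb E[|G_\lambda(0,x;E+i0)|^s]$ for every $x\in\mathcal T$, so that the limits $\eta\downarrow0$ and $|x|\to\infty$ commute. In addition $\log|G_\lambda(0,0;E+i0)|$ is integrable, $s\mapsto\varphi_\lambda(s;E)$ is convex and non-increasing on $[-\varsigma,1)$, (b) holds at $\zeta=E$ for $s\in[0,1)$, (c) holds at $\zeta=E$ for $s\in[-\varsigma,1)$ and all $x\in\mathcal T$, and $\frac{\partial\varphi_\lambda}{\partial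 s}(0;E)=-L_\lambda(E)$. -/

import Mathlib

open scoped ENNReal Topology
open Filter MeasureTheory

noncomputable section

namespace TreeAnderson

/-! ### The rooted regular tree -/

/-- Vertices of the rooted tree in which every vertex has exactly `K` children: a vertex is the
word recording the path from the root to it (most recent step first). -/
abbrev Vertex (K : ℕ) : Type := List (Fin K)

/-- The root `0`. -/
abbrev root (K : ℕ) : Vertex K := []

/-- The rooted tree graph with branching number `K`: the children of `x` are the words `i :: x`. -/
def regularTree (K : ℕ) : SimpleGraph (Vertex K) where
  Adj x y := (∃ i, y = i :: x) ∨ (∃ i, x = i :: y)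
  symm := ⟨fun _ _ h => h.symm⟩
  loopless := ⟨by
    rintro x (⟨i, h⟩ | ⟨i, h⟩) <;> simpa using congrArg List.length h⟩

theorem neighborSet_finite (K : ℕ) (x : Vertex K) : ((regularTree K).neighborSet x).Finite := by
  refine ((Set.finite_range (fun i : Fin K => i :: x)).union
    (Set.finite_singleton x.tail)).subset ?_
  rintro y (⟨i, rfl⟩ | ⟨i, rfl⟩)
  · exact Or.inl ⟨i, rfl⟩
  · exact Or.inr rfl

instance (K : ℕ) : (regularTree K).LocallyFinite := fun x => (neighborSet_finite K x).fintype

/-- `|x|`, the graph distance of `x` to the root. -/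
def level {K : ℕ} (x : Vertex K) : ℕ := (regularTree K).dist (root K) x

theorem regularTree_reachable {K : ℕ} (x : Vertex K) :
    ∃ w : (regularTree K).Walk (root K) x, w.length = x.length := by
  induction x with
  | nil => exact ⟨SimpleGraph.Walk.nil, rfl⟩
  | cons i x ih =>
    obtain ⟨w, hw⟩ := ih
    have h : (regularTree K).Adj x (i :: x) := Or.inl ⟨i, rfl⟩
    exact ⟨w.concat h, by simp [SimpleGraph.Walk.length_concat, hw]⟩

theorem length_le_walk {K : ℕ} {x y : Vertex K} (w : (regularTree K).Walk x y) :
    y.length ≤ x.length + w.length := by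
  induction w with
  | nil => simp
  | cons h w ih =>
    rw [SimpleGraph.Walk.length_cons]
    rcases h with ⟨i, h⟩ | ⟨i, h⟩ <;>
    · have := congrArg List.length h
      rw [List.length_cons] at this
      omega

theorem level_eq_length {K : ℕ} (x : Vertex K) : level x = x.length := by
  obtain ⟨w, hw⟩ := regularTree_reachable x
  refine le_antisymm (hw ▸ SimpleGraph.dist_le w) ?_
  obtain ⟨p, hp⟩ := (SimpleGraph.Walk.reachable w).exists_walk_length_eq_dist
  have := length_le_walk p
  simpa [level, hp] using this

/-- The filter `|x| → ∞` on the vertices. -/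
def levelAtTop (K : ℕ) : Filter (Vertex K) := comap level atTop

/-! ### The operator `H = T + lam V` and its Green function -/

/-- The Hilbert space `ℓ²` of the tree. -/
abbrev Hilb (K : ℕ) : Type := lp (fun _ : Vertex K => ℂ) 2

/-- The pointwise action `(H ψ)(x) = ∑_{dist(x,y)=1} ψ(y) + lam v(x) ψ(x)`. -/
def hamFun {K : ℕ} (lam : ℝ) (v : Vertex K → ℝ) (ψ : Vertex K → ℂ) (x : Vertex K) : ℂ :=
  ∑ y ∈ (regularTree K).neighborFinset x, ψ y + (lam : ℂ) * (v x : ℂ) * ψ x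

theorem hamFun_add {K : ℕ} (lam : ℝ) (v : Vertex K → ℝ) (ψ φ : Vertex K → ℂ) :
    hamFun lam v (ψ + φ) = hamFun lam v ψ + hamFun lam v φ := by
  funext x
  simp only [hamFun, Pi.add_apply, Finset.sum_add_distrib]
  ring

theorem hamFun_smul {K : ℕ} (lam : ℝ) (v : Vertex K → ℝ) (c : ℂ) (ψ : Vertex K → ℂ) :
    hamFun lam v (c • ψ) = c • hamFun lam v ψ := by
  funext x
  simp only [hamFun, Pi.smul_apply, smul_eq_mul, ← Finset.mul_sum]
  ring

theorem hamFun_zero {K : ℕ} (lam : ℝ) (v : Vertex K → ℝ) :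
    hamFun lam v (0 : Vertex K → ℂ) = 0 := by
  funext x
  simp [hamFun]

/-- The operator `H = T + lam v` in `ℓ²`, on its natural domain
`{ψ ∈ ℓ² : H ψ ∈ ℓ²}`; as `T` is bounded, this is `{ψ ∈ ℓ² : lam v ψ ∈ ℓ²}`. -/
def ham {K : ℕ} (lam : ℝ) (v : Vertex K → ℝ) : Hilb K →ₗ.[ℂ] Hilb K where
  domain :=
    { carrier := {ψ | Memℓp (hamFun lam v ψ) 2}
      add_mem' := by
        intro ψ φ hψ hφ
        have h : hamFun lam v (ψ + φ : Hilb K) = hamFun lam v ψ + hamFun lam v φ := by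
          rw [lp.coeFn_add, hamFun_add]
        simpa only [Set.mem_ofPred_eq, h] using Memℓp.add hψ hφ
      zero_mem' := by
        have h : hamFun lam v (0 : Hilb K) = 0 := by
          rw [lp.coeFn_zero, hamFun_zero]
        simpa only [Set.mem_ofPred_eq, h] using zero_memℓp
      smul_mem' := by
        intro c ψ hψ
        have h : hamFun lam v (c • ψ : Hilb K) = c • hamFun lam v ψ := by
          rw [lp.coeFn_smul, hamFun_smul]
        simpa only [Set.mem_ofPred_eq, h] using Memℓp.const_smul hψ c }
  toFun :=
    { toFun := fun ψ => ⟨hamFun lam v ψ.1, ψ.2⟩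
      map_add' := by
        intro ψ φ
        apply lp.ext
        funext x
        simp only [Submodule.coe_add, lp.coeFn_add]
        exact congrFun (hamFun_add lam v ψ.1 φ.1) x
      map_smul' := by
        intro c ψ
        apply lp.ext
        funext x
        simpa using congrFun (hamFun_smul lam v c ψ.1) x }

/-- `R` is the bounded two-sided inverse of `A - ζ`. -/
def IsResolvent {H : Type*} [NormedAddCommGroup H] [NormedSpace ℂ H]
    (A : H →ₗ.[ℂ] H) (ζ : ℂ) (R : H →L[ℂ] H) : Prop :=
  (∀ ψ : A.domain, R (A ψ - ζ • (ψ : H)) = ψ) ∧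
    ∀ f : H, ∃ h : R f ∈ A.domain, A ⟨R f, h⟩ - ζ • R f = f

open Classical in
/-- The resolvent operator `(A - ζ)⁻¹` (and `0` if `A - ζ` has no bounded inverse). -/
def resolventOp {H : Type*} [NormedAddCommGroup H] [NormedSpace ℂ H]
    (A : H →ₗ.[ℂ] H) (ζ : ℂ) : H →L[ℂ] H :=
  if h : ∃ R, IsResolvent A ζ R then h.choose else 0

/-- The Kronecker function `δ_x`. -/
def delta {K : ℕ} (x : Vertex K) : Hilb K := lp.single 2 x (1 : ℂ)

/-- The resolvent kernel `⟨δ_x, (H - ζ)⁻¹ δ_y⟩`. -/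
def resolventKernel {K : ℕ} (lam : ℝ) (v : Vertex K → ℝ) (ζ : ℂ) (x y : Vertex K) : ℂ :=
  inner ℂ (delta x) (resolventOp (ham lam v) ζ (delta y))

/-- The Green function `G(x,y;ζ)` on the closed upper half-plane: the resolvent kernel if
`Im ζ > 0`, and the boundary value `G(x,y;E+i0) = lim_{η ↓ 0} G(x,y;E+iη)` at real `ζ = E`. -/
def green {K : ℕ} (lam : ℝ) (v : Vertex K → ℝ) (ζ : ℂ) (x y : Vertex K) : ℂ :=
  if 0 < ζ.im then resolventKernel lam v ζ x y
  else limUnder (𝓝[>] (0 : ℝ))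
    (fun η : ℝ => resolventKernel lam v (ζ + (η : ℂ) * Complex.I) x y)

/-! ### Moments, free energy, Lyapunov exponent -/

section Random

variable {K : ℕ} {Ω : Type*} [MeasurableSpace Ω]

/-- The moment `𝔼[|G(0,x;ζ)|^s]`, with values in `[0,∞]`; for `s < 0` the integrand is `∞` where
the Green function vanishes. At real `ζ = E` it refers to `E + i0`. -/
def greenMoment (P : Measure Ω) (V : Vertex K → Ω → ℝ) (lam s : ℝ) (ζ : ℂ) (x : Vertex K) : ℝ≥0∞ :=
  ∫⁻ ω, ‖green lam (fun y => V y ω) ζ (root K) x‖ₑ ^ s ∂P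

/-- `|x|⁻¹ log 𝔼[|G(0,x;ζ)|^s]`. -/
def logMomentRate (P : Measure Ω) (V : Vertex K → Ω → ℝ) (lam s : ℝ) (ζ : ℂ) (x : Vertex K) : ℝ :=
  Real.log (greenMoment P V lam s ζ x).toReal / (level x : ℝ)

/-- The free energy `φ(s;ζ) = lim_{|x| → ∞} |x|⁻¹ log 𝔼[|G(0,x;ζ)|^s]`. -/
def freeEnergy (P : Measure Ω) (V : Vertex K → Ω → ℝ) (lam s : ℝ) (ζ : ℂ) : ℝ :=
  limUnder (levelAtTop K) (logMomentRate P V lam s ζ)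

/-- The Lyapunov exponent `L(ζ) = -𝔼[log |G(0,0;ζ)|]`. -/
def lyapunov (P : Measure Ω) (V : Vertex K → Ω → ℝ) (lam : ℝ) (ζ : ℂ) : ℝ :=
  -∫ ω, Real.log ‖green lam (fun y => V y ω) ζ (root K) (root K)‖ ∂P

end Random

/-- The minimal function `M(v) = inf_{ν ∈ (0,1]} (2ν)⁻¹ ∫_{|u - v| ≤ ν} ϱ(u) du`. -/
def minimalFunction (ϱ : ℝ → ℝ) (v : ℝ) : ℝ :=
  ⨅ ν : Set.Ioc (0 : ℝ) 1, (2 * (ν : ℝ))⁻¹ * ∫ u in {u : ℝ | |u - v| ≤ ν}, ϱ u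

end TreeAnderson

end

open TreeAnderson

namespace TreeAnderson

noncomputable section

/-! ### The Laplacian as a sum over children and parent -/

section Resolvent

variable {K : ℕ}

/-! Cutting the edges at the root turns the resolvent equation into a recursion. If Γ is the
diagonal Green function at the root and Γ_j are those of the subtrees of its children, then Γ =
(λV(0) - ζ - Σ Γ_j)⁻¹. The kernel G(0,x) is, up to sign, the product of the Γ's of the subtrees met
along the path to x (`rootGreen_mul`, `resolventKernel_root_append`). Read from x towards the root,
these Γ's form a Markov chain γ ↦ (W - γ)⁻¹. Here W = λV - ζ - Σ Γ runs over the children off the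
path and is independent of γ. Hence E|G(0,x)|^s depends only on |x|: it is the total mass after
|x|+1 applications of the weighted `transfer` operator to the law of Γ
(`lintegral_resolventKernel_rpow`).

The heart is quasi-multiplicativity, M(n+m+1) ≈ M(n) M(m) (`ChainBounds.quasi_mul`). The transfer
operator is self-adjoint for the pairing with kernel E|W - b - c|^{-s}, because moving a step across
produces |(W-b)(W'-c) - 1|^{-s}, symmetric in the two sides (`pairing_transfer`). A path can thus be
run from both ends and joined in the middle. The joint decouples into a product after |W - b - c|
and |(W-b)(W'-c) - 1| are replaced by 1 + |W-b| and (1 + |W-b|)(1 + |W'-c|). The price is a constant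
C^{|s|/r}, by Hölder under the tilted measure (`tilt_compare`). For Im ζ > 0 the singularities are
avoided and every r is allowed. Uniformly in ζ, the condition on ϱ (`exists_locallyRegular`)
controls them for r < 1 (`uniform_chainBounds`); the case λ = 0 is deterministic.

Log-moments are therefore almost additive in n, so their rates exist, with two-sided bounds
(`AlmostAdditive.exists_rate`). Convexity comes from the cumulant generating functions and
monotonicity from |G| ≤ 1/Im ζ. The defect of additivity is O(|s|) near s = 0, while E log|G(0,x)|
is exactly additive in the number of factors; this gives the derivative -L at 0
(`IsAlmostAdditive.hasDerivAt`), and convexity then gives the lower bound -sL. Summing |G(0,x)|²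
over a sphere gives φ(2) ≤ -log K, and interpolation with φ(0) = 0 gives the upper bound.

For real energies, the Cayley transform of Γ is bounded and holomorphic, so Fatou's theorem and
Fubini give boundary values for almost every E; the half moment excludes infinite ones
(`UniformBounds.ae_hasBoundaryValues`). Moments with 0 < s < 1 converge by uniform integrability.
For negative s, including the endpoint -ς where no higher moment is available, they converge under a
majorant built from independent factors whose mean also converges
(`UniformBounds.tendsto_moment_of_neg`). Since the additivity defects do not depend on ζ, the limits
in η and |x| commute (`tendsto_div_prod`). -/

theorem hilb_add_apply (f g : Hilb K) (x : Vertex K) : (f + g : Hilb K) x = f x + g x := rfl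

theorem hilb_sub_apply (f g : Hilb K) (x : Vertex K) : (f - g : Hilb K) x = f x - g x := rfl

theorem hilb_smul_apply (c : ℂ) (f : Hilb K) (x : Vertex K) : (c • f : Hilb K) x = c * f x := rfl

theorem hilb_star_apply (f : Hilb K) (x : Vertex K) : (star f : Hilb K) x = star (f x) := rfl

/-- The value of `ψ` at the parent of a vertex, and `0` at the root. -/
def parentFun (ψ : Vertex K → ℂ) : Vertex K → ℂ
  | [] => 0
  | _ :: x => ψ x

/-- The sum of `ψ` over the children of a vertex. -/
def childFun (ψ : Vertex K → ℂ) (x : Vertex K) : ℂ := ∑ i : Fin K, ψ (i :: x)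

theorem sum_neighborFinset (ψ : Vertex K → ℂ) (x : Vertex K) :
    ∑ y ∈ (regularTree K).neighborFinset x, ψ y = childFun ψ x + parentFun ψ x := by
  classical
  have hinj : Function.Injective (fun i : Fin K => i :: x) := fun i j h => by simpa using h
  cases x with
  | nil =>
    have : (regularTree K).neighborFinset ([] : Vertex K)
        = Finset.univ.image (fun i : Fin K => [i]) := by
      ext y
      rw [SimpleGraph.mem_neighborFinset]
      simp [regularTree, eq_comm]
    rw [this, Finset.sum_image (fun i _ j _ h => by simpa using h)]
    simp [childFun, parentFun]
  | cons j x =>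
    have : (regularTree K).neighborFinset (j :: x : Vertex K)
        = insert x (Finset.univ.image (fun i : Fin K => i :: j :: x)) := by
      ext y
      rw [SimpleGraph.mem_neighborFinset]
      simp only [regularTree, Finset.mem_insert,
        Finset.mem_image, Finset.mem_univ, true_and]
      constructor
      · rintro (⟨i, rfl⟩ | ⟨i, h⟩)
        · exact Or.inr ⟨i, rfl⟩
        · exact Or.inl (List.cons.inj h).2.symm
      · rintro (rfl | ⟨i, rfl⟩)
        · exact Or.inr ⟨j, rfl⟩
        · exact Or.inl ⟨i, rfl⟩
    rw [this, Finset.sum_insert, Finset.sum_image (fun i _ j _ h => by simpa using h)]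
    · simp [childFun, parentFun, add_comm]
    · simp only [Finset.mem_image, Finset.mem_univ, true_and, not_exists]
      intro i h
      have := congrArg List.length h
      simp only [List.length_cons] at this
      omega

theorem hamFun_eq (lam : ℝ) (v : Vertex K → ℝ) (ψ : Vertex K → ℂ) (x : Vertex K) :
    hamFun lam v ψ x = childFun ψ x + parentFun ψ x + (lam : ℂ) * (v x : ℂ) * ψ x := by
  rw [hamFun, sum_neighborFinset]

theorem memℓp_two_iff {ι : Type*} {f : ι → ℂ} : Memℓp f 2 ↔ Summable fun i => ‖f i‖ ^ 2 := by
  rw [memℓp_gen_iff (by norm_num)]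
  norm_num

theorem cons_injective : Function.Injective (fun p : Fin K × Vertex K => p.1 :: p.2) := by
  rintro ⟨i, x⟩ ⟨j, y⟩ h
  simpa using h

theorem memℓp_cons (ψ : Hilb K) (i : Fin K) : Memℓp (fun x => ψ (i :: x)) 2 := by
  have h := memℓp_two_iff.1 ψ.2
  exact memℓp_two_iff.2 (h.comp_injective (i := fun x => i :: x) (fun x y h => by simpa using h))

theorem memℓp_childFun (ψ : Hilb K) : Memℓp (childFun ψ) 2 := by
  let φ : Hilb K := ∑ i : Fin K, ⟨fun x => ψ (i :: x), memℓp_cons ψ i⟩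
  have : childFun ψ = φ := by
    ext x
    rw [lp.coeFn_sum, Finset.sum_apply]
    rfl
  rw [this]
  exact φ.2

theorem memℓp_parentFun (ψ : Hilb K) : Memℓp (parentFun ψ) 2 := by
  rw [memℓp_two_iff]
  have h := memℓp_two_iff.1 ψ.2
  refine (cons_injective.summable_iff ?_).1 ?_
  · rintro (_ | ⟨i, x⟩) hx
    · simp [parentFun]
    · exact absurd ⟨(i, x), rfl⟩ hx
  · have : (fun p : Fin K × Vertex K => ‖ψ p.2‖ ^ 2) = fun p => 1 * ‖ψ p.2‖ ^ 2 := by simp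
    change Summable (fun p : Fin K × Vertex K => ‖ψ p.2‖ ^ 2)
    rw [this]
    exact Summable.mul_of_nonneg (f := fun _ : Fin K => (1 : ℝ)) (Summable.of_finite) h
      (fun _ => zero_le_one) (fun _ => by positivity)

/-- The children operator on `ℓ²`. -/
def childL (ψ : Hilb K) : Hilb K := ⟨childFun ψ, memℓp_childFun ψ⟩
/-- The parent operator on `ℓ²`. -/
def parentL (ψ : Hilb K) : Hilb K := ⟨parentFun ψ, memℓp_parentFun ψ⟩

/-- The map (i, x) ↦ i :: x enumerates the vertices other than the root, and `parentFun` vanishes at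
the root. Reindexing the sum makes the child and parent operators adjoint to each other. -/
theorem inner_childL (ψ φ : Hilb K) : inner ℂ (childL ψ) φ = inner ℂ ψ (parentL φ) := by
  rw [lp.inner_eq_tsum, lp.inner_eq_tsum]
  have h1 : ∀ i : Fin K, Summable fun x => inner ℂ (ψ (i :: x)) (φ x) := fun i => by
    have h := lp.summable_inner (𝕜 := ℂ) (⟨fun x => ψ (i :: x), memℓp_cons ψ i⟩ : Hilb K) φ
    exact h
  have h2 : ∀ x, inner ℂ (childL ψ x) (φ x) = ∑ i : Fin K, inner ℂ (ψ (i :: x)) (φ x) := by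
    intro x
    exact sum_inner (𝕜 := ℂ) (E := ℂ) Finset.univ (fun i : Fin K => ψ (i :: x)) (φ x)
  simp_rw [h2]
  rw [Summable.tsum_finsetSum (fun i _ => h1 i)]
  have h3 : (∑' y, inner ℂ (ψ y) (parentL φ y))
      = ∑' p : Fin K × Vertex K, inner ℂ (ψ (p.1 :: p.2)) (φ p.2) := by
    refine (cons_injective.tsum_eq (f := fun y => inner ℂ (ψ y) (parentL φ y)) ?_).symm
    rintro (_ | ⟨i, x⟩) hx
    · exact absurd (by change inner ℂ _ (0 : ℂ) = 0; simp) hx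
    · exact ⟨(i, x), rfl⟩
  have h4 : Summable fun p : Fin K × Vertex K => inner ℂ (ψ (p.1 :: p.2)) (φ p.2) := by
    have := lp.summable_inner (𝕜 := ℂ) ψ (parentL φ)
    exact this.comp_injective cons_injective
  rw [h3, h4.tsum_prod, tsum_fintype]

theorem inner_parentL (ψ φ : Hilb K) : inner ℂ (parentL ψ) φ = inner ℂ ψ (childL φ) := by
  rw [← inner_conj_symm, ← inner_childL, inner_conj_symm]

/-! ### Symmetry of the Hamiltonian and its action on Kronecker functions -/

variable (lam : ℝ) (v : Vertex K → ℝ)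

theorem ham_apply (ψ : (ham lam v).domain) (x : Vertex K) :
    (ham lam v ψ : Hilb K) x = hamFun lam v (ψ : Hilb K) x := rfl

theorem mem_ham_domain {ψ : Hilb K} : ψ ∈ (ham lam v).domain ↔ Memℓp (hamFun lam v ψ) 2 :=
  Iff.rfl

/-- The child and parent operators exchange roles under the inner product. What remains of H is
multiplication by a real function, and this remainder is in ℓ² on the domain because it is a
difference of ℓ² vectors. -/
theorem ham_symm (ψ φ : (ham lam v).domain) :
    inner ℂ (ham lam v ψ) (φ : Hilb K) = inner ℂ (ψ : Hilb K) (ham lam v φ) := by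
  have key : ∀ ψ : (ham lam v).domain, ham lam v ψ = childL ψ.1 + parentL ψ.1
      + (ham lam v ψ - childL ψ.1 - parentL ψ.1) := fun ψ => by abel
  have hd : ∀ (ψ : (ham lam v).domain) x,
      (ham lam v ψ - childL ψ.1 - parentL ψ.1 : Hilb K) x = (lam : ℂ) * (v x : ℂ) * ψ.1 x := by
    intro ψ x
    simp only [hilb_sub_apply, ham_apply, hamFun_eq]
    change _ - childFun _ x - parentFun _ x = _
    ring
  rw [key ψ, key φ, inner_add_left, inner_add_left, inner_add_right, inner_add_right,
    inner_childL, inner_parentL, add_comm (inner ℂ ψ.1 (parentL φ.1))]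
  congr 1
  rw [lp.inner_eq_tsum, lp.inner_eq_tsum]
  congr 1
  ext x
  rw [hd, hd]
  simp only [RCLike.inner_apply, map_mul, Complex.conj_ofReal]
  ring

theorem delta_apply (x y : Vertex K) : (delta x : Hilb K) y = if y = x then 1 else 0 := by
  rw [delta, lp.single_apply]
  split_ifs with h
  · subst h; simp
  · simp [h]

theorem inner_delta (x : Vertex K) (ψ : Hilb K) : inner ℂ (delta x) ψ = ψ x := by
  rw [delta, lp.inner_single_left]; simp

theorem norm_delta (x : Vertex K) : ‖(delta x : Hilb K)‖ = 1 := by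
  rw [delta, lp.norm_single (by norm_num)]; simp

theorem delta_mem_domain (x : Vertex K) : (delta x : Hilb K) ∈ (ham lam v).domain := by
  rw [mem_ham_domain]
  have : hamFun lam v (delta x : Hilb K) = fun y => (childL (delta x) + parentL (delta x)
      + ((lam * v x : ℝ) : ℂ) • delta x : Hilb K) y := by
    ext y
    rw [hamFun_eq]
    simp only [hilb_add_apply, hilb_smul_apply]
    congr 1
    rw [delta_apply]
    split_ifs with h
    · subst h; push_cast; ring
    · simp
  rw [this]
  exact (childL (delta x) + parentL (delta x) + ((lam * v x : ℝ) : ℂ) • delta x : Hilb K).2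

theorem ham_delta (x : Vertex K) :
    ham lam v ⟨delta x, delta_mem_domain lam v x⟩
      = childL (delta x) + parentL (delta x) + ((lam * v x : ℝ) : ℂ) • delta x := by
  apply lp.ext
  ext y
  rw [ham_apply, hamFun_eq]
  simp only [hilb_add_apply, hilb_smul_apply]
  congr 1
  rw [delta_apply]
  split_ifs with h
  · subst h; push_cast; ring
  · simp

theorem inner_ham_delta (x : Vertex K) (ψ : Hilb K) :
    inner ℂ (ham lam v ⟨delta x, delta_mem_domain lam v x⟩) ψ = hamFun lam v ψ x := by
  rw [ham_delta, inner_add_left, inner_add_left, inner_childL, inner_parentL, inner_smul_left,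
    inner_delta, inner_delta, inner_delta, hamFun_eq]
  change parentFun ψ x + childFun ψ x + _ = _
  simp only [Complex.conj_ofReal]
  push_cast
  ring

/-! ### Self-adjointness and the resolvent -/

variable {lam v}

theorem im_inner_sub_smul (ψ : (ham lam v).domain) (ζ : ℂ) :
    (inner ℂ (ψ : Hilb K) (ham lam v ψ - ζ • (ψ : Hilb K))).im = - ζ.im * ‖(ψ : Hilb K)‖ ^ 2 := by
  have h : (inner ℂ (ψ : Hilb K) (ham lam v ψ)).im = 0 := by
    have h1 := inner_conj_symm (𝕜 := ℂ) (ψ : Hilb K) (ham lam v ψ)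
    rw [ham_symm] at h1
    exact Complex.conj_eq_iff_im.1 h1
  rw [inner_sub_right, inner_smul_right, inner_self_eq_norm_sq_to_K, Complex.sub_im, h]
  have : ((‖(ψ : Hilb K)‖ : ℂ) ^ 2) = ((‖(ψ : Hilb K)‖ ^ 2 : ℝ) : ℂ) := by push_cast; rfl
  change 0 - (ζ * (‖(ψ : Hilb K)‖ : ℂ) ^ 2).im = _
  rw [this, Complex.im_mul_ofReal]
  ring

theorem im_mul_norm_le {ζ : ℂ} (hζ : 0 < ζ.im) (ψ : (ham lam v).domain) :
    ζ.im * ‖(ψ : Hilb K)‖ ≤ ‖ham lam v ψ - ζ • (ψ : Hilb K)‖ := by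
  by_cases h0 : ‖(ψ : Hilb K)‖ = 0
  · rw [h0, mul_zero]; positivity
  have h1 := im_inner_sub_smul ψ ζ
  have h2 : |(inner ℂ (ψ : Hilb K) (ham lam v ψ - ζ • (ψ : Hilb K))).im| ≤
      ‖(ψ : Hilb K)‖ * ‖ham lam v ψ - ζ • (ψ : Hilb K)‖ :=
    (Complex.abs_im_le_norm _).trans (norm_inner_le_norm _ _)
  rw [h1, abs_mul, abs_neg, abs_of_pos hζ, abs_of_nonneg (by positivity)] at h2
  have h3 : 0 < ‖(ψ : Hilb K)‖ := lt_of_le_of_ne (norm_nonneg _) (Ne.symm h0)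
  nlinarith

/-- Such an f satisfies Hf = ζ̄f pointwise. The domain is maximal, so it contains f, and a symmetric
operator has no non-real eigenvalue. This density of the range on finitely supported functions
serves both for the existence of the resolvent and for its continuity in the potential. -/
theorem eq_zero_of_inner_ham_delta {ζ : ℂ} (hζ : 0 < ζ.im) {f : Hilb K}
    (hf : ∀ x, inner ℂ (ham lam v ⟨delta x, delta_mem_domain lam v x⟩ - ζ • delta x) f = 0) :
    f = 0 := by
  have h1 : ∀ x, hamFun lam v f x = (starRingEnd ℂ ζ) * f x := by
    intro x
    have := hf x
    rw [inner_sub_left, inner_ham_delta, inner_smul_left, inner_delta, sub_eq_zero] at this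
    exact this
  have h2 : f ∈ (ham lam v).domain := by
    rw [mem_ham_domain]
    have : hamFun lam v f = fun x => (starRingEnd ℂ ζ • f : Hilb K) x := by
      ext x; rw [h1, hilb_smul_apply]
    rw [this]
    exact (starRingEnd ℂ ζ • f : Hilb K).2
  have h3 := im_inner_sub_smul ⟨f, h2⟩ ((starRingEnd ℂ) ζ)
  have h4 : ham lam v ⟨f, h2⟩ - (starRingEnd ℂ) ζ • f = 0 := by
    apply lp.ext
    ext x
    change _ - _ = (0 : ℂ)
    rw [ham_apply, h1, hilb_smul_apply, sub_self]
  simp only [h4, inner_zero_right, Complex.zero_im, Complex.conj_im, neg_neg] at h3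
  have h5 : ‖f‖ ^ 2 = 0 := by
    rcases mul_eq_zero.1 h3.symm with h | h
    · exact absurd h hζ.ne'
    · exact h
  simpa using h5

theorem continuous_apply_hilb (x : Vertex K) : Continuous fun ψ : Hilb K => ψ x := by
  have : (fun ψ : Hilb K => ψ x) = fun ψ => inner ℂ (delta x) ψ := by
    ext ψ; rw [inner_delta]
  rw [this]
  fun_prop

theorem continuous_hamFun_apply (x : Vertex K) :
    Continuous fun ψ : Hilb K => hamFun lam v ψ x := by
  have : (fun ψ : Hilb K => hamFun lam v ψ x)
      = fun ψ => inner ℂ (ham lam v ⟨delta x, delta_mem_domain lam v x⟩) ψ := by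
    ext ψ; rw [inner_ham_delta]
  rw [this]
  fun_prop

variable (lam v) in
/-- The operator `H - ζ` on the domain of `H`. -/
def hamSub (ζ : ℂ) : (ham lam v).domain →ₗ[ℂ] Hilb K :=
  (ham lam v).toFun - ζ • (ham lam v).domain.subtype

theorem hamSub_apply (ζ : ℂ) (ψ : (ham lam v).domain) :
    hamSub lam v ζ ψ = ham lam v ψ - ζ • (ψ : Hilb K) := rfl

/-- The range is closed: the lower bound Im ζ ‖ψ‖ ≤ ‖(H-ζ)ψ‖ makes preimages of a convergent
sequence Cauchy, and Hψ(x) is the inner product with Hδ_x, so the equation passes to the limit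
pointwise. The range is dense by `eq_zero_of_inner_ham_delta`. -/
theorem hamSub_surjective {ζ : ℂ} (hζ : 0 < ζ.im) : Function.Surjective (hamSub lam v ζ) := by
  have hclosed : IsClosed ((LinearMap.range (hamSub lam v ζ) : Submodule ℂ (Hilb K)) :
      Set (Hilb K)) := by
    rw [← isSeqClosed_iff_isClosed]
    intro f f0 hf hlim
    choose ψ hψ using hf
    have hc : CauchySeq (fun n => (ψ n : Hilb K)) := by
      have hfc := hlim.cauchySeq
      rw [Metric.cauchySeq_iff'] at hfc ⊢
      intro ε hε
      obtain ⟨N, hN⟩ := hfc (ζ.im * ε) (by positivity)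
      refine ⟨N, fun n hn => ?_⟩
      have h1 := hN n hn
      have h2 := im_mul_norm_le hζ (ψ n - ψ N)
      rw [← hamSub_apply, map_sub, hψ, hψ, ← dist_eq_norm] at h2
      have h3 : ζ.im * dist (ψ n : Hilb K) (ψ N) < ζ.im * ε := by
        rw [dist_eq_norm]; exact lt_of_le_of_lt h2 h1
      exact lt_of_mul_lt_mul_left h3 hζ.le
    obtain ⟨ψ0, hψ0⟩ := cauchySeq_tendsto_of_complete hc
    have hpt : ∀ x, hamFun lam v ψ0 x = (f0 + ζ • ψ0 : Hilb K) x := by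
      intro x
      have a1 : Tendsto (fun n => hamFun lam v (ψ n : Hilb K) x) atTop (𝓝 (hamFun lam v ψ0 x)) :=
        ((continuous_hamFun_apply x).tendsto ψ0).comp hψ0
      have a2 : Tendsto (fun n => (f n + ζ • (ψ n : Hilb K) : Hilb K) x) atTop
          (𝓝 ((f0 + ζ • ψ0 : Hilb K) x)) :=
        ((continuous_apply_hilb x).tendsto _).comp (hlim.add (hψ0.const_smul ζ))
      have : (fun n => hamFun lam v (ψ n : Hilb K) x)
          = fun n => (f n + ζ • (ψ n : Hilb K) : Hilb K) x := by
        ext n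
        rw [← hψ n, hamSub_apply, sub_add_cancel, ham_apply]
      rw [this] at a1
      exact tendsto_nhds_unique a1 a2
    have hmem : ψ0 ∈ (ham lam v).domain := by
      rw [mem_ham_domain, show hamFun lam v ψ0 = fun x => (f0 + ζ • ψ0 : Hilb K) x from
        funext hpt]
      exact (f0 + ζ • ψ0 : Hilb K).2
    refine ⟨⟨ψ0, hmem⟩, ?_⟩
    rw [hamSub_apply, sub_eq_iff_eq_add]
    apply lp.ext
    ext x
    exact hpt x
  have horth : (LinearMap.range (hamSub lam v ζ))ᗮ = ⊥ := by
    rw [Submodule.eq_bot_iff]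
    intro f hf
    refine eq_zero_of_inner_ham_delta (lam := lam) (v := v) hζ fun x => ?_
    exact hf _ ⟨⟨delta x, delta_mem_domain lam v x⟩, rfl⟩
  have := Submodule.topologicalClosure_eq_top_iff.2 horth
  rw [IsClosed.submodule_topologicalClosure_eq hclosed] at this
  exact LinearMap.range_eq_top.1 this

theorem hamSub_injective {ζ : ℂ} (hζ : 0 < ζ.im) : Function.Injective (hamSub lam v ζ) := by
  rw [injective_iff_map_eq_zero]
  intro ψ hψ
  have := im_mul_norm_le hζ ψ
  rw [← hamSub_apply, hψ, norm_zero] at this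
  have h2 : ‖(ψ : Hilb K)‖ = 0 := by
    have := norm_nonneg (ψ : Hilb K)
    nlinarith
  exact Subtype.ext (norm_eq_zero.1 h2)

theorem exists_isResolvent {ζ : ℂ} (hζ : 0 < ζ.im) : ∃ R, IsResolvent (ham lam v) ζ R := by
  let e := LinearEquiv.ofBijective (hamSub lam v ζ) ⟨hamSub_injective hζ, hamSub_surjective hζ⟩
  have he : ∀ ψ, e ψ = ham lam v ψ - ζ • (ψ : Hilb K) := fun ψ => rfl
  let R : Hilb K →L[ℂ] Hilb K :=
    ((ham lam v).domain.subtype ∘ₗ e.symm.toLinearMap).mkContinuous (ζ.im)⁻¹ (by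
      intro f
      have := im_mul_norm_le hζ (e.symm f)
      rw [← he, e.apply_symm_apply] at this
      rw [inv_mul_eq_div, le_div_iff₀' hζ]
      exact this)
  have hR : ∀ f, R f = (e.symm f : Hilb K) := fun f => rfl
  refine ⟨R, fun ψ => ?_, fun f => ⟨?_, ?_⟩⟩
  · rw [hR, ← he, e.symm_apply_apply]
  · rw [hR]; exact (e.symm f).2
  · simp only [hR]
    rw [Subtype.coe_eta, ← he, e.apply_symm_apply]

variable (lam v) in
/-- The resolvent of `H`. -/
abbrev res (ζ : ℂ) : Hilb K →L[ℂ] Hilb K := resolventOp (ham lam v) ζ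

theorem isResolvent_res {ζ : ℂ} (hζ : 0 < ζ.im) : IsResolvent (ham lam v) ζ (res lam v ζ) := by
  have h := exists_isResolvent (lam := lam) (v := v) hζ
  rw [res, resolventOp, dif_pos h]
  exact h.choose_spec

theorem hamFun_res {ζ : ℂ} (hζ : 0 < ζ.im) (f : Hilb K) (x : Vertex K) :
    hamFun lam v (res lam v ζ f) x = ζ * res lam v ζ f x + f x := by
  obtain ⟨h, h2⟩ := (isResolvent_res (lam := lam) (v := v) hζ).2 f
  have := congrArg (fun g : Hilb K => g x) h2
  simp only [hilb_sub_apply, ham_apply, hilb_smul_apply] at this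
  rw [← this]; ring

/-- An ℓ² function solving the equation pointwise lies automatically in the maximal domain.
Resolvent identities are thereby reduced to pointwise checks. -/
theorem eq_res {ζ : ℂ} (hζ : 0 < ζ.im) {u f : Hilb K}
    (h : ∀ x, hamFun lam v u x = ζ * u x + f x) : u = res lam v ζ f := by
  have hpt : hamFun lam v u = fun x => (ζ • u + f : Hilb K) x := by
    ext x; rw [h, hilb_add_apply, hilb_smul_apply]
  have hmem : u ∈ (ham lam v).domain := by
    rw [mem_ham_domain, hpt]
    exact (ζ • u + f : Hilb K).2
  have := (isResolvent_res (lam := lam) (v := v) hζ).1 ⟨u, hmem⟩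
  refine this.symm.trans (congrArg _ (lp.ext (funext fun x => ?_)))
  rw [hilb_sub_apply, ham_apply, hilb_smul_apply, h]
  ring

theorem norm_res_le {ζ : ℂ} (hζ : 0 < ζ.im) (f : Hilb K) : ‖res lam v ζ f‖ ≤ ‖f‖ / ζ.im := by
  obtain ⟨h, h2⟩ := (isResolvent_res (lam := lam) (v := v) hζ).2 f
  have := im_mul_norm_le hζ ⟨_, h⟩
  rw [h2] at this
  rw [le_div_iff₀' hζ]
  exact this

theorem resolventKernel_eq (ζ : ℂ) (x y : Vertex K) :
    resolventKernel lam v ζ x y = res lam v ζ (delta y) x := by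
  rw [resolventKernel, inner_delta]

theorem childFun_star (ψ : Vertex K → ℂ) (x : Vertex K) :
    childFun (star ψ) x = star (childFun ψ x) := by
  simp [childFun]

theorem parentFun_star (ψ : Vertex K → ℂ) (x : Vertex K) :
    parentFun (star ψ) x = star (parentFun ψ x) := by
  cases x <;> simp [parentFun]

theorem hamFun_star (ψ : Vertex K → ℂ) (x : Vertex K) :
    hamFun lam v (star ψ) x = star (hamFun lam v ψ x) := by
  simp only [hamFun_eq, childFun_star, parentFun_star, star_add, star_mul', Pi.star_apply]
  simp

/-- H is symmetric and commutes with complex conjugation. Testing the symmetry on the conjugate of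
one column of the resolvent and on another column gives the claim. -/
theorem resolventKernel_comm {ζ : ℂ} (hζ : 0 < ζ.im) (x y : Vertex K) :
    resolventKernel lam v ζ x y = resolventKernel lam v ζ y x := by
  rw [resolventKernel_eq, resolventKernel_eq]
  set u := res lam v ζ (delta x) with hu
  set w := res lam v ζ (delta y) with hw
  have hud : u ∈ (ham lam v).domain := ((isResolvent_res (lam := lam) (v := v) hζ).2 _).1
  have hHw : ∀ z, hamFun lam v (star w : Hilb K) z
      = star (ζ * w z + (delta y : Hilb K) z) := by
    intro z
    exact (hamFun_star _ z).trans (congrArg star (hamFun_res hζ (delta y) z))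
  have hwd : star w ∈ (ham lam v).domain := by
    rw [mem_ham_domain]
    have : hamFun lam v (star w : Hilb K) = fun z => (star (ζ • w + delta y) : Hilb K) z := by
      ext z
      rw [hHw z, hilb_star_apply, hilb_add_apply, hilb_smul_apply]
    rw [this]
    exact (star (ζ • w + delta y) : Hilb K).2
  have h1 := ham_symm lam v ⟨star w, hwd⟩ ⟨u, hud⟩
  have h2 : ham lam v ⟨u, hud⟩ = ζ • u + delta x := by
    apply lp.ext; ext z
    exact hamFun_res hζ (delta x) z
  have h3 : ham lam v ⟨star w, hwd⟩ = star (ζ • w + delta y) := by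
    apply lp.ext; ext z
    rw [ham_apply, hHw, hilb_star_apply, hilb_add_apply, hilb_smul_apply]
  have hs : (star (delta y) : Hilb K) = delta y := by
    apply lp.ext; ext z
    rw [hilb_star_apply, delta_apply]
    split_ifs <;> simp
  rw [h2, h3, star_add, hs, inner_add_left, inner_add_right, star_smul, inner_smul_left,
    inner_smul_right, inner_delta] at h1
  have h4 : inner ℂ (star w) (delta x : Hilb K) = w x := by
    rw [← inner_conj_symm, inner_delta, hilb_star_apply]
    simp
  rw [h4] at h1
  simp only [RCLike.star_def, Complex.conj_conj] at h1
  exact (add_left_cancel h1).symm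

/-! ### The diagonal Green function of the root, and the recursion -/

variable (lam v) in
/-- The Green function at the root. -/
def rootGreen (ζ : ℂ) : ℂ := resolventKernel lam v ζ (root K) (root K)

/-- The restriction of a potential to the subtree of the `i`-th child of the root. -/
def shiftPot (v : Vertex K → ℝ) (i : Fin K) : Vertex K → ℝ := fun y => v (y ++ [i])

/-- Words list the most recent step first, so y ++ [i] lies below the child i of the root. On that
subtree the column of the root solves the resolvent equation of the subtree; the cut edge
contributes the source -G(0,0) at its top vertex. -/
theorem resolventKernel_root_append' {ζ : ℂ} (hζ : 0 < ζ.im) (y : Vertex K) (i : Fin K) :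
    resolventKernel lam v ζ (y ++ [i]) (root K)
      = - rootGreen lam v ζ * resolventKernel lam (shiftPot v i) ζ y (root K) := by
  set u := res lam v ζ (delta (root K)) with hu
  have hinj : Function.Injective (fun y : Vertex K => y ++ [i]) := fun a b h => by simpa using h
  let ui : Hilb K := ⟨fun y => u (y ++ [i]), memℓp_two_iff.2
    ((memℓp_two_iff.1 u.2).comp_injective hinj)⟩
  have h : ui = res lam (shiftPot v i) ζ (- u (root K) • delta (root K)) := by
    refine eq_res hζ fun y => ?_
    have h1 := hamFun_res (lam := lam) (v := v) hζ (delta (root K)) (y ++ [i])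
    rw [← hu, hamFun_eq, delta_apply, if_neg (by simp), add_zero] at h1
    rw [hamFun_eq]
    change childFun u (y ++ [i]) + parentFun ui y + lam * (v (y ++ [i]) : ℂ) * u (y ++ [i])
      = ζ * u (y ++ [i]) + (- u (root K) • delta (root K) : Hilb K) y
    rw [← h1]
    cases y with
    | nil =>
      simp only [parentFun, hilb_smul_apply, delta_apply, List.nil_append]
      simp
      ring
    | cons j y =>
      simp only [hilb_smul_apply, delta_apply, List.cons_append, parentFun, root]
      simp [ui]
  have := congrArg (fun f : Hilb K => f y) h
  rw [resolventKernel_eq, resolventKernel_eq, rootGreen, resolventKernel_eq, ← hu]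
  rw [map_smul, hilb_smul_apply] at this
  exact this

theorem resolventKernel_root_append {ζ : ℂ} (hζ : 0 < ζ.im) (y : Vertex K) (i : Fin K) :
    resolventKernel lam v ζ (root K) (y ++ [i])
      = - rootGreen lam v ζ * resolventKernel lam (shiftPot v i) ζ (root K) y := by
  rw [resolventKernel_comm hζ, resolventKernel_root_append' hζ, resolventKernel_comm hζ y]

/-- This is the resolvent equation evaluated at the root, with the values at the children expressed
through the factorization over subtrees. -/
theorem rootGreen_mul {ζ : ℂ} (hζ : 0 < ζ.im) :
    rootGreen lam v ζ * (lam * v (root K) - ζ - ∑ i, rootGreen lam (shiftPot v i) ζ) = 1 := by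
  have h1 := hamFun_res (lam := lam) (v := v) hζ (delta (root K)) (root K)
  have h2 : ∀ i : Fin K, res lam v ζ (delta (root K)) [i]
      = - rootGreen lam v ζ * rootGreen lam (shiftPot v i) ζ := by
    intro i
    have := resolventKernel_root_append' (lam := lam) (v := v) hζ (root K) i
    rw [resolventKernel_eq] at this
    simpa [rootGreen] using this
  have h3 : res lam v ζ (delta (root K)) (root K) = rootGreen lam v ζ := by
    rw [rootGreen, resolventKernel_eq]
  rw [hamFun_eq, childFun, delta_apply, if_pos rfl, h3] at h1
  simp only [h2, parentFun, ← Finset.mul_sum] at h1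
  linear_combination h1

theorem rootGreen_ne_zero {ζ : ℂ} (hζ : 0 < ζ.im) : rootGreen lam v ζ ≠ 0 :=
  left_ne_zero_of_mul_eq_one (rootGreen_mul hζ)

theorem norm_resolventKernel_le {ζ : ℂ} (hζ : 0 < ζ.im) (x y : Vertex K) :
    ‖resolventKernel lam v ζ x y‖ ≤ (ζ.im)⁻¹ := by
  rw [resolventKernel]
  refine (norm_inner_le_norm _ _).trans ?_
  have := norm_res_le (lam := lam) (v := v) hζ (delta y)
  rw [norm_delta] at *
  simpa using this

theorem norm_rootGreen_le {ζ : ℂ} (hζ : 0 < ζ.im) : ‖rootGreen lam v ζ‖ ≤ (ζ.im)⁻¹ :=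
  norm_resolventKernel_le hζ _ _

theorem im_rootGreen_pos {ζ : ℂ} (hζ : 0 < ζ.im) : 0 < (rootGreen lam v ζ).im := by
  set u := res lam v ζ (delta (root K)) with hu
  obtain ⟨h, h2⟩ := (isResolvent_res (lam := lam) (v := v) hζ).2 (delta (root K))
  have h3 := im_inner_sub_smul ⟨_, h⟩ ζ
  rw [h2, ← inner_conj_symm, inner_delta, ← resolventKernel_eq, Complex.conj_im] at h3
  change - (rootGreen lam v ζ).im = _ at h3
  have h4 : u ≠ 0 := by
    intro h0
    apply rootGreen_ne_zero (lam := lam) (v := v) hζ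
    rw [rootGreen, resolventKernel_eq, ← hu, h0]
    simp
  have h5 : 0 < ‖u‖ := norm_pos_iff.2 h4
  have h6 : 0 < ζ.im * ‖u‖ ^ 2 := by positivity
  change _ = -ζ.im * ‖u‖ ^ 2 at h3
  linarith

/-- The left side is the squared norm of (H-ζ)⁻¹δ₀. It is the input for the bound of the free energy
at s = 2. -/
theorem tsum_resolventKernel_sq_le {ζ : ℂ} (hζ : 0 < ζ.im) :
    ∑' x, ENNReal.ofReal (‖resolventKernel lam v ζ (root K) x‖ ^ 2)
      ≤ ENNReal.ofReal ((ζ.im)⁻¹ ^ 2) := by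
  set u := res lam v ζ (delta (root K)) with hu
  have h1 : ∀ x, resolventKernel lam v ζ (root K) x = u x := fun x => by
    rw [resolventKernel_comm hζ, resolventKernel_eq]
  simp_rw [h1]
  rw [← ENNReal.ofReal_tsum_of_nonneg (fun _ => by positivity) (memℓp_two_iff.1 u.2)]
  apply ENNReal.ofReal_le_ofReal
  have h2 : ∑' x, ‖u x‖ ^ 2 = ‖u‖ ^ 2 := by
    have := lp.norm_rpow_eq_tsum (p := 2) (by norm_num) u
    norm_num at this
    exact this.symm
  rw [h2]
  have := norm_res_le (lam := lam) (v := v) hζ (delta (root K))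
  rw [norm_delta, one_div] at this
  gcongr

/-! ### Regularity in the potential and in the spectral parameter -/

/-- Strong resolvent convergence for the product topology on potentials. The vectors f with
convergence form a closed subspace, by the uniform norm bound near ζ₀. It contains (H-ζ₀)δ_x, for
which the difference of resolvents only involves v(x) and ζ, and these vectors span a dense
subspace. -/
theorem tendsto_res {ζ₀ : ℂ} (hζ₀ : 0 < ζ₀.im) (v₀ : Vertex K → ℝ) (f : Hilb K) :
    Tendsto (fun p : (Vertex K → ℝ) × ℂ => res lam p.1 p.2 f) (𝓝 (v₀, ζ₀))
      (𝓝 (res lam v₀ ζ₀ f)) := by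
  have hev : ∀ᶠ p : (Vertex K → ℝ) × ℂ in 𝓝 (v₀, ζ₀), ζ₀.im / 2 < p.2.im := by
    have : Continuous fun p : (Vertex K → ℝ) × ℂ => p.2.im := by fun_prop
    exact this.continuousAt.eventually (lt_mem_nhds (by simpa using half_lt_self hζ₀))
  let S : Submodule ℂ (Hilb K) :=
    { carrier := {f | Tendsto (fun p : (Vertex K → ℝ) × ℂ => res lam p.1 p.2 f) (𝓝 (v₀, ζ₀))
        (𝓝 (res lam v₀ ζ₀ f))}
      add_mem' := by
        intro f g hf hg
        simpa [map_add] using Tendsto.add hf hg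
      zero_mem' := by simp
      smul_mem' := by
        intro c f hf
        simpa [map_smul] using Tendsto.const_smul hf c }
  have hbd : ∀ p : (Vertex K → ℝ) × ℂ, ζ₀.im / 2 < p.2.im → ∀ f : Hilb K,
      ‖res lam p.1 p.2 f‖ ≤ ‖f‖ * (2 / ζ₀.im) := by
    intro p hp f
    have h0 : 0 < ζ₀.im / 2 := by positivity
    refine (norm_res_le (h0.trans hp) f).trans ?_
    rw [div_eq_mul_inv]
    gcongr
    rw [inv_le_comm₀ (h0.trans hp) (by positivity), inv_div]
    exact hp.le
  have hclosed : IsClosed (S : Set (Hilb K)) := by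
    rw [← isSeqClosed_iff_isClosed]
    intro g g0 hg hlim
    change Tendsto _ _ _
    rw [Metric.tendsto_nhds]
    intro ε hε
    have hc : 0 < ε / 3 / (2 / ζ₀.im) := by positivity
    obtain ⟨n, hn⟩ := (Metric.tendsto_nhds.1 hlim _ hc).exists
    have h1 : ‖g0 - g n‖ * (2 / ζ₀.im) < ε / 3 := by
      rw [dist_comm, dist_eq_norm, lt_div_iff₀ (by positivity)] at hn
      exact hn
    filter_upwards [hev, Metric.tendsto_nhds.1 (hg n) (ε / 3) (by positivity)] with p hp1 hp2
    have h2 := hbd p hp1 (g0 - g n)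
    have h3 := hbd (v₀, ζ₀) (by simpa using half_lt_self hζ₀) (g0 - g n)
    rw [map_sub, ← dist_eq_norm] at h2 h3
    have h4 := dist_triangle4 (res lam p.1 p.2 g0) (res lam p.1 p.2 (g n))
      (res lam v₀ ζ₀ (g n)) (res lam v₀ ζ₀ g0)
    rw [dist_comm (res lam v₀ ζ₀ (g n)) (res lam v₀ ζ₀ g0)] at h4
    simp only at h3
    linarith
  have hcore : ∀ x, ham lam v₀ ⟨delta x, delta_mem_domain lam v₀ x⟩ - ζ₀ • delta x ∈ S := by
    intro x
    set F : Hilb K := ham lam v₀ ⟨delta x, delta_mem_domain lam v₀ x⟩ - ζ₀ • delta x with hF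
    change Tendsto _ _ _
    have h0 : res lam v₀ ζ₀ F = delta x :=
      (isResolvent_res hζ₀).1 ⟨delta x, delta_mem_domain lam v₀ x⟩
    rw [h0, tendsto_iff_norm_sub_tendsto_zero]
    have hlim : Tendsto (fun p : (Vertex K → ℝ) × ℂ =>
        ‖((lam * v₀ x : ℝ) : ℂ) - ((lam * p.1 x : ℝ) : ℂ) - ζ₀ + p.2‖ * (2 / ζ₀.im))
        (𝓝 (v₀, ζ₀)) (𝓝 0) := by
      have : Continuous (fun p : (Vertex K → ℝ) × ℂ =>
        ‖((lam * v₀ x : ℝ) : ℂ) - ((lam * p.1 x : ℝ) : ℂ) - ζ₀ + p.2‖ * (2 / ζ₀.im)) := by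
        fun_prop
      convert this.tendsto (v₀, ζ₀) using 2
      simp
    refine squeeze_zero' (Eventually.of_forall fun _ => norm_nonneg _) ?_ hlim
    filter_upwards [hev] with p hp
    have hp0 : 0 < p.2.im := lt_trans (by positivity) hp
    have h1 : delta x = res lam p.1 p.2
        (ham lam p.1 ⟨delta x, delta_mem_domain lam p.1 x⟩ - p.2 • delta x) :=
      ((isResolvent_res hp0).1 ⟨delta x, delta_mem_domain lam p.1 x⟩).symm
    have h2 : res lam p.1 p.2 F - delta x
        = res lam p.1 p.2 ((((lam * v₀ x : ℝ) : ℂ) - ((lam * p.1 x : ℝ) : ℂ) - ζ₀ + p.2)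
            • delta x) := by
      conv_lhs => rw [h1, ← map_sub, hF, ham_delta, ham_delta]
      congr 1
      simp only [sub_smul, add_smul]
      abel
    rw [h2]
    refine (hbd p hp _).trans ?_
    rw [norm_smul, norm_delta, mul_one]
  have hS : S = ⊤ := by
    rw [← IsClosed.submodule_topologicalClosure_eq hclosed]
    rw [Submodule.topologicalClosure_eq_top_iff, Submodule.eq_bot_iff]
    intro g hg
    exact eq_zero_of_inner_ham_delta (lam := lam) (v := v₀) hζ₀ fun x => hg _ (hcore x)
  have : f ∈ S := hS ▸ Submodule.mem_top
  exact this

theorem continuousAt_resolventKernel {ζ₀ : ℂ} (hζ₀ : 0 < ζ₀.im) (v₀ : Vertex K → ℝ)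
    (x y : Vertex K) :
    ContinuousAt (fun p : (Vertex K → ℝ) × ℂ => resolventKernel lam p.1 p.2 x y) (v₀, ζ₀) := by
  unfold resolventKernel
  exact (Filter.Tendsto.inner tendsto_const_nhds (tendsto_res hζ₀ v₀ (delta y)))

theorem continuous_resolventKernel {ζ : ℂ} (hζ : 0 < ζ.im) (x y : Vertex K) :
    Continuous fun v : Vertex K → ℝ => resolventKernel lam v ζ x y := by
  rw [continuous_iff_continuousAt]
  intro v
  have h : Tendsto (fun v : Vertex K → ℝ => (v, ζ)) (𝓝 v) (𝓝 (v, ζ)) :=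
    (continuous_id.prodMk continuous_const).tendsto v
  have h2 := Tendsto.comp (continuousAt_resolventKernel (lam := lam) hζ v x y) h
  rwa [Function.comp_def] at h2

theorem res_sub_res {ζ ζ' : ℂ} (hζ : 0 < ζ.im) (hζ' : 0 < ζ'.im) (f : Hilb K) :
    res lam v ζ f - res lam v ζ' f = (ζ - ζ') • res lam v ζ (res lam v ζ' f) := by
  rw [← map_smul]
  refine eq_res hζ fun x => ?_
  have h1 := hamFun_res (lam := lam) (v := v) hζ f x
  have h2 := hamFun_res (lam := lam) (v := v) hζ' f x
  have h3 : hamFun lam v (res lam v ζ f - res lam v ζ' f : Hilb K)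
      = hamFun lam v (res lam v ζ f) - hamFun lam v (res lam v ζ' f) := by
    have h4 : (res lam v ζ f - res lam v ζ' f : Hilb K)
        = (res lam v ζ f : Vertex K → ℂ) + (-1 : ℂ) • (res lam v ζ' f : Vertex K → ℂ) := by
      ext z
      simp [sub_eq_add_neg]
    rw [h4, hamFun_add, hamFun_smul, neg_one_smul, sub_eq_add_neg]
  rw [h3, Pi.sub_apply, h1, h2]
  simp only [hilb_sub_apply, hilb_smul_apply]
  ring

theorem differentiableAt_rootGreen {ζ₀ : ℂ} (hζ₀ : 0 < ζ₀.im) :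
    DifferentiableAt ℂ (fun ζ => rootGreen lam v ζ) ζ₀ := by
  have hev : ∀ᶠ ζ : ℂ in 𝓝[≠] ζ₀, 0 < ζ.im :=
    nhdsWithin_le_nhds (Complex.continuous_im.continuousAt.eventually (lt_mem_nhds hζ₀))
  refine HasDerivAt.differentiableAt (f' := res lam v ζ₀ (res lam v ζ₀ (delta (root K))) (root K))
    ?_
  rw [hasDerivAt_iff_tendsto_slope]
  have hlim : Tendsto (fun ζ => res lam v ζ (res lam v ζ₀ (delta (root K))) (root K)) (𝓝[≠] ζ₀)
      (𝓝 (res lam v ζ₀ (res lam v ζ₀ (delta (root K))) (root K))) := by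
    refine ((continuous_apply_hilb (root K)).tendsto _).comp ?_
    have h : Tendsto (fun ζ : ℂ => (v, ζ)) (𝓝[≠] ζ₀) (𝓝 (v, ζ₀)) :=
      ((continuous_const.prodMk continuous_id).tendsto ζ₀).mono_left nhdsWithin_le_nhds
    have h2 := (tendsto_res (lam := lam) hζ₀ v (res lam v ζ₀ (delta (root K)))).comp h
    rwa [Function.comp_def] at h2
  refine hlim.congr' ?_
  filter_upwards [hev, self_mem_nhdsWithin] with ζ hζ hne
  have h := congrArg (fun g : Hilb K => g (root K))
    (res_sub_res (lam := lam) (v := v) hζ hζ₀ (delta (root K)))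
  simp only [hilb_sub_apply, hilb_smul_apply] at h
  have hne' : ζ - ζ₀ ≠ 0 := sub_ne_zero.2 hne
  rw [slope_def_field, rootGreen, rootGreen, resolventKernel_eq, resolventKernel_eq, h]
  field_simp

end Resolvent

end

/-! ### Boundary values of bounded holomorphic functions on the upper half-plane -/

/-- The half-plane is rotated and rescaled so that the point at height r becomes 1. Dividing by
(z+1)² makes the function bounded and vanishing at infinity, at rate L/|z|. On the boundary line,
smallness of h is used up to |rt| = δ; beyond it the decay gives L/|t| ≤ Lr/δ ≤ ε. -/
theorem norm_le_of_phragmenLindelof {h : ℂ → ℂ} {L ε δ r : ℝ} (hL : 0 < L) (hε : 0 < ε)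
    (hδ : 0 < δ) (hr : 0 < r) (hrδ : L * r ≤ ε * δ)
    (hcont : Continuous h) (hdiff : ∀ z : ℂ, 0 < z.im → DifferentiableAt ℂ h z)
    (hlip : ∀ z, ‖h z‖ ≤ L * ‖z‖) (hsmall : ∀ t : ℝ, |t| ≤ δ → ‖h t‖ ≤ ε * |t|)
    {z : ℂ} (hz : 0 ≤ z.re) : ‖h (r * (Complex.I * z)) / r / (z + 1) ^ 2‖ ≤ ε := by
  have hne : ∀ z : ℂ, 0 ≤ z.re → (z + 1) ≠ 0 := by
    intro z hz h0
    have := congrArg Complex.re h0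
    simp at this
    linarith
  have hsq : ∀ z : ℂ, 0 ≤ z.re → 1 + ‖z‖ ^ 2 ≤ ‖z + 1‖ ^ 2 := by
    intro z hz
    rw [Complex.sq_norm, Complex.sq_norm, Complex.normSq_apply, Complex.normSq_apply]
    simp only [Complex.add_re, Complex.one_re, Complex.add_im, Complex.one_im]
    nlinarith
  have hkey : ∀ z : ℂ, 0 ≤ z.re →
      ‖h (r * (Complex.I * z)) / r / (z + 1) ^ 2‖ ≤ L * (‖z‖ / (1 + ‖z‖ ^ 2)) := by
    intro z hz
    rw [norm_div, norm_div, norm_pow, Complex.norm_real, Real.norm_eq_abs, abs_of_pos hr]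
    have h1 := hlip (r * (Complex.I * z))
    rw [norm_mul, norm_mul, Complex.norm_I, one_mul, Complex.norm_real, Real.norm_eq_abs,
      abs_of_pos hr] at h1
    have h2 : ‖h (r * (Complex.I * z))‖ / r ≤ L * ‖z‖ := by
      rw [div_le_iff₀ hr]; linarith
    rw [← mul_div_assoc]
    have := hsq z hz
    gcongr
  refine PhragmenLindelof.right_half_plane_of_tendsto_zero_on_real
    (f := fun z => h (r * (Complex.I * z)) / r / (z + 1) ^ 2) ?_ ?_ ?_ ?_ hz
  · refine ⟨fun z hz => ?_, ?_⟩
    · have hz' : 0 < z.re := hz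
      have : DifferentiableAt ℂ (fun z => h (r * (Complex.I * z))) z := by
        refine DifferentiableAt.comp (g := h) z (hdiff _ ?_) (by fun_prop)
        simpa using mul_pos hr hz'
      refine DifferentiableAt.differentiableWithinAt ?_
      refine (this.div_const _).div (by fun_prop) ?_
      exact pow_ne_zero _ (hne z hz'.le)
    · rw [Complex.closure_setOfPred_lt_re]
      refine ContinuousOn.div (by fun_prop) (by fun_prop) fun z hz => ?_
      exact pow_ne_zero _ (hne z hz)
  · refine ⟨1, by norm_num, 0, ?_⟩
    simp only [zero_mul, Real.exp_zero]
    refine Asymptotics.IsBigO.of_bound L ?_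
    filter_upwards [mem_inf_of_right (mem_principal_self _)] with z hz
    have hz' : 0 < z.re := hz
    refine (hkey z hz'.le).trans ?_
    rw [norm_one]
    gcongr
    rw [div_le_one (by positivity)]
    nlinarith [sq_nonneg (‖z‖ - 1)]
  · rw [tendsto_zero_iff_norm_tendsto_zero]
    have h1 : Tendsto (fun x : ℝ => L * x⁻¹) atTop (𝓝 0) := by
      simpa using tendsto_inv_atTop_zero.const_mul L
    refine squeeze_zero' (Eventually.of_forall fun _ => norm_nonneg _) ?_ h1
    filter_upwards [eventually_gt_atTop 0] with x hx
    refine (hkey x (by simpa using hx.le)).trans ?_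
    rw [Complex.norm_real, Real.norm_eq_abs, abs_of_pos hx]
    gcongr
    rw [div_le_iff₀ (by positivity)]
    have : x⁻¹ * (1 + x ^ 2) = x⁻¹ + x := by field_simp
    rw [this]
    have : 0 < x⁻¹ := by positivity
    linarith
  · intro t
    by_cases ht : |r * t| ≤ δ
    · have e1 : (r * (Complex.I * (t * Complex.I)) : ℂ) = ((-(r * t) : ℝ) : ℂ) := by
        push_cast
        linear_combination (r * t : ℂ) * Complex.I_mul_I
      have h1 := hsmall (-(r * t)) (by rwa [abs_neg])
      rw [abs_neg, abs_mul, abs_of_pos hr] at h1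
      simp only [e1]
      rw [norm_div, norm_div, norm_pow, Complex.norm_real r, Real.norm_eq_abs, abs_of_pos hr]
      have h2 : ‖h ((-(r * t) : ℝ) : ℂ)‖ / r ≤ ε * |t| := by
        rw [div_le_iff₀ hr]; linarith
      have h3 := hsq (t * Complex.I) (by simp)
      have h4 : ‖(t * Complex.I : ℂ)‖ = |t| := by simp
      rw [h4] at h3
      rw [div_le_iff₀ (by nlinarith [abs_nonneg t])]
      have h5 : |t| ≤ 1 + |t| ^ 2 := by nlinarith [sq_nonneg (|t| - 1)]
      have : ε * |t| ≤ ε * ‖(t * Complex.I : ℂ) + 1‖ ^ 2 := by gcongr; linarith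
      linarith
    · push Not at ht
      rw [abs_mul, abs_of_pos hr] at ht
      refine (hkey _ (by simp)).trans ?_
      have h4 : ‖(t * Complex.I : ℂ)‖ = |t| := by simp
      rw [h4]
      have ht0 : 0 < |t| := by
        by_contra h0
        have : |t| = 0 := le_antisymm (not_lt.1 h0) (abs_nonneg _)
        rw [this, mul_zero] at ht
        linarith
      have h5 : |t| / (1 + |t| ^ 2) ≤ |t|⁻¹ := by
        rw [div_le_iff₀ (by positivity)]
        have : |t|⁻¹ * (1 + |t| ^ 2) = |t|⁻¹ + |t| := by field_simp
        rw [this]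
        have : 0 < |t|⁻¹ := by positivity
        linarith
      calc L * (|t| / (1 + |t| ^ 2)) ≤ L * |t|⁻¹ := by gcongr
        _ = (L * r) / (r * |t|) := by field_simp
        _ ≤ (ε * δ) / (r * |t|) := by gcongr
        _ ≤ ε := by
          rw [div_le_iff₀ (by positivity)]
          gcongr

/-- Differentiability along the real line says that Φ minus its affine approximation is o(|t|) on
the axis. Phragmén–Lindelöf carries this into the half-plane at scale r, and Cauchy's estimate turns
it into smallness of the derivative f - a at height r. -/
theorem tendsto_deriv_of_hasDerivAt_boundary {Φ f : ℂ → ℂ} {C : NNReal} (hΦ : LipschitzWith C Φ)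
    (hd : ∀ z : ℂ, 0 < z.im → HasDerivAt Φ (f z) z) {E : ℝ} {a : ℂ}
    (ha : HasDerivAt (fun x : ℝ => Φ x) a E) :
    Tendsto (fun η : ℝ => f (E + η * Complex.I)) (𝓝[>] 0) (𝓝 a) := by
  set h : ℂ → ℂ := fun z => Φ (E + z) - Φ E - a * z with hh
  set L : ℝ := C + ‖a‖ + 1
  have hL : 0 < L := by positivity
  have hcont : Continuous h := by
    have := hΦ.continuous
    fun_prop
  have hderiv : ∀ z : ℂ, 0 < z.im → HasDerivAt h (f (E + z) - a) z := by
    intro z hz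
    have h1 : HasDerivAt (fun z => Φ (E + z)) (f (E + z)) z :=
      (hd (E + z) (by simpa using hz)).comp_const_add (E : ℂ) z
    exact ((h1.sub_const (Φ E)).sub ((hasDerivAt_id z).const_mul a)).congr_deriv (by simp)
  have hlip : ∀ z, ‖h z‖ ≤ L * ‖z‖ := by
    intro z
    have h1 : ‖Φ (E + z) - Φ E‖ ≤ C * ‖z‖ := by
      simpa using hΦ.norm_sub_le (E + z) E
    calc ‖h z‖ ≤ ‖Φ (E + z) - Φ E‖ + ‖a * z‖ := norm_sub_le _ _
      _ ≤ C * ‖z‖ + ‖a‖ * ‖z‖ := by rw [norm_mul]; gcongr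
      _ ≤ L * ‖z‖ := by
        rw [← add_mul]
        gcongr
        simp [L]
  rw [Metric.tendsto_nhds]
  intro ε' hε'
  -- On the circle of radius 1/2 about 1 one has |z + 1|² ≤ 9, so Cauchy's estimate yields 18ε,
  -- which must be less than ε'.
  set ε : ℝ := ε' / 20 with hεdef
  have hε : 0 < ε := by positivity
  obtain ⟨δ, hδ, hsmall⟩ : ∃ δ > 0, ∀ t : ℝ, |t| ≤ δ → ‖h t‖ ≤ ε * |t| := by
    rw [hasDerivAt_iff_isLittleO_nhds_zero] at ha
    have := ha.def hε
    rw [Metric.eventually_nhds_iff] at this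
    obtain ⟨δ, hδ, H⟩ := this
    refine ⟨δ / 2, by positivity, fun t ht => ?_⟩
    have := H (y := t) (by rw [dist_zero_right, Real.norm_eq_abs]; linarith)
    simpa [hh, mul_comm] using this
  have hev : ∀ᶠ r : ℝ in 𝓝[>] 0, r < ε * δ / L :=
    nhdsWithin_le_nhds (gt_mem_nhds (by positivity))
  filter_upwards [hev, self_mem_nhdsWithin] with r hr1 hr
  have hr : 0 < r := hr
  have hrδ : L * r ≤ ε * δ := by
    rw [lt_div_iff₀ hL] at hr1
    linarith
  have hPL := fun z hz => norm_le_of_phragmenLindelof (z := z) hL hε hδ hr hrδ hcont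
    (fun z hz => (hderiv z hz).differentiableAt) hlip hsmall hz
  set k : ℂ → ℂ := fun z => h (r * (Complex.I * z)) / r with hk
  have hkd : ∀ z : ℂ, 0 < z.re →
      HasDerivAt k (Complex.I * (f (E + r * (Complex.I * z)) - a)) z := by
    intro z hz
    have h1 : HasDerivAt (fun z : ℂ => (r : ℂ) * (Complex.I * z)) (r * (Complex.I * 1)) z :=
      ((hasDerivAt_id z).const_mul Complex.I).const_mul (r : ℂ)
    have h2 := (hderiv (r * (Complex.I * z)) (by simpa using mul_pos hr hz)).comp z h1
    have h3 := h2.div_const (r : ℂ)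
    have hr0 : (r : ℂ) ≠ 0 := by exact_mod_cast hr.ne'
    refine h3.congr_deriv ?_
    rw [div_eq_iff hr0]
    ring
  have hre : ∀ z : ℂ, z ∈ Metric.closedBall (1 : ℂ) (1 / 2) → 0 < z.re := by
    intro z hz
    rw [mem_closedBall_iff_norm] at hz
    have := (Complex.abs_re_le_norm (z - 1)).trans hz
    rw [abs_le] at this
    simp at this
    linarith [this.1]
  have hcauchy : ‖deriv k 1‖ ≤ (9 * ε) / (1 / 2) := by
    refine Complex.norm_deriv_le_of_forall_mem_sphere_norm_le (by norm_num) ?_ ?_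
    · refine ⟨fun z hz => ?_, ?_⟩
      · exact (hkd z (hre z (Metric.ball_subset_closedBall hz))).differentiableAt
          |>.differentiableWithinAt
      · have : Continuous k := by fun_prop
        exact this.continuousOn
    · intro z hz
      have hz' := hre z (Metric.sphere_subset_closedBall hz)
      have h1 := hPL z hz'.le
      have h0 : (z + 1) ≠ 0 := by
        intro h0
        have := congrArg Complex.re h0
        simp at this
        linarith
      rw [norm_div, norm_pow, div_le_iff₀ (by positivity)] at h1
      have h2 : ‖z + 1‖ ≤ 3 := by
        rw [mem_sphere_iff_norm] at hz
        calc ‖z + 1‖ = ‖(z - 1) + 2‖ := by congr 1; ring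
          _ ≤ ‖z - 1‖ + ‖(2 : ℂ)‖ := norm_add_le _ _
          _ ≤ 3 := by rw [hz]; norm_num
      have h3 : ‖z + 1‖ ^ 2 ≤ 9 := by nlinarith [norm_nonneg (z + 1)]
      calc ‖k z‖ ≤ ε * ‖z + 1‖ ^ 2 := h1
        _ ≤ ε * 9 := by gcongr
        _ = 9 * ε := by ring
  rw [(hkd 1 (by simp)).deriv, norm_mul, Complex.norm_I, one_mul, mul_one] at hcauchy
  rw [dist_eq_norm]
  calc ‖f (E + r * Complex.I) - a‖ ≤ 9 * ε / (1 / 2) := hcauchy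
    _ < ε' := by rw [hεdef]; linarith

/-- The Cayley transform moves the problem to the unit disc, where holomorphic functions have
primitives. The function integrated there is f times the derivative of the inverse transform. -/
theorem exists_primitive_upperHalfPlane {f : ℂ → ℂ}
    (hf : ∀ z : ℂ, 0 < z.im → DifferentiableAt ℂ f z) :
    ∃ Φ : ℂ → ℂ, ∀ z : ℂ, 0 < z.im → HasDerivAt Φ (f z) z := by
  have hne : ∀ w : ℂ, w ∈ Metric.ball (0 : ℂ) 1 → (1 - w) ≠ 0 := by
    intro w hw h0
    rw [mem_ball_zero_iff, ← sub_eq_zero.1 h0] at hw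
    simp at hw
  set F : ℂ → ℂ := fun w => f (Complex.I * (1 + w) / (1 - w)) * (2 * Complex.I / (1 - w) ^ 2)
  have hF : DifferentiableOn ℂ F (Metric.ball 0 1) := by
    intro w hw
    have h0 := hne w hw
    refine DifferentiableAt.differentiableWithinAt (DifferentiableAt.mul ?_ ?_)
    · refine DifferentiableAt.comp (g := f) w (hf _ ?_) ?_
      · have hns : 0 < Complex.normSq (1 - w) := Complex.normSq_pos.2 h0
        have e : (Complex.I * (1 + w) / (1 - w)).im
            = (1 - Complex.normSq w) / Complex.normSq (1 - w) := by
          rw [Complex.div_im]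
          simp only [Complex.mul_im, Complex.mul_re, Complex.I_re, Complex.I_im, Complex.add_re,
            Complex.add_im, Complex.one_re, Complex.one_im, Complex.sub_re, Complex.sub_im,
            Complex.normSq_apply w]
          field_simp
          ring
        rw [e]
        refine div_pos ?_ hns
        rw [mem_ball_zero_iff] at hw
        rw [← Complex.sq_norm]
        nlinarith [norm_nonneg w]
      · exact DifferentiableAt.div (by fun_prop) (by fun_prop) h0
    · exact DifferentiableAt.div (by fun_prop) (by fun_prop) (pow_ne_zero _ h0)
  obtain ⟨Ψ, hΨ⟩ := hF.isExactOn_ball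
  refine ⟨fun z => Ψ ((z - Complex.I) / (z + Complex.I)), fun z hz => ?_⟩
  have hzI : z + Complex.I ≠ 0 := by
    intro h0
    have := congrArg Complex.im h0
    simp at this
    linarith
  have hmem : (z - Complex.I) / (z + Complex.I) ∈ Metric.ball (0 : ℂ) 1 := by
    rw [mem_ball_zero_iff, norm_div, div_lt_one (norm_pos_iff.2 hzI)]
    refine lt_of_pow_lt_pow_left₀ 2 (norm_nonneg _) ?_
    rw [Complex.sq_norm, Complex.sq_norm, Complex.normSq_apply, Complex.normSq_apply]
    simp
    nlinarith
  have h1 : HasDerivAt (fun z : ℂ => (z - Complex.I) / (z + Complex.I))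
      ((1 * (z + Complex.I) - (z - Complex.I) * 1) / (z + Complex.I) ^ 2) z :=
    ((hasDerivAt_id z).sub_const _).div ((hasDerivAt_id z).add_const _) hzI
  have h2 := (hΨ _ hmem).comp z h1
  have hI := Complex.I_sq
  have e1 : 1 - (z - Complex.I) / (z + Complex.I) = 2 * Complex.I / (z + Complex.I) := by
    field_simp; ring
  have e2 : Complex.I * (1 + (z - Complex.I) / (z + Complex.I))
      / (1 - (z - Complex.I) / (z + Complex.I)) = z := by
    rw [e1]
    have : 1 + (z - Complex.I) / (z + Complex.I) = 2 * z / (z + Complex.I) := by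
      field_simp; ring
    rw [this]
    field_simp
  refine h2.congr_deriv ?_
  change f _ * _ * _ = _
  rw [e2, e1]
  field_simp
  ring

/-- **Fatou's theorem** (vertical limits) for bounded holomorphic functions on the upper
half-plane. -/
theorem ae_exists_tendsto_of_bounded {f : ℂ → ℂ} {C : ℝ}
    (hf : ∀ z : ℂ, 0 < z.im → DifferentiableAt ℂ f z) (hC : ∀ z : ℂ, 0 < z.im → ‖f z‖ ≤ C) :
    ∀ᵐ E : ℝ, ∃ l, Tendsto (fun η : ℝ => f (E + η * Complex.I)) (𝓝[>] 0) (𝓝 l) := by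
  -- Boundedness of f makes its primitive Lipschitz on the convex half-plane. A Lipschitz extension
  -- to the plane restricts to a Lipschitz function on the real line, which is differentiable almost
  -- everywhere; the derivative there is the vertical limit of f.
  obtain ⟨Φ, hΦ⟩ := exists_primitive_upperHalfPlane hf
  have hlip : LipschitzOnWith C.toNNReal Φ {z : ℂ | 0 < z.im} := by
    refine Convex.lipschitzOnWith_of_nnnorm_hasDerivWithin_le (f' := f)
      (convex_halfSpace_im_gt 0) (fun z hz => (hΦ z hz).hasDerivWithinAt) fun z hz => ?_
    rw [← NNReal.coe_le_coe, coe_nnnorm]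
    exact (hC z hz).trans (Real.le_coe_toNNReal C)
  obtain ⟨Ψ, hΨ, heq⟩ := hlip.extend_finite_dimension
  have hΨd : ∀ z : ℂ, 0 < z.im → HasDerivAt Ψ (f z) z := by
    intro z hz
    refine (hΦ z hz).congr_of_eventuallyEq ?_
    filter_upwards [(isOpen_lt continuous_const Complex.continuous_im).mem_nhds hz] with w hw
    exact (heq hw).symm
  have hreal := hΨ.comp (Complex.isometry_ofReal.lipschitz)
  filter_upwards [hreal.ae_differentiableAt_real] with E hE
  exact ⟨_, tendsto_deriv_of_hasDerivAt_boundary hΨ hΨd hE.hasDerivAt⟩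

/-! ### Comparison of weighted moments -/

section Tilt

variable {α : Type*} [MeasurableSpace α]

/-- Hölder interpolation between the exponents 0 and r. The power s/r on the constant matters: it
makes the logarithm of the constant vanish linearly as s tends to 0. -/
theorem lintegral_rpow_le_of_le {Q : Measure α} {X : α → ℝ≥0∞} (hX : Measurable X) {s r : ℝ}
    {C : ℝ≥0∞} (hs : 0 ≤ s) (hr : 0 < r) (hsr : s ≤ r)
    (h : ∫⁻ a, X a ^ r ∂Q ≤ C * Q Set.univ) :
    ∫⁻ a, X a ^ s ∂Q ≤ C ^ (s / r) * Q Set.univ := by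
  have hp : 0 ≤ s / r := by positivity
  have hq : 0 ≤ 1 - s / r := by
    rw [sub_nonneg, div_le_one hr]; exact hsr
  have h1 := ENNReal.lintegral_mul_norm_pow_le (μ := Q) (f := fun a => X a ^ r)
    (g := fun _ => 1) (hX.pow_const r).aemeasurable aemeasurable_const hp hq (by ring)
  have h2 : ∀ a, (X a ^ r) ^ (s / r) * (1 : ℝ≥0∞) ^ (1 - s / r) = X a ^ s := by
    intro a
    rw [← ENNReal.rpow_mul, mul_div_cancel₀ _ hr.ne', ENNReal.one_rpow, mul_one]
  simp only [h2, lintegral_one] at h1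
  calc ∫⁻ a, X a ^ s ∂Q ≤ (∫⁻ a, X a ^ r ∂Q) ^ (s / r) * Q Set.univ ^ (1 - s / r) := h1
    _ ≤ (C * Q Set.univ) ^ (s / r) * Q Set.univ ^ (1 - s / r) := by gcongr
    _ = C ^ (s / r) * (Q Set.univ ^ (s / r) * Q Set.univ ^ (1 - s / r)) := by
      rw [ENNReal.mul_rpow_of_nonneg _ _ hp, mul_assoc]
    _ = C ^ (s / r) * Q Set.univ := by
      rw [← ENNReal.rpow_add_of_nonneg _ _ hp hq]; simp

theorem lintegral_rpow_le_of_abs_le {Q : Measure α} {X : α → ℝ≥0∞} (hX : Measurable X) {s r : ℝ}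
    {C : ℝ≥0∞} (hr : 0 < r) (hsr : |s| ≤ r)
    (h : ∫⁻ a, X a ^ r ∂Q ≤ C * Q Set.univ) (h' : ∫⁻ a, X a ^ (-r) ∂Q ≤ C * Q Set.univ) :
    ∫⁻ a, X a ^ s ∂Q ≤ C ^ (|s| / r) * Q Set.univ := by
  rcases le_total 0 s with hs | hs
  · rw [abs_of_nonneg hs] at *
    exact lintegral_rpow_le_of_le hX hs hr hsr h
  · rw [abs_of_nonpos hs] at *
    have h1 := lintegral_rpow_le_of_le (Q := Q) (X := fun a => (X a)⁻¹) hX.inv (s := -s)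
      (r := r) (C := C) (by linarith) hr hsr (by simpa only [ENNReal.inv_rpow,
        ← ENNReal.rpow_neg] using h')
    simpa only [ENNReal.inv_rpow, ← ENNReal.rpow_neg, neg_neg] using h1

/-- By Cauchy–Schwarz, Q(1)² is at most the product of the integrals of X^s and X^{-s}, and the
second factor is bounded above by interpolation. -/
theorem le_lintegral_rpow_of_abs_le {Q : Measure α} {X : α → ℝ≥0∞} (hX : Measurable X) {s r : ℝ}
    {C : ℝ≥0∞} (hr : 0 < r) (hsr : |s| ≤ r) (hQ : Q Set.univ ≠ ∞)
    (hX0 : ∀ᵐ a ∂Q, X a ≠ 0 ∧ X a ≠ ∞)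
    (h : ∫⁻ a, X a ^ r ∂Q ≤ C * Q Set.univ) (h' : ∫⁻ a, X a ^ (-r) ∂Q ≤ C * Q Set.univ) :
    Q Set.univ ≤ C ^ (|s| / r) * ∫⁻ a, X a ^ s ∂Q := by
  by_cases hQ0 : Q Set.univ = 0
  · rw [hQ0]; exact zero_le
  have h1 := ENNReal.lintegral_mul_norm_pow_le (μ := Q) (f := fun a => X a ^ s)
    (g := fun a => X a ^ (-s)) (hX.pow_const s).aemeasurable (hX.pow_const _).aemeasurable
    (p := 1 / 2) (q := 1 / 2) (by norm_num) (by norm_num) (by norm_num)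
  have h2 : ∫⁻ a, (X a ^ s) ^ (1 / 2 : ℝ) * (X a ^ (-s)) ^ (1 / 2 : ℝ) ∂Q = Q Set.univ := by
    rw [← lintegral_one]
    refine lintegral_congr_ae ?_
    filter_upwards [hX0] with a ha
    rw [← ENNReal.rpow_mul, ← ENNReal.rpow_mul, ← ENNReal.rpow_add _ _ ha.1 ha.2]
    ring_nf
    exact ENNReal.rpow_zero
  rw [h2, ← ENNReal.mul_rpow_of_nonneg _ _ (by norm_num)] at h1
  have h3 := lintegral_rpow_le_of_abs_le hX (s := -s) hr (by rwa [abs_neg]) h h'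
  rw [abs_neg] at h3
  have h4 : Q Set.univ ^ (2 : ℝ) ≤ (∫⁻ a, X a ^ s ∂Q) * (C ^ (|s| / r) * Q Set.univ) := by
    calc Q Set.univ ^ (2 : ℝ)
        ≤ (((∫⁻ a, X a ^ s ∂Q) * ∫⁻ a, X a ^ (-s) ∂Q) ^ (1 / 2 : ℝ)) ^ (2 : ℝ) := by gcongr
      _ = (∫⁻ a, X a ^ s ∂Q) * ∫⁻ a, X a ^ (-s) ∂Q := by
        rw [← ENNReal.rpow_mul]; norm_num
      _ ≤ _ := by gcongr
  rw [ENNReal.rpow_two, pow_two, ← mul_assoc, mul_comm (∫⁻ a, X a ^ s ∂Q)] at h4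
  exact (ENNReal.mul_le_mul_iff_left hQ0 hQ).1 h4

theorem rpow_neg_mul_div_rpow {x y : ℝ≥0∞} (hx0 : x ≠ 0) (hx : x ≠ ∞) (hy : y ≠ ∞)
    (s : ℝ) : x ^ (-s) * (x / y) ^ s = y ^ (-s) := by
  rw [div_eq_mul_inv, ENNReal.mul_rpow_of_ne_zero hx0 (ENNReal.inv_ne_zero.2 hy), ← mul_assoc,
    ← ENNReal.rpow_add _ _ hx0 hx, neg_add_cancel, ENNReal.rpow_zero, one_mul,
    ENNReal.inv_rpow, ENNReal.rpow_neg]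

/-- If `(x / y) ^ r` and `(x / y) ^ (-r)` have bounded mean with respect to the weight `x ^ (-s)`,
then replacing `x ^ (-s)` by `y ^ (-s)` changes the integral by a bounded factor only. -/
theorem tilt_compare {μ : Measure α} {x y : α → ℝ≥0∞} (hxm : Measurable x) (hym : Measurable y)
    (hx0 : ∀ a, x a ≠ 0) (hx : ∀ a, x a ≠ ∞) (hy0 : ∀ᵐ a ∂μ, y a ≠ 0) (hy : ∀ a, y a ≠ ∞)
    {s r : ℝ} {C : ℝ≥0∞} (hr : 0 < r) (hsr : |s| ≤ r) (hfin : ∫⁻ a, x a ^ (-s) ∂μ ≠ ∞)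
    (h : ∫⁻ a, x a ^ (-s) * (x a / y a) ^ r ∂μ ≤ C * ∫⁻ a, x a ^ (-s) ∂μ)
    (h' : ∫⁻ a, x a ^ (-s) * (x a / y a) ^ (-r) ∂μ ≤ C * ∫⁻ a, x a ^ (-s) ∂μ) :
    ∫⁻ a, y a ^ (-s) ∂μ ≤ C ^ (|s| / r) * ∫⁻ a, x a ^ (-s) ∂μ ∧
    ∫⁻ a, x a ^ (-s) ∂μ ≤ C ^ (|s| / r) * ∫⁻ a, y a ^ (-s) ∂μ := by
  -- Under this tilted measure the integral of y^{-s} is the s-th moment of the ratio x/y, so the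
  -- comparison reduces to moments of one variable.
  set Q := μ.withDensity (fun a => x a ^ (-s)) with hQ
  have hw : Measurable fun a => x a ^ (-s) := hxm.pow_const _
  have hX : Measurable fun a => x a / y a := hxm.div hym
  have hQu : Q Set.univ = ∫⁻ a, x a ^ (-s) ∂μ := by
    rw [hQ, withDensity_apply _ MeasurableSet.univ, Measure.restrict_univ]
  have hint : ∀ t : ℝ, ∫⁻ a, (x a / y a) ^ t ∂Q = ∫⁻ a, x a ^ (-s) * (x a / y a) ^ t ∂μ := by
    intro t
    rw [hQ, lintegral_withDensity_eq_lintegral_mul _ hw (hX.pow_const t)]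
    rfl
  have hys : ∫⁻ a, (x a / y a) ^ s ∂Q = ∫⁻ a, y a ^ (-s) ∂μ := by
    rw [hint]
    refine lintegral_congr_ae ?_
    exact Eventually.of_forall fun a => rpow_neg_mul_div_rpow (hx0 a) (hx a) (hy a) s
  rw [← hint, ← hQu] at h h'
  rw [← hys, ← hQu]
  rw [← hQu] at hfin
  refine ⟨lintegral_rpow_le_of_abs_le hX hr hsr h h',
    le_lintegral_rpow_of_abs_le hX hr hsr hfin ?_ h h'⟩
  refine (withDensity_absolutelyContinuous μ _).ae_le ?_
  filter_upwards [hy0] with a ha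
  exact ⟨ENNReal.div_ne_zero.2 ⟨hx0 a, hy a⟩, ENNReal.div_ne_top (hx a) ha⟩

end Tilt

/-! ### Transfer operators and quasi-multiplicativity -/

section Chain

variable (κ : Measure ℂ) (s : ℝ)

/-- The transfer operator of the Markov chain `γ ↦ (W - γ)⁻¹`, `W ∼ κ`, weighted with
`|W - γ|^{-s}`, acting on measures. -/
noncomputable def transfer (μ : Measure ℂ) : Measure ℂ :=
  ((μ.prod κ).withDensity (fun p => ‖p.2 - p.1‖ₑ ^ (-s))).map (fun p => (p.2 - p.1)⁻¹)

/-- The pairing `∫∫∫ |W - b - c|^{-s} dκ(W) dμ(b) dν(c)`. -/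
noncomputable def pairing (μ ν : Measure ℂ) : ℝ≥0∞ :=
  ∫⁻ b, ∫⁻ c, ∫⁻ W, ‖W - b - c‖ₑ ^ (-s) ∂κ ∂ν ∂μ

/-- The weighted mass `∫∫ (1 + |W - b|)^{-s} dκ(W) dμ(b)`. -/
noncomputable def smoothMass (μ : Measure ℂ) : ℝ≥0∞ :=
  ∫⁻ b, ∫⁻ W, (1 + ‖W - b‖ₑ) ^ (-s) ∂κ ∂μ

variable [IsProbabilityMeasure κ]

instance (μ : Measure ℂ) [SFinite μ] : SFinite (transfer κ s μ) := by
  unfold transfer; infer_instance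

instance (μ : Measure ℂ) [SFinite μ] (n : ℕ) : SFinite ((transfer κ s)^[n] μ) := by
  induction n with
  | zero => simpa
  | succ n ih => rw [Function.iterate_succ_apply']; infer_instance

variable {κ s}

theorem lintegral_transfer (μ : Measure ℂ) [SFinite μ] {f : ℂ → ℝ≥0∞} (hf : Measurable f) :
    ∫⁻ x, f x ∂transfer κ s μ
      = ∫⁻ b, ∫⁻ W, ‖W - b‖ₑ ^ (-s) * f (W - b)⁻¹ ∂κ ∂μ := by
  rw [transfer, lintegral_map hf (by fun_prop),
    lintegral_withDensity_eq_lintegral_mul _ (by fun_prop) (by fun_prop), lintegral_prod]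
  · rfl
  · exact Measurable.aemeasurable (by fun_prop)

theorem transfer_univ (μ : Measure ℂ) [SFinite μ] :
    transfer κ s μ Set.univ = ∫⁻ b, ∫⁻ W, ‖W - b‖ₑ ^ (-s) ∂κ ∂μ := by
  rw [← lintegral_one, lintegral_transfer μ measurable_const]
  simp

/-- A set which is invariant under almost every step of the chain, and avoids its poles. -/
structure IsInvariant (κ : Measure ℂ) (S : Set ℂ) : Prop where
  measurable : MeasurableSet S
  zero_mem : 0 ∈ S
  step : ∀ b ∈ S, ∀ᵐ W ∂κ, (W - b)⁻¹ ∈ S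
  ne : ∀ b ∈ S, ∀ c ∈ S, ∀ᵐ W ∂κ, W - b - c ≠ 0

variable {S : Set ℂ}

theorem IsInvariant.ne_zero (hS : IsInvariant κ S) {b : ℂ} (hb : b ∈ S) :
    ∀ᵐ W ∂κ, W - b ≠ 0 := by
  simpa using hS.ne b hb 0 hS.zero_mem

theorem IsInvariant.transfer_mem (hS : IsInvariant κ S) {μ : Measure ℂ} [SFinite μ]
    (hμ : ∀ᵐ b ∂μ, b ∈ S) : ∀ᵐ b ∂transfer κ s μ, b ∈ S := by
  rw [transfer, ae_map_iff (p := fun b => b ∈ S) (Measurable.aemeasurable (by fun_prop)) hS.measurable]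
  refine (withDensity_absolutelyContinuous _ _).ae_le ?_
  have hm : Measurable fun p : ℂ × ℂ => (p.2 - p.1)⁻¹ := by fun_prop
  have : MeasurableSet {p : ℂ × ℂ | (p.2 - p.1)⁻¹ ∈ S} := hm hS.measurable
  refine (Measure.ae_prod_iff_ae_ae this).2 ?_
  filter_upwards [hμ] with b hb using hS.step b hb

theorem IsInvariant.iterate_mem (hS : IsInvariant κ S) {μ : Measure ℂ} [SFinite μ]
    (hμ : ∀ᵐ b ∂μ, b ∈ S) (n : ℕ) : ∀ᵐ b ∂(transfer κ s)^[n] μ, b ∈ S := by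
  induction n with
  | zero => simpa
  | succ n ih => rw [Function.iterate_succ_apply']; exact hS.transfer_mem ih

theorem pairing_comm (μ ν : Measure ℂ) [SFinite μ] [SFinite ν] :
    pairing κ s μ ν = pairing κ s ν μ := by
  unfold pairing
  rw [lintegral_lintegral_swap]
  · simp_rw [sub_right_comm]
  · refine Measurable.aemeasurable ?_
    have : Measurable fun p : (ℂ × ℂ) × ℂ => ‖p.2 - p.1.1 - p.1.2‖ₑ ^ (-s) := by fun_prop
    exact this.lintegral_prod_right'

/-- The pairing of one step of the chain, as an integral over two independent steps. -/
noncomputable def twoStep (κ : Measure ℂ) (s : ℝ) (μ ν : Measure ℂ) : ℝ≥0∞ :=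
  ∫⁻ p, ‖(p.1.2 - p.1.1) * (p.2.2 - p.2.1) - 1‖ₑ ^ (-s) ∂((μ.prod κ).prod (ν.prod κ))

theorem twoStep_comm (μ ν : Measure ℂ) [SFinite μ] [SFinite ν] :
    twoStep κ s μ ν = twoStep κ s ν μ := by
  unfold twoStep
  rw [← lintegral_prod_swap]
  simp only [Prod.fst_swap, Prod.snd_swap, mul_comm]

/-- The weight |W-b|^{-s} times |W' - (W-b)⁻¹ - c|^{-s} equals |(W-b)(W'-c) - 1|^{-s}. This is
symmetric in the two sides, whence the transfer operator is self-adjoint for the pairing. -/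
theorem pairing_transfer (hS : IsInvariant κ S) {μ ν : Measure ℂ} [SFinite μ] [SFinite ν]
    (hμ : ∀ᵐ b ∂μ, b ∈ S) : pairing κ s (transfer κ s μ) ν = twoStep κ s μ ν := by
  have hm : Measurable fun b : ℂ => ∫⁻ c, ∫⁻ W, ‖W - b - c‖ₑ ^ (-s) ∂κ ∂ν := by
    have h1 : Measurable fun p : (ℂ × ℂ) × ℂ => ‖p.2 - p.1.1 - p.1.2‖ₑ ^ (-s) := by fun_prop
    exact h1.lintegral_prod_right'.lintegral_prod_right'
  rw [pairing, lintegral_transfer μ hm, twoStep,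
    lintegral_prod _ (Measurable.aemeasurable (by fun_prop)), lintegral_prod]
  · refine lintegral_congr_ae ?_
    filter_upwards [hμ] with b hb
    refine lintegral_congr_ae ?_
    filter_upwards [hS.ne_zero hb] with W hW
    rw [lintegral_prod _ (Measurable.aemeasurable (by fun_prop)),
      ← lintegral_const_mul]
    · refine lintegral_congr fun c => ?_
      rw [← lintegral_const_mul _ (by fun_prop)]
      refine lintegral_congr fun W' => ?_
      rw [← ENNReal.mul_rpow_of_ne_top enorm_ne_top enorm_ne_top, ← enorm_mul]
      congr 2
      field_simp
      ring
    · have h1 : Measurable fun p : ℂ × ℂ => ‖p.2 - (W - b)⁻¹ - p.1‖ₑ ^ (-s) := by fun_prop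
      exact h1.lintegral_prod_right'
  · refine Measurable.aemeasurable ?_
    have h1 : Measurable fun p : (ℂ × ℂ) × (ℂ × ℂ) =>
      ‖(p.1.2 - p.1.1) * (p.2.2 - p.2.1) - 1‖ₑ ^ (-s) := by fun_prop
    exact h1.lintegral_prod_right'

theorem pairing_transfer_comm (hS : IsInvariant κ S) {μ ν : Measure ℂ} [SFinite μ] [SFinite ν]
    (hμ : ∀ᵐ b ∂μ, b ∈ S) (hν : ∀ᵐ b ∂ν, b ∈ S) :
    pairing κ s (transfer κ s μ) ν = pairing κ s μ (transfer κ s ν) := by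
  rw [pairing_transfer hS hμ, twoStep_comm, ← pairing_transfer hS hν, pairing_comm]

theorem pairing_iterate_comm (hS : IsInvariant κ S) {μ ν : Measure ℂ} [SFinite μ] [SFinite ν]
    (hμ : ∀ᵐ b ∂μ, b ∈ S) (hν : ∀ᵐ b ∂ν, b ∈ S) (n : ℕ) :
    pairing κ s ((transfer κ s)^[n] μ) ν = pairing κ s μ ((transfer κ s)^[n] ν) := by
  induction n generalizing μ with
  | zero => rfl
  | succ n ih =>
    rw [Function.iterate_succ_apply, ih (hS.transfer_mem hμ),
      pairing_transfer_comm hS hμ (hS.iterate_mem hν n), ← Function.iterate_succ_apply' (transfer κ s)]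

/-- The moments `τ(Φ^{n+1} 1)` of the chain started from `τ`. -/
noncomputable def chainMoment (κ τ : Measure ℂ) (s : ℝ) (n : ℕ) : ℝ≥0∞ :=
  (transfer κ s)^[n + 1] τ Set.univ

theorem chainMoment_eq_pairing (τ : Measure ℂ) [SFinite τ] (n : ℕ) :
    chainMoment κ τ s n = pairing κ s (Measure.dirac 0) ((transfer κ s)^[n] τ) := by
  rw [chainMoment, Function.iterate_succ_apply', transfer_univ, pairing, lintegral_dirac]
  simp

/-- The estimates under which the moments of the chain are quasi-multiplicative. -/
structure ChainBounds (κ τ : Measure ℂ) (S : Set ℂ) (s r : ℝ) (C : ℝ≥0∞) : Prop where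
  invariant : IsInvariant κ S
  start_mem : ∀ᵐ γ ∂τ, γ ∈ S
  pos : 0 < r
  abs_le : |s| ≤ r
  one_le : 1 ≤ C
  finite : ∃ M : ℝ≥0∞, M ≠ ∞ ∧ ∀ b ∈ S, ∫⁻ W, ‖W - b‖ₑ ^ (-s) ∂κ ≤ M ∧
    ∫⁻ W, (1 + ‖W - b‖ₑ) ^ (-s) ∂κ ≤ M
  one_step : ∀ b ∈ S, ∀ c ∈ S,
    ∫⁻ W, (1 + ‖W - b‖ₑ) ^ (-s) * ((1 + ‖W - b‖ₑ) / ‖W - b - c‖ₑ) ^ r ∂κ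
      ≤ C * (1 + ‖c‖ₑ) ^ r * ∫⁻ W, (1 + ‖W - b‖ₑ) ^ (-s) ∂κ
  two_step : ∀ b ∈ S, ∀ c ∈ S,
    ∫⁻ W, ∫⁻ W', ((1 + ‖W - b‖ₑ) * (1 + ‖W' - c‖ₑ)) ^ (-s) *
        ((1 + ‖W - b‖ₑ) * (1 + ‖W' - c‖ₑ) / ‖(W - b) * (W' - c) - 1‖ₑ) ^ r ∂κ ∂κ
      ≤ C * ((∫⁻ W, (1 + ‖W - b‖ₑ) ^ (-s) ∂κ) * ∫⁻ W, (1 + ‖W - c‖ₑ) ^ (-s) ∂κ)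
  start_moment : ∫⁻ γ, (1 + ‖γ‖ₑ) ^ r ∂τ ≤ C

/-! ### Decoupling estimates and quasi-multiplicativity -/

section QM

variable {τ : Measure ℂ} [IsProbabilityMeasure τ] {r : ℝ} {C : ℝ≥0∞}

theorem one_add_enorm_ne_zero (z : ℂ) : 1 + ‖z‖ₑ ≠ 0 := by simp

theorem one_add_enorm_ne_top (z : ℂ) : 1 + ‖z‖ₑ ≠ ∞ := by simp

theorem ChainBounds.transfer_univ_le (h : ChainBounds κ τ S s r C) :
    ∃ M : ℝ≥0∞, M ≠ ∞ ∧ ∀ μ : Measure ℂ, SFinite μ → (∀ᵐ b ∂μ, b ∈ S) →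
      transfer κ s μ Set.univ ≤ M * μ Set.univ ∧ smoothMass κ s μ ≤ M * μ Set.univ := by
  obtain ⟨M, hM, H⟩ := h.finite
  refine ⟨M, hM, fun μ _ hμ => ?_⟩
  rw [transfer_univ, smoothMass]
  constructor
  · calc _ ≤ ∫⁻ _, M ∂μ := lintegral_mono_ae (by
          filter_upwards [hμ] with b hb using (H b hb).1)
      _ = _ := by simp
  · calc _ ≤ ∫⁻ _, M ∂μ := lintegral_mono_ae (by
          filter_upwards [hμ] with b hb using (H b hb).2)
      _ = _ := by simp

theorem ChainBounds.iterate_univ_ne_top (h : ChainBounds κ τ S s r C) {μ : Measure ℂ} [SFinite μ]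
    (hμ : ∀ᵐ b ∂μ, b ∈ S) (hfin : μ Set.univ ≠ ∞) (n : ℕ) :
    (transfer κ s)^[n] μ Set.univ ≠ ∞ := by
  obtain ⟨M, hM, H⟩ := h.transfer_univ_le
  induction n with
  | zero => exact hfin
  | succ n ih =>
    rw [Function.iterate_succ_apply']
    exact ne_top_of_le_ne_top (ENNReal.mul_ne_top hM ih)
      (H _ inferInstance (h.invariant.iterate_mem hμ n)).1

theorem ChainBounds.smoothMass_ne_top (h : ChainBounds κ τ S s r C) {μ : Measure ℂ} [SFinite μ]
    (hμ : ∀ᵐ b ∂μ, b ∈ S) (hfin : μ Set.univ ≠ ∞) (n : ℕ) :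
    smoothMass κ s ((transfer κ s)^[n] μ) ≠ ∞ := by
  obtain ⟨M, hM, H⟩ := h.transfer_univ_le
  exact ne_top_of_le_ne_top (ENNReal.mul_ne_top hM (h.iterate_univ_ne_top hμ hfin n))
      (H _ inferInstance (h.invariant.iterate_mem hμ n)).2

theorem smoothMass_eq (μ : Measure ℂ) [SFinite μ] :
    smoothMass κ s μ = ∫⁻ p, (1 + ‖p.2 - p.1‖ₑ) ^ (-s) ∂(μ.prod κ) := by
  rw [lintegral_prod _ (Measurable.aemeasurable (by fun_prop)), smoothMass]

/-- The transfer of a measure and its smoothed mass are comparable. -/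
theorem ChainBounds.pairing_dirac (h : ChainBounds κ τ S s r C) {μ : Measure ℂ} [SFinite μ]
    (hμ : ∀ᵐ b ∂μ, b ∈ S) (hfin : smoothMass κ s μ ≠ ∞) :
    pairing κ s (Measure.dirac 0) μ ≤ C ^ (|s| / r) * smoothMass κ s μ ∧
    smoothMass κ s μ ≤ C ^ (|s| / r) * pairing κ s (Measure.dirac 0) μ := by
  have e1 : pairing κ s (Measure.dirac 0) μ = ∫⁻ p, ‖p.2 - p.1‖ₑ ^ (-s) ∂(μ.prod κ) := by
    rw [pairing, lintegral_dirac, lintegral_prod _ (Measurable.aemeasurable (by fun_prop))]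
    simp
  have hne : ∀ᵐ p ∂(μ.prod κ), ‖p.2 - p.1‖ₑ ≠ 0 := by
    rw [Measure.ae_prod_iff_ae_ae]
    · filter_upwards [hμ] with b hb
      filter_upwards [h.invariant.ne_zero hb] with W hW
      simpa using hW
    · exact (measurableSet_eq_fun (by fun_prop) (by fun_prop)).compl
  rw [e1, smoothMass_eq] at *
  refine tilt_compare (x := fun p : ℂ × ℂ => 1 + ‖p.2 - p.1‖ₑ) (y := fun p => ‖p.2 - p.1‖ₑ)
    (by fun_prop) (by fun_prop) (fun _ => one_add_enorm_ne_zero _)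
    (fun _ => one_add_enorm_ne_top _) hne (fun _ => enorm_ne_top) h.pos h.abs_le hfin ?_ ?_
  · rw [lintegral_prod _ (Measurable.aemeasurable (by fun_prop)),
      lintegral_prod _ (Measurable.aemeasurable (by fun_prop)), ← lintegral_const_mul]
    · refine lintegral_mono_ae ?_
      filter_upwards [hμ] with b hb
      simpa using h.one_step b hb 0 h.invariant.zero_mem
    · have h1 : Measurable fun p : ℂ × ℂ => (1 + ‖p.2 - p.1‖ₑ) ^ (-s) := by fun_prop
      exact h1.lintegral_prod_right'
  -- The modulus |W-b| is at most 1 + |W-b|, so the ratio is at least one and its negative power at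
  -- most one.
  · refine (lintegral_mono fun p => ?_).trans (le_mul_of_one_le_left' h.one_le)
    refine mul_le_of_le_one_right' ?_
    rw [ENNReal.rpow_neg, ENNReal.inv_le_one]
    refine ENNReal.one_le_rpow ?_ h.pos
    by_cases h0 : ‖p.2 - p.1‖ₑ = 0
    · simp [h0]
    · rw [ENNReal.le_div_iff_mul_le (Or.inl h0) (Or.inl enorm_ne_top), one_mul]
      exact le_add_self

/-- The one-step estimate costs a factor (1+|c|)^r at a starting value c. Averaging it over τ
produces the second factor C. For the opposite ratio, |W-b-c| ≤ (1+|c|)(1+|W-b|). -/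
theorem ChainBounds.pairing_start (h : ChainBounds κ τ S s r C) {μ : Measure ℂ} [SFinite μ]
    (hμ : ∀ᵐ b ∂μ, b ∈ S) (hfin : smoothMass κ s μ ≠ ∞) :
    pairing κ s μ τ ≤ (C * C) ^ (|s| / r) * smoothMass κ s μ ∧
    smoothMass κ s μ ≤ (C * C) ^ (|s| / r) * pairing κ s μ τ := by
  have hm1 : Measurable fun p : ℂ × ℂ => ∫⁻ W, ‖W - p.1 - p.2‖ₑ ^ (-s) ∂κ := by
    have h1 : Measurable fun p : (ℂ × ℂ) × ℂ => ‖p.2 - p.1.1 - p.1.2‖ₑ ^ (-s) := by fun_prop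
    exact h1.lintegral_prod_right'
  have hm2 : Measurable fun b : ℂ => ∫⁻ W, (1 + ‖W - b‖ₑ) ^ (-s) ∂κ := by
    have h1 : Measurable fun p : ℂ × ℂ => (1 + ‖p.2 - p.1‖ₑ) ^ (-s) := by fun_prop
    exact h1.lintegral_prod_right'
  have hgen : ∀ f : (ℂ × ℂ) × ℂ → ℝ≥0∞, Measurable f → ∫⁻ p, f p ∂((μ.prod τ).prod κ)
      = ∫⁻ b, ∫⁻ c, ∫⁻ W, f ((b, c), W) ∂κ ∂τ ∂μ := by
    intro f hf
    rw [lintegral_prod _ hf.aemeasurable, lintegral_prod _ hf.lintegral_prod_right'.aemeasurable]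
  have e1 : pairing κ s μ τ = ∫⁻ p, ‖p.2 - p.1.1 - p.1.2‖ₑ ^ (-s) ∂((μ.prod τ).prod κ) := by
    rw [hgen _ (by fun_prop), pairing]
  have e2 : smoothMass κ s μ = ∫⁻ p, (1 + ‖p.2 - p.1.1‖ₑ) ^ (-s) ∂((μ.prod τ).prod κ) := by
    rw [hgen _ (by fun_prop), smoothMass]
    simp
  have hne : ∀ᵐ p ∂((μ.prod τ).prod κ), ‖p.2 - p.1.1 - p.1.2‖ₑ ≠ 0 := by
    rw [Measure.ae_prod_iff_ae_ae]
    · have : ∀ᵐ p ∂(μ.prod τ), p.1 ∈ S ∧ p.2 ∈ S := by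
        rw [Measure.ae_prod_iff_ae_ae]
        · filter_upwards [hμ] with b hb
          filter_upwards [h.start_mem] with c hc using ⟨hb, hc⟩
        · exact (measurable_fst h.invariant.measurable).inter
            (measurable_snd h.invariant.measurable)
      filter_upwards [this] with p hp
      filter_upwards [h.invariant.ne _ hp.1 _ hp.2] with W hW
      simpa using hW
    · exact (measurableSet_eq_fun (by fun_prop) (by fun_prop)).compl
  have hCC : ∫⁻ b, ∫⁻ c, C * (1 + ‖c‖ₑ) ^ r * ∫⁻ W, (1 + ‖W - b‖ₑ) ^ (-s) ∂κ ∂τ ∂μ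
      ≤ C * C * smoothMass κ s μ := by
    have hA : Measurable fun c : ℂ => C * (1 + ‖c‖ₑ) ^ r := by fun_prop
    simp_rw [lintegral_mul_const _ hA]
    rw [lintegral_const_mul _ hm2, ← smoothMass, lintegral_const_mul _ (by fun_prop)]
    gcongr
    exact h.start_moment
  rw [e1]
  rw [e2] at hfin hCC ⊢
  refine tilt_compare (x := fun p : (ℂ × ℂ) × ℂ => 1 + ‖p.2 - p.1.1‖ₑ)
    (y := fun p => ‖p.2 - p.1.1 - p.1.2‖ₑ)
    (by fun_prop) (by fun_prop) (fun _ => one_add_enorm_ne_zero _)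
    (fun _ => one_add_enorm_ne_top _) hne (fun _ => enorm_ne_top) h.pos h.abs_le hfin ?_ ?_
  · rw [hgen _ (by fun_prop)]
    refine le_trans (lintegral_mono_ae ?_) hCC
    filter_upwards [hμ] with b hb
    refine lintegral_mono_ae ?_
    filter_upwards [h.start_mem] with c hc
    exact h.one_step b hb c hc
  · refine le_trans ?_ hCC
    rw [hgen _ (by fun_prop)]
    refine lintegral_mono fun b => lintegral_mono fun c => ?_
    rw [← lintegral_const_mul _ (by fun_prop)]
    refine lintegral_mono fun W => ?_
    rw [mul_comm]
    gcongr
    refine le_trans ?_ (le_mul_of_one_le_left' h.one_le)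
    rw [ENNReal.rpow_neg, ← ENNReal.inv_rpow,
      ENNReal.inv_div (Or.inl enorm_ne_top) (Or.inr (one_add_enorm_ne_zero _))]
    refine ENNReal.rpow_le_rpow ?_ h.pos.le
    rw [ENNReal.div_le_iff (one_add_enorm_ne_zero _) (one_add_enorm_ne_top _)]
    calc ‖W - b - c‖ₑ ≤ ‖W - b‖ₑ + ‖c‖ₑ := enorm_sub_le
      _ ≤ (1 + ‖c‖ₑ) * (1 + ‖W - b‖ₑ) := by
        rw [add_mul, one_mul, mul_add, mul_one, add_comm (1 : ℝ≥0∞), add_assoc]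
        gcongr
        rw [← add_assoc, add_comm (1 : ℝ≥0∞), add_assoc]
        exact le_self_add

/-- This is the decoupling at the junction of two half-paths: the interaction |uu' - 1| is traded
for (1+|u|)(1+|u'|), whose integral factorizes. The two-step estimate controls the singular side;
the other side is |uu' - 1| ≤ (1+|u|)(1+|u'|). -/
theorem ChainBounds.twoStep_compare (h : ChainBounds κ τ S s r C) {μ ν : Measure ℂ} [SFinite μ]
    [SFinite ν] (hμ : ∀ᵐ b ∂μ, b ∈ S) (hν : ∀ᵐ b ∂ν, b ∈ S)
    (hfin : smoothMass κ s μ ≠ ∞) (hfin' : smoothMass κ s ν ≠ ∞) :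
    twoStep κ s μ ν ≤ C ^ (|s| / r) * (smoothMass κ s μ * smoothMass κ s ν) ∧
    smoothMass κ s μ * smoothMass κ s ν ≤ C ^ (|s| / r) * twoStep κ s μ ν := by
  have hm2 : Measurable fun b : ℂ => ∫⁻ W, (1 + ‖W - b‖ₑ) ^ (-s) ∂κ := by
    have h1 : Measurable fun p : ℂ × ℂ => (1 + ‖p.2 - p.1‖ₑ) ^ (-s) := by fun_prop
    exact h1.lintegral_prod_right'
  have hgen : ∀ f : (ℂ × ℂ) × (ℂ × ℂ) → ℝ≥0∞, Measurable f →
      ∫⁻ p, f p ∂((μ.prod κ).prod (ν.prod κ))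
      = ∫⁻ b, ∫⁻ c, ∫⁻ W, ∫⁻ W', f ((b, W), (c, W')) ∂κ ∂κ ∂ν ∂μ := by
    intro f hf
    rw [lintegral_prod _ hf.aemeasurable, lintegral_prod _ hf.lintegral_prod_right'.aemeasurable]
    refine lintegral_congr fun b => ?_
    have : ∀ W, ∫⁻ y, f ((b, W), y) ∂(ν.prod κ) = ∫⁻ c, ∫⁻ W', f ((b, W), (c, W')) ∂κ ∂ν :=
      fun W => lintegral_prod _ (Measurable.aemeasurable (by fun_prop))
    simp_rw [this]
    rw [lintegral_lintegral_swap]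
    refine Measurable.aemeasurable ?_
    have h1 : Measurable fun p : (ℂ × ℂ) × ℂ => f ((b, p.1.1), (p.1.2, p.2)) := by fun_prop
    exact h1.lintegral_prod_right'
  have hw : ∀ (p : (ℂ × ℂ) × (ℂ × ℂ)), ((1 + ‖p.1.2 - p.1.1‖ₑ) * (1 + ‖p.2.2 - p.2.1‖ₑ)) ^ (-s)
      = (1 + ‖p.1.2 - p.1.1‖ₑ) ^ (-s) * (1 + ‖p.2.2 - p.2.1‖ₑ) ^ (-s) := fun p =>
    ENNReal.mul_rpow_of_ne_top (one_add_enorm_ne_top _) (one_add_enorm_ne_top _) _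
  have e2 : smoothMass κ s μ * smoothMass κ s ν = ∫⁻ p, ((1 + ‖p.1.2 - p.1.1‖ₑ)
      * (1 + ‖p.2.2 - p.2.1‖ₑ)) ^ (-s) ∂((μ.prod κ).prod (ν.prod κ)) := by
    simp_rw [hw]
    rw [smoothMass_eq, smoothMass_eq, lintegral_prod_mul (f := fun p : ℂ × ℂ =>
      (1 + ‖p.2 - p.1‖ₑ) ^ (-s)) (g := fun p : ℂ × ℂ => (1 + ‖p.2 - p.1‖ₑ) ^ (-s))
      (Measurable.aemeasurable (by fun_prop)) (Measurable.aemeasurable (by fun_prop))]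
  have hne : ∀ᵐ p ∂((μ.prod κ).prod (ν.prod κ)),
      ‖(p.1.2 - p.1.1) * (p.2.2 - p.2.1) - 1‖ₑ ≠ 0 := by
    have hms : MeasurableSet {p : (ℂ × ℂ) × (ℂ × ℂ) |
        ‖(p.1.2 - p.1.1) * (p.2.2 - p.2.1) - 1‖ₑ ≠ 0} :=
      (measurableSet_eq_fun (by fun_prop) (by fun_prop)).compl
    rw [Measure.ae_prod_iff_ae_ae hms]
    have h1 : ∀ᵐ p ∂(μ.prod κ), p.2 - p.1 ≠ 0 ∧ (p.2 - p.1)⁻¹ ∈ S := by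
      rw [Measure.ae_prod_iff_ae_ae]
      · filter_upwards [hμ] with b hb
        filter_upwards [h.invariant.ne_zero hb, h.invariant.step b hb] with W hW hW'
          using ⟨hW, hW'⟩
      · refine MeasurableSet.inter (measurableSet_eq_fun (by fun_prop) (by fun_prop)).compl ?_
        have hm : Measurable fun p : ℂ × ℂ => (p.2 - p.1)⁻¹ := by fun_prop
        exact hm h.invariant.measurable
    filter_upwards [h1] with p hp
    have hms' : MeasurableSet {q : ℂ × ℂ | ‖(p.2 - p.1) * (q.2 - q.1) - 1‖ₑ ≠ 0} :=
      (measurableSet_eq_fun (by fun_prop) (by fun_prop)).compl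
    rw [Measure.ae_prod_iff_ae_ae hms']
    filter_upwards [hν] with c hc
    -- With u = W₁ - b nonzero, uu' = 1 would mean u' = u⁻¹, and u⁻¹ is again a value of the chain;
    -- the invariant set excludes this.
    filter_upwards [h.invariant.ne c hc _ hp.2] with W hW
    rw [enorm_ne_zero]
    intro h0
    apply hW
    have := hp.1
    field_simp
    linear_combination h0
  have hfin2 := ENNReal.mul_ne_top hfin hfin'
  have e3 : (∫⁻ b, ∫⁻ c, C * ((∫⁻ W, (1 + ‖W - b‖ₑ) ^ (-s) ∂κ) *
      ∫⁻ W, (1 + ‖W - c‖ₑ) ^ (-s) ∂κ) ∂ν ∂μ) = C * (smoothMass κ s μ * smoothMass κ s ν) := by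
    have : ∀ b, ∫⁻ c, C * ((∫⁻ W, (1 + ‖W - b‖ₑ) ^ (-s) ∂κ) *
      ∫⁻ W, (1 + ‖W - c‖ₑ) ^ (-s) ∂κ) ∂ν
        = C * ((∫⁻ W, (1 + ‖W - b‖ₑ) ^ (-s) ∂κ) * smoothMass κ s ν) := by
      intro b
      rw [lintegral_const_mul _ (by fun_prop), lintegral_const_mul _ hm2, smoothMass]
    simp_rw [this]
    rw [lintegral_const_mul _ (by fun_prop), lintegral_mul_const _ hm2, smoothMass, smoothMass]
  rw [twoStep]
  rw [e2] at hfin2 e3 ⊢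
  refine tilt_compare (x := fun p : (ℂ × ℂ) × (ℂ × ℂ) =>
      (1 + ‖p.1.2 - p.1.1‖ₑ) * (1 + ‖p.2.2 - p.2.1‖ₑ))
    (y := fun p => ‖(p.1.2 - p.1.1) * (p.2.2 - p.2.1) - 1‖ₑ)
    (by fun_prop) (by fun_prop)
    (fun _ => mul_ne_zero (one_add_enorm_ne_zero _) (one_add_enorm_ne_zero _))
    (fun _ => ENNReal.mul_ne_top (one_add_enorm_ne_top _) (one_add_enorm_ne_top _)) hne
    (fun _ => enorm_ne_top) h.pos h.abs_le hfin2 ?_ ?_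
  · rw [hgen _ (by fun_prop), ← e3]
    refine lintegral_mono_ae ?_
    filter_upwards [hμ] with b hb
    refine lintegral_mono_ae ?_
    filter_upwards [hν] with c hc
    exact h.two_step b hb c hc
  · refine (lintegral_mono fun p => ?_).trans (le_mul_of_one_le_left' h.one_le)
    refine mul_le_of_le_one_right' ?_
    rw [ENNReal.rpow_neg, ENNReal.inv_le_one]
    refine ENNReal.one_le_rpow ?_ h.pos
    set u := p.1.2 - p.1.1
    set u' := p.2.2 - p.2.1
    by_cases h0 : ‖u * u' - 1‖ₑ = 0
    · rw [h0, ENNReal.div_zero]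
      · simp
      · exact mul_ne_zero (one_add_enorm_ne_zero _) (one_add_enorm_ne_zero _)
    · rw [ENNReal.le_div_iff_mul_le (Or.inl h0) (Or.inl enorm_ne_top), one_mul]
      calc ‖u * u' - 1‖ₑ ≤ ‖u * u'‖ₑ + ‖(1 : ℂ)‖ₑ := enorm_sub_le
        _ = ‖u‖ₑ * ‖u'‖ₑ + 1 := by rw [enorm_mul, enorm_one]
        _ ≤ 1 + ‖u'‖ₑ + ‖u‖ₑ * (1 + ‖u'‖ₑ) := by
          rw [mul_add, add_comm]
          gcongr
          · exact le_self_add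
          · exact le_add_self
        _ = _ := by rw [add_mul, one_mul]

/-- **Quasi-multiplicativity** of the moments of the chain. -/
theorem ChainBounds.quasi_mul (h : ChainBounds κ τ S s r C) (n m : ℕ) :
    chainMoment κ τ s (n + m + 1)
      ≤ (C ^ 4) ^ (|s| / r) * (chainMoment κ τ s n * chainMoment κ τ s m) ∧
    chainMoment κ τ s n * chainMoment κ τ s m
      ≤ (C ^ 4) ^ (|s| / r) * chainMoment κ τ s (n + m + 1) := by
  have h0 : ∀ᵐ b ∂(Measure.dirac (0 : ℂ)), b ∈ S := by
    rw [ae_dirac_iff (p := fun b => b ∈ S) h.invariant.measurable]; exact h.invariant.zero_mem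
  set β := (transfer κ s)^[n] (Measure.dirac 0) with hβ
  set α := (transfer κ s)^[m] τ with hα
  have hβS : ∀ᵐ b ∂β, b ∈ S := h.invariant.iterate_mem h0 n
  have hαS : ∀ᵐ b ∂α, b ∈ S := h.invariant.iterate_mem h.start_mem m
  -- Self-adjointness lets the path of n steps be run entirely from the root end. The long path is
  -- run n steps from the root end and m steps from the far end, and the remaining step is the
  -- junction.
  have e1 : chainMoment κ τ s n = pairing κ s β τ := by
    rw [chainMoment_eq_pairing, hβ, pairing_iterate_comm h.invariant h0 h.start_mem]
  have e2 : chainMoment κ τ s m = pairing κ s (Measure.dirac 0) α := chainMoment_eq_pairing τ m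
  have e3 : chainMoment κ τ s (n + m + 1) = twoStep κ s β α := by
    rw [chainMoment_eq_pairing, ← pairing_transfer h.invariant hβS, hβ,
      ← Function.iterate_succ_apply' (transfer κ s), pairing_iterate_comm h.invariant h0 hαS, hα,
      ← Function.iterate_add_apply]
    congr 2
    omega
  have hfβ := h.smoothMass_ne_top h0 (by simp) n
  have hfα := h.smoothMass_ne_top h.start_mem (by simp) m
  obtain ⟨a1, a2⟩ := h.pairing_start hβS hfβ
  obtain ⟨b1, b2⟩ := h.pairing_dirac hαS hfα
  obtain ⟨c1, c2⟩ := h.twoStep_compare hβS hαS hfβ hfα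
  rw [← e1] at a1 a2
  rw [← e2] at b1 b2
  rw [← e3] at c1 c2
  have ht : 0 ≤ |s| / r := div_nonneg (abs_nonneg _) h.pos.le
  set D := C ^ (|s| / r) with hD
  have eCC : (C * C) ^ (|s| / r) = D * D := ENNReal.mul_rpow_of_nonneg _ _ ht
  -- The powers of D add up: two from the start, one from the free end, one from the junction.
  have eC4 : (C ^ 4) ^ (|s| / r) = D * D * D * D := by
    rw [show C ^ 4 = C * C * (C * C) by ring, ENNReal.mul_rpow_of_nonneg _ _ ht, eCC]
    ring
  rw [eCC] at a1 a2
  rw [eC4]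
  constructor
  · calc _ ≤ _ := c1
      _ ≤ D * ((D * D * chainMoment κ τ s n) * (D * chainMoment κ τ s m)) := by gcongr
      _ = _ := by ring
  · calc _ ≤ (D * D * smoothMass κ s β) * (D * smoothMass κ s α) := by gcongr
      _ = D * D * D * (smoothMass κ s β * smoothMass κ s α) := by ring
      _ ≤ D * D * D * (D * chainMoment κ τ s (n + m + 1)) := by gcongr
      _ = _ := by ring

theorem ChainBounds.chainMoment_ne_top (h : ChainBounds κ τ S s r C) (n : ℕ) :
    chainMoment κ τ s n ≠ ∞ :=
  h.iterate_univ_ne_top h.start_mem (by simp) (n + 1)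

end QM

end Chain

/-! ### The law of the potential, and its decomposition at the root -/

section Law

variable {K : ℕ} (ν : Measure ℝ)

/-- The law of an i.i.d. potential with single-site law `ν`. -/
noncomputable abbrev potLaw (K : ℕ) (ν : Measure ℝ) : Measure (Vertex K → ℝ) :=
  Measure.infinitePi fun _ => ν

/-- The potential with value `p.1` at the root and `p.2 i` on the subtree of the child `i`. -/
def assemble (p : ℝ × (Fin K → Vertex K → ℝ)) (x : Vertex K) : ℝ :=
  match x.getLast? with
  | none => p.1
  | some i => p.2 i x.dropLast

theorem assemble_concat (p : ℝ × (Fin K → Vertex K → ℝ)) (y : Vertex K) (i : Fin K) :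
    assemble p (y ++ [i]) = p.2 i y := by
  simp [assemble]

theorem shiftPot_assemble (p : ℝ × (Fin K → Vertex K → ℝ)) (i : Fin K) :
    shiftPot (assemble p) i = p.2 i := by
  ext y
  rw [shiftPot, assemble_concat]

theorem eq_nil_or_concat (x : Vertex K) : x = [] ∨ ∃ y i, x = y ++ [i] := by
  rcases List.eq_nil_or_concat x with h | ⟨y, i, h⟩
  · exact Or.inl h
  · exact Or.inr ⟨y, i, by simpa using h⟩

theorem measurable_assemble : Measurable (assemble (K := K)) := by
  rw [measurable_pi_iff]
  intro x
  rcases eq_nil_or_concat x with rfl | ⟨y, i, rfl⟩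
  · exact measurable_fst
  · simp_rw [assemble_concat]
    fun_prop

variable [IsProbabilityMeasure ν]

/-- It suffices to test finite boxes. The coordinates of a box are sorted by the last letter of the
word, that is, by the child of the root below which they lie; the empty word is the root. -/
theorem map_assemble :
    (ν.prod (Measure.pi fun _ : Fin K => potLaw K ν)).map assemble = potLaw K ν := by
  classical
  refine Measure.eq_infinitePi _ fun s t ht => ?_
  have hinj : ∀ i : Fin K, Function.Injective (fun y : Vertex K => y ++ [i]) :=
    fun i a b h => by simpa using h
  let si : Fin K → Finset (Vertex K) := fun i => s.preimage (fun y => y ++ [i]) ((hinj i).injOn)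
  have hpre : assemble ⁻¹' (Set.pi s t)
      = (if [] ∈ s then t [] else Set.univ) ×ˢ
        Set.pi Set.univ (fun i => Set.pi (si i) fun y => t (y ++ [i])) := by
    ext p
    simp only [Set.mem_preimage, Set.mem_pi, Set.mem_prod, Set.mem_univ, true_implies,
      Finset.mem_coe, si, Finset.mem_preimage]
    constructor
    · intro h
      refine ⟨?_, fun i y hy => ?_⟩
      · split_ifs with h0
        · exact h [] h0
        · trivial
      · have := h _ hy
        rwa [assemble_concat] at this
    · rintro ⟨h1, h2⟩ x hx
      rcases eq_nil_or_concat x with rfl | ⟨y, i, rfl⟩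
      · rw [if_pos hx] at h1; exact h1
      · rw [assemble_concat]; exact h2 i y hx
  rw [Measure.map_apply measurable_assemble (MeasurableSet.pi s.countable_toSet fun x _ => ht x),
    hpre, Measure.prod_prod, Measure.pi_pi]
  have h1 : ∀ i, potLaw K ν (Set.pi (si i) fun y => t (y ++ [i]))
      = ∏ y ∈ si i, ν (t (y ++ [i])) := fun i =>
    Measure.infinitePi_pi _ fun y _ => ht _
  simp_rw [h1]
  rw [← Finset.prod_fiberwise s (fun x => x.getLast?), Fintype.prod_option]
  congr 1
  · have : (s.filter fun x => x.getLast? = none) = if [] ∈ s then {[]} else ∅ := by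
      ext x
      simp only [Finset.mem_filter, List.getLast?_eq_none_iff]
      split_ifs with h0
      · simp only [Finset.mem_singleton]
        exact ⟨fun h => h.2, fun h => ⟨h ▸ h0, h⟩⟩
      · simp only [Finset.notMem_empty, iff_false, not_and]
        rintro h rfl
        exact h0 h
    rw [this]
    split_ifs with h0
    · simp
    · simp
  · refine Finset.prod_congr rfl fun i _ => ?_
    have : (s.filter fun x => x.getLast? = some i) = (si i).image (fun y => y ++ [i]) := by
      ext x
      simp only [Finset.mem_filter, Finset.mem_image, si, Finset.mem_preimage]
      constructor
      · rintro ⟨hx, hl⟩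
        rcases eq_nil_or_concat x with rfl | ⟨y, j, rfl⟩
        · simp at hl
        · simp only [List.getLast?_append, List.getLast?_singleton, Option.some_or,
            Option.some.injEq] at hl
          subst hl
          exact ⟨y, hx, rfl⟩
      · rintro ⟨y, hy, rfl⟩
        exact ⟨hy, by simp⟩
    rw [this, Finset.prod_image fun a _ b _ h => hinj i h]

end Law

section Decomposition

variable {k : ℕ} (ν : Measure ℝ) [IsProbabilityMeasure ν]

theorem measurable_shiftPot {K : ℕ} (i : Fin K) :
    Measurable fun v : Vertex K → ℝ => shiftPot v i := by
  rw [measurable_pi_iff]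
  intro y
  exact measurable_pi_apply _

/-- The potential at the root, on the subtrees of the other children, and on the subtree of
the child `i` are independent. -/
theorem map_root_children (i : Fin (k + 1)) :
    (potLaw (k + 1) ν).map
        (fun v => (v [], (shiftPot v i, fun j : Fin k => shiftPot v (i.succAbove j))))
      = ν.prod ((potLaw (k + 1) ν).prod (Measure.pi fun _ => potLaw (k + 1) ν)) := by
  have hpi := measurePreserving_piFinSuccAbove
    (fun _ : Fin (k + 1) => potLaw (k + 1) ν) i
  have hprod := (MeasurePreserving.id ν).prod hpi
  rw [← hprod.map_eq]
  conv_lhs => rw [← map_assemble]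
  rw [Measure.map_map _ measurable_assemble]
  · congr 1
    ext p
    · rfl
    · exact congrFun (shiftPot_assemble p i) _
    · exact congrFun (shiftPot_assemble p _) _
  · refine (measurable_pi_apply _).prodMk ((measurable_shiftPot i).prodMk ?_)
    rw [measurable_pi_iff]
    exact fun j => measurable_shiftPot _

theorem lintegral_root_children (i : Fin (k + 1))
    {F : ℝ × (Vertex (k + 1) → ℝ) × (Fin k → Vertex (k + 1) → ℝ) → ℝ≥0∞} (hF : Measurable F) :
    ∫⁻ v, F (v [], (shiftPot v i, fun j : Fin k => shiftPot v (i.succAbove j)))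
        ∂potLaw (k + 1) ν
      = ∫⁻ p, F p ∂(ν.prod ((potLaw (k + 1) ν).prod (Measure.pi fun _ => potLaw (k + 1) ν))) := by
  rw [← map_root_children ν i, lintegral_map hF]
  refine (measurable_pi_apply _).prodMk ((measurable_shiftPot i).prodMk ?_)
  rw [measurable_pi_iff]
  exact fun j => measurable_shiftPot _

theorem map_shiftPot (i : Fin (k + 1)) :
    (potLaw (k + 1) ν).map (fun v => shiftPot v i) = potLaw (k + 1) ν := by
  have h := congrArg (fun m => Measure.map (fun p => p.2.1) m) (map_root_children ν i)
  rw [Measure.map_map (by fun_prop)] at h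
  · have h2 : (ν.prod ((potLaw (k + 1) ν).prod (Measure.pi fun _ : Fin k => potLaw (k + 1) ν))).map
        (fun p => p.2.1) = potLaw (k + 1) ν := by
      have : (fun p : ℝ × (Vertex (k + 1) → ℝ) × (Fin k → Vertex (k + 1) → ℝ) => p.2.1)
        = Prod.fst ∘ Prod.snd := rfl
      rw [this, ← Measure.map_map measurable_fst measurable_snd]
      have a1 := Measure.map_snd_prod (μ := ν)
        (ν := ((potLaw (k + 1) ν).prod (Measure.pi fun _ : Fin k => potLaw (k + 1) ν)))
      rw [a1]
      simp [Measure.map_fst_prod]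
    rw [h2] at h
    exact h
  · refine (measurable_pi_apply _).prodMk ((measurable_shiftPot i).prodMk ?_)
    rw [measurable_pi_iff]
    exact fun j => measurable_shiftPot _

/-! ### The Markov chain of Green functions along a ray -/

variable (lam : ℝ) (ζ : ℂ)

/-- The law of the Green function at the root. -/
noncomputable def greenLaw : Measure ℂ := (potLaw (k + 1) ν).map fun v => rootGreen lam v ζ

/-- The law of `lam V(0) - ζ - ∑ Γ`, the sum running over all children but one. -/
noncomputable def stepLaw (k : ℕ) (ν : Measure ℝ) (lam : ℝ) (ζ : ℂ) : Measure ℂ :=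
  (ν.prod (Measure.pi fun _ : Fin k => potLaw (k + 1) ν)).map
    fun p => lam * p.1 - ζ - ∑ j, rootGreen lam (p.2 j) ζ

variable {lam ζ}

theorem measurable_rootGreen {K : ℕ} (hζ : 0 < ζ.im) :
    Measurable fun v : Vertex K → ℝ => rootGreen lam v ζ :=
  (continuous_resolventKernel hζ _ _).measurable

theorem measurable_resolventKernel {K : ℕ} (hζ : 0 < ζ.im) (x y : Vertex K) :
    Measurable fun v : Vertex K → ℝ => resolventKernel lam v ζ x y :=
  (continuous_resolventKernel hζ _ _).measurable

theorem measurable_step (hζ : 0 < ζ.im) :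
    Measurable fun p : ℝ × (Fin k → Vertex (k + 1) → ℝ) =>
      (lam * p.1 - ζ - ∑ j, rootGreen lam (p.2 j) ζ : ℂ) := by
  have : ∀ j : Fin k, Measurable fun p : ℝ × (Fin k → Vertex (k + 1) → ℝ) =>
      rootGreen lam (p.2 j) ζ := fun j => (measurable_rootGreen hζ).comp (by fun_prop)
  fun_prop

theorem isProbabilityMeasure_greenLaw (hζ : 0 < ζ.im) :
    IsProbabilityMeasure (greenLaw (k := k) ν lam ζ) :=
  Measure.isProbabilityMeasure_map (measurable_rootGreen hζ).aemeasurable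

theorem isProbabilityMeasure_stepLaw (hζ : 0 < ζ.im) :
    IsProbabilityMeasure (stepLaw k ν lam ζ) :=
  Measure.isProbabilityMeasure_map (measurable_step hζ).aemeasurable

theorem rootGreen_eq_inv (hζ : 0 < ζ.im) (v : Vertex (k + 1) → ℝ) (i : Fin (k + 1)) :
    rootGreen lam v ζ = (lam * v [] - ζ - ∑ j : Fin k, rootGreen lam (shiftPot v (i.succAbove j)) ζ
      - rootGreen lam (shiftPot v i) ζ)⁻¹ := by
  have h := rootGreen_mul (lam := lam) (v := v) hζ
  rw [Fin.sum_univ_succAbove _ i] at h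
  rw [eq_inv_of_mul_eq_one_left h]
  congr 1
  ring

/-- The Green function at the root and the kernel on the subtree of a child. -/
theorem lintegral_step (hζ : 0 < ζ.im) (i : Fin (k + 1)) {F : ℂ → (Vertex (k + 1) → ℝ) → ℝ≥0∞}
    (hF : Measurable (Function.uncurry F)) :
    ∫⁻ v, F (rootGreen lam v ζ) (shiftPot v i) ∂potLaw (k + 1) ν
      = ∫⁻ u, ∫⁻ W, F (W - rootGreen lam u ζ)⁻¹ u ∂stepLaw k ν lam ζ ∂potLaw (k + 1) ν := by
  have := isProbabilityMeasure_stepLaw (k := k) ν (lam := lam) hζ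
  have hg := measurable_rootGreen (lam := lam) (K := k + 1) hζ
  have hst := measurable_step (k := k) (lam := lam) hζ
  let G : ℝ × (Vertex (k + 1) → ℝ) × (Fin k → Vertex (k + 1) → ℝ) → ℝ≥0∞ := fun p =>
    F ((lam * p.1 - ζ - ∑ j, rootGreen lam (p.2.2 j) ζ) - rootGreen lam p.2.1 ζ)⁻¹ p.2.1
  have hG : Measurable G := by
    have h1 : Measurable fun p : ℝ × (Vertex (k + 1) → ℝ) × (Fin k → Vertex (k + 1) → ℝ) =>
        (lam * p.1 - ζ - ∑ j, rootGreen lam (p.2.2 j) ζ : ℂ) :=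
      hst.comp (measurable_fst.prodMk (measurable_snd.comp measurable_snd))
    have h2 : Measurable fun p : ℝ × (Vertex (k + 1) → ℝ) × (Fin k → Vertex (k + 1) → ℝ) =>
        rootGreen lam p.2.1 ζ := hg.comp (by fun_prop)
    exact hF.comp ((h1.sub h2).inv.prodMk (by fun_prop))
  have e1 : ∫⁻ v, F (rootGreen lam v ζ) (shiftPot v i) ∂potLaw (k + 1) ν
      = ∫⁻ v, G (v [], (shiftPot v i, fun j : Fin k => shiftPot v (i.succAbove j)))
        ∂potLaw (k + 1) ν := by
    refine lintegral_congr fun v => ?_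
    simp only [G]
    rw [← rootGreen_eq_inv hζ]
  rw [e1, lintegral_root_children ν i hG, lintegral_prod _ hG.aemeasurable]
  have e2 : ∀ t, ∫⁻ y, G (t, y) ∂((potLaw (k + 1) ν).prod (Measure.pi fun _ => potLaw (k + 1) ν))
      = ∫⁻ u, ∫⁻ c, G (t, u, c) ∂(Measure.pi fun _ => potLaw (k + 1) ν) ∂potLaw (k + 1) ν :=
    fun t => lintegral_prod _ (Measurable.aemeasurable (by fun_prop))
  simp_rw [e2]
  rw [lintegral_lintegral_swap]
  · refine lintegral_congr fun u => ?_
    rw [stepLaw, lintegral_map _ hst, lintegral_prod]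
    · refine Measurable.aemeasurable ?_
      exact hF.comp ((hst.sub_const _).inv.prodMk measurable_const)
    · exact hF.comp ((measurable_id.sub_const _).inv.prodMk measurable_const)
  · refine Measurable.aemeasurable ?_
    have : Measurable fun q : (ℝ × (Vertex (k + 1) → ℝ)) × (Fin k → Vertex (k + 1) → ℝ) =>
      G (q.1.1, q.1.2, q.2) := by fun_prop
    exact this.lintegral_prod_right'

/-- The test function f of Γ is carried along because the next step of the chain depends on the
current Γ. The chain starts from the Green function of the subtree of a child of x, so x itself
accounts for the extra application of the operator. -/
theorem lintegral_resolventKernel (hζ : 0 < ζ.im) (s : ℝ) (x : Vertex (k + 1)) {f : ℂ → ℝ≥0∞}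
    (hf : Measurable f) :
    ∫⁻ v, ‖resolventKernel lam v ζ (root (k + 1)) x‖ₑ ^ s * f (rootGreen lam v ζ)
        ∂potLaw (k + 1) ν
      = ∫⁻ z, f z ∂(transfer (stepLaw k ν lam ζ) s)^[x.length + 1] (greenLaw (k := k) ν lam ζ) := by
  have := isProbabilityMeasure_stepLaw (k := k) ν (lam := lam) hζ
  have := isProbabilityMeasure_greenLaw (k := k) ν (lam := lam) hζ
  have hg := measurable_rootGreen (lam := lam) (K := k + 1) hζ
  have hH : ∀ f : ℂ → ℝ≥0∞, Measurable f → Measurable fun b : ℂ =>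
      ∫⁻ W, ‖W - b‖ₑ ^ (-s) * f (W - b)⁻¹ ∂stepLaw k ν lam ζ := by
    intro f hf
    have : Measurable fun p : ℂ × ℂ => ‖p.2 - p.1‖ₑ ^ (-s) * f (p.2 - p.1)⁻¹ := by fun_prop
    exact this.lintegral_prod_right'
  -- With 0⁻¹ = 0 the two sides can disagree at z = 0; the positive imaginary parts of ζ and Γ rule
  -- this case out.
  have hinv : ∀ z : ℂ, ‖z⁻¹‖ₑ ^ s = ‖z‖ₑ ^ (-s) ∨ z = 0 := by
    intro z
    by_cases h0 : z = 0
    · exact Or.inr h0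
    · left; rw [enorm_inv h0, ENNReal.inv_rpow, ENNReal.rpow_neg]
  have hne : ∀ u : Vertex (k + 1) → ℝ, ∀ᵐ W ∂stepLaw k ν lam ζ, W - rootGreen lam u ζ ≠ 0 := by
    intro u
    have hm : MeasurableSet {W : ℂ | W - rootGreen lam u ζ ≠ 0} :=
      (measurableSet_eq_fun (by fun_prop) (by fun_prop)).compl
    rw [stepLaw, ae_map_iff (measurable_step hζ).aemeasurable hm]
    refine Eventually.of_forall fun p h0 => ?_
    have h1 := congrArg Complex.im h0
    have h2 : 0 ≤ (∑ j, rootGreen lam (p.2 j) ζ).im := by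
      rw [Complex.im_sum]
      exact Finset.sum_nonneg fun j _ => (im_rootGreen_pos hζ).le
    have h3 := im_rootGreen_pos (lam := lam) (v := u) hζ
    have h4 : ((lam : ℂ) * (p.1 : ℂ)).im = 0 := by simp
    simp only [Complex.sub_im, h4, Complex.zero_im] at h1
    linarith
  induction x using List.reverseRecOn generalizing f with
  | nil =>
    have h1 := lintegral_step (k := k) ν (lam := lam) hζ 0
      (F := fun z _ => ‖z‖ₑ ^ s * f z) (by fun_prop)
    change ∫⁻ v, ‖rootGreen lam v ζ‖ₑ ^ s * f (rootGreen lam v ζ) ∂potLaw (k + 1) ν = _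
    rw [h1]
    simp only [List.length_nil, zero_add, Function.iterate_one]
    rw [lintegral_transfer _ hf, greenLaw, lintegral_map (hH f hf) hg]
    refine lintegral_congr fun u => ?_
    refine lintegral_congr_ae ?_
    filter_upwards [hne u] with W hW
    rcases hinv (W - rootGreen lam u ζ) with h | h
    · rw [h]
    · exact absurd h hW
  | append_singleton y i ih =>
    have hk := measurable_resolventKernel (lam := lam) hζ (root (k + 1)) y
    have h1 := lintegral_step (k := k) ν (lam := lam) hζ i
      (F := fun z u => ‖z‖ₑ ^ s * ‖resolventKernel lam u ζ (root (k + 1)) y‖ₑ ^ s * f z) (by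
        have : Measurable fun p : ℂ × (Vertex (k + 1) → ℝ) =>
          resolventKernel lam p.2 ζ (root (k + 1)) y := hk.comp measurable_snd
        simp only [Function.uncurry_def]
        fun_prop)
    have e1 : ∀ v : Vertex (k + 1) → ℝ, ‖resolventKernel lam v ζ (root (k + 1)) (y ++ [i])‖ₑ ^ s
        * f (rootGreen lam v ζ) = ‖rootGreen lam v ζ‖ₑ ^ s *
          ‖resolventKernel lam (shiftPot v i) ζ (root (k + 1)) y‖ₑ ^ s * f (rootGreen lam v ζ) := by
      intro v
      rw [resolventKernel_root_append hζ, enorm_mul, enorm_neg,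
        ENNReal.mul_rpow_of_ne_top enorm_ne_top enorm_ne_top]
    simp_rw [e1]
    rw [h1]
    have e2 : ∀ u : Vertex (k + 1) → ℝ, ∫⁻ W, ‖(W - rootGreen lam u ζ)⁻¹‖ₑ ^ s *
          ‖resolventKernel lam u ζ (root (k + 1)) y‖ₑ ^ s * f (W - rootGreen lam u ζ)⁻¹
            ∂stepLaw k ν lam ζ
        = ‖resolventKernel lam u ζ (root (k + 1)) y‖ₑ ^ s *
          ∫⁻ W, ‖W - rootGreen lam u ζ‖ₑ ^ (-s) * f (W - rootGreen lam u ζ)⁻¹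
            ∂stepLaw k ν lam ζ := by
      intro u
      rw [← lintegral_const_mul _ (by fun_prop)]
      refine lintegral_congr_ae ?_
      filter_upwards [hne u] with W hW
      rcases hinv (W - rootGreen lam u ζ) with h | h
      · rw [h]; ring
      · exact absurd h hW
    simp_rw [e2]
    rw [ih (f := fun b => ∫⁻ W, ‖W - b‖ₑ ^ (-s) * f (W - b)⁻¹ ∂stepLaw k ν lam ζ) (hH f hf),
      List.length_append, List.length_singleton, Function.iterate_succ_apply' _ (y.length + 1),
      lintegral_transfer _ hf]

theorem lintegral_resolventKernel_rpow (hζ : 0 < ζ.im) (s : ℝ) (x : Vertex (k + 1)) :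
    ∫⁻ v, ‖resolventKernel lam v ζ (root (k + 1)) x‖ₑ ^ s ∂potLaw (k + 1) ν
      = chainMoment (stepLaw k ν lam ζ) (greenLaw (k := k) ν lam ζ) s x.length := by
  have := lintegral_resolventKernel (k := k) ν (lam := lam) hζ s x (f := fun _ => 1)
    measurable_const
  simpa [chainMoment] using this

end Decomposition

/-! ### Local regularity of the single-site law -/

/-- The `-r`-th moments of `lam v - a` near `0` are controlled by the mass near `a`. -/
def LocallyRegular (ν : Measure ℝ) (lam r : ℝ) (C : ℝ≥0∞) : Prop :=
  ∀ a : ℂ, ∫⁻ v in {v : ℝ | ‖(lam * v - a : ℂ)‖ₑ < 3⁻¹}, ‖(lam * v - a : ℂ)‖ₑ ^ (-r) ∂ν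
    ≤ C * ν {v : ℝ | ‖(lam * v - a : ℂ)‖ₑ < 1}

theorem lintegral_ball_rpow_ne_top {r δ : ℝ} (hr : r < 1) :
    ∫⁻ v in Metric.ball (0 : ℝ) δ, ‖v‖ₑ ^ (-r) ≠ ∞ := by
  have h : IntegrableOn (fun v : ℝ => ‖v‖ ^ (-r)) (Metric.ball (0 : ℝ) δ) := by
    refine integrableOn_ball_of_norm_le_rpow (C := 1) (α := r) (by simp) (by simpa using hr) ?_ ?_
    · refine Eventually.of_forall fun x => ?_
      rw [one_mul, Real.norm_of_nonneg (by positivity)]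
    · exact Measurable.aestronglyMeasurable (by fun_prop)
  have h2 := h.2
  rw [hasFiniteIntegral_iff_enorm] at h2
  refine ne_of_lt (lt_of_le_of_lt (le_of_eq ?_) h2)
  refine lintegral_congr_ae ?_
  have h0 : ∀ᵐ v : ℝ ∂volume.restrict (Metric.ball (0 : ℝ) δ), v ≠ 0 :=
    ae_restrict_of_ae (by simp [ae_iff])
  filter_upwards [h0] with v hv
  rw [Real.enorm_of_nonneg (r := ‖v‖ ^ (-r)) (by positivity), ← ofReal_norm v,
    ENNReal.ofReal_rpow_of_pos (norm_pos_iff.2 hv)]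

section Density

variable {ϱ : ℝ → ℝ} {lam : ℝ}

/-- The infimum is at most the average at the single scale σ, which is all that is needed. -/
theorem ofReal_le_of_minimalFunction (hϱ_nonneg : ∀ v, 0 ≤ ϱ v) (hint : Integrable ϱ) {c σ v : ℝ}
    (hσ : σ ∈ Set.Ioc (0 : ℝ) 1) (h : ϱ v ≤ c * minimalFunction ϱ v) :
    ENNReal.ofReal (ϱ v) ≤ ENNReal.ofReal (|c| * (2 * σ)⁻¹)
      * ∫⁻ u in {u : ℝ | |u - v| ≤ σ}, ENNReal.ofReal (ϱ u) := by
  have hbdd : BddBelow (Set.range fun ν : Set.Ioc (0 : ℝ) 1 =>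
      (2 * (ν : ℝ))⁻¹ * ∫ u in {u : ℝ | |u - v| ≤ ν}, ϱ u) := by
    refine ⟨0, ?_⟩
    rintro _ ⟨ν, rfl⟩
    have := ν.2.1
    have h2 : 0 ≤ ∫ u in {u : ℝ | |u - v| ≤ ν}, ϱ u := integral_nonneg hϱ_nonneg
    positivity
  have h1 : minimalFunction ϱ v ≤ (2 * σ)⁻¹ * ∫ u in {u : ℝ | |u - v| ≤ σ}, ϱ u :=
    ciInf_le hbdd ⟨σ, hσ⟩
  have h0 : 0 ≤ minimalFunction ϱ v := by
    refine Real.iInf_nonneg fun ν => ?_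
    have := ν.2.1
    have h2 : 0 ≤ ∫ u in {u : ℝ | |u - v| ≤ ν}, ϱ u := integral_nonneg hϱ_nonneg
    positivity
  have h2 : ϱ v ≤ |c| * (2 * σ)⁻¹ * ∫ u in {u : ℝ | |u - v| ≤ σ}, ϱ u := by
    calc ϱ v ≤ c * minimalFunction ϱ v := h
      _ ≤ |c| * minimalFunction ϱ v := by gcongr; exact le_abs_self c
      _ ≤ |c| * ((2 * σ)⁻¹ * ∫ u in {u : ℝ | |u - v| ≤ σ}, ϱ u) := by gcongr
      _ = _ := by ring
  have hσ0 := hσ.1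
  refine (ENNReal.ofReal_le_ofReal h2).trans ?_
  rw [ENNReal.ofReal_mul (by positivity), ofReal_integral_eq_lintegral_ofReal hint.integrableOn
    (Eventually.of_forall hϱ_nonneg)]

/-- At points v with |λv - a| < 1/3 the density is bounded by a multiple of the mass of a window
about v, and the window stays inside |λv - a| < 1. What is left is the Lebesgue integral of |v|^{-r}
near 0, finite because r < 1. -/
theorem exists_locallyRegular (hlam : 0 < lam) (hϱ_meas : Measurable ϱ)
    (hϱ_nonneg : ∀ v, 0 ≤ ϱ v) (hint : Integrable ϱ)
    (hϱ_min : ∃ c : ℝ, ∀ᵐ v : ℝ, ϱ v ≤ c * minimalFunction ϱ v) {r : ℝ} (hr0 : 0 ≤ r)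
    (hr : r < 1) :
    ∃ C : ℝ≥0∞, C ≠ ∞ ∧
      LocallyRegular (volume.withDensity (fun v => ENNReal.ofReal (ϱ v))) lam r C := by
  obtain ⟨c, hc⟩ := hϱ_min
  set ν := volume.withDensity (fun v => ENNReal.ofReal (ϱ v)) with hν
  -- With this δ, a window of radius at most δ about a point within δ of Re a/λ gives |λu - Re a| <
  -- 2/3, and |Im a| < 1/3 completes the bound by 1.
  set δ : ℝ := (3 * lam)⁻¹ with hδ
  have hδ0 : 0 < δ := by positivity
  set σ : ℝ := min 1 δ with hσ
  have hσmem : σ ∈ Set.Ioc (0 : ℝ) 1 := ⟨lt_min one_pos hδ0, min_le_left _ _⟩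
  have hlδ : lam * δ = 1 / 3 := by rw [hδ]; field_simp
  set J : ℝ≥0∞ := ∫⁻ v in Metric.ball (0 : ℝ) δ, ‖v‖ₑ ^ (-r) with hJ
  set D : ℝ≥0∞ := ENNReal.ofReal (|c| * (2 * σ)⁻¹) with hD
  have hlam_e : ‖lam‖ₑ ^ (-r) ≠ ∞ :=
    ENNReal.rpow_ne_top_of_ne_zero (by simpa using hlam.ne') enorm_ne_top
  refine ⟨D * (‖lam‖ₑ ^ (-r) * J), ENNReal.mul_ne_top ENNReal.ofReal_ne_top
    (ENNReal.mul_ne_top hlam_e (lintegral_ball_rpow_ne_top hr)), fun a => ?_⟩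
  set A := {v : ℝ | ‖(lam * v - a : ℂ)‖ₑ < 3⁻¹} with hA
  set B := {v : ℝ | ‖(lam * v - a : ℂ)‖ₑ < 1} with hB
  have hAm : MeasurableSet A := measurableSet_lt (by fun_prop) measurable_const
  set α := a.re / lam with hα
  have hre : ∀ v : ℝ, (lam * v - a : ℂ).re = lam * (v - α) := by
    intro v
    simp [hα]
    field_simp
  have him : ∀ v : ℝ, (lam * v - a : ℂ).im = - a.im := by
    intro v
    simp
  have hAball : ∀ v ∈ A, v ∈ Metric.ball α δ ∧ |a.im| < 1 / 3 := by
    intro v hv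
    have hv' : ‖(lam * v - a : ℂ)‖ < 1 / 3 := by
      have h1 : ‖(lam * v - a : ℂ)‖ₑ < 3⁻¹ := hv
      rw [← ofReal_norm, ENNReal.ofReal_lt_iff_lt_toReal (norm_nonneg _) (by simp)] at h1
      simpa using h1
    have h1 := (Complex.abs_re_le_norm (lam * v - a : ℂ)).trans_lt hv'
    have h2 := (Complex.abs_im_le_norm (lam * v - a : ℂ)).trans_lt hv'
    rw [hre, abs_mul, abs_of_pos hlam, ← hlδ] at h1
    rw [him, abs_neg] at h2
    exact ⟨by rw [Metric.mem_ball, Real.dist_eq]; exact lt_of_mul_lt_mul_left h1 hlam.le, h2⟩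
  have hdens : ∀ᵐ v : ℝ, v ∈ A → ENNReal.ofReal (ϱ v) ≤ D * ν B := by
    filter_upwards [hc] with v hv hvA
    refine (ofReal_le_of_minimalFunction hϱ_nonneg hint hσmem hv).trans ?_
    gcongr
    rw [hν, withDensity_apply' _ B]
    refine lintegral_mono_set fun u hu => ?_
    have hu' : |u - v| ≤ σ := hu
    obtain ⟨h1, h2⟩ := hAball v hvA
    rw [Metric.mem_ball, Real.dist_eq] at h1
    have h3 : |u - α| < δ + δ := by
      calc |u - α| = |(u - v) + (v - α)| := by ring_nf
        _ ≤ |u - v| + |v - α| := abs_add_le _ _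
        _ < δ + δ := add_lt_add_of_le_of_lt (hu'.trans (min_le_right _ _)) h1
    change ‖(lam * u - a : ℂ)‖ₑ < 1
    rw [← ofReal_norm, ENNReal.ofReal_lt_one]
    refine lt_of_le_of_lt (Complex.norm_le_abs_re_add_abs_im _) ?_
    rw [hre, him, abs_neg, abs_mul, abs_of_pos hlam]
    have : lam * |u - α| < lam * (δ + δ) := by gcongr
    rw [mul_add, hlδ] at this
    linarith
  have hlow : ∀ v : ℝ, ‖(lam * v - a : ℂ)‖ₑ ^ (-r) ≤ ‖lam‖ₑ ^ (-r) * ‖v - α‖ₑ ^ (-r) := by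
    intro v
    rw [← ENNReal.mul_rpow_of_ne_top enorm_ne_top enorm_ne_top, ← enorm_mul, ENNReal.rpow_neg,
      ENNReal.rpow_neg]
    refine ENNReal.inv_le_inv.2 (ENNReal.rpow_le_rpow ?_ hr0)
    rw [enorm_le_iff_norm_le, ← hre]
    exact Complex.abs_re_le_norm _
  calc ∫⁻ v in A, ‖(lam * v - a : ℂ)‖ₑ ^ (-r) ∂ν
      = ∫⁻ v in A, ENNReal.ofReal (ϱ v) * ‖(lam * v - a : ℂ)‖ₑ ^ (-r) := by
        rw [hν, setLIntegral_withDensity_eq_setLIntegral_mul _ (by fun_prop) (by fun_prop) hAm]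
        rfl
    _ ≤ ∫⁻ v in A, D * ν B * (‖lam‖ₑ ^ (-r) * ‖v - α‖ₑ ^ (-r)) := by
        refine setLIntegral_mono_ae' hAm ?_
        filter_upwards [hdens] with v hv hvA
        exact mul_le_mul' (hv hvA) (hlow v)
    _ ≤ ∫⁻ v in Metric.ball α δ, D * ν B * (‖lam‖ₑ ^ (-r) * ‖v - α‖ₑ ^ (-r)) :=
        lintegral_mono_set fun v hv => (hAball v hv).1
    _ = D * ν B * (‖lam‖ₑ ^ (-r) * ∫⁻ v in Metric.ball α δ, ‖v - α‖ₑ ^ (-r)) := by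
        rw [lintegral_const_mul _ (by fun_prop), lintegral_const_mul _ (by fun_prop)]
    _ = D * ν B * (‖lam‖ₑ ^ (-r) * J) := by
        congr 2
        rw [hJ, ← lintegral_indicator Metric.isOpen_ball.measurableSet,
          ← lintegral_indicator Metric.isOpen_ball.measurableSet,
          ← lintegral_sub_right_eq_self
            ((Metric.ball (0 : ℝ) δ).indicator fun v => ‖v‖ₑ ^ (-r)) α]
        refine lintegral_congr fun v => ?_
        simp only [Set.indicator, Metric.mem_ball, dist_zero_right, Real.dist_eq,
          Real.norm_eq_abs]
    _ = _ := by ring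

end Density

/-! ### Weighted estimates for one and two sites -/

section Weighted

theorem rpow_neg_le_two_mul {x y : ℝ≥0∞} {s : ℝ} (hs : |s| ≤ 1) (hx : x ≤ 2 * y) (hy : y ≤ 2 * x) :
    x ^ (-s) ≤ 2 * y ^ (-s) := by
  have h2 : ∀ t : ℝ, 0 ≤ t → t ≤ 1 → (2 : ℝ≥0∞) ^ t ≤ 2 := by
    intro t _ ht
    simpa using ENNReal.rpow_le_rpow_of_exponent_le (x := 2) (by norm_num) ht
  rcases le_total 0 s with h0 | h0
  · rw [abs_of_nonneg h0] at hs
    rw [ENNReal.rpow_neg, ENNReal.rpow_neg, ← ENNReal.inv_rpow, ← ENNReal.inv_rpow]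
    have hxy : x⁻¹ ≤ 2 * y⁻¹ := by
      have := ENNReal.inv_le_inv.2 hy
      rw [ENNReal.mul_inv (Or.inl (by norm_num)) (Or.inl (by norm_num))] at this
      calc x⁻¹ = 2 * (2⁻¹ * x⁻¹) := by
            rw [← mul_assoc, ENNReal.mul_inv_cancel (by norm_num) (by norm_num), one_mul]
        _ ≤ 2 * y⁻¹ := by gcongr
    calc x⁻¹ ^ s ≤ (2 * y⁻¹) ^ s := by gcongr
      _ = 2 ^ s * y⁻¹ ^ s := ENNReal.mul_rpow_of_nonneg _ _ h0
      _ ≤ _ := by gcongr; exact h2 s h0 hs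
  · rw [abs_of_nonpos h0] at hs
    have h0' : 0 ≤ -s := by linarith
    calc x ^ (-s) ≤ (2 * y) ^ (-s) := by gcongr
      _ = 2 ^ (-s) * y ^ (-s) := ENNReal.mul_rpow_of_nonneg _ _ h0'
      _ ≤ _ := by gcongr; exact h2 _ h0' hs

theorem one_add_enorm_le_mul (u c : ℂ) : 1 + ‖u‖ₑ ≤ (1 + ‖c‖ₑ) * (1 + ‖u - c‖ₑ) := by
  have h : ‖u‖ₑ ≤ ‖u - c‖ₑ + ‖c‖ₑ := by
    simpa using enorm_add_le (u - c) c
  calc 1 + ‖u‖ₑ ≤ 1 + (‖u - c‖ₑ + ‖c‖ₑ) := by gcongr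
    _ ≤ 1 + (‖u - c‖ₑ + ‖c‖ₑ) + ‖c‖ₑ * ‖u - c‖ₑ := le_self_add
    _ = _ := by ring

variable {ν : Measure ℝ} {lam r s : ℝ} {C : ℝ≥0∞}

/-- First 1+|u| ≤ (1+|c|)(1+|u-c|) extracts the factor in c. Where |u-c| ≥ 1/3 the remaining ratio
is at most 4. Near the singularity the weight is essentially constant, so local regularity replaces
the singular integral by the mass of the unit neighbourhood, and the weight is put back. -/
theorem weighted_one_site (hC : LocallyRegular ν lam r C) (hr0 : 0 < r) (hr : r ≤ 1)
    (hs : |s| ≤ 1) (a c : ℂ) :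
    ∫⁻ v, (1 + ‖(lam * v - a : ℂ)‖ₑ) ^ (-s)
        * ((1 + ‖(lam * v - a : ℂ)‖ₑ) / ‖(lam * v - a - c : ℂ)‖ₑ) ^ r ∂ν
      ≤ (4 + 8 * C) * (1 + ‖c‖ₑ) ^ r * ∫⁻ v, (1 + ‖(lam * v - a : ℂ)‖ₑ) ^ (-s) ∂ν := by
  set w : ℝ → ℝ≥0∞ := fun v => (1 + ‖(lam * v - a : ℂ)‖ₑ) ^ (-s) with hw
  set y : ℝ → ℝ≥0∞ := fun v => ‖(lam * v - (a + c) : ℂ)‖ₑ with hy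
  have hwm : Measurable w := by fun_prop
  have hym : Measurable y := by fun_prop
  have hyc : ∀ v : ℝ, ‖(lam * v - a - c : ℂ)‖ₑ = y v := fun v => by
    simp only [hy]; congr 1; ring
  set A := {v : ℝ | y v < 3⁻¹} with hA
  set B := {v : ℝ | y v < 1} with hB
  have hAm : MeasurableSet A := measurableSet_lt (by fun_prop) measurable_const
  have hBm : MeasurableSet B := measurableSet_lt (by fun_prop) measurable_const
  set wc : ℝ≥0∞ := (1 + ‖c‖ₑ) ^ (-s) with hwc
  have hAB : A ⊆ B := fun v hv => lt_trans hv (ENNReal.inv_lt_one.2 (by norm_num))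
  -- On B the numbers 1+|λv-a| and 1+|c| agree up to a factor 2, and |s| ≤ 1 keeps the factor at 2
  -- for the powers.
  have hcomp : ∀ v ∈ B, w v ≤ 2 * wc ∧ wc ≤ 2 * w v := by
    intro v hv
    have hv' : y v < 1 := hv
    have h1 := one_add_enorm_le_mul (lam * v - a : ℂ) c
    have h2 : 1 + ‖c‖ₑ ≤ (1 + ‖(lam * v - a : ℂ)‖ₑ) * (1 + y v) := by
      have := one_add_enorm_le_mul c (lam * v - a : ℂ)
      rwa [enorm_sub_rev c, hyc] at this
    rw [hyc] at h1
    have h3 : 1 + y v ≤ 2 := by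
      rw [← one_add_one_eq_two]; gcongr
    have h1' : 1 + ‖(lam * v - a : ℂ)‖ₑ ≤ 2 * (1 + ‖c‖ₑ) := by
      rw [mul_comm 2]; exact h1.trans (by gcongr)
    have h2' : 1 + ‖c‖ₑ ≤ 2 * (1 + ‖(lam * v - a : ℂ)‖ₑ) := by
      rw [mul_comm 2]; exact h2.trans (by gcongr)
    exact ⟨rpow_neg_le_two_mul hs h1' h2', rpow_neg_le_two_mul hs h2' h1'⟩
  have hle4 : ∀ x : ℝ≥0∞, x ≤ 4 → x ^ r ≤ 4 := by
    intro x hx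
    calc x ^ r ≤ 4 ^ r := by gcongr
      _ ≤ 4 ^ (1 : ℝ) := ENNReal.rpow_le_rpow_of_exponent_le (by norm_num) hr
      _ = 4 := by simp
  have hpt : ∀ v, w v * ((1 + ‖(lam * v - a : ℂ)‖ₑ) / y v) ^ r
      ≤ (1 + ‖c‖ₑ) ^ r * (4 * w v + A.indicator (fun v => 4 * wc * y v ^ (-r)) v) := by
    intro v
    have h1 : ((1 + ‖(lam * v - a : ℂ)‖ₑ) / y v) ^ r
        ≤ (1 + ‖c‖ₑ) ^ r * ((1 + y v) / y v) ^ r := by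
      rw [← ENNReal.mul_rpow_of_nonneg _ _ hr0.le, ← mul_div_assoc]
      gcongr
      have := one_add_enorm_le_mul (lam * v - a : ℂ) c
      rwa [hyc] at this
    have h2 : w v * ((1 + y v) / y v) ^ r
        ≤ 4 * w v + A.indicator (fun v => 4 * wc * y v ^ (-r)) v := by
      by_cases hv : v ∈ A
      · rw [Set.indicator_of_mem hv]
        refine le_trans ?_ le_add_self
        have h3 : ((1 + y v) / y v) ^ r ≤ 2 * y v ^ (-r) := by
          have hy1 : y v < 1 := hAB hv
          calc ((1 + y v) / y v) ^ r ≤ (2 * (y v)⁻¹) ^ r := by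
                rw [div_eq_mul_inv]
                gcongr
                rw [← one_add_one_eq_two]; gcongr
            _ = 2 ^ r * y v ^ (-r) := by
                rw [ENNReal.mul_rpow_of_nonneg _ _ hr0.le, ENNReal.inv_rpow, ENNReal.rpow_neg]
            _ ≤ _ := by
                gcongr
                simpa using ENNReal.rpow_le_rpow_of_exponent_le (x := 2) (by norm_num) hr
        calc w v * ((1 + y v) / y v) ^ r ≤ (2 * wc) * (2 * y v ^ (-r)) :=
              mul_le_mul' (hcomp v (hAB hv)).1 h3
          _ = _ := by ring
      · refine le_trans ?_ le_self_add
        rw [mul_comm]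
        gcongr
        apply hle4
        have hv' : 3⁻¹ ≤ y v := not_lt.1 hv
        have hy0 : y v ≠ 0 := fun h => by rw [h] at hv'; simp at hv'
        have hyt : y v ≠ ∞ := enorm_ne_top
        rw [ENNReal.div_le_iff hy0 hyt]
        have : (1 : ℝ≥0∞) ≤ 3 * y v := by
          calc (1 : ℝ≥0∞) = 3 * 3⁻¹ := (ENNReal.mul_inv_cancel (by norm_num) (by norm_num)).symm
            _ ≤ _ := by gcongr
        calc 1 + y v ≤ 3 * y v + y v := by gcongr
          _ = 4 * y v := by ring
    calc _ ≤ w v * ((1 + ‖c‖ₑ) ^ r * ((1 + y v) / y v) ^ r) := by gcongr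
      _ = (1 + ‖c‖ₑ) ^ r * (w v * ((1 + y v) / y v) ^ r) := by ring
      _ ≤ _ := by gcongr
  have hloc : ∫⁻ v in A, 4 * wc * y v ^ (-r) ∂ν ≤ 8 * C * ∫⁻ v, w v ∂ν := by
    rw [lintegral_const_mul _ (by fun_prop)]
    calc 4 * wc * ∫⁻ v in A, y v ^ (-r) ∂ν ≤ 4 * wc * (C * ν B) := by
          gcongr
          exact hC (a + c)
      _ = 4 * C * ∫⁻ _ in B, wc ∂ν := by
          rw [setLIntegral_const]; ring
      _ ≤ 4 * C * ∫⁻ v in B, 2 * w v ∂ν := by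
          gcongr 4 * C * ?_
          exact setLIntegral_mono (by fun_prop) fun v hv => (hcomp v hv).2
      _ = 8 * C * ∫⁻ v in B, w v ∂ν := by
          rw [lintegral_const_mul _ hwm]; ring
      _ ≤ 8 * C * ∫⁻ v, w v ∂ν := by
          gcongr
          exact Measure.restrict_le_self
  calc _ = ∫⁻ v, w v * ((1 + ‖(lam * v - a : ℂ)‖ₑ) / y v) ^ r ∂ν := by simp_rw [hyc]; rfl
    _ ≤ ∫⁻ v, (1 + ‖c‖ₑ) ^ r * (4 * w v + A.indicator (fun v => 4 * wc * y v ^ (-r)) v) ∂ν :=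
        lintegral_mono hpt
    _ = (1 + ‖c‖ₑ) ^ r * (4 * ∫⁻ v, w v ∂ν + ∫⁻ v in A, 4 * wc * y v ^ (-r) ∂ν) := by
        rw [lintegral_const_mul _ (by fun_prop), lintegral_add_left (by fun_prop),
          lintegral_const_mul _ hwm, lintegral_indicator hAm]
    _ ≤ (1 + ‖c‖ₑ) ^ r * (4 * ∫⁻ v, w v ∂ν + 8 * C * ∫⁻ v, w v ∂ν) := by gcongr
    _ = _ := by ring

theorem lintegral_rpow_neg_le (hC : LocallyRegular ν lam r C) [IsProbabilityMeasure ν]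
    (hr0 : 0 < r) (hr : r ≤ 1) (a : ℂ) :
    ∫⁻ v, ‖(lam * v - a : ℂ)‖ₑ ^ (-r) ∂ν ≤ 3 + C := by
  set A := {v : ℝ | ‖(lam * v - a : ℂ)‖ₑ < 3⁻¹} with hA
  have hAm : MeasurableSet A := measurableSet_lt (by fun_prop) measurable_const
  rw [← lintegral_add_compl _ hAm, add_comm]
  gcongr
  · calc ∫⁻ v in Aᶜ, ‖(lam * v - a : ℂ)‖ₑ ^ (-r) ∂ν ≤ ∫⁻ _ in Aᶜ, 3 ∂ν := by
          refine setLIntegral_mono measurable_const fun v hv => ?_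
          have hv' : 3⁻¹ ≤ ‖(lam * v - a : ℂ)‖ₑ := not_lt.1 hv
          rw [ENNReal.rpow_neg, ← ENNReal.inv_rpow]
          calc (‖(lam * v - a : ℂ)‖ₑ⁻¹) ^ r ≤ 3 ^ r := by
                gcongr
                rw [ENNReal.inv_le_iff_inv_le]; exact hv'
            _ ≤ 3 ^ (1 : ℝ) := ENNReal.rpow_le_rpow_of_exponent_le (by norm_num) hr
            _ = 3 := by simp
      _ ≤ 3 := by
          rw [setLIntegral_const]
          exact mul_le_of_le_one_right' prob_le_one
  · exact (hC a).trans (mul_le_of_le_one_right' prob_le_one)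

theorem lintegral_lintegral_le_of_le_add {α β : Type*} [MeasurableSpace α] [MeasurableSpace β]
    {μ : Measure α} {ν : Measure β} [SFinite μ] [SFinite ν] {F F₁ F₂ F₃ : α → β → ℝ≥0∞}
    (h₁ : Measurable (Function.uncurry F₁)) (h₂ : Measurable (Function.uncurry F₂))
    (h₃ : Measurable (Function.uncurry F₃))
    (hF : ∀ v v', F v v' ≤ F₁ v v' + F₂ v v' + F₃ v v') :
    ∫⁻ v, ∫⁻ v', F v v' ∂ν ∂μ ≤ ∫⁻ v', ∫⁻ v, F₁ v v' ∂μ ∂ν + ∫⁻ v, ∫⁻ v', F₂ v v' ∂ν ∂μ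
      + ∫⁻ v, ∫⁻ v', F₃ v v' ∂ν ∂μ := by
  have e : ∀ v, ∫⁻ v', F v v' ∂ν
      ≤ ∫⁻ v', F₁ v v' ∂ν + ∫⁻ v', F₂ v v' ∂ν + ∫⁻ v', F₃ v v' ∂ν := by
    intro v
    have q₂ : Measurable (F₂ v) := h₂.comp measurable_prodMk_left
    have q₃ : Measurable (F₃ v) := h₃.comp measurable_prodMk_left
    rw [← lintegral_add_right _ q₂, ← lintegral_add_right _ q₃]
    exact lintegral_mono (hF v)
  refine (lintegral_mono e).trans ?_
  have q₂ : Measurable fun v => ∫⁻ v', F₂ v v' ∂ν := h₂.lintegral_prod_right'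
  have q₃ : Measurable fun v => ∫⁻ v', F₃ v v' ∂ν := h₃.lintegral_prod_right'
  rw [lintegral_add_right _ q₃, lintegral_add_right _ q₂,
    lintegral_lintegral_swap h₁.aemeasurable]

/-- The factor by which moving one step past a pair of sites distorts the weights. -/
noncomputable def pairFactor (r : ℝ) (u u' : ℂ) : ℝ≥0∞ :=
  ((1 + ‖u‖ₑ) * (1 + ‖u'‖ₑ) / ‖u * u' - 1‖ₑ) ^ r

theorem pairFactor_comm (r : ℝ) (u u' : ℂ) : pairFactor r u u' = pairFactor r u' u := by
  simp only [pairFactor, mul_comm]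

theorem measurable_pairFactor {α : Type*} [MeasurableSpace α] (r : ℝ) {f g : α → ℂ}
    (hf : Measurable f) (hg : Measurable g) : Measurable fun x => pairFactor r (f x) (g x) := by
  unfold pairFactor
  fun_prop

theorem rpow_le_of_le {r : ℝ} (hr0 : 0 < r) (hr : r ≤ 1) {x n : ℝ≥0∞} (hn : 1 ≤ n) (hx : x ≤ n) :
    x ^ r ≤ n := by
  calc x ^ r ≤ n ^ r := by gcongr
    _ ≤ n ^ (1 : ℝ) := ENNReal.rpow_le_rpow_of_exponent_le hn hr
    _ = n := by simp

theorem pairFactor_le_three (hr0 : 0 < r) (hr : r ≤ 1) {u u' : ℂ} (hu : ‖u‖ₑ < 2⁻¹)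
    (hu' : ‖u'‖ₑ < 2⁻¹) : pairFactor r u u' ≤ 3 := by
  refine rpow_le_of_le hr0 hr (by norm_num) ?_
  have h1 : ‖u‖ < 2⁻¹ := by
    rw [← ofReal_norm, ENNReal.ofReal_lt_iff_lt_toReal (norm_nonneg _) (by simp)] at hu
    simpa using hu
  have h2 : ‖u'‖ < 2⁻¹ := by
    rw [← ofReal_norm, ENNReal.ofReal_lt_iff_lt_toReal (norm_nonneg _) (by simp)] at hu'
    simpa using hu'
  have h3 : 3 / 4 ≤ ‖u * u' - 1‖ := by
    have h4 : ‖u * u'‖ ≤ 1 / 4 := by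
      rw [norm_mul]
      nlinarith [norm_nonneg u, norm_nonneg u']
    have h5 := norm_sub_norm_le (1 : ℂ) (u * u')
    rw [norm_sub_rev, norm_one] at h5
    linarith
  have e1 : ∀ z : ℂ, 1 + ‖z‖ₑ = ENNReal.ofReal (1 + ‖z‖) := fun z => by
    rw [ENNReal.ofReal_add zero_le_one (norm_nonneg _), ENNReal.ofReal_one, ofReal_norm]
  have h0 : 0 < ‖u * u' - 1‖ := by linarith
  rw [e1, e1, ← ENNReal.ofReal_mul (by positivity), ← ofReal_norm,
    ← ENNReal.ofReal_div_of_pos h0]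
  refine ENNReal.ofReal_le_of_le_toReal ?_
  rw [div_le_iff₀ h0]
  simp only [ENNReal.toReal_ofNat]
  have h6 : (1 + ‖u‖) * (1 + ‖u'‖) ≤ (3 / 2) * (3 / 2) := by
    gcongr <;> linarith
  linarith

/-- Since |uu' - 1| = |u'| |u - 1/u'|, the one-site estimate applies with c = 1/u'. The lower bound
on |u'| gives one factor 3 for (1+|u'|)/|u'| and another for 1+|c|. -/
theorem lintegral_pairFactor_le (hC : LocallyRegular ν lam r C) (hr0 : 0 < r) (hr : r ≤ 1)
    (hs : |s| ≤ 1) (b u' : ℂ) (hu' : 2⁻¹ ≤ ‖u'‖ₑ) :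
    ∫⁻ v, (1 + ‖(lam * v - b : ℂ)‖ₑ) ^ (-s) * pairFactor r (lam * v - b) u' ∂ν
      ≤ 9 * (4 + 8 * C) * ∫⁻ v, (1 + ‖(lam * v - b : ℂ)‖ₑ) ^ (-s) ∂ν := by
  have hu0 : u' ≠ 0 := by
    rintro rfl
    simp at hu'
  have hue : ‖u'‖ₑ ≠ 0 := by simpa using hu0
  have h2 : (1 : ℝ≥0∞) ≤ 2 * ‖u'‖ₑ := by
    calc (1 : ℝ≥0∞) = 2 * 2⁻¹ := (ENNReal.mul_inv_cancel (by norm_num) (by norm_num)).symm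
      _ ≤ _ := by gcongr
  have h3 : (1 + ‖u'‖ₑ) / ‖u'‖ₑ ≤ 3 := by
    rw [ENNReal.div_le_iff hue enorm_ne_top]
    calc 1 + ‖u'‖ₑ ≤ 2 * ‖u'‖ₑ + ‖u'‖ₑ := by gcongr
      _ = 3 * ‖u'‖ₑ := by ring
  have h4 : ∀ u, pairFactor r u u' ≤ 3 * ((1 + ‖u‖ₑ) / ‖u - u'⁻¹‖ₑ) ^ r := by
    intro u
    have e : ‖u * u' - 1‖ₑ = ‖u'‖ₑ * ‖u - u'⁻¹‖ₑ := by
      rw [← enorm_mul]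
      congr 1
      field_simp
    have e2 : (1 + ‖u‖ₑ) * (1 + ‖u'‖ₑ) / ‖u * u' - 1‖ₑ
        = ((1 + ‖u'‖ₑ) / ‖u'‖ₑ) * ((1 + ‖u‖ₑ) / ‖u - u'⁻¹‖ₑ) := by
      rw [e, div_eq_mul_inv, div_eq_mul_inv, div_eq_mul_inv,
        ENNReal.mul_inv (Or.inl hue) (Or.inl enorm_ne_top)]
      ring
    rw [pairFactor, e2, ENNReal.mul_rpow_of_nonneg _ _ hr0.le]
    gcongr
    exact rpow_le_of_le hr0 hr (by norm_num) h3
  have h5 : (1 + ‖u'⁻¹‖ₑ) ^ r ≤ 3 := by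
    refine rpow_le_of_le hr0 hr (by norm_num) ?_
    rw [enorm_inv hu0]
    have : ‖u'‖ₑ⁻¹ ≤ 2 := by rw [← inv_inv (2 : ℝ≥0∞)]; exact ENNReal.inv_le_inv.2 hu'
    calc 1 + ‖u'‖ₑ⁻¹ ≤ 1 + 2 := by gcongr
      _ = 3 := by norm_num
  calc _ ≤ ∫⁻ v, 3 * ((1 + ‖(lam * v - b : ℂ)‖ₑ) ^ (-s) * ((1 + ‖(lam * v - b : ℂ)‖ₑ)
          / ‖(lam * v - b - u'⁻¹ : ℂ)‖ₑ) ^ r) ∂ν := by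
        refine lintegral_mono fun v => ?_
        calc _ ≤ (1 + ‖(lam * v - b : ℂ)‖ₑ) ^ (-s) * (3 * ((1 + ‖(lam * v - b : ℂ)‖ₑ)
            / ‖(lam * v - b - u'⁻¹ : ℂ)‖ₑ) ^ r) := by gcongr; exact h4 _
          _ = _ := by ring
    _ = 3 * ∫⁻ v, (1 + ‖(lam * v - b : ℂ)‖ₑ) ^ (-s) * ((1 + ‖(lam * v - b : ℂ)‖ₑ)
          / ‖(lam * v - b - u'⁻¹ : ℂ)‖ₑ) ^ r ∂ν := lintegral_const_mul _ (by fun_prop)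
    _ ≤ 3 * ((4 + 8 * C) * (1 + ‖u'⁻¹‖ₑ) ^ r
          * ∫⁻ v, (1 + ‖(lam * v - b : ℂ)‖ₑ) ^ (-s) ∂ν) := by
        gcongr 3 * ?_
        exact weighted_one_site hC hr0 hr hs b _
    _ ≤ 3 * ((4 + 8 * C) * 3 * ∫⁻ v, (1 + ‖(lam * v - b : ℂ)‖ₑ) ^ (-s) ∂ν) := by gcongr
    _ = _ := by ring

/-- If one of the variables is in its good set, the integral over the other one is controlled with
the first frozen. If neither is, the factor X is at most 3. In the application, good means modulus
at least 1/2: two smaller numbers have a product far from 1. -/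
theorem lintegral_two_weights_le {α : Type*} [MeasurableSpace α] {μ : Measure α} [SFinite μ]
    {w w' : α → ℝ≥0∞} {X : α → α → ℝ≥0∞} {S S' : Set α} {D : ℝ≥0∞} (hw : Measurable w)
    (hw' : Measurable w') (hX : Measurable (Function.uncurry X)) (hS : MeasurableSet S)
    (hS' : MeasurableSet S') (h₁ : ∀ v' ∈ S', ∫⁻ v, w v * X v v' ∂μ ≤ D * ∫⁻ v, w v ∂μ)
    (h₂ : ∀ v ∈ S, ∫⁻ v', w' v' * X v v' ∂μ ≤ D * ∫⁻ v, w' v ∂μ)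
    (h₃ : ∀ v ∉ S, ∀ v' ∉ S', X v v' ≤ 3) :
    ∫⁻ v, ∫⁻ v', w v * w' v' * X v v' ∂μ ∂μ
      ≤ (2 * D + 3) * ((∫⁻ v, w v ∂μ) * ∫⁻ v, w' v ∂μ) := by
  have hpt : ∀ v v', w v * w' v' * X v v' ≤ S'.indicator w' v' * (w v * X v v')
      + S.indicator w v * (w' v' * X v v') + 3 * (w v * w' v') := by
    intro v v'
    by_cases h1 : v' ∈ S'
    · rw [Set.indicator_of_mem h1]
      refine le_trans (le_of_eq ?_) (le_self_add.trans le_self_add)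
      ring
    · by_cases h2 : v ∈ S
      · rw [Set.indicator_of_mem h2]
        refine le_trans (le_of_eq ?_) (le_add_self.trans le_self_add)
        ring
      · refine le_trans ?_ le_add_self
        rw [mul_comm]
        gcongr
        exact h₃ v h2 v' h1
  have m1 : Measurable (Function.uncurry fun v v' => S'.indicator w' v' * (w v * X v v')) :=
    ((hw'.indicator hS').comp measurable_snd).mul ((hw.comp measurable_fst).mul hX)
  have m2 : Measurable (Function.uncurry fun v v' => S.indicator w v * (w' v' * X v v')) :=
    ((hw.indicator hS).comp measurable_fst).mul ((hw'.comp measurable_snd).mul hX)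
  have m3 : Measurable (Function.uncurry fun v v' => 3 * (w v * w' v')) :=
    ((hw.comp measurable_fst).mul (hw'.comp measurable_snd)).const_mul 3
  refine (lintegral_lintegral_le_of_le_add m1 m2 m3 hpt).trans ?_
  have t1 : ∫⁻ v', ∫⁻ v, S'.indicator w' v' * (w v * X v v') ∂μ ∂μ
      ≤ D * ((∫⁻ v, w v ∂μ) * ∫⁻ v, w' v ∂μ) := by
    rw [← mul_assoc, ← lintegral_const_mul _ hw']
    refine lintegral_mono fun v' => ?_
    have q : Measurable fun v => w v * X v v' := hw.mul (hX.comp measurable_prodMk_right)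
    rw [lintegral_const_mul _ q]
    by_cases h : v' ∈ S'
    · rw [Set.indicator_of_mem h, mul_comm]
      gcongr
      exact h₁ v' h
    · rw [Set.indicator_of_notMem h, zero_mul]
      exact zero_le
  have t2 : ∫⁻ v, ∫⁻ v', S.indicator w v * (w' v' * X v v') ∂μ ∂μ
      ≤ D * ((∫⁻ v, w v ∂μ) * ∫⁻ v, w' v ∂μ) := by
    rw [mul_comm (∫⁻ v, w v ∂μ), ← mul_assoc, ← lintegral_const_mul _ hw]
    refine lintegral_mono fun v => ?_
    have q : Measurable fun v' => w' v' * X v v' := hw'.mul (hX.comp measurable_prodMk_left)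
    rw [lintegral_const_mul _ q]
    by_cases h : v ∈ S
    · rw [Set.indicator_of_mem h, mul_comm]
      gcongr
      exact h₂ v h
    · rw [Set.indicator_of_notMem h, zero_mul]
      exact zero_le
  have t3 : ∫⁻ v, ∫⁻ v', 3 * (w v * w' v') ∂μ ∂μ
      = 3 * ((∫⁻ v, w v ∂μ) * ∫⁻ v, w' v ∂μ) := by
    rw [← lintegral_mul_const _ hw, ← lintegral_const_mul _ (hw.mul_const _)]
    refine lintegral_congr fun v => ?_
    rw [lintegral_const_mul _ (hw'.const_mul _), lintegral_const_mul _ hw']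
  rw [t3]
  calc _ ≤ D * ((∫⁻ v, w v ∂μ) * ∫⁻ v, w' v ∂μ) + D * ((∫⁻ v, w v ∂μ) * ∫⁻ v, w' v ∂μ)
        + 3 * ((∫⁻ v, w v ∂μ) * ∫⁻ v, w' v ∂μ) := by gcongr
    _ = _ := by ring

theorem weighted_two_sites (hC : LocallyRegular ν lam r C) [SFinite ν] (hr0 : 0 < r) (hr : r ≤ 1)
    (hs : |s| ≤ 1) (a a' : ℂ) :
    ∫⁻ v, ∫⁻ v', ((1 + ‖(lam * v - a : ℂ)‖ₑ) * (1 + ‖(lam * v' - a' : ℂ)‖ₑ)) ^ (-s)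
        * pairFactor r (lam * v - a) (lam * v' - a') ∂ν ∂ν
      ≤ (18 * (4 + 8 * C) + 3) * ((∫⁻ v, (1 + ‖(lam * v - a : ℂ)‖ₑ) ^ (-s) ∂ν)
        * ∫⁻ v, (1 + ‖(lam * v - a' : ℂ)‖ₑ) ^ (-s) ∂ν) := by
  have hX : Measurable fun p : ℝ × ℝ =>
      pairFactor r ((lam : ℂ) * p.1 - a) ((lam : ℂ) * p.2 - a') :=
    measurable_pairFactor r (by fun_prop) (by fun_prop)
  have hS : ∀ b : ℂ, MeasurableSet {v : ℝ | (2⁻¹ : ℝ≥0∞) ≤ ‖(lam * v - b : ℂ)‖ₑ} := fun b =>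
    measurableSet_le measurable_const (by fun_prop)
  have hw : ∀ b : ℂ, Measurable fun v : ℝ => (1 + ‖(lam * v - b : ℂ)‖ₑ) ^ (-s) := fun b => by
    fun_prop
  have key := lintegral_two_weights_le (μ := ν) (D := 9 * (4 + 8 * C))
    (X := fun v v' : ℝ => pairFactor r ((lam : ℂ) * v - a) ((lam : ℂ) * v' - a'))
    (hw a) (hw a') hX (hS a) (hS a')
    (fun v' h => lintegral_pairFactor_le hC hr0 hr hs a _ h)
    (fun v h => by
      simp_rw [pairFactor_comm r (lam * v - a)]
      exact lintegral_pairFactor_le hC hr0 hr hs a' _ h)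
    (fun v h v' h' => pairFactor_le_three hr0 hr (not_le.1 h) (not_le.1 h'))
  have e : ∀ v v' : ℝ, ((1 + ‖(lam * v - a : ℂ)‖ₑ) * (1 + ‖(lam * v' - a' : ℂ)‖ₑ)) ^ (-s)
      = (1 + ‖(lam * v - a : ℂ)‖ₑ) ^ (-s) * (1 + ‖(lam * v' - a' : ℂ)‖ₑ) ^ (-s) := fun v v' =>
    ENNReal.mul_rpow_of_ne_top (one_add_enorm_ne_top _) (one_add_enorm_ne_top _) _
  simp_rw [e]
  refine key.trans (le_of_eq ?_)
  ring

end Weighted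

/-! ### The chain of the Green function satisfies the required estimates -/

section Bounds

variable {k : ℕ} {ν : Measure ℝ} [IsProbabilityMeasure ν] {lam r s ς : ℝ} {ζ : ℂ}

/-- Values in the closed upper half-plane, of modulus at most `η⁻¹`. -/
def greenRange (η : ℝ) : Set ℂ := {z | 0 ≤ z.im ∧ ‖z‖ ≤ η⁻¹}

theorem stepLaw_im_le (hζ : 0 < ζ.im) : ∀ᵐ W ∂stepLaw k ν lam ζ, W.im ≤ -ζ.im := by
  rw [stepLaw, ae_map_iff (measurable_step hζ).aemeasurable
    (measurableSet_le Complex.measurable_im measurable_const)]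
  refine Eventually.of_forall fun p => ?_
  have : 0 ≤ ∑ j, (rootGreen lam (p.2 j) ζ).im :=
    Finset.sum_nonneg fun j _ => (im_rootGreen_pos hζ).le
  simp only [Complex.sub_im, Complex.im_sum]
  simp
  linarith

theorem le_norm_of_im_le {z : ℂ} {η : ℝ} (hz : z.im ≤ -η) : η ≤ ‖z‖ := by
  have := Complex.abs_im_le_norm z
  have h2 := neg_abs_le z.im
  linarith

theorem inv_mem_greenRange {z : ℂ} {η : ℝ} (hη : 0 < η) (hz : z.im ≤ -η) :
    z⁻¹ ∈ greenRange η := by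
  have h := le_norm_of_im_le hz
  refine ⟨?_, ?_⟩
  · rw [Complex.inv_im]
    have := Complex.normSq_nonneg z
    apply div_nonneg _ this
    linarith
  · rw [norm_inv]
    exact inv_anti₀ hη h

theorem isInvariant_greenRange (hζ : 0 < ζ.im) :
    IsInvariant (stepLaw k ν lam ζ) (greenRange ζ.im) where
  measurable := (measurableSet_le measurable_const Complex.measurable_im).inter
    (measurableSet_le measurable_norm measurable_const)
  zero_mem := ⟨by simp, by simpa using hζ.le⟩
  step b hb := by
    filter_upwards [stepLaw_im_le hζ] with W hW
    refine inv_mem_greenRange hζ ?_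
    have := hb.1
    rw [Complex.sub_im]
    linarith
  ne b hb c hc := by
    filter_upwards [stepLaw_im_le hζ] with W hW h0
    have h1 := congrArg Complex.im h0
    have := hb.1
    have := hc.1
    simp only [Complex.sub_im, Complex.zero_im] at h1
    linarith

theorem greenLaw_mem_greenRange (hζ : 0 < ζ.im) :
    ∀ᵐ γ ∂greenLaw (k := k) ν lam ζ, γ ∈ greenRange ζ.im := by
  rw [greenLaw, ae_map_iff (p := fun γ => γ ∈ greenRange ζ.im)
    (measurable_rootGreen hζ).aemeasurable
    (isInvariant_greenRange (k := k) (ν := ν) (lam := lam) hζ).measurable]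
  exact Eventually.of_forall fun v => ⟨(im_rootGreen_pos hζ).le, norm_rootGreen_le hζ⟩

theorem lintegral_stepLaw (hζ : 0 < ζ.im) {F : ℂ → ℝ≥0∞} (hF : Measurable F) :
    ∫⁻ W, F W ∂stepLaw k ν lam ζ
      = ∫⁻ p : Fin k → Vertex (k + 1) → ℝ, ∫⁻ v,
          F (lam * v - (ζ + ∑ j, rootGreen lam (p j) ζ)) ∂ν
          ∂(Measure.pi fun _ => potLaw (k + 1) ν) := by
  rw [stepLaw, lintegral_map hF (measurable_step hζ), lintegral_prod_symm]
  · simp_rw [sub_sub]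
  · exact (hF.comp (measurable_step hζ)).aemeasurable

theorem measurable_sum_rootGreen (hζ : 0 < ζ.im) :
    Measurable fun p : Fin k → Vertex (k + 1) → ℝ => ∑ j, rootGreen lam (p j) ζ := by
  have : ∀ j : Fin k, Measurable fun p : Fin k → Vertex (k + 1) → ℝ =>
      rootGreen lam (p j) ζ := fun j => (measurable_rootGreen hζ).comp (by fun_prop)
  fun_prop

theorem lintegral_lintegral_stepLaw (hζ : 0 < ζ.im) {F : ℂ → ℂ → ℝ≥0∞}
    (hF : Measurable fun q : ℂ × ℂ => F q.1 q.2) :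
    ∫⁻ W, ∫⁻ W', F W W' ∂stepLaw k ν lam ζ ∂stepLaw k ν lam ζ
      = ∫⁻ p : Fin k → Vertex (k + 1) → ℝ, ∫⁻ p' : Fin k → Vertex (k + 1) → ℝ,
          ∫⁻ v, ∫⁻ v', F (lam * v - (ζ + ∑ j, rootGreen lam (p j) ζ))
            (lam * v' - (ζ + ∑ j, rootGreen lam (p' j) ζ)) ∂ν ∂ν
          ∂(Measure.pi fun _ => potLaw (k + 1) ν) ∂(Measure.pi fun _ => potLaw (k + 1) ν) := by
  have := isProbabilityMeasure_stepLaw (k := k) ν (lam := lam) hζ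
  have h1 : Measurable fun W => ∫⁻ W', F W W' ∂stepLaw k ν lam ζ := hF.lintegral_prod_right'
  have h2 : ∀ W, Measurable (F W) := fun W => hF.comp measurable_prodMk_left
  rw [lintegral_stepLaw hζ h1]
  refine lintegral_congr fun p => ?_
  simp_rw [lintegral_stepLaw hζ (h2 _)]
  rw [lintegral_lintegral_swap]
  have hΘ := (measurable_sum_rootGreen (k := k) (lam := lam) hζ).const_add ζ
  have h3 : Measurable fun q : (ℝ × (Fin k → Vertex (k + 1) → ℝ)) × ℝ =>
      F (lam * q.1.1 - (ζ + ∑ j, rootGreen lam (p j) ζ))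
        (lam * q.2 - (ζ + ∑ j, rootGreen lam (q.1.2 j) ζ)) :=
    hF.comp (Measurable.prodMk (by fun_prop) (Measurable.sub (by fun_prop)
      (hΘ.comp (measurable_snd.comp measurable_fst))))
  exact h3.lintegral_prod_right'.aemeasurable

theorem lintegral_add_mul_rpow_ne_top (hς : ς ∈ Set.Ioo (0 : ℝ) 1)
    (hν : ∫⁻ v, ‖v‖ₑ ^ ς ∂ν ≠ ∞) {t : ℝ} (ht0 : 0 ≤ t) (ht : t ≤ ς) {A B : ℝ≥0∞} (hA : A ≠ ∞)
    (hB : B ≠ ∞) : ∫⁻ v, (A + B * ‖v‖ₑ) ^ t ∂ν ≠ ∞ := by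
  have h : ∀ v : ℝ, (A + B * ‖v‖ₑ) ^ t ≤ A ^ t + B ^ t * (1 + ‖v‖ₑ ^ ς) := by
    intro v
    calc (A + B * ‖v‖ₑ) ^ t ≤ A ^ t + (B * ‖v‖ₑ) ^ t :=
          ENNReal.rpow_add_le_add_rpow _ _ ht0 (ht.trans hς.2.le)
      _ = A ^ t + B ^ t * ‖v‖ₑ ^ t := by rw [ENNReal.mul_rpow_of_nonneg _ _ ht0]
      _ ≤ _ := by
        gcongr
        rcases le_total ‖v‖ₑ 1 with h1 | h1
        · exact (ENNReal.rpow_le_one h1 ht0).trans le_self_add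
        · exact (ENNReal.rpow_le_rpow_of_exponent_le h1 ht).trans le_add_self
  refine ne_top_of_le_ne_top ?_ (lintegral_mono h)
  rw [lintegral_add_left measurable_const, lintegral_const_mul _ (by fun_prop),
    lintegral_add_left measurable_const]
  have h1 : A ^ t ≠ ∞ := ENNReal.rpow_ne_top_of_nonneg ht0 hA
  have h2 : B ^ t ≠ ∞ := ENNReal.rpow_ne_top_of_nonneg ht0 hB
  simp only [lintegral_const, measure_univ, mul_one]
  exact ENNReal.add_ne_top.2 ⟨h1, ENNReal.mul_ne_top h2 (ENNReal.add_ne_top.2 ⟨by simp, hν⟩)⟩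

theorem enorm_step_le (hζ : 0 < ζ.im) {b : ℂ} (hb : b ∈ greenRange ζ.im) (v : ℝ)
    (p : Fin k → Vertex (k + 1) → ℝ) :
    1 + ‖(lam * v - (ζ + ∑ j, rootGreen lam (p j) ζ) - b : ℂ)‖ₑ
      ≤ (1 + ‖ζ‖ₑ + (k + 1) * ENNReal.ofReal (ζ.im)⁻¹) + ‖lam‖ₑ * ‖v‖ₑ := by
  have h1 : ‖(lam * v - (ζ + ∑ j, rootGreen lam (p j) ζ) - b : ℂ)‖
      ≤ |lam| * |v| + ‖ζ‖ + (k + 1) * (ζ.im)⁻¹ := by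
    have e1 : ‖∑ j, rootGreen lam (p j) ζ‖ ≤ k * (ζ.im)⁻¹ := by
      refine (norm_sum_le _ _).trans ?_
      calc _ ≤ ∑ _j : Fin k, (ζ.im)⁻¹ := Finset.sum_le_sum fun j _ => norm_rootGreen_le hζ
        _ = _ := by simp
    have e2 : ‖(lam * v : ℂ)‖ = |lam| * |v| := by simp
    have e3 := norm_sub_le (lam * v - (ζ + ∑ j, rootGreen lam (p j) ζ) : ℂ) b
    have e4 := norm_sub_le (lam * v : ℂ) (ζ + ∑ j, rootGreen lam (p j) ζ)
    have e5 := norm_add_le ζ (∑ j, rootGreen lam (p j) ζ)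
    have := hb.2
    linarith
  have hη : 0 ≤ (ζ.im)⁻¹ := (inv_pos.2 hζ).le
  have h2 : ‖(lam * v - (ζ + ∑ j, rootGreen lam (p j) ζ) - b : ℂ)‖ₑ
      ≤ ‖lam‖ₑ * ‖v‖ₑ + ‖ζ‖ₑ + (k + 1) * ENNReal.ofReal (ζ.im)⁻¹ := by
    rw [← ofReal_norm, ← ofReal_norm lam, ← ofReal_norm v, ← ofReal_norm ζ,
      ← ENNReal.ofReal_mul (norm_nonneg _), ← ENNReal.ofReal_add (by positivity) (by positivity),
      show ((k : ℝ≥0∞) + 1) = ENNReal.ofReal (k + 1) by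
        rw [ENNReal.ofReal_add (by positivity) zero_le_one]; simp,
      ← ENNReal.ofReal_mul (by positivity), ← ENNReal.ofReal_add (by positivity) (by positivity)]
    exact ENNReal.ofReal_le_ofReal h1
  calc _ ≤ 1 + (‖lam‖ₑ * ‖v‖ₑ + ‖ζ‖ₑ + (k + 1) * ENNReal.ofReal (ζ.im)⁻¹) := by gcongr
    _ = _ := by ring

theorem one_add_le_of_le_enorm {z : ℂ} {η : ℝ} (hη : 0 < η) (hz : η ≤ ‖z‖) :
    (1 + ‖z‖ₑ) / ‖z‖ₑ ≤ 1 + ENNReal.ofReal η⁻¹ := by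
  have h0 : ‖z‖ₑ ≠ 0 := by
    rw [← ofReal_norm]; simpa using lt_of_lt_of_le hη hz
  rw [ENNReal.add_div, ENNReal.div_self h0 enorm_ne_top, add_comm, one_div]
  gcongr
  rw [ENNReal.ofReal_inv_of_pos hη, ← ofReal_norm]
  exact ENNReal.inv_le_inv.2 (ENNReal.ofReal_le_ofReal hz)

/-- For s ≥ 0 the distance |W-b| is at least Im ζ. For s < 0 it grows at most linearly in the
potential, whose moment of order ς is finite. -/
theorem exists_finite_bound (hς : ς ∈ Set.Ioo (0 : ℝ) 1) (hν : ∫⁻ v, ‖v‖ₑ ^ ς ∂ν ≠ ∞)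
    (hζ : 0 < ζ.im) (hs : -ς ≤ s) :
    ∃ M : ℝ≥0∞, M ≠ ∞ ∧ ∀ b ∈ greenRange ζ.im,
      ∫⁻ W, ‖W - b‖ₑ ^ (-s) ∂stepLaw k ν lam ζ ≤ M ∧
      ∫⁻ W, (1 + ‖W - b‖ₑ) ^ (-s) ∂stepLaw k ν lam ζ ≤ M := by
  have := isProbabilityMeasure_stepLaw (k := k) ν (lam := lam) hζ
  rcases le_total 0 s with h0 | h0
  · refine ⟨max 1 (ENNReal.ofReal (ζ.im)⁻¹ ^ s), max_lt (by simp)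
      (ENNReal.rpow_lt_top_of_nonneg h0 (by simp)) |>.ne, fun b hb => ⟨?_, ?_⟩⟩
    · calc _ ≤ ∫⁻ _, max 1 (ENNReal.ofReal (ζ.im)⁻¹ ^ s) ∂stepLaw k ν lam ζ := by
            refine lintegral_mono_ae ?_
            filter_upwards [stepLaw_im_le hζ] with W hW
            refine le_trans ?_ (le_max_right _ _)
            have h1 : ζ.im ≤ ‖W - b‖ := by
              apply le_norm_of_im_le
              have := hb.1
              rw [Complex.sub_im]
              linarith
            rw [ENNReal.rpow_neg, ← ENNReal.inv_rpow, ENNReal.ofReal_inv_of_pos hζ, ← ofReal_norm]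
            gcongr
        _ = _ := by simp
    · calc _ ≤ ∫⁻ _, max 1 (ENNReal.ofReal (ζ.im)⁻¹ ^ s) ∂stepLaw k ν lam ζ := by
            refine lintegral_mono fun W => le_trans ?_ (le_max_left _ _)
            rw [ENNReal.rpow_neg, ENNReal.inv_le_one]
            simpa using ENNReal.rpow_le_rpow (z := s) (show (1 : ℝ≥0∞) ≤ 1 + ‖W - b‖ₑ from le_self_add)
              h0
        _ = _ := by simp
  · have h0' : 0 ≤ -s := by linarith
    set A : ℝ≥0∞ := 1 + ‖ζ‖ₑ + (k + 1) * ENNReal.ofReal (ζ.im)⁻¹ with hA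
    have hAt : A ≠ ∞ := by
      rw [hA]
      finiteness
    refine ⟨∫⁻ v, (A + ‖lam‖ₑ * ‖v‖ₑ) ^ (-s) ∂ν,
      lintegral_add_mul_rpow_ne_top hς hν h0' (by linarith) hAt enorm_ne_top, fun b hb => ?_⟩
    have key : ∫⁻ W, (1 + ‖W - b‖ₑ) ^ (-s) ∂stepLaw k ν lam ζ
        ≤ ∫⁻ v, (A + ‖lam‖ₑ * ‖v‖ₑ) ^ (-s) ∂ν := by
      rw [lintegral_stepLaw hζ (by fun_prop)]
      calc _ ≤ ∫⁻ _ : Fin k → Vertex (k + 1) → ℝ, ∫⁻ v, (A + ‖lam‖ₑ * ‖v‖ₑ) ^ (-s) ∂ν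
              ∂(Measure.pi fun _ => potLaw (k + 1) ν) := by
            refine lintegral_mono fun p => lintegral_mono fun v => ?_
            exact ENNReal.rpow_le_rpow (enorm_step_le hζ hb v p) h0'
        _ = _ := by simp
    refine ⟨le_trans (lintegral_mono fun W => ?_) key, key⟩
    exact ENNReal.rpow_le_rpow le_add_self h0'

/-- The estimates at a fixed energy in the upper half-plane. -/
theorem exists_chainBounds (hς : ς ∈ Set.Ioo (0 : ℝ) 1) (hν : ∫⁻ v, ‖v‖ₑ ^ ς ∂ν ≠ ∞)
    (hζ : 0 < ζ.im) (hr : 0 < r) :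
    ∃ C : ℝ≥0∞, C ≠ ∞ ∧ ∀ s, -ς ≤ s → |s| ≤ r →
      ChainBounds (stepLaw k ν lam ζ) (greenLaw (k := k) ν lam ζ) (greenRange ζ.im) s r C := by
  have := isProbabilityMeasure_stepLaw (k := k) ν (lam := lam) hζ
  have := isProbabilityMeasure_greenLaw (k := k) ν (lam := lam) hζ
  -- The number q bounds (1+|z|)/|z| for |z| ≥ Im ζ, and also 1+|γ| for values γ of the chain.
  set q : ℝ≥0∞ := 1 + ENNReal.ofReal (ζ.im)⁻¹ with hq
  have hq1 : 1 ≤ q := le_self_add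
  have hqt : q ≠ ∞ := by rw [hq]; finiteness
  have hpow : ∀ W b : ℂ, b ∈ greenRange ζ.im → W.im ≤ -ζ.im → ζ.im ≤ ‖W - b‖ := by
    intro W b hb hW
    apply le_norm_of_im_le
    have := hb.1
    rw [Complex.sub_im]
    linarith
  have hstep : ∀ u c : ℂ, ζ.im ≤ ‖u - c‖ → (1 + ‖u‖ₑ) / ‖u - c‖ₑ ≤ (1 + ‖c‖ₑ) * q := by
    intro u c h
    calc (1 + ‖u‖ₑ) / ‖u - c‖ₑ ≤ (1 + ‖c‖ₑ) * (1 + ‖u - c‖ₑ) / ‖u - c‖ₑ := by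
          gcongr
          exact one_add_enorm_le_mul u c
      _ = (1 + ‖c‖ₑ) * ((1 + ‖u - c‖ₑ) / ‖u - c‖ₑ) := mul_div_assoc _ _ _
      _ ≤ _ := by
          gcongr
          exact one_add_le_of_le_enorm hζ h
  have hqr : q ^ r ≤ (q ^ 3) ^ r := by
    gcongr
    exact le_self_pow₀ hq1 (by norm_num)
  -- The two-step ratio costs q for (1+|u|)/|u|, and q² for the second step with its pole at u⁻¹.
  refine ⟨(q ^ 3) ^ r, ENNReal.rpow_ne_top_of_nonneg hr.le (by finiteness), fun s hs1 hs2 => ?_⟩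
  refine ⟨isInvariant_greenRange hζ, greenLaw_mem_greenRange hζ, hr, hs2,
    ENNReal.one_le_rpow (one_le_pow₀ hq1) hr, exists_finite_bound hς hν hζ hs1, ?_, ?_, ?_⟩
  · intro b hb c hc
    rw [mul_comm, ← lintegral_mul_const _ (by fun_prop)]
    refine lintegral_mono_ae ?_
    filter_upwards [stepLaw_im_le hζ] with W hW
    gcongr
    have h1 : ζ.im ≤ ‖W - b - c‖ := by
      apply le_norm_of_im_le
      have := hb.1
      have := hc.1
      simp only [Complex.sub_im]
      linarith
    calc ((1 + ‖W - b‖ₑ) / ‖W - b - c‖ₑ) ^ r ≤ ((1 + ‖c‖ₑ) * q) ^ r := by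
          gcongr
          exact hstep _ _ h1
      _ = q ^ r * (1 + ‖c‖ₑ) ^ r := by rw [ENNReal.mul_rpow_of_nonneg _ _ hr.le, mul_comm]
      _ ≤ _ := by gcongr
  · intro b hb c hc
    have hbound : ∀ᵐ W ∂stepLaw k ν lam ζ, ∀ᵐ W' ∂stepLaw k ν lam ζ,
        ((1 + ‖W - b‖ₑ) * (1 + ‖W' - c‖ₑ)) ^ (-s) *
        ((1 + ‖W - b‖ₑ) * (1 + ‖W' - c‖ₑ) / ‖(W - b) * (W' - c) - 1‖ₑ) ^ r
        ≤ (q ^ 3) ^ r * ((1 + ‖W - b‖ₑ) ^ (-s) * (1 + ‖W' - c‖ₑ) ^ (-s)) := by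
      filter_upwards [stepLaw_im_le hζ] with W hW
      filter_upwards [stepLaw_im_le hζ] with W' hW'
      rw [ENNReal.mul_rpow_of_ne_top (one_add_enorm_ne_top _) (one_add_enorm_ne_top _) (-s),
        mul_comm]
      gcongr
      set u := W - b
      set u' := W' - c
      have hu : u.im ≤ -ζ.im := by
        have := hb.1
        simp only [u, Complex.sub_im]
        linarith
      have hu' : u'.im ≤ -ζ.im := by
        have := hc.1
        simp only [u', Complex.sub_im]
        linarith
      have hun := le_norm_of_im_le hu
      have hu0 : u ≠ 0 := norm_pos_iff.1 (hζ.trans_le hun)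
      have hue : ‖u‖ₑ ≠ 0 := by simpa using hu0
      have hinv := inv_mem_greenRange hζ hu
      have h1 : ζ.im ≤ ‖u' - u⁻¹‖ := by
        apply le_norm_of_im_le
        have := hinv.1
        rw [Complex.sub_im]
        linarith
      have e : ‖u * u' - 1‖ₑ = ‖u‖ₑ * ‖u' - u⁻¹‖ₑ := by
        rw [← enorm_mul]
        congr 1
        field_simp
      have e2 : (1 + ‖u‖ₑ) * (1 + ‖u'‖ₑ) / ‖u * u' - 1‖ₑ
          = ((1 + ‖u‖ₑ) / ‖u‖ₑ) * ((1 + ‖u'‖ₑ) / ‖u' - u⁻¹‖ₑ) := by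
        rw [e, div_eq_mul_inv, div_eq_mul_inv, div_eq_mul_inv,
          ENNReal.mul_inv (Or.inl hue) (Or.inl enorm_ne_top)]
        ring
      have h2 : 1 + ‖u⁻¹‖ₑ ≤ q := by
        rw [hq, ← ofReal_norm]
        gcongr
        exact hinv.2
      calc _ = ((1 + ‖u‖ₑ) / ‖u‖ₑ) * ((1 + ‖u'‖ₑ) / ‖u' - u⁻¹‖ₑ) := e2
        _ ≤ q * ((1 + ‖u⁻¹‖ₑ) * q) := mul_le_mul' (one_add_le_of_le_enorm hζ hun) (hstep _ _ h1)
        _ ≤ q * (q * q) := by gcongr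
        _ = q ^ 3 := by ring
    calc _ ≤ ∫⁻ W, ∫⁻ W', (q ^ 3) ^ r * ((1 + ‖W - b‖ₑ) ^ (-s) * (1 + ‖W' - c‖ₑ) ^ (-s))
          ∂stepLaw k ν lam ζ ∂stepLaw k ν lam ζ := by
          refine lintegral_mono_ae ?_
          filter_upwards [hbound] with W hW
          exact lintegral_mono_ae hW
      _ = _ := by
          have : ∀ W : ℂ, ∫⁻ W', (q ^ 3) ^ r * ((1 + ‖W - b‖ₑ) ^ (-s) * (1 + ‖W' - c‖ₑ) ^ (-s))
              ∂stepLaw k ν lam ζ = (q ^ 3) ^ r * ((1 + ‖W - b‖ₑ) ^ (-s)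
              * ∫⁻ W', (1 + ‖W' - c‖ₑ) ^ (-s) ∂stepLaw k ν lam ζ) := by
            intro W
            rw [lintegral_const_mul _ (by fun_prop), lintegral_const_mul _ (by fun_prop)]
          simp_rw [this]
          rw [lintegral_const_mul _ (by fun_prop), lintegral_mul_const _ (by fun_prop)]
  · calc _ ≤ ∫⁻ _, (q ^ 3) ^ r ∂greenLaw (k := k) ν lam ζ := by
          refine lintegral_mono_ae ?_
          filter_upwards [greenLaw_mem_greenRange hζ] with γ hγ
          refine le_trans ?_ hqr
          gcongr
          rw [hq, ← ofReal_norm]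
          gcongr
          exact hγ.2
      _ = _ := by simp

/-! ### Estimates uniform in the energy -/

/-- Given all the potentials below the root, Γ is the inverse of λV(0) minus a fixed complex number.
Integrating over V(0) alone bounds the fractional moment uniformly in ζ. -/
theorem lintegral_rootGreen_rpow_le {C : ℝ≥0∞} (hC : LocallyRegular ν lam r C) (hζ : 0 < ζ.im)
    (hr0 : 0 < r) (hr : r ≤ 1) :
    ∫⁻ v, ‖rootGreen lam v ζ‖ₑ ^ r ∂potLaw (k + 1) ν ≤ 3 + C := by
  rw [lintegral_step ν hζ 0 (F := fun g _ => ‖g‖ₑ ^ r) (by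
    simp only [Function.uncurry_def]; fun_prop)]
  calc _ ≤ ∫⁻ _, (3 + C) ∂potLaw (k + 1) ν := by
        refine lintegral_mono fun u => ?_
        rw [lintegral_stepLaw hζ (by fun_prop)]
        calc _ ≤ ∫⁻ _ : Fin k → Vertex (k + 1) → ℝ, (3 + C)
                ∂(Measure.pi fun _ => potLaw (k + 1) ν) := by
              refine lintegral_mono fun p => ?_
              refine le_trans (le_of_eq ?_) (lintegral_rpow_neg_le hC hr0 hr
                (ζ + ∑ j, rootGreen lam (p j) ζ + rootGreen lam u ζ))
              refine lintegral_congr fun v => ?_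
              rw [ENNReal.rpow_neg, ← ENNReal.inv_rpow, ← sub_sub (lam * v : ℂ) (ζ + _)]
              congr 1
              rcases eq_or_ne (lam * v - (ζ + ∑ j, rootGreen lam (p j) ζ) - rootGreen lam u ζ : ℂ) 0
                with h | h
              · exfalso
                have h1 := congrArg Complex.im h
                have h2 : 0 ≤ ∑ j, (rootGreen lam (p j) ζ).im :=
                  Finset.sum_nonneg fun j _ => (im_rootGreen_pos hζ).le
                have h3 := im_rootGreen_pos (lam := lam) (v := u) hζ
                simp only [Complex.sub_im, Complex.add_im, Complex.im_sum] at h1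
                simp at h1
                linarith
              · exact enorm_inv h
          _ = _ := by simp
    _ = _ := by simp

/-- The Green functions of the off-path children are frozen first, and the estimates over the
potentials alone hold uniformly in the frozen value. The resulting constant therefore does not
depend on ζ; only the qualitative finiteness bound does. -/
theorem uniform_chainBounds {C : ℝ≥0∞} (hC : LocallyRegular ν lam r C)
    (hς : ς ∈ Set.Ioo (0 : ℝ) 1) (hν : ∫⁻ v, ‖v‖ₑ ^ ς ∂ν ≠ ∞) (hζ : 0 < ζ.im) (hr0 : 0 < r)
    (hr : r ≤ 1) (hs1 : -ς ≤ s) (hs2 : |s| ≤ r) :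
    ChainBounds (stepLaw k ν lam ζ) (greenLaw (k := k) ν lam ζ) (greenRange ζ.im) s r
      (18 * (4 + 8 * C) + 3) := by
  have := isProbabilityMeasure_stepLaw (k := k) ν (lam := lam) hζ
  have := isProbabilityMeasure_greenLaw (k := k) ν (lam := lam) hζ
  set D : ℝ≥0∞ := 18 * (4 + 8 * C) + 3 with hD
  have hD1 : 4 + 8 * C ≤ D := by
    calc 4 + 8 * C = 1 * (4 + 8 * C) := (one_mul _).symm
      _ ≤ 18 * (4 + 8 * C) := by gcongr; norm_num
      _ ≤ D := le_self_add
  set π := Measure.pi fun _ : Fin k => potLaw (k + 1) ν with hπ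
  set Θ : (Fin k → Vertex (k + 1) → ℝ) → ℂ := fun p => ζ + ∑ j, rootGreen lam (p j) ζ with hΘ
  have hΘm : Measurable Θ := (measurable_sum_rootGreen hζ).const_add _
  have hsub : ∀ (v : ℝ) p b, (lam * v - Θ p - b : ℂ) = lam * v - (Θ p + b) := fun v p b =>
    sub_sub _ _ _
  have hs' : |s| ≤ 1 := hs2.trans hr
  have hwint : ∀ b : ℂ, ∫⁻ W, (1 + ‖W - b‖ₑ) ^ (-s) ∂stepLaw k ν lam ζ
      = ∫⁻ p, ∫⁻ v, (1 + ‖(lam * v - (Θ p + b) : ℂ)‖ₑ) ^ (-s) ∂ν ∂π := by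
    intro b
    rw [lintegral_stepLaw hζ (by fun_prop)]
    simp_rw [← hsub]
    rfl
  have hwm : ∀ b : ℂ, Measurable fun p =>
      ∫⁻ v, (1 + ‖(lam * v - (Θ p + b) : ℂ)‖ₑ) ^ (-s) ∂ν := by
    intro b
    have h1 : Measurable fun q : (Fin k → Vertex (k + 1) → ℝ) × ℝ =>
      (1 + ‖(lam * q.2 - (Θ q.1 + b) : ℂ)‖ₑ) ^ (-s) := by fun_prop
    exact h1.lintegral_prod_right'
  refine ⟨isInvariant_greenRange hζ, greenLaw_mem_greenRange hζ, hr0, hs2, ?_,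
    exists_finite_bound hς hν hζ hs1, ?_, ?_, ?_⟩
  · exact le_trans (by norm_num) (le_self_add.trans hD1 : (4 : ℝ≥0∞) ≤ D)
  · intro b _ c _
    rw [hwint, ← lintegral_const_mul _ (hwm b), lintegral_stepLaw hζ (by fun_prop)]
    refine lintegral_mono fun p => ?_
    refine le_trans (le_of_eq ?_) ((weighted_one_site hC hr0 hr hs' (Θ p + b) c).trans ?_)
    · simp_rw [← hsub]
      rfl
    · gcongr
  · intro b _ c _
    have hG : Measurable fun q : ℂ × ℂ => ((1 + ‖q.1 - b‖ₑ) * (1 + ‖q.2 - c‖ₑ)) ^ (-s) *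
        pairFactor r (q.1 - b) (q.2 - c) := by
      have := measurable_pairFactor (α := ℂ × ℂ) r (f := fun q => q.1 - b) (g := fun q => q.2 - c)
        (by fun_prop) (by fun_prop)
      fun_prop
    calc _ = _ := lintegral_lintegral_stepLaw (k := k) (ν := ν) (lam := lam) hζ hG
      _ ≤ ∫⁻ p, ∫⁻ p', D * ((∫⁻ v, (1 + ‖(lam * v - (Θ p + b) : ℂ)‖ₑ) ^ (-s) ∂ν)
            * ∫⁻ v, (1 + ‖(lam * v - (Θ p' + c) : ℂ)‖ₑ) ^ (-s) ∂ν) ∂π ∂π := by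
          refine lintegral_mono fun p => lintegral_mono fun p' => ?_
          refine le_trans (le_of_eq ?_) (weighted_two_sites hC hr0 hr hs' _ _)
          simp only [← hsub]
          rfl
      _ = _ := by
          rw [hwint, hwint, ← lintegral_mul_const _ (hwm b),
            ← lintegral_const_mul _ ((hwm b).mul_const _)]
          refine lintegral_congr fun p => ?_
          rw [lintegral_const_mul _ ((hwm c).const_mul _), lintegral_const_mul _ (hwm c)]
  · have h1 : ∀ γ : ℂ, (1 + ‖γ‖ₑ) ^ r ≤ 1 + ‖γ‖ₑ ^ r := fun γ => by
      simpa using ENNReal.rpow_add_le_add_rpow 1 ‖γ‖ₑ hr0.le hr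
    calc _ ≤ ∫⁻ γ, (1 + ‖γ‖ₑ ^ r) ∂greenLaw (k := k) ν lam ζ := lintegral_mono h1
      _ = 1 + ∫⁻ v, ‖rootGreen lam v ζ‖ₑ ^ r ∂potLaw (k + 1) ν := by
          rw [lintegral_add_left measurable_const, greenLaw,
            lintegral_map (by fun_prop) (measurable_rootGreen hζ), lintegral_const]
          have := isProbabilityMeasure_greenLaw (k := k) ν (lam := lam) hζ
          rw [greenLaw] at this
          simp [lintegral_map (f := fun γ : ℂ => ‖γ‖ₑ ^ r) (by fun_prop) (measurable_rootGreen hζ)]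
      _ ≤ 1 + (3 + C) := by
          gcongr
          exact lintegral_rootGreen_rpow_le hC hζ hr0 hr
      _ = 4 + 1 * C := by ring
      _ ≤ 4 + 8 * C := by gcongr; norm_num
      _ ≤ D := hD1

end Bounds

/-! ### Almost additive sequences -/

/-- `a (n + m + 1)` agrees with `a n + a m` up to `d`. -/
def AlmostAdditive (a : ℕ → ℝ) (d : ℝ) : Prop := ∀ n m, |a (n + m + 1) - a n - a m| ≤ d

/-- Fekete's lemma applied to a + d bounds a from below by its rate. The same for -a gives the bound
from above. -/
theorem AlmostAdditive.exists_rate {a : ℕ → ℝ} {d : ℝ} (h : AlmostAdditive a d) :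
    ∃ φ : ℝ, ∀ n, |a n - (n + 1) * φ| ≤ d := by
  have hd : 0 ≤ d := (abs_nonneg _).trans (h 0 0)
  -- a subadditive sequence with a linear lower bound stays above its rate
  have key : ∀ b : ℕ → ℝ, AlmostAdditive b d → ∃ φ : ℝ,
      (∀ n, (n + 1) * φ ≤ b n + d) ∧ Tendsto (fun n => b n / (n + 1 : ℝ)) atTop (𝓝 φ) := by
    intro b hb
    -- The index is shifted by one, since a(n) belongs to a path with n+1 factors, and adding d
    -- turns almost additivity into subadditivity.
    let u : ℕ → ℝ := fun n => n.casesOn 0 (fun m => b m) + d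
    have u0 : u 0 = d := by simp [u]
    have us : ∀ n, u (n + 1) = b n + d := fun n => rfl
    have hu : Subadditive u := by
      intro m n
      rcases m with _ | m
      · rw [zero_add, u0]; linarith
      rcases n with _ | n
      · rw [add_zero, u0]; linarith
      rw [show m + 1 + (n + 1) = (m + n + 1) + 1 by ring, us, us, us]
      have := (abs_le.1 (hb m n)).2
      linarith
    have hlow : ∀ n : ℕ, (n + 1) * (b 0 - d) ≤ b n := by
      intro n
      induction n with
      | zero => simp; linarith
      | succ n ih =>
        have := (abs_le.1 (hb n 0)).1
        rw [add_zero] at this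
        push_cast
        linarith
    have hbdd : BddBelow (Set.range fun n => u n / n) := by
      refine ⟨min 0 (b 0 - d), ?_⟩
      rintro _ ⟨n, rfl⟩
      rcases n with _ | n
      · simp
      · refine (min_le_right _ _).trans ?_
        simp only [us]
        rw [le_div_iff₀ (by positivity)]
        have := hlow n
        push_cast
        linarith
    refine ⟨hu.lim, fun n => ?_, ?_⟩
    · have := hu.lim_le_div hbdd (n := n + 1) (by omega)
      rw [us, le_div_iff₀ (by positivity)] at this
      push_cast at this
      linarith
    · have h1 := (hu.tendsto_lim hbdd).comp (tendsto_add_atTop_nat 1)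
      have h2 : Tendsto (fun n : ℕ => d / (n + 1 : ℝ)) atTop (𝓝 0) := by
        have := (tendsto_one_div_add_atTop_nhds_zero_nat (𝕜 := ℝ)).const_mul d
        simpa [div_eq_mul_inv] using this
      have h3 := h1.sub h2
      rw [sub_zero] at h3
      refine h3.congr fun n => ?_
      simp only [Function.comp, us]
      push_cast
      ring
  obtain ⟨φ, h1, h2⟩ := key a h
  obtain ⟨φ', h3, h4⟩ := key (fun n => -a n) (fun n m => by
    have := h n m
    rwa [← abs_neg, show -(-a (n + m + 1) - -a n - -a m) = a (n + m + 1) - a n - a m by ring])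
  have h5 : φ' = -φ := by
    refine tendsto_nhds_unique h4 ?_
    simpa [neg_div] using h2.neg
  refine ⟨φ, fun n => abs_le.2 ⟨?_, ?_⟩⟩
  · have := h1 n
    linarith
  · have := h3 n
    rw [h5] at this
    linarith

/-- The rate of an almost additive sequence. -/
noncomputable def rate (a : ℕ → ℝ) : ℝ := limUnder atTop fun n : ℕ => a n / n

theorem tendsto_div_of_abs_sub_le {a : ℕ → ℝ} {d φ : ℝ} (h : ∀ n, |a n - (n + 1) * φ| ≤ d) :
    Tendsto (fun n : ℕ => a n / n) atTop (𝓝 φ) := by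
  have h2 : Tendsto (fun n : ℕ => (d + |φ|) / (n : ℝ)) atTop (𝓝 0) :=
    tendsto_const_div_atTop_nhds_zero_nat _
  rw [← tendsto_sub_nhds_zero_iff]
  refine squeeze_zero_norm' ?_ h2
  filter_upwards [eventually_gt_atTop 0] with n hn
  have hn' : (0 : ℝ) < n := by exact_mod_cast hn
  rw [Real.norm_eq_abs, show a n / n - φ = (a n - (n + 1) * φ + φ) / n by field_simp; ring,
    abs_div, abs_of_pos hn']
  gcongr
  exact (abs_add_le _ _).trans (by linarith [h n])

theorem AlmostAdditive.abs_sub_rate_le {a : ℕ → ℝ} {d : ℝ} (h : AlmostAdditive a d) (n : ℕ) :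
    |a n - (n + 1) * rate a| ≤ d := by
  obtain ⟨φ, hφ⟩ := h.exists_rate
  have : rate a = φ := (tendsto_div_of_abs_sub_le hφ).limUnder_eq
  rw [this]
  exact hφ n

theorem AlmostAdditive.tendsto_rate {a : ℕ → ℝ} {d : ℝ} (h : AlmostAdditive a d) :
    Tendsto (fun n : ℕ => a n / n) atTop (𝓝 (rate a)) :=
  tendsto_div_of_abs_sub_le h.abs_sub_rate_le

theorem AlmostAdditive.abs_rate_le {a : ℕ → ℝ} {d : ℝ} (h : AlmostAdditive a d) :
    |rate a| ≤ d + |a 0| := by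
  have := h.abs_sub_rate_le 0
  simp only [Nat.cast_zero, zero_add, one_mul] at this
  have h2 := abs_sub_abs_le_abs_sub (rate a) (a 0)
  rw [abs_sub_comm] at h2
  linarith

theorem AlmostAdditive.abs_sub_mul_rate_le {a : ℕ → ℝ} {d : ℝ} (h : AlmostAdditive a d) (n : ℕ) :
    |a n - n * rate a| ≤ 2 * d + |a 0| := by
  have h1 := h.abs_sub_rate_le n
  have h2 := h.abs_rate_le
  calc |a n - n * rate a| = |(a n - (n + 1) * rate a) + rate a| := by ring_nf
    _ ≤ |a n - (n + 1) * rate a| + |rate a| := abs_add_le _ _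
    _ ≤ _ := by linarith

/-! ### Rates of cumulant generating functions -/

section Cgf

open ProbabilityTheory

variable {α : Type*} [MeasurableSpace α] {μ : Measure α} [IsProbabilityMeasure μ]

/-- This is Hölder's inequality, obtained by applying convexity of the exponential to the exponents
normalized by their cumulant generating functions. -/
theorem convexOn_cgf {X : α → ℝ} : ConvexOn ℝ (integrableExpSet X μ) (cgf X μ) := by
  refine ⟨convex_integrableExpSet, fun s hs t ht a b ha hb hab => ?_⟩
  have hst := convex_integrableExpSet hs ht ha hb hab
  simp only [smul_eq_mul] at hst ⊢
  have key : mgf X μ (a * s + b * t) ≤ Real.exp (a * cgf X μ s + b * cgf X μ t) := by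
    have hpt : ∀ ω, Real.exp ((a * s + b * t) * X ω) ≤ Real.exp (a * cgf X μ s + b * cgf X μ t)
        * (a * (Real.exp (s * X ω) / mgf X μ s) + b * (Real.exp (t * X ω) / mgf X μ t)) := by
      intro ω
      have h1 := convexOn_exp.2 (Set.mem_univ (s * X ω - cgf X μ s))
        (Set.mem_univ (t * X ω - cgf X μ t)) ha hb hab
      simp only [smul_eq_mul] at h1
      rw [Real.exp_sub, Real.exp_sub, exp_cgf hs, exp_cgf ht] at h1
      calc Real.exp ((a * s + b * t) * X ω) = Real.exp (a * cgf X μ s + b * cgf X μ t)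
            * Real.exp (a * (s * X ω - cgf X μ s) + b * (t * X ω - cgf X μ t)) := by
            rw [← Real.exp_add]; ring_nf
        _ ≤ _ := by gcongr
    have hi1 : Integrable (fun ω => a * (Real.exp (s * X ω) / mgf X μ s)) μ :=
      (Integrable.div_const hs _).const_mul _
    have hi2 : Integrable (fun ω => b * (Real.exp (t * X ω) / mgf X μ t)) μ :=
      (Integrable.div_const ht _).const_mul _
    calc mgf X μ (a * s + b * t) ≤ ∫ ω, Real.exp (a * cgf X μ s + b * cgf X μ t)
        * (a * (Real.exp (s * X ω) / mgf X μ s) + b * (Real.exp (t * X ω) / mgf X μ t)) ∂μ :=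
          integral_mono hst ((hi1.add hi2).const_mul _) hpt
      _ = Real.exp (a * cgf X μ s + b * cgf X μ t) := by
          rw [integral_const_mul, integral_add hi1 hi2, integral_const_mul, integral_const_mul,
            integral_div, integral_div]
          change _ * (a * (mgf X μ s / mgf X μ s) + b * (mgf X μ t / mgf X μ t)) = _
          rw [div_self (mgf_pos hs).ne', div_self (mgf_pos ht).ne', mul_one, mul_one, hab, mul_one]
  rw [cgf, Real.log_le_iff_le_exp (mgf_pos hst)]
  exact key

theorem hasDerivAt_cgf_zero {X : α → ℝ} (h : 0 ∈ interior (integrableExpSet X μ)) :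
    HasDerivAt (cgf X μ) (∫ ω, X ω ∂μ) 0 := by
  have h1 := hasDerivAt_mgf h
  have h2 : HasDerivAt (cgf X μ) _ 0 := h1.log (by simp)
  simpa using h2

/-- Random variables whose cumulant generating functions are almost additive on `I`. -/
structure IsAlmostAdditive (X : ℕ → α → ℝ) (μ : Measure α) (I : Set ℝ) (d : ℝ → ℝ) (c : ℝ) :
    Prop where
  integrable : ∀ n, I ⊆ integrableExpSet (X n) μ
  convex : Convex ℝ I
  mem_interior : 0 ∈ interior I
  almostAdditive : ∀ s ∈ I, AlmostAdditive (fun n => cgf (X n) μ s) (d s)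
  mean : ∀ n : ℕ, ∫ ω, X n ω ∂μ = (n + 1) * ∫ ω, X 0 ω ∂μ
  le_linear : ∀ᶠ s in 𝓝 0, d s ≤ c * |s|

variable {X : ℕ → α → ℝ} {I : Set ℝ} {d : ℝ → ℝ} {c : ℝ}

/-- The rate of the cumulant generating functions. -/
noncomputable def cgfRate (X : ℕ → α → ℝ) (μ : Measure α) (s : ℝ) : ℝ :=
  rate fun n => cgf (X n) μ s

theorem IsAlmostAdditive.convexOn (h : IsAlmostAdditive X μ I d c) :
    ConvexOn ℝ I (cgfRate X μ) := by
  refine ⟨h.convex, fun s hs t ht a b ha hb hab => ?_⟩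
  have h1 := (h.almostAdditive s hs).tendsto_rate
  have h2 := (h.almostAdditive t ht).tendsto_rate
  have h3 := (h.almostAdditive _ (h.convex hs ht ha hb hab)).tendsto_rate
  refine le_of_tendsto_of_tendsto' h3 ((h1.const_mul a).add (h2.const_mul b)) fun n => ?_
  have h4 := (convexOn_cgf (X := X n) (μ := μ)).2 (h.integrable n hs) (h.integrable n ht) ha hb hab
  simp only [smul_eq_mul] at h4 ⊢
  rw [← mul_div_assoc, ← mul_div_assoc, ← add_div]
  gcongr

theorem IsAlmostAdditive.zero_mem_interior (h : IsAlmostAdditive X μ I d c) (n : ℕ) :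
    0 ∈ interior (integrableExpSet (X n) μ) :=
  interior_mono (h.integrable n) h.mem_interior

theorem IsAlmostAdditive.integrable_zero (h : IsAlmostAdditive X μ I d c) : Integrable (X 0) μ :=
  integrable_of_mem_interior_integrableExpSet (h.zero_mem_interior 0)

theorem IsAlmostAdditive.rate_zero (h : IsAlmostAdditive X μ I d c) : cgfRate X μ 0 = 0 := by
  have h1 := (h.almostAdditive 0 (interior_subset h.mem_interior)).tendsto_rate
  refine tendsto_nhds_unique h1 ?_
  simp

/-- The rate differs from cgf_n(s)/(n+1) by at most c|s|/(n+1), and each of these quotients has the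
same derivative at 0 because the means are exactly additive. For n large the error in the difference
quotient is as small as desired. -/
theorem IsAlmostAdditive.hasDerivAt (h : IsAlmostAdditive X μ I d c) :
    HasDerivAt (cgfRate X μ) (∫ ω, X 0 ω ∂μ) 0 := by
  set ℓ := ∫ ω, X 0 ω ∂μ with hℓ
  have hc : 0 ≤ c := by
    have h1 : ∀ᶠ s in 𝓝[≠] (0 : ℝ), d s ≤ c * |s| := h.le_linear.filter_mono nhdsWithin_le_nhds
    have h2 : ∀ᶠ s in 𝓝[≠] (0 : ℝ), s ∈ I :=
      (mem_interior_iff_mem_nhds.1 h.mem_interior |> mem_nhdsWithin_of_mem_nhds)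
    obtain ⟨s, ⟨hs1, hs2⟩, hs3⟩ := ((h1.and h2).and self_mem_nhdsWithin).exists
    have h3 : 0 ≤ d s := (abs_nonneg _).trans ((h.almostAdditive s hs2) 0 0)
    have h4 : 0 < |s| := abs_pos.2 hs3
    by_contra hcon
    nlinarith
  rw [hasDerivAt_iff_isLittleO_nhds_zero, Asymptotics.isLittleO_iff]
  intro ε hε
  -- Half of ε is spent on the defect c/(n+1), the other half on the differentiability of the n-th
  -- function.
  obtain ⟨n, hn⟩ := exists_nat_gt (2 * c / ε)
  have hn1 : (0 : ℝ) < n + 1 := by positivity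
  have hcn : c / (n + 1) ≤ ε / 2 := by
    rw [div_le_iff₀ hn1]
    rw [div_lt_iff₀ hε] at hn
    nlinarith
  have hder := hasDerivAt_cgf_zero (h.zero_mem_interior n)
  rw [h.mean n, hasDerivAt_iff_isLittleO_nhds_zero, Asymptotics.isLittleO_iff] at hder
  have hder' := hder (half_pos (mul_pos hε hn1))
  filter_upwards [hder', h.le_linear, mem_interior_iff_mem_nhds.1 h.mem_interior] with s h1 h2 h3
  simp only [zero_add, cgf_zero, sub_zero, smul_eq_mul, Real.norm_eq_abs, h.rate_zero] at h1 ⊢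
  have h4 := (h.almostAdditive s h3).abs_sub_rate_le n
  change |cgf (X n) μ s - (n + 1) * cgfRate X μ s| ≤ d s at h4
  have h5 : (n + 1) * |cgfRate X μ s - s * ℓ| ≤ (n + 1) * (ε * |s|) := by
    calc (n + 1) * |cgfRate X μ s - s * ℓ| = |(n + 1) * (cgfRate X μ s - s * ℓ)| := by
          rw [abs_mul, abs_of_pos hn1]
      _ = |(cgf (X n) μ s - s * ((n + 1) * ℓ)) - (cgf (X n) μ s - (n + 1) * cgfRate X μ s)| := by
          ring_nf
      _ ≤ |cgf (X n) μ s - s * ((n + 1) * ℓ)| + |cgf (X n) μ s - (n + 1) * cgfRate X μ s| :=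
          abs_sub _ _
      _ ≤ ε * (n + 1) / 2 * |s| + c * |s| := add_le_add h1 (h4.trans h2)
      _ ≤ (n + 1) * (ε * |s|) := by
          rw [div_le_iff₀ hn1] at hcn
          nlinarith [abs_nonneg s]
  exact le_of_mul_le_mul_left h5 hn1

theorem IsAlmostAdditive.tendsto_cgfRate (h : IsAlmostAdditive X μ I d c) {s : ℝ} (hs : s ∈ I) :
    Tendsto (fun n : ℕ => cgf (X n) μ s / n) atTop (𝓝 (cgfRate X μ s)) :=
  (h.almostAdditive s hs).tendsto_rate

/-- The rate is non-increasing if the variables are bounded above. -/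
theorem IsAlmostAdditive.antitoneOn (h : IsAlmostAdditive X μ I d c) {B : ℝ}
    (hB : ∀ n, ∀ᵐ ω ∂μ, X n ω ≤ B) : AntitoneOn (cgfRate X μ) I := by
  intro s hs t ht hst
  have h0 : Tendsto (fun n : ℕ => (t - s) * B / n) atTop (𝓝 0) :=
    tendsto_const_div_atTop_nhds_zero_nat _
  have h1 := (h.tendsto_cgfRate hs).add h0
  rw [add_zero] at h1
  refine le_of_tendsto_of_tendsto' (h.tendsto_cgfRate ht) h1 fun n => ?_
  rw [← add_div]
  gcongr
  rw [cgf, Real.log_le_iff_le_exp (mgf_pos (h.integrable n ht)), Real.exp_add,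
    exp_cgf (h.integrable n hs), mgf, mgf, ← integral_mul_const]
  refine integral_mono_ae (h.integrable n ht) (Integrable.mul_const (h.integrable n hs) _) ?_
  filter_upwards [hB n] with ω hω
  rw [← Real.exp_add, Real.exp_le_exp]
  nlinarith

/-- A convex function lies above its tangent at 0. -/
theorem IsAlmostAdditive.mul_le_rate (h : IsAlmostAdditive X μ I d c) {s : ℝ} (hs0 : 0 ≤ s)
    (hs : s ∈ I) : s * ∫ ω, X 0 ω ∂μ ≤ cgfRate X μ s := by
  rcases hs0.eq_or_lt with rfl | hs0
  · rw [zero_mul, h.rate_zero]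
  have h0 := interior_subset h.mem_interior
  have h1 := h.convexOn.le_slope_of_hasDerivAt h0 hs hs0 h.hasDerivAt
  rw [slope_def_field, h.rate_zero, sub_zero, sub_zero, le_div_iff₀ hs0] at h1
  linarith

end Cgf

/-! ### Moments as moment generating functions -/

section Moments

open ProbabilityTheory

variable {α : Type*} [MeasurableSpace α] {μ : Measure α}

theorem enorm_rpow_eq_ofReal_exp {z : ℂ} (hz : z ≠ 0) (s : ℝ) :
    ‖z‖ₑ ^ s = ENNReal.ofReal (Real.exp (s * Real.log ‖z‖)) := by
  have h := norm_pos_iff.2 hz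
  rw [← ofReal_norm, ENNReal.ofReal_rpow_of_pos h, Real.rpow_def_of_pos h, mul_comm]

theorem lintegral_enorm_rpow_eq {f : α → ℂ} (h0 : ∀ᵐ ω ∂μ, f ω ≠ 0) (s : ℝ) :
    ∫⁻ ω, ‖f ω‖ₑ ^ s ∂μ = ∫⁻ ω, ENNReal.ofReal (Real.exp (s * Real.log ‖f ω‖)) ∂μ := by
  refine lintegral_congr_ae ?_
  filter_upwards [h0] with ω hω
  exact enorm_rpow_eq_ofReal_exp hω s

theorem mem_integrableExpSet_of_lintegral {f : α → ℂ} (hf : AEMeasurable f μ)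
    (h0 : ∀ᵐ ω ∂μ, f ω ≠ 0) {s : ℝ} (h : ∫⁻ ω, ‖f ω‖ₑ ^ s ∂μ ≠ ∞) :
    s ∈ integrableExpSet (fun ω => Real.log ‖f ω‖) μ := by
  refine ⟨?_, ?_⟩
  · exact (Real.measurable_exp.comp_aemeasurable
      ((Real.measurable_log.comp_aemeasurable hf.norm).const_mul s)).aestronglyMeasurable
  · rw [hasFiniteIntegral_iff_ofReal (Eventually.of_forall fun ω => (Real.exp_pos _).le),
      ← lintegral_enorm_rpow_eq h0]
    exact h.lt_top

theorem lintegral_eq_ofReal_exp_cgf [NeZero μ] {f : α → ℂ} (hf : AEMeasurable f μ)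
    (h0 : ∀ᵐ ω ∂μ, f ω ≠ 0) {s : ℝ} (h : ∫⁻ ω, ‖f ω‖ₑ ^ s ∂μ ≠ ∞) :
    ∫⁻ ω, ‖f ω‖ₑ ^ s ∂μ
      = ENNReal.ofReal (Real.exp (cgf (fun ω => Real.log ‖f ω‖) μ s)) := by
  have hi := mem_integrableExpSet_of_lintegral hf h0 h
  rw [exp_cgf hi, mgf, lintegral_enorm_rpow_eq h0,
    ofReal_integral_eq_lintegral_ofReal hi (Eventually.of_forall fun ω => (Real.exp_pos _).le)]

theorem log_toReal_lintegral [NeZero μ] {f : α → ℂ} (hf : AEMeasurable f μ)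
    (h0 : ∀ᵐ ω ∂μ, f ω ≠ 0) {s : ℝ} (h : ∫⁻ ω, ‖f ω‖ₑ ^ s ∂μ ≠ ∞) :
    Real.log (∫⁻ ω, ‖f ω‖ₑ ^ s ∂μ).toReal = cgf (fun ω => Real.log ‖f ω‖) μ s := by
  rw [lintegral_eq_ofReal_exp_cgf hf h0 h, ENNReal.toReal_ofReal (Real.exp_pos _).le,
    Real.log_exp]

/-- The exponent at which a moment of order `s` is controlled. -/
noncomputable def orderBound (s : ℝ) : ℝ := max (1 / 2) |s|

theorem orderBound_pos (s : ℝ) : 0 < orderBound s := lt_max_of_lt_left (by norm_num)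

theorem abs_le_orderBound (s : ℝ) : |s| ≤ orderBound s := le_max_right _ _

/-- Quasi-multiplicativity of the moments of `f n`, with constants `B`. -/
def QuasiMul (f : ℕ → α → ℂ) (μ : Measure α) (B : ℝ → ℝ≥0∞) (s : ℝ) : Prop :=
  ∀ n m, ∫⁻ ω, ‖f (n + m + 1) ω‖ₑ ^ s ∂μ ≤ B (orderBound s) ^ (|s| / orderBound s)
      * ((∫⁻ ω, ‖f n ω‖ₑ ^ s ∂μ) * ∫⁻ ω, ‖f m ω‖ₑ ^ s ∂μ) ∧
    (∫⁻ ω, ‖f n ω‖ₑ ^ s ∂μ) * ∫⁻ ω, ‖f m ω‖ₑ ^ s ∂μ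
      ≤ B (orderBound s) ^ (|s| / orderBound s) * ∫⁻ ω, ‖f (n + m + 1) ω‖ₑ ^ s ∂μ

/-- The defect of additivity of the logarithms of the moments. -/
noncomputable def defect (B : ℝ → ℝ≥0∞) (s : ℝ) : ℝ :=
  |s| / orderBound s * Real.log (B (orderBound s)).toReal

theorem rpow_eq_ofReal_exp_defect {B : ℝ → ℝ≥0∞} {s : ℝ} (h1 : 1 ≤ B (orderBound s))
    (h2 : B (orderBound s) ≠ ∞) :
    B (orderBound s) ^ (|s| / orderBound s) = ENNReal.ofReal (Real.exp (defect B s)) := by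
  have h3 : 0 < (B (orderBound s)).toReal :=
    ENNReal.toReal_pos (zero_lt_one.trans_le h1).ne' h2
  conv_lhs => rw [← ENNReal.ofReal_toReal h2]
  rw [ENNReal.ofReal_rpow_of_pos h3, Real.rpow_def_of_pos h3, defect, mul_comm]

/-- Taking logarithms turns the multiplicative bounds into additive ones. The measure-preserving
shift T splits off one factor of the path at a time, which makes the means of the logarithms exactly
additive. -/
theorem isAlmostAdditive_of_quasiMul [IsProbabilityMeasure μ] {f : ℕ → α → ℂ} {I : Set ℝ}
    {B : ℝ → ℝ≥0∞} (hf : ∀ n, AEMeasurable (f n) μ) (h0 : ∀ n, ∀ᵐ ω ∂μ, f n ω ≠ 0)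
    (hI : Convex ℝ I) (hI0 : 0 ∈ interior I)
    (hfin : ∀ s ∈ I, ∀ n, ∫⁻ ω, ‖f n ω‖ₑ ^ s ∂μ ≠ ∞)
    (hB1 : ∀ r, 1 ≤ B r) (hB2 : ∀ r, B r ≠ ∞) (hQ : ∀ s ∈ I, QuasiMul f μ B s) {T : α → α}
    (hT : MeasurePreserving T μ μ) (hfT : ∀ n, ∀ᵐ ω ∂μ, ‖f (n + 1) ω‖ = ‖f 0 ω‖ * ‖f n (T ω)‖) :
    IsAlmostAdditive (fun n ω => Real.log ‖f n ω‖) μ I (defect B)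
      (2 * Real.log (B (1 / 2)).toReal) := by
  have hint : ∀ n, I ⊆ integrableExpSet (fun ω => Real.log ‖f n ω‖) μ := fun n s hs =>
    mem_integrableExpSet_of_lintegral (hf n) (h0 n) (hfin s hs n)
  have hint0 : ∀ n, Integrable (fun ω => Real.log ‖f n ω‖) μ := fun n =>
    integrable_of_mem_interior_integrableExpSet (interior_mono (hint n) hI0)
  refine ⟨hint, hI, hI0, fun s hs n m => ?_, fun n => ?_, ?_⟩
  · obtain ⟨h1, h2⟩ := hQ s hs n m
    rw [lintegral_eq_ofReal_exp_cgf (hf _) (h0 _) (hfin s hs _),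
      lintegral_eq_ofReal_exp_cgf (hf n) (h0 n) (hfin s hs n),
      lintegral_eq_ofReal_exp_cgf (hf m) (h0 m) (hfin s hs m),
      rpow_eq_ofReal_exp_defect (hB1 _) (hB2 _), ← ENNReal.ofReal_mul (Real.exp_pos _).le,
      ← ENNReal.ofReal_mul (Real.exp_pos _).le, ← Real.exp_add, ← Real.exp_add,
      ENNReal.ofReal_le_ofReal_iff (Real.exp_pos _).le, Real.exp_le_exp] at h1
    rw [lintegral_eq_ofReal_exp_cgf (hf (n + m + 1)) (h0 _) (hfin s hs _),
      lintegral_eq_ofReal_exp_cgf (hf n) (h0 n) (hfin s hs n),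
      lintegral_eq_ofReal_exp_cgf (hf m) (h0 m) (hfin s hs m),
      rpow_eq_ofReal_exp_defect (hB1 _) (hB2 _), ← ENNReal.ofReal_mul (Real.exp_pos _).le,
      ← ENNReal.ofReal_mul (Real.exp_pos _).le, ← Real.exp_add, ← Real.exp_add,
      ENNReal.ofReal_le_ofReal_iff (Real.exp_pos _).le, Real.exp_le_exp] at h2
    rw [abs_le]
    constructor <;> linarith
  · induction n with
    | zero => simp
    | succ n ih =>
      have e : ∫ ω, Real.log ‖f (n + 1) ω‖ ∂μ
          = ∫ ω, (Real.log ‖f 0 ω‖ + Real.log ‖f n (T ω)‖) ∂μ := by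
        refine integral_congr_ae ?_
        filter_upwards [hfT n, h0 0, hT.quasiMeasurePreserving.ae (h0 n)] with ω h1 h2 h3
        rw [h1, Real.log_mul (norm_ne_zero_iff.2 h2) (norm_ne_zero_iff.2 h3)]
      have hi : Integrable (fun ω => Real.log ‖f n (T ω)‖) μ :=
        hT.integrable_comp_of_integrable (hint0 n)
      have e2 : ∫ ω, Real.log ‖f n (T ω)‖ ∂μ = ∫ ω, Real.log ‖f n ω‖ ∂μ := by
        have h1 := integral_map (μ := μ) hT.measurable.aemeasurable
          (f := fun ω => Real.log ‖f n ω‖) (by rw [hT.map_eq]; exact (hint0 n).1)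
        rw [hT.map_eq] at h1
        exact h1.symm
      rw [e, integral_add (hint0 0) hi, e2, ih]
      push_cast
      ring
  -- Near 0 the controlling exponent is constantly 1/2, so the defect is exactly linear in |s|.
  · have : ∀ᶠ s : ℝ in 𝓝 0, |s| < 1 / 2 := by
      have : Tendsto (fun s : ℝ => |s|) (𝓝 0) (𝓝 0) := by
        simpa using (continuous_abs (G := ℝ)).tendsto 0
      exact this.eventually_lt_const (by norm_num)
    filter_upwards [this] with s hs
    rw [defect, orderBound, max_eq_left hs.le]
    refine le_of_eq ?_
    ring

end Moments

/-! ### Vanishing disorder -/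

section Free

variable {K : ℕ} {ζ : ℂ}

theorem ham_zero_eq (v v' : Vertex K → ℝ) : ham 0 v = ham 0 v' := by
  have h : ∀ ψ : Vertex K → ℂ, hamFun 0 v ψ = hamFun 0 v' ψ := fun ψ => by
    funext x
    simp [hamFun]
  refine LinearPMap.ext ?_ ?_
  · ext ψ
    change Memℓp (hamFun 0 v ψ) 2 ↔ Memℓp (hamFun 0 v' ψ) 2
    rw [h]
  · intro ψ h1 h2
    apply lp.ext
    exact h ψ

theorem resolventKernel_zero_eq (v v' : Vertex K → ℝ) (x y : Vertex K) :
    resolventKernel 0 v ζ x y = resolventKernel 0 v' ζ x y := by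
  rw [resolventKernel, resolventKernel, ham_zero_eq v v']

theorem rootGreen_zero_eq (v v' : Vertex K → ℝ) : rootGreen 0 v ζ = rootGreen 0 v' ζ :=
  resolventKernel_zero_eq v v' _ _

theorem norm_resolventKernel_zero (hζ : 0 < ζ.im) (v : Vertex K → ℝ) (x : Vertex K) :
    ‖resolventKernel 0 v ζ (root K) x‖ = ‖rootGreen 0 v ζ‖ ^ (x.length + 1) := by
  induction x using List.reverseRecOn with
  | nil => simp [rootGreen]
  | append_singleton y i ih =>
    rw [resolventKernel_root_append hζ, norm_mul, norm_neg, resolventKernel_zero_eq _ v, ih]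
    simp only [List.length_append, List.length_singleton]
    ring

/-- Without disorder all subtrees have the same Green function g, and -ζ - Kg = 1/g. Comparing
imaginary parts gives (Im ζ + K Im g)|g|² = Im g, which is impossible for |g| > 1. -/
theorem norm_rootGreen_zero_le_one (hK : 0 < K) (hζ : 0 < ζ.im) (v : Vertex K → ℝ) :
    ‖rootGreen 0 v ζ‖ ≤ 1 := by
  set g := rootGreen 0 v ζ with hg
  have h1 : g * (-ζ - K * g) = 1 := by
    have := rootGreen_mul (lam := 0) (v := v) hζ
    simp_rw [rootGreen_zero_eq (shiftPot v _) v] at this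
    simpa [← hg] using this
  have h0 : g ≠ 0 := left_ne_zero_of_mul_eq_one h1
  have him : 0 < g.im := im_rootGreen_pos hζ
  have h2 : -ζ - K * g = g⁻¹ := eq_inv_of_mul_eq_one_right h1
  have h3 := congrArg Complex.im h2
  rw [Complex.inv_im] at h3
  simp only [Complex.sub_im, Complex.neg_im, Complex.mul_im, Complex.natCast_re,
    Complex.natCast_im, zero_mul, add_zero] at h3
  have hn : 0 < Complex.normSq g := Complex.normSq_pos.2 h0
  rw [eq_div_iff hn.ne'] at h3
  have hK1 : (1 : ℝ) ≤ K := by exact_mod_cast hK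
  have h4 : Complex.normSq g ≤ 1 := by
    by_contra hcon
    push Not at hcon
    have : g.im < K * g.im * Complex.normSq g := by
      calc g.im = 1 * g.im * 1 := by ring
        _ < 1 * g.im * Complex.normSq g := by gcongr
        _ ≤ K * g.im * Complex.normSq g := by gcongr
    nlinarith [mul_pos hζ hn]
  rw [Complex.normSq_eq_norm_sq] at h4
  exact (sq_le_one_iff₀ (norm_nonneg _)).1 h4

end Free

/-! ### Bounds uniform in the energy -/

section Uniform

variable {k : ℕ} {ν : Measure ℝ} [IsProbabilityMeasure ν] {lam ς : ℝ}

/-- The vertex of level `n` on the leftmost branch. -/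
abbrev branch (k n : ℕ) : Vertex (k + 1) := List.replicate n 0

/-- The kernel from the root to level `n` of the leftmost branch. -/
noncomputable def branchKernel (k : ℕ) (lam : ℝ) (ζ : ℂ) (n : ℕ) (v : Vertex (k + 1) → ℝ) : ℂ :=
  resolventKernel lam v ζ (root (k + 1)) (branch k n)

theorem lintegral_branchKernel {ζ : ℂ} (hζ : 0 < ζ.im) (s : ℝ) (n : ℕ) :
    ∫⁻ v, ‖branchKernel k lam ζ n v‖ₑ ^ s ∂potLaw (k + 1) ν
      = chainMoment (stepLaw k ν lam ζ) (greenLaw (k := k) ν lam ζ) s n := by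
  rw [← List.length_replicate (n := n) (a := (0 : Fin (k + 1)))]
  simp only [branchKernel, lintegral_resolventKernel_rpow ν hζ, List.length_replicate]

theorem branchKernel_succ {ζ : ℂ} (hζ : 0 < ζ.im) (n : ℕ) (v : Vertex (k + 1) → ℝ) :
    branchKernel k lam ζ (n + 1) v = -rootGreen lam v ζ * branchKernel k lam ζ n (shiftPot v 0) := by
  rw [branchKernel, branchKernel, branch, List.replicate_succ', resolventKernel_root_append hζ]

theorem branchKernel_zero {ζ : ℂ} (v : Vertex (k + 1) → ℝ) :
    branchKernel k lam ζ 0 v = rootGreen lam v ζ := rfl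

theorem measurable_branchKernel {ζ : ℂ} (hζ : 0 < ζ.im) (n : ℕ) :
    Measurable (branchKernel k lam ζ n) := measurable_resolventKernel hζ _ _

theorem branchKernel_ne_zero {ζ : ℂ} (hζ : 0 < ζ.im) (n : ℕ) (v : Vertex (k + 1) → ℝ) :
    branchKernel k lam ζ n v ≠ 0 := by
  induction n generalizing v with
  | zero => exact rootGreen_ne_zero hζ
  | succ n ih =>
    rw [branchKernel_succ hζ]
    exact mul_ne_zero (neg_ne_zero.2 (rootGreen_ne_zero hζ)) (ih _)

/-- Moment bounds of order below one, uniform in the energy. -/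
structure UniformBounds (k : ℕ) (ν : Measure ℝ) (lam ς : ℝ) (B : ℝ → ℝ≥0∞) : Prop where
  one_le : ∀ r, 1 ≤ B r
  ne_top : ∀ r, B r ≠ ∞
  moment_le : ∀ r ∈ Set.Ioo (0 : ℝ) 1, ∀ ζ : ℂ, 0 < ζ.im →
    ∫⁻ v, ‖rootGreen lam v ζ‖ₑ ^ r ∂potLaw (k + 1) ν ≤ B r
  quasiMul : ∀ s ∈ Set.Ico (-ς) 1, ∀ ζ : ℂ, 0 < ζ.im →
    QuasiMul (branchKernel k lam ζ) (potLaw (k + 1) ν) B s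

theorem orderBound_lt_one (hς : ς ∈ Set.Ioo (0 : ℝ) 1) {s : ℝ} (hs : s ∈ Set.Ico (-ς) 1) :
    orderBound s < 1 :=
  max_lt (by norm_num) (abs_lt.2 ⟨by linarith [hs.1, hς.2], hs.2⟩)

theorem exists_uniformBounds_of_locallyRegular (hς : ς ∈ Set.Ioo (0 : ℝ) 1)
    (hν : ∫⁻ v, ‖v‖ₑ ^ ς ∂ν ≠ ∞)
    (hreg : ∀ r, 0 ≤ r → r < 1 → ∃ C : ℝ≥0∞, C ≠ ∞ ∧ LocallyRegular ν lam r C) :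
    ∃ B, UniformBounds k ν lam ς B := by
  have : ∀ r, ∃ C : ℝ≥0∞, C ≠ ∞ ∧ (0 ≤ r → r < 1 → LocallyRegular ν lam r C) := by
    intro r
    by_cases h : 0 ≤ r ∧ r < 1
    · obtain ⟨C, h1, h2⟩ := hreg r h.1 h.2
      exact ⟨C, h1, fun _ _ => h2⟩
    · exact ⟨0, by simp, fun h1 h2 => absurd ⟨h1, h2⟩ h⟩
  choose C hC1 hC2 using this
  have hle : ∀ r, 3 + C r ≤ 18 * (4 + 8 * C r) + 3 := by
    intro r
    calc 3 + C r = C r + 3 := add_comm _ _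
      _ ≤ 18 * (4 + 8 * C r) + 3 := by
        gcongr
        calc C r ≤ 144 * C r := le_mul_of_one_le_left' (by norm_num)
          _ ≤ 72 + 144 * C r := le_add_self
          _ = _ := by ring
  have h1 : ∀ r, 1 ≤ 18 * (4 + 8 * C r) + 3 := fun r =>
    le_trans (by norm_num) (le_add_self : (3 : ℝ≥0∞) ≤ _)
  -- The fourth power is the constant produced by quasi-multiplicativity.
  refine ⟨fun r => (18 * (4 + 8 * C r) + 3) ^ 4, fun r => one_le_pow₀ (h1 r), fun r => ?_, ?_, ?_⟩
  · have := hC1 r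
    finiteness
  · intro r hr ζ hζ
    refine (lintegral_rootGreen_rpow_le (hC2 r hr.1.le hr.2) hζ hr.1 hr.2.le).trans ?_
    exact (hle r).trans (le_self_pow₀ (h1 r) (by norm_num))
  · intro s hs ζ hζ n m
    have := isProbabilityMeasure_stepLaw (k := k) ν (lam := lam) hζ
    have := isProbabilityMeasure_greenLaw (k := k) ν (lam := lam) hζ
    have hr := orderBound_lt_one hς hs
    have h := uniform_chainBounds (k := k) (hC2 _ (orderBound_pos s).le hr) hς hν hζ
      (orderBound_pos s) hr.le hs.1 (abs_le_orderBound s)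
    simp only [lintegral_branchKernel hζ]
    exact h.quasi_mul n m

/-- At λ = 0 the modulus |G(0,x)| is deterministic and equals |g|^(|x|+1), so the moments are
exactly multiplicative. This case is separate because local regularity requires λ > 0. -/
theorem exists_uniformBounds_zero : ∃ B, UniformBounds k ν 0 ς B := by
  have hpow : ∀ ζ : ℂ, 0 < ζ.im → ∀ (s : ℝ) n,
      ∫⁻ v, ‖branchKernel k 0 ζ n v‖ₑ ^ s ∂potLaw (k + 1) ν
        = (‖rootGreen 0 (0 : Vertex (k + 1) → ℝ) ζ‖ₑ ^ s) ^ (n + 1) := by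
    intro ζ hζ s n
    have : ∀ v, ‖branchKernel k 0 ζ n v‖ₑ ^ s
        = (‖rootGreen 0 (0 : Vertex (k + 1) → ℝ) ζ‖ₑ ^ s) ^ (n + 1) := by
      intro v
      rw [branchKernel, ← ofReal_norm, norm_resolventKernel_zero hζ, List.length_replicate,
        rootGreen_zero_eq v 0, ENNReal.ofReal_pow (norm_nonneg _), ofReal_norm,
        ← ENNReal.rpow_natCast, ← ENNReal.rpow_natCast, ← ENNReal.rpow_mul, ← ENNReal.rpow_mul,
        mul_comm]
    simp [this]
  refine ⟨fun _ => 1, fun _ => le_rfl, fun _ => by simp, ?_, ?_⟩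
  · intro r hr ζ hζ
    calc _ ≤ ∫⁻ _, 1 ∂potLaw (k + 1) ν := by
          refine lintegral_mono fun v => ENNReal.rpow_le_one ?_ hr.1.le
          rw [← ofReal_norm, ENNReal.ofReal_le_one]
          exact norm_rootGreen_zero_le_one (by omega) hζ v
      _ = 1 := by simp
  · intro s _ ζ hζ n m
    simp only [hpow ζ hζ, ENNReal.one_rpow, one_mul]
    constructor <;> refine le_of_eq ?_ <;> ring

end Uniform

/-! ### Energies in the upper half-plane -/

section UpperHalfPlane

open ProbabilityTheory

variable {k : ℕ} {ν : Measure ℝ} [IsProbabilityMeasure ν] {lam ς : ℝ} {ζ : ℂ}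

theorem measurePreserving_shiftPot (i : Fin (k + 1)) :
    MeasurePreserving (fun v => shiftPot v i) (potLaw (k + 1) ν) (potLaw (k + 1) ν) :=
  ⟨measurable_shiftPot i, map_shiftPot ν i⟩

theorem lintegral_branchKernel_ne_top (hς : ς ∈ Set.Ioo (0 : ℝ) 1) (hν : ∫⁻ v, ‖v‖ₑ ^ ς ∂ν ≠ ∞)
    (hζ : 0 < ζ.im) {s : ℝ} (hs : -ς ≤ s) (n : ℕ) :
    ∫⁻ v, ‖branchKernel k lam ζ n v‖ₑ ^ s ∂potLaw (k + 1) ν ≠ ∞ := by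
  have := isProbabilityMeasure_stepLaw (k := k) ν (lam := lam) hζ
  have := isProbabilityMeasure_greenLaw (k := k) ν (lam := lam) hζ
  obtain ⟨C, _, hC⟩ := exists_chainBounds (k := k) (lam := lam) hς hν hζ (orderBound_pos s)
  rw [lintegral_branchKernel hζ]
  exact (hC s hs (abs_le_orderBound s)).chainMoment_ne_top n

/-- Away from the real axis the order s may be arbitrarily large, at the price of constants
depending on ζ. This is what gives access to s = 2. -/
theorem exists_quasiMul (hς : ς ∈ Set.Ioo (0 : ℝ) 1) (hν : ∫⁻ v, ‖v‖ₑ ^ ς ∂ν ≠ ∞)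
    (hζ : 0 < ζ.im) : ∃ B : ℝ → ℝ≥0∞, (∀ r, 1 ≤ B r) ∧ (∀ r, B r ≠ ∞) ∧
      ∀ s ∈ Set.Ici (-ς), QuasiMul (branchKernel k lam ζ) (potLaw (k + 1) ν) B s := by
  have := isProbabilityMeasure_stepLaw (k := k) ν (lam := lam) hζ
  have := isProbabilityMeasure_greenLaw (k := k) ν (lam := lam) hζ
  have : ∀ r, ∃ C : ℝ≥0∞, C ≠ ∞ ∧ (0 < r → ∀ s, -ς ≤ s → |s| ≤ r →
      ChainBounds (stepLaw k ν lam ζ) (greenLaw (k := k) ν lam ζ) (greenRange ζ.im) s r C) := by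
    intro r
    by_cases h : 0 < r
    · obtain ⟨C, h1, h2⟩ := exists_chainBounds (k := k) (lam := lam) hς hν hζ h
      exact ⟨C, h1, fun _ => h2⟩
    · exact ⟨1, by simp, fun h' => absurd h' h⟩
  choose C hC1 hC2 using this
  refine ⟨fun r => max 1 (C r ^ 4), fun r => le_max_left _ _, fun r => ?_, fun s hs n m => ?_⟩
  · have := hC1 r
    exact (max_lt (by simp) (by finiteness)).ne
  · have h := (hC2 _ (orderBound_pos s) s hs (abs_le_orderBound s)).quasi_mul n m
    simp only [lintegral_branchKernel hζ]
    have hle : (C (orderBound s) ^ 4) ^ (|s| / orderBound s)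
        ≤ (max 1 (C (orderBound s) ^ 4)) ^ (|s| / orderBound s) :=
      ENNReal.rpow_le_rpow (le_max_right _ _) (div_nonneg (abs_nonneg _) (orderBound_pos s).le)
    exact ⟨h.1.trans (by gcongr), h.2.trans (by gcongr)⟩

theorem isAlmostAdditive_branchKernel (hς : ς ∈ Set.Ioo (0 : ℝ) 1)
    (hν : ∫⁻ v, ‖v‖ₑ ^ ς ∂ν ≠ ∞) (hζ : 0 < ζ.im) {B : ℝ → ℝ≥0∞} (hB1 : ∀ r, 1 ≤ B r)
    (hB2 : ∀ r, B r ≠ ∞) {I : Set ℝ} (hI : Convex ℝ I) (hI0 : 0 ∈ interior I)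
    (hIς : I ⊆ Set.Ici (-ς))
    (hQ : ∀ s ∈ I, QuasiMul (branchKernel k lam ζ) (potLaw (k + 1) ν) B s) :
    IsAlmostAdditive (fun n v => Real.log ‖branchKernel k lam ζ n v‖) (potLaw (k + 1) ν) I
      (defect B) (2 * Real.log (B (1 / 2)).toReal) := by
  refine isAlmostAdditive_of_quasiMul (fun n => (measurable_branchKernel hζ n).aemeasurable)
    (fun n => Eventually.of_forall (branchKernel_ne_zero hζ n)) hI hI0
    (fun s hs n => lintegral_branchKernel_ne_top hς hν hζ (hIς hs) n) hB1 hB2 hQ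
    (measurePreserving_shiftPot 0) fun n => Eventually.of_forall fun v => ?_
  rw [branchKernel_succ hζ, norm_mul, norm_neg, branchKernel_zero]

/-- The kernel is at most 1/Im ζ at every length, so its logarithm has an upper bound independent of
n, which disappears after division by n. -/
theorem antitoneOn_cgfRate_branchKernel (hζ : 0 < ζ.im) {I : Set ℝ} {d : ℝ → ℝ} {c : ℝ}
    (h : IsAlmostAdditive (fun n v => Real.log ‖branchKernel k lam ζ n v‖) (potLaw (k + 1) ν) I
      d c) :
    AntitoneOn (cgfRate (fun n v => Real.log ‖branchKernel k lam ζ n v‖) (potLaw (k + 1) ν)) I :=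
  h.antitoneOn (B := Real.log (ζ.im)⁻¹) fun n => Eventually.of_forall fun v =>
    Real.log_le_log (norm_pos_iff.2 (branchKernel_ne_zero hζ n v)) (norm_resolventKernel_le hζ _ _)

/-- All K^n vertices of level n have the same second moment, and the sum of |G(0,x)|² over them is
at most the squared ℓ² norm. -/
theorem pow_mul_lintegral_branchKernel_sq_le (hζ : 0 < ζ.im) (n : ℕ) :
    (k + 1 : ℝ≥0∞) ^ n * ∫⁻ v, ‖branchKernel k lam ζ n v‖ₑ ^ (2 : ℝ) ∂potLaw (k + 1) ν
      ≤ ENNReal.ofReal ((ζ.im)⁻¹ ^ 2) := by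
  classical
  have e : ∀ x : Vertex (k + 1), x.length = n →
      ∫⁻ v, ‖branchKernel k lam ζ n v‖ₑ ^ (2 : ℝ) ∂potLaw (k + 1) ν
        = ∫⁻ v, ‖resolventKernel lam v ζ (root (k + 1)) x‖ₑ ^ (2 : ℝ) ∂potLaw (k + 1) ν := by
    intro x hx
    rw [lintegral_branchKernel hζ, lintegral_resolventKernel_rpow ν hζ, hx]
  set S : Finset (Vertex (k + 1)) := Finset.univ.image (List.ofFn (n := n)) with hS
  have hcard : S.card = (k + 1) ^ n := by
    rw [hS, Finset.card_image_of_injective _ List.ofFn_injective]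
    simp
  calc (k + 1 : ℝ≥0∞) ^ n * ∫⁻ v, ‖branchKernel k lam ζ n v‖ₑ ^ (2 : ℝ) ∂potLaw (k + 1) ν
      = ∑ _x ∈ S, ∫⁻ v, ‖branchKernel k lam ζ n v‖ₑ ^ (2 : ℝ) ∂potLaw (k + 1) ν := by
        rw [Finset.sum_const, hcard, nsmul_eq_mul]
        push_cast
        rfl
    _ = ∑ x ∈ S, ∫⁻ v, ‖resolventKernel lam v ζ (root (k + 1)) x‖ₑ ^ (2 : ℝ)
          ∂potLaw (k + 1) ν := by
        refine Finset.sum_congr rfl fun x hx => e x ?_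
        obtain ⟨y, _, rfl⟩ := Finset.mem_image.1 hx
        exact List.length_ofFn
    _ = ∫⁻ v, ∑ x ∈ S, ‖resolventKernel lam v ζ (root (k + 1)) x‖ₑ ^ (2 : ℝ)
          ∂potLaw (k + 1) ν := by
        rw [lintegral_finsetSum]
        intro x _
        have := measurable_resolventKernel (lam := lam) hζ (root (k + 1)) x
        fun_prop
    _ ≤ ∫⁻ _, ENNReal.ofReal ((ζ.im)⁻¹ ^ 2) ∂potLaw (k + 1) ν := by
        refine lintegral_mono fun v => ?_
        refine le_trans ?_ (tsum_resolventKernel_sq_le (lam := lam) (v := v) hζ)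
        refine le_trans (le_of_eq ?_) (ENNReal.sum_le_tsum S)
        refine Finset.sum_congr rfl fun x _ => ?_
        rw [← ofReal_norm, ENNReal.ofReal_rpow_of_nonneg (norm_nonneg _) (by norm_num)]
        simp
    _ = _ := by simp

theorem cgfRate_two_le (hς : ς ∈ Set.Ioo (0 : ℝ) 1) (hν : ∫⁻ v, ‖v‖ₑ ^ ς ∂ν ≠ ∞) (hζ : 0 < ζ.im)
    {I : Set ℝ} {d : ℝ → ℝ} {c : ℝ}
    (h : IsAlmostAdditive (fun n v => Real.log ‖branchKernel k lam ζ n v‖) (potLaw (k + 1) ν) I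
      d c) (h2 : 2 ∈ I) :
    cgfRate (fun n v => Real.log ‖branchKernel k lam ζ n v‖) (potLaw (k + 1) ν) 2
      ≤ -Real.log (k + 1) := by
  have h1 := h.tendsto_cgfRate h2
  set A : ℝ := Real.log ((ζ.im)⁻¹ ^ 2) with hA
  have h3 : Tendsto (fun n : ℕ => A / n - Real.log (k + 1)) atTop (𝓝 (0 - Real.log (k + 1))) :=
    (tendsto_const_div_atTop_nhds_zero_nat _).sub tendsto_const_nhds
  rw [zero_sub] at h3
  refine le_of_tendsto_of_tendsto h1 h3 ?_
  filter_upwards [eventually_gt_atTop 0] with n hn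
  have hn' : (0 : ℝ) < n := by exact_mod_cast hn
  have h4 := pow_mul_lintegral_branchKernel_sq_le (k := k) (ν := ν) (lam := lam) hζ n
  rw [lintegral_eq_ofReal_exp_cgf (measurable_branchKernel hζ n).aemeasurable
    (Eventually.of_forall (branchKernel_ne_zero hζ n))
    (lintegral_branchKernel_ne_top hς hν hζ (by linarith [hς.1]) n)] at h4
  have h5 : ((k : ℝ≥0∞) + 1) ^ n = ENNReal.ofReal (Real.exp (n * Real.log (k + 1))) := by
    rw [← Real.log_pow, Real.exp_log (by positivity), ENNReal.ofReal_pow (by positivity),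
      ENNReal.ofReal_add (by positivity) zero_le_one]
    simp
  have hη : 0 < (ζ.im)⁻¹ ^ 2 := by positivity
  rw [h5, ← ENNReal.ofReal_mul (Real.exp_pos _).le, ← Real.exp_add,
    ENNReal.ofReal_le_ofReal_iff hη.le, ← Real.le_log_iff_exp_le hη] at h4
  rw [div_le_iff₀ hn', sub_mul, div_mul_cancel₀ _ hn'.ne']
  linarith

/-- Convex interpolation between the value 0 at s = 0 and the bound -log K at s = 2. -/
theorem cgfRate_le_of_le_two (hς : ς ∈ Set.Ioo (0 : ℝ) 1) (hν : ∫⁻ v, ‖v‖ₑ ^ ς ∂ν ≠ ∞)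
    (hζ : 0 < ζ.im) {I : Set ℝ} {d : ℝ → ℝ} {c : ℝ}
    (h : IsAlmostAdditive (fun n v => Real.log ‖branchKernel k lam ζ n v‖) (potLaw (k + 1) ν) I
      d c) (h2 : 2 ∈ I) {s : ℝ} (hs : s ∈ Set.Icc (0 : ℝ) 2) :
    cgfRate (fun n v => Real.log ‖branchKernel k lam ζ n v‖) (potLaw (k + 1) ν) s
      ≤ -s * Real.log (Real.sqrt (k + 1 : ℕ)) := by
  have h0 := interior_subset h.mem_interior
  have hconv := h.convexOn.2
  have h1 := hconv h0 h2 (show 0 ≤ 1 - s / 2 by linarith [hs.2])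
    (show 0 ≤ s / 2 by linarith [hs.1]) (by ring)
  have h3 := cgfRate_two_le hς hν hζ h h2
  simp only [smul_eq_mul, h.rate_zero, mul_zero, zero_add, div_mul_cancel₀ s two_ne_zero] at h1
  rw [Real.log_sqrt (by positivity)]
  push_cast
  have := hs.1
  nlinarith

end UpperHalfPlane

/-! ### Boundary values of the Green function -/

section Boundary

/-- Existence of the limit is a measurable event when tested along the countable set of rational
heights; continuity in the height recovers the full limit. -/
theorem tendsto_of_tendsto_rat {F : ℝ → ℂ} {c : ℂ} (hF : ContinuousOn F (Set.Ioi 0))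
    (h : Tendsto (fun q : ℚ => F q) (comap ((↑) : ℚ → ℝ) (𝓝[>] 0)) (𝓝 c)) :
    Tendsto F (𝓝[>] 0) (𝓝 c) := by
  rw [(nhdsGT_basis (0 : ℝ)).tendsto_iff Metric.nhds_basis_closedBall]
  intro ε hε
  rw [((nhdsGT_basis (0 : ℝ)).comap _).tendsto_iff Metric.nhds_basis_closedBall] at h
  obtain ⟨δ, hδ, H⟩ := h ε hε
  refine ⟨δ, hδ, fun η hη => ?_⟩
  have h1 : η ∈ closure (Set.Ioo 0 δ ∩ Set.range ((↑) : ℚ → ℝ)) :=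
    Dense.open_subset_closure_inter Rat.denseRange_cast isOpen_Ioo hη
  have h2 : ContinuousWithinAt F (Set.Ioo 0 δ ∩ Set.range ((↑) : ℚ → ℝ)) η :=
    (hF.continuousAt (Ioi_mem_nhds hη.1)).continuousWithinAt
  refine closure_minimal ?_ Metric.isClosed_closedBall (h2.mem_closure_image h1)
  rintro _ ⟨_, ⟨h3, ⟨q, rfl⟩⟩, rfl⟩
  exact H q h3

variable {k : ℕ} {ν : Measure ℝ} [IsProbabilityMeasure ν] {lam ς : ℝ} {B : ℝ → ℝ≥0∞}

theorem im_add_mul_I (E η : ℝ) : ((E : ℂ) + (η : ℂ) * Complex.I).im = η := by simp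

/-- The Cayley transform of the Green function. -/
noncomputable def cayleyGreen {K : ℕ} (lam : ℝ) (v : Vertex K → ℝ) (ζ : ℂ) : ℂ :=
  (rootGreen lam v ζ - Complex.I) / (rootGreen lam v ζ + Complex.I)

theorem add_I_ne_zero {z : ℂ} (hz : 0 < z.im) : z + Complex.I ≠ 0 := by
  intro h
  have := congrArg Complex.im h
  simp only [Complex.add_im, Complex.I_im, Complex.zero_im] at this
  linarith

theorem norm_cayleyGreen_le {K : ℕ} {v : Vertex K → ℝ} {ζ : ℂ} (hζ : 0 < ζ.im) :
    ‖cayleyGreen lam v ζ‖ ≤ 1 := by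
  have h := im_rootGreen_pos (lam := lam) (v := v) hζ
  rw [cayleyGreen, norm_div, div_le_one (norm_pos_iff.2 (add_I_ne_zero h)),
    ← sq_le_sq₀ (norm_nonneg _) (norm_nonneg _), ← Complex.normSq_eq_norm_sq,
    ← Complex.normSq_eq_norm_sq, Complex.normSq_apply, Complex.normSq_apply]
  simp only [Complex.sub_re, Complex.sub_im, Complex.add_re, Complex.add_im, Complex.I_re,
    Complex.I_im]
  nlinarith

theorem differentiableAt_cayleyGreen {K : ℕ} {v : Vertex K → ℝ} {ζ : ℂ} (hζ : 0 < ζ.im) :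
    DifferentiableAt ℂ (cayleyGreen lam v) ζ := by
  have h := differentiableAt_rootGreen (lam := lam) (v := v) hζ
  exact (h.sub_const _).div (h.add_const _) (add_I_ne_zero (im_rootGreen_pos hζ))

theorem continuous_cayleyGreen {K : ℕ} {η : ℝ} (hη : 0 < η) :
    Continuous fun p : (Vertex K → ℝ) × ℝ =>
      cayleyGreen lam p.1 ((p.2 : ℂ) + (η : ℂ) * Complex.I) := by
  have h : Continuous fun p : (Vertex K → ℝ) × ℝ =>
      rootGreen lam p.1 ((p.2 : ℂ) + (η : ℂ) * Complex.I) := by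
    rw [continuous_iff_continuousAt]
    intro p
    have h1 := continuousAt_resolventKernel (lam := lam)
      (ζ₀ := (p.2 : ℂ) + (η : ℂ) * Complex.I) (by simpa using hη) p.1 (root K) (root K)
    exact ContinuousAt.comp (f := fun p : (Vertex K → ℝ) × ℝ =>
      (p.1, (p.2 : ℂ) + (η : ℂ) * Complex.I)) h1 (by fun_prop)
  refine (h.sub continuous_const).div (h.add continuous_const) fun p => ?_
  exact add_I_ne_zero (im_rootGreen_pos (by simpa using hη))

/-- For each fixed potential, Fatou's theorem applies to the bounded function. Fubini then exchanges
the quantifiers over potentials and energies, which requires joint measurability of the set of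
convergence. -/
theorem ae_exists_tendsto_cayleyGreen (μ : Measure (Vertex k → ℝ)) [SFinite μ] :
    ∀ᵐ E : ℝ, ∀ᵐ v ∂μ, ∃ l, Tendsto
      (fun η : ℝ => cayleyGreen lam v ((E : ℂ) + (η : ℂ) * Complex.I)) (𝓝[>] 0) (𝓝 l) := by
  let F : ℚ → (Vertex k → ℝ) × ℝ → ℂ := fun q p =>
    if 0 < (q : ℝ) then cayleyGreen lam p.1 ((p.2 : ℂ) + ((q : ℝ) : ℂ) * Complex.I) else 0
  have hFm : ∀ q, StronglyMeasurable (F q) := by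
    intro q
    by_cases hq : 0 < (q : ℝ)
    · simp only [F, hq, if_true]
      exact (continuous_cayleyGreen hq).stronglyMeasurable
    · simp only [F, hq, if_false]
      exact stronglyMeasurable_const
  have hS := measurableSet_exists_tendsto (l := comap ((↑) : ℚ → ℝ) (𝓝[>] 0))
    fun q => (hFm q).measurable
  have hpos : ∀ᶠ q : ℚ in comap ((↑) : ℚ → ℝ) (𝓝[>] 0), 0 < (q : ℝ) :=
    tendsto_comap.eventually (eventually_mem_nhdsWithin (a := (0 : ℝ)) (s := Set.Ioi 0))
  have hiff : ∀ (v : Vertex k → ℝ) (E : ℝ),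
      (∃ l, Tendsto (F · (v, E)) (comap ((↑) : ℚ → ℝ) (𝓝[>] 0)) (𝓝 l)) ↔
      ∃ l, Tendsto (fun η : ℝ => cayleyGreen lam v ((E : ℂ) + (η : ℂ) * Complex.I))
        (𝓝[>] 0) (𝓝 l) := by
    intro v E
    have he : ∀ᶠ q : ℚ in comap ((↑) : ℚ → ℝ) (𝓝[>] 0), F q (v, E)
        = cayleyGreen lam v ((E : ℂ) + ((q : ℝ) : ℂ) * Complex.I) := by
      filter_upwards [hpos] with q hq
      simp only [F, hq, if_true]
    have hcont : ContinuousOn (fun η : ℝ => cayleyGreen lam v ((E : ℂ) + (η : ℂ) * Complex.I))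
        (Set.Ioi 0) := by
      intro η hη
      have h1 := (differentiableAt_cayleyGreen (lam := lam) (v := v)
        (ζ := (E : ℂ) + (η : ℂ) * Complex.I) (by simpa using hη)).continuousAt
      exact (ContinuousAt.comp (f := fun η : ℝ => (E : ℂ) + (η : ℂ) * Complex.I) h1
        (by fun_prop)).continuousWithinAt
    constructor
    · rintro ⟨l, hl⟩
      exact ⟨l, tendsto_of_tendsto_rat hcont (hl.congr' he)⟩
    · rintro ⟨l, hl⟩
      exact ⟨l, (hl.comp tendsto_comap).congr' (he.mono fun _ h => h.symm)⟩
  have hmeas : MeasurableSet {x : (Vertex k → ℝ) × ℝ | ∃ l, Tendsto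
      (fun η : ℝ => cayleyGreen lam x.1 ((x.2 : ℂ) + (η : ℂ) * Complex.I)) (𝓝[>] 0) (𝓝 l)} := by
    simp_rw [← hiff]
    exact hS
  refine (Measure.ae_ae_comm (μ := μ) (ν := volume) (p := fun v (E : ℝ) => ∃ l, Tendsto
      (fun η : ℝ => cayleyGreen lam v ((E : ℂ) + (η : ℂ) * Complex.I)) (𝓝[>] 0) (𝓝 l))
      hmeas).1 ?_
  exact Eventually.of_forall fun v => ae_exists_tendsto_of_bounded (C := 1)
    (fun z hz => differentiableAt_cayleyGreen hz) fun z hz => norm_cayleyGreen_le hz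

/-- Almost surely, the Green function has a boundary value at `E`. -/
def HasBoundaryValues (k : ℕ) (ν : Measure ℝ) (lam E : ℝ) : Prop :=
  ∀ᵐ v ∂potLaw (k + 1) ν, ∃ l, Tendsto
    (fun η : ℝ => rootGreen lam v ((E : ℂ) + (η : ℂ) * Complex.I)) (𝓝[>] 0) (𝓝 l)

theorem one_sub_cayleyGreen {K : ℕ} {v : Vertex K → ℝ} {ζ : ℂ} (hζ : 0 < ζ.im) :
    1 - cayleyGreen lam v ζ = 2 * Complex.I / (rootGreen lam v ζ + Complex.I) := by
  have h := add_I_ne_zero (im_rootGreen_pos (lam := lam) (v := v) hζ)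
  rw [cayleyGreen]
  field_simp
  ring

theorem rootGreen_eq_of_cayleyGreen {K : ℕ} {v : Vertex K → ℝ} {ζ : ℂ} (hζ : 0 < ζ.im) :
    rootGreen lam v ζ = 2 * Complex.I / (1 - cayleyGreen lam v ζ) - Complex.I := by
  have h := add_I_ne_zero (im_rootGreen_pos (lam := lam) (v := v) hζ)
  rw [one_sub_cayleyGreen hζ, div_div_cancel₀ (by simp)]
  ring

/-- Inverting the Cayley transform fails only where its boundary value is 1, that is, where |Γ|
diverges. Fatou's lemma and the uniform bound on the moment of order 1/2 show that this has
probability zero. -/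
theorem UniformBounds.ae_hasBoundaryValues (hB : UniformBounds k ν lam ς B) :
    ∀ᵐ E : ℝ, HasBoundaryValues k ν lam E := by
  filter_upwards [ae_exists_tendsto_cayleyGreen (lam := lam) (potLaw (k + 1) ν)] with E hE
  let a : ℕ → ℝ := fun n => 1 / ((n : ℝ) + 1)
  have ha : ∀ n, 0 < a n := fun n => by positivity
  have hlim : Tendsto a atTop (𝓝[>] 0) :=
    tendsto_nhdsWithin_iff.2 ⟨tendsto_one_div_add_atTop_nhds_zero_nat,
      Eventually.of_forall ha⟩
  let h : ℕ → (Vertex (k + 1) → ℝ) → ℝ≥0∞ := fun n v =>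
    ‖rootGreen lam v ((E : ℂ) + (a n : ℂ) * Complex.I)‖ₑ ^ (1 / 2 : ℝ)
  have hm : ∀ n, Measurable (h n) := by
    intro n
    have := measurable_rootGreen (K := k + 1) (lam := lam)
      (ζ := (E : ℂ) + (a n : ℂ) * Complex.I) (by simpa using ha n)
    fun_prop
  have hfin : ∀ᵐ v ∂potLaw (k + 1) ν, liminf (fun n => h n v) atTop < ∞ := by
    refine ae_lt_top (Measurable.liminf hm) (ne_top_of_le_ne_top (hB.ne_top (1 / 2)) ?_)
    refine (lintegral_liminf_le hm).trans ?_
    refine liminf_le_of_le (by isBoundedDefault) fun b hb => ?_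
    obtain ⟨n, hn⟩ := hb.exists
    exact hn.trans (hB.moment_le _ ⟨by norm_num, by norm_num⟩ _ (by simpa using ha n))
  filter_upwards [hE, hfin] with v ⟨l, hl⟩ hv
  have hev : ∀ᶠ η : ℝ in 𝓝[>] 0, 0 < ((E : ℂ) + (η : ℂ) * Complex.I).im := by
    filter_upwards [self_mem_nhdsWithin] with η hη
    simpa using hη
  have h1 : Tendsto (fun η : ℝ => 1 - cayleyGreen lam v ((E : ℂ) + (η : ℂ) * Complex.I))
      (𝓝[>] 0) (𝓝 (1 - l)) := hl.const_sub 1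
  -- If the limit is 1, then |Γ| tends to infinity along the chosen heights, contradicting the
  -- finite lower limit.
  by_cases hl1 : 1 - l = 0
  · exfalso
    rw [hl1] at h1
    have h2 : Tendsto (fun n => ‖1 - cayleyGreen lam v ((E : ℂ) + (a n : ℂ) * Complex.I)‖)
        atTop (𝓝[>] 0) := by
      refine tendsto_nhdsWithin_iff.2 ⟨?_, Eventually.of_forall fun n => ?_⟩
      · simpa using (h1.comp hlim).norm
      · have hz : 0 < ((E : ℂ) + (a n : ℂ) * Complex.I).im := by simpa using ha n
        rw [one_sub_cayleyGreen hz]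
        exact norm_pos_iff.2 (div_ne_zero (by simp) (add_I_ne_zero (im_rootGreen_pos hz)))
    have h3 := h2.inv_tendsto_nhdsGT_zero
    have h4 : Tendsto (fun n => ‖rootGreen lam v ((E : ℂ) + (a n : ℂ) * Complex.I)‖)
        atTop atTop := by
      refine tendsto_atTop_mono (fun n => ?_) (tendsto_atTop_add_const_right atTop (-1)
        (h3.const_mul_atTop (two_pos)))
      have hz : 0 < ((E : ℂ) + (a n : ℂ) * Complex.I).im := by simpa using ha n
      have h5 := norm_sub_le (rootGreen lam v ((E : ℂ) + (a n : ℂ) * Complex.I) + Complex.I)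
        Complex.I
      have h6 := norm_add_le (rootGreen lam v ((E : ℂ) + (a n : ℂ) * Complex.I)) Complex.I
      rw [Pi.inv_apply, one_sub_cayleyGreen hz, norm_div, inv_div, norm_mul, Complex.norm_I,
        Complex.norm_two, mul_one, mul_div_cancel₀ _ (two_ne_zero' ℝ)]
      rw [Complex.norm_I] at h6
      linarith
    have h7 : Tendsto (fun n => h n v) atTop (𝓝 ∞) := by
      have h8 := ENNReal.tendsto_ofReal_atTop.comp
        ((tendsto_rpow_atTop (y := 1 / 2) (by norm_num)).comp h4)
      refine h8.congr fun n => ?_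
      simp only [Function.comp, h]
      rw [← ofReal_norm, ENNReal.ofReal_rpow_of_nonneg (norm_nonneg _) (by norm_num)]
    rw [h7.liminf_eq] at hv
    exact lt_irrefl _ hv
  · refine ⟨2 * Complex.I / (1 - l) - Complex.I, ?_⟩
    refine Tendsto.congr' ?_ ((tendsto_const_nhds.div h1 hl1).sub_const Complex.I)
    filter_upwards [hev] with η hη
    exact (rootGreen_eq_of_cayleyGreen hη).symm

/-- The recursion passes to the limit and exhibits an inverse of the boundary value: the Green
functions of the children's subtrees have finite limits too, having the same law. -/
theorem HasBoundaryValues.ae_exists_ne_zero {E : ℝ} (h : HasBoundaryValues k ν lam E) :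
    ∀ᵐ v ∂potLaw (k + 1) ν, ∃ l ≠ 0, Tendsto
      (fun η : ℝ => rootGreen lam v ((E : ℂ) + (η : ℂ) * Complex.I)) (𝓝[>] 0) (𝓝 l) := by
  have hsh : ∀ᵐ v ∂potLaw (k + 1) ν, ∀ i, ∃ l, Tendsto
      (fun η : ℝ => rootGreen lam (shiftPot v i) ((E : ℂ) + (η : ℂ) * Complex.I))
      (𝓝[>] 0) (𝓝 l) :=
    ae_all_iff.2 fun i => (measurePreserving_shiftPot i).quasiMeasurePreserving.ae h
  filter_upwards [h, hsh] with v ⟨l, hl⟩ hv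
  choose l' hl' using hv
  refine ⟨l, ?_, hl⟩
  have h1 : Tendsto (fun η : ℝ => rootGreen lam v ((E : ℂ) + (η : ℂ) * Complex.I)
      * (lam * v (root (k + 1)) - ((E : ℂ) + (η : ℂ) * Complex.I)
        - ∑ i, rootGreen lam (shiftPot v i) ((E : ℂ) + (η : ℂ) * Complex.I))) (𝓝[>] 0)
      (𝓝 (l * (lam * v (root (k + 1)) - ((E : ℂ) + ((0 : ℝ) : ℂ) * Complex.I) - ∑ i, l' i))) := by
    refine hl.mul ((tendsto_const_nhds.sub ?_).sub (tendsto_finsetSum _ fun i _ => hl' i))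
    refine Tendsto.mono_left ?_ nhdsWithin_le_nhds
    exact Continuous.tendsto (f := fun η : ℝ => (E : ℂ) + (η : ℂ) * Complex.I) (by fun_prop) 0
  have h2 := tendsto_nhds_unique (h1.congr' (by
    filter_upwards [self_mem_nhdsWithin] with η hη
    exact rootGreen_mul (by simpa using hη))) tendsto_const_nhds
  exact left_ne_zero_of_mul_eq_one h2

theorem HasBoundaryValues.ae_exists_tendsto {E : ℝ} (h : HasBoundaryValues k ν lam E) :
    ∀ᵐ v ∂potLaw (k + 1) ν, ∀ x, ∃ l ≠ 0, Tendsto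
      (fun η : ℝ => resolventKernel lam v ((E : ℂ) + (η : ℂ) * Complex.I) (root (k + 1)) x)
      (𝓝[>] 0) (𝓝 l) := by
  refine ae_all_iff.2 fun x => ?_
  induction x using List.reverseRecOn with
  | nil => exact h.ae_exists_ne_zero
  | append_singleton y i ih =>
    filter_upwards [h.ae_exists_ne_zero, (measurePreserving_shiftPot i).quasiMeasurePreserving.ae ih]
      with v ⟨l, hl0, hl⟩ ⟨l', hl0', hl'⟩
    refine ⟨-l * l', mul_ne_zero (neg_ne_zero.2 hl0) hl0', (hl.neg.mul hl').congr' ?_⟩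
    filter_upwards [self_mem_nhdsWithin] with η hη
    exact (resolventKernel_root_append (by simpa using hη) y i).symm

theorem green_of_pos {K : ℕ} {v : Vertex K → ℝ} {ζ : ℂ} (hζ : 0 < ζ.im) (x y : Vertex K) :
    green lam v ζ x y = resolventKernel lam v ζ x y := if_pos hζ

theorem green_eq_of_tendsto {K : ℕ} {v : Vertex K → ℝ} {E : ℝ} {x y : Vertex K} {l : ℂ}
    (h : Tendsto (fun η : ℝ => resolventKernel lam v ((E : ℂ) + (η : ℂ) * Complex.I) x y)
      (𝓝[>] 0) (𝓝 l)) : green lam v E x y = l := by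
  rw [green, if_neg (by simp)]
  exact h.limUnder_eq

/-- Almost surely, the boundary values exist, do not vanish, and are given by `green`. -/
theorem HasBoundaryValues.ae_tendsto_green {E : ℝ} (h : HasBoundaryValues k ν lam E) :
    ∀ᵐ v ∂potLaw (k + 1) ν, ∀ x, green lam v E (root (k + 1)) x ≠ 0 ∧ Tendsto
      (fun η : ℝ => resolventKernel lam v ((E : ℂ) + (η : ℂ) * Complex.I) (root (k + 1)) x)
      (𝓝[>] 0) (𝓝 (green lam v E (root (k + 1)) x)) := by
  filter_upwards [h.ae_exists_tendsto] with v hv x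
  obtain ⟨l, h0, hl⟩ := hv x
  rw [green_eq_of_tendsto hl]
  exact ⟨h0, hl⟩

end Boundary

/-! ### Convergence of integrals -/

section Convergence

variable {α ι : Type*} [MeasurableSpace α] {μ : Measure α} {l : Filter ι}

theorem tendsto_lintegral_min [IsFiniteMeasure μ] [l.IsCountablyGenerated] {f : ι → α → ℝ≥0∞}
    {g : α → ℝ≥0∞} (hf : ∀ᶠ i in l, AEMeasurable (f i) μ)
    (hlim : ∀ᵐ a ∂μ, Tendsto (fun i => f i a) l (𝓝 (g a))) (R : ℕ) :
    Tendsto (fun i => ∫⁻ a, min (f i a) R ∂μ) l (𝓝 (∫⁻ a, min (g a) R ∂μ)) := by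
  refine tendsto_lintegral_filter_of_dominated_convergence' (fun _ => (R : ℝ≥0∞)) ?_ ?_ ?_ ?_
  · filter_upwards [hf] with i hi
    exact hi.min aemeasurable_const
  · exact Eventually.of_forall fun i => Eventually.of_forall fun a => min_le_right _ _
  · simp [ENNReal.mul_eq_top]
  · filter_upwards [hlim] with a ha
    exact ha.min tendsto_const_nhds

theorem tendsto_lintegral_min_natCast {g : α → ℝ≥0∞} (hg : AEMeasurable g μ) :
    Tendsto (fun R : ℕ => ∫⁻ a, min (g a) R ∂μ) atTop (𝓝 (∫⁻ a, g a ∂μ)) := by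
  refine lintegral_tendsto_of_tendsto_of_monotone (fun R => hg.min aemeasurable_const) ?_ ?_
  · exact Eventually.of_forall fun a m n hmn => min_le_min_left _ (by exact_mod_cast hmn)
  · refine Eventually.of_forall fun a => ?_
    have := (tendsto_const_nhds (x := g a)).min ENNReal.tendsto_nat_nhds_top
    simpa using this

theorem le_min_add_rpow {p : ℝ} (hp : 1 < p) (x : ℝ≥0∞) {R : ℕ} (hR : 0 < R) :
    x ≤ min x R + (R : ℝ≥0∞) ^ (1 - p) * x ^ p := by
  rcases le_total x R with h | h
  · rw [min_eq_left h]
    exact le_self_add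
  · refine le_trans ?_ le_add_self
    have hR0 : (R : ℝ≥0∞) ≠ 0 := by exact_mod_cast hR.ne'
    have hRt : (R : ℝ≥0∞) ≠ ∞ := ENNReal.natCast_ne_top R
    have hx0 : x ≠ 0 := fun h0 => by
      rw [h0] at h
      exact hR0 (le_zero_iff.1 h)
    rcases eq_or_ne x ∞ with rfl | hxt
    · rw [ENNReal.top_rpow_of_pos (by linarith), ENNReal.mul_top]
      exact (ENNReal.rpow_pos (pos_iff_ne_zero.2 hR0) hRt).ne'
    · calc x = x ^ (1 - p) * x ^ p := by
            rw [← ENNReal.rpow_add _ _ hx0 hxt]; simp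
        _ ≤ (R : ℝ≥0∞) ^ (1 - p) * x ^ p := by
            gcongr ?_ * _
            rw [← neg_sub p 1, ENNReal.rpow_neg, ENNReal.rpow_neg]
            exact ENNReal.inv_le_inv.2 (ENNReal.rpow_le_rpow h (by linarith))

/-- Convergence of integrals under a bound on a higher moment. -/
theorem tendsto_lintegral_of_rpow_le [IsFiniteMeasure μ] [l.IsCountablyGenerated]
    {f : ι → α → ℝ≥0∞} {g : α → ℝ≥0∞} (hf : ∀ᶠ i in l, AEMeasurable (f i) μ)
    (hg : AEMeasurable g μ)
    (hlim : ∀ᵐ a ∂μ, Tendsto (fun i => f i a) l (𝓝 (g a))) {p : ℝ} (hp : 1 < p) {C : ℝ≥0∞}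
    (hC : C ≠ ∞) (hbd : ∀ᶠ i in l, ∫⁻ a, f i a ^ p ∂μ ≤ C) :
    Tendsto (fun i => ∫⁻ a, f i a ∂μ) l (𝓝 (∫⁻ a, g a ∂μ)) := by
  have hmin := tendsto_lintegral_min hf hlim
  have hsup := tendsto_lintegral_min_natCast hg
  refine tendsto_order.2 ⟨fun b hb => ?_, fun b hb => ?_⟩
  -- The lower bound follows by truncating at level R. For the upper bound, the part above R is at
  -- most R^(1-p) times the p-th moment.
  · obtain ⟨R, hR⟩ := (hsup.eventually_const_lt hb).exists
    filter_upwards [(hmin R).eventually_const_lt hR] with i hi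
    exact hi.trans_le (lintegral_mono fun a => min_le_left _ _)
  · have hR0 : Tendsto (fun R : ℕ => ∫⁻ a, g a ∂μ + (R : ℝ≥0∞) ^ (1 - p) * C) atTop
        (𝓝 (∫⁻ a, g a ∂μ + 0 * C)) := by
      refine tendsto_const_nhds.add (ENNReal.Tendsto.mul_const ?_ (Or.inr hC))
      have h1 : Tendsto (fun x : ℝ≥0∞ => x ^ (1 - p)) (𝓝 ∞) (𝓝 (∞ ^ (1 - p))) :=
        (ENNReal.continuous_rpow_const).tendsto ∞
      rw [ENNReal.top_rpow_of_neg (by linarith)] at h1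
      exact h1.comp ENNReal.tendsto_nat_nhds_top
    rw [zero_mul, add_zero] at hR0
    obtain ⟨R, hRb, hR⟩ := ((hR0.eventually_lt_const hb).and (eventually_gt_atTop 0)).exists
    have h2 : ∫⁻ a, min (g a) R ∂μ + (R : ℝ≥0∞) ^ (1 - p) * C < b :=
      lt_of_le_of_lt (by gcongr; exact min_le_left _ _) hRb
    have h3 := ((hmin R).add_const ((R : ℝ≥0∞) ^ (1 - p) * C)).eventually_lt_const h2
    filter_upwards [h3, hbd, hf] with i hi hi2 hi3
    refine lt_of_le_of_lt ?_ hi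
    calc ∫⁻ a, f i a ∂μ ≤ ∫⁻ a, (min (f i a) R + (R : ℝ≥0∞) ^ (1 - p) * f i a ^ p) ∂μ :=
          lintegral_mono fun a => le_min_add_rpow hp _ hR
      _ = ∫⁻ a, min (f i a) R ∂μ + (R : ℝ≥0∞) ^ (1 - p) * ∫⁻ a, f i a ^ p ∂μ := by
          rw [lintegral_add_left' (hi3.min aemeasurable_const),
            lintegral_const_mul'' _ (hi3.pow_const p)]
      _ ≤ _ := by gcongr

/-- Convergence of integrals under a converging majorant. -/
theorem tendsto_lintegral_of_le_tendsto [l.IsCountablyGenerated]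
    {f b : ι → α → ℝ≥0∞} {g c : α → ℝ≥0∞} (hf : ∀ᶠ i in l, AEMeasurable (f i) μ)
    (hb : ∀ᶠ i in l, AEMeasurable (b i) μ) (hc : AEMeasurable c μ)
    (hlim : ∀ᵐ a ∂μ, Tendsto (fun i => f i a) l (𝓝 (g a)))
    (hblim : ∀ᵐ a ∂μ, Tendsto (fun i => b i a) l (𝓝 (c a)))
    (hle : ∀ᶠ i in l, ∀ a, f i a ≤ b i a) (hgc : ∀ᵐ a ∂μ, g a ≤ c a)
    (hcfin : ∫⁻ a, c a ∂μ ≠ ∞)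
    (hint : Tendsto (fun i => ∫⁻ a, b i a ∂μ) l (𝓝 (∫⁻ a, c a ∂μ))) :
    Tendsto (fun i => ∫⁻ a, f i a ∂μ) l (𝓝 (∫⁻ a, g a ∂μ)) := by
  have h1 : Tendsto (fun i => ∫⁻ a, min (f i a) (c a) ∂μ) l (𝓝 (∫⁻ a, g a ∂μ)) := by
    refine tendsto_lintegral_filter_of_dominated_convergence' c ?_ ?_ hcfin ?_
    · filter_upwards [hf] with i hi
      exact hi.min hc
    · exact Eventually.of_forall fun i => Eventually.of_forall fun a => min_le_right _ _
    · filter_upwards [hlim, hgc] with a ha ha2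
      have := ha.min (tendsto_const_nhds (x := c a))
      rwa [min_eq_left ha2] at this
  have h2 : Tendsto (fun i => ∫⁻ a, min (b i a) (c a) ∂μ) l (𝓝 (∫⁻ a, c a ∂μ)) := by
    refine tendsto_lintegral_filter_of_dominated_convergence' c ?_ ?_ hcfin ?_
    · filter_upwards [hb] with i hi
      exact hi.min hc
    · exact Eventually.of_forall fun i => Eventually.of_forall fun a => min_le_right _ _
    · filter_upwards [hblim] with a ha
      have := ha.min (tendsto_const_nhds (x := c a))
      rwa [min_self] at this
  -- The mass of the majorants in excess of c tends to zero. It dominates the part of f above c,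
  -- while the part below c converges by domination.
  have h3 := ENNReal.Tendsto.sub hint h2 (Or.inl hcfin)
  rw [tsub_self] at h3
  have h4 := h1.add h3
  rw [add_zero] at h4
  refine tendsto_of_tendsto_of_tendsto_of_le_of_le' h1 h4
    (Eventually.of_forall fun i => lintegral_mono fun a => min_le_left _ _) ?_
  filter_upwards [hf, hb, hle] with i hi hbi hlei
  have hfin : ∫⁻ a, min (b i a) (c a) ∂μ ≠ ∞ :=
    ne_top_of_le_ne_top hcfin (lintegral_mono fun a => min_le_right _ _)
  rw [← lintegral_sub' (hbi.min hc) hfin (Eventually.of_forall fun a => min_le_left _ _),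
    ← lintegral_add_left' (hi.min hc)]
  refine lintegral_mono fun a => ?_
  change f i a ≤ min (f i a) (c a) + (b i a - min (b i a) (c a))
  rcases le_total (f i a) (c a) with h | h
  · rw [min_eq_left h]; exact le_self_add
  · rw [min_eq_right h, min_eq_right (h.trans (hlei a))]
    exact (hlei a).trans le_add_tsub

end Convergence

/-! ### A majorant for the inverse of the Green function -/

section Majorant

variable {k : ℕ} {ν : Measure ℝ} [IsProbabilityMeasure ν] {lam ς t : ℝ} {e : ℝ≥0∞}
  {h : (Vertex (k + 1) → ℝ) → ℝ≥0∞}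

/-- The factor contributed by one site of the path. -/
noncomputable def siteBound (lam t : ℝ) (e : ℝ≥0∞) (h : (Vertex (k + 1) → ℝ) → ℝ≥0∞)
    (v : Vertex (k + 1) → ℝ) : ℝ≥0∞ :=
  1 + (‖lam‖ₑ * ‖v []‖ₑ + e) ^ t + ∑ j : Fin k, h (shiftPot v (Fin.succAbove 0 j)) ^ t

/-- The product of the factors of the sites of the leftmost branch. -/
noncomputable def pathBound (lam t : ℝ) (e : ℝ≥0∞) (h : (Vertex (k + 1) → ℝ) → ℝ≥0∞) :
    ℕ → (Vertex (k + 1) → ℝ) → ℝ≥0∞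
  | 0, v => siteBound lam t e h v + h (shiftPot v 0) ^ t
  | n + 1, v => siteBound lam t e h v * pathBound lam t e h n (shiftPot v 0)

theorem one_le_siteBound (v : Vertex (k + 1) → ℝ) : 1 ≤ siteBound lam t e h v := by
  rw [siteBound, add_assoc]
  exact le_self_add

theorem one_le_pathBound (n : ℕ) (v : Vertex (k + 1) → ℝ) : 1 ≤ pathBound lam t e h n v := by
  induction n generalizing v with
  | zero => exact (one_le_siteBound v).trans le_self_add
  | succ n ih => exact one_le_mul (one_le_siteBound v) (ih _)

theorem measurable_siteBound (hh : Measurable h) : Measurable (siteBound lam t e h) := by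
  have : ∀ j : Fin k, Measurable fun v : Vertex (k + 1) → ℝ =>
      h (shiftPot v (Fin.succAbove 0 j)) ^ t := fun j =>
    (hh.comp (measurable_shiftPot _)).pow_const t
  unfold siteBound
  fun_prop

theorem measurable_pathBound (hh : Measurable h) (n : ℕ) :
    Measurable (pathBound lam t e h n) := by
  induction n with
  | zero =>
    exact (measurable_siteBound hh).add ((hh.comp (measurable_shiftPot 0)).pow_const t)
  | succ n ih => exact (measurable_siteBound hh).mul (ih.comp (measurable_shiftPot 0))

theorem lintegral_shiftPot (hh : Measurable h) (i : Fin (k + 1)) :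
    ∫⁻ v, h (shiftPot v i) ∂potLaw (k + 1) ν = ∫⁻ v, h v ∂potLaw (k + 1) ν :=
  (measurePreserving_shiftPot i).lintegral_comp hh

theorem lintegral_eval_root {F : ℝ → ℝ≥0∞} (hF : Measurable F) :
    ∫⁻ v, F (v []) ∂potLaw (k + 1) ν = ∫⁻ v, F v ∂ν :=
  (measurePreserving_eval_infinitePi (fun _ : Vertex (k + 1) => ν) []).lintegral_comp hF

/-- The mean of the factor of one site. -/
noncomputable def siteMean (k : ℕ) (ν : Measure ℝ) (lam t : ℝ) (e m : ℝ≥0∞) : ℝ≥0∞ :=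
  1 + ∫⁻ v, (‖lam‖ₑ * ‖v‖ₑ + e) ^ t ∂ν + k * m

theorem lintegral_siteBound (hh : Measurable h) :
    ∫⁻ v, siteBound lam t e h v ∂potLaw (k + 1) ν
      = siteMean k ν lam t e (∫⁻ v, h v ^ t ∂potLaw (k + 1) ν) := by
  have h1 : ∀ j : Fin k, Measurable fun v : Vertex (k + 1) → ℝ =>
      h (shiftPot v (Fin.succAbove 0 j)) ^ t := fun j =>
    (hh.comp (measurable_shiftPot _)).pow_const t
  simp only [siteBound]
  rw [lintegral_add_left (by fun_prop), lintegral_add_left measurable_const,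
    lintegral_finsetSum _ fun j _ => h1 j, siteMean]
  have h2 : ∀ j : Fin k, ∫⁻ v, h (shiftPot v (Fin.succAbove 0 j)) ^ t ∂potLaw (k + 1) ν
      = ∫⁻ v, h v ^ t ∂potLaw (k + 1) ν := fun j =>
    lintegral_shiftPot (hh.pow_const t) _
  have h3 := lintegral_eval_root (k := k) (ν := ν)
    (F := fun x : ℝ => (‖lam‖ₑ * ‖x‖ₑ + e) ^ t) (by fun_prop)
  simp_rw [h2]
  rw [h3]
  simp

/-- The factor of a site involves only its potential and the off-path subtrees, so it is independent
of all factors further down the path. The means multiply, and the last site carries one additional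
subtree. -/
theorem lintegral_pathBound (hh : Measurable h) (n : ℕ) :
    ∫⁻ v, pathBound lam t e h n v ∂potLaw (k + 1) ν
      = siteMean k ν lam t e (∫⁻ v, h v ^ t ∂potLaw (k + 1) ν) ^ n
        * (siteMean k ν lam t e (∫⁻ v, h v ^ t ∂potLaw (k + 1) ν)
          + ∫⁻ v, h v ^ t ∂potLaw (k + 1) ν) := by
  induction n with
  | zero =>
    simp only [pathBound, pow_zero, one_mul]
    rw [lintegral_add_left (measurable_siteBound hh), lintegral_siteBound hh,
      lintegral_shiftPot (hh.pow_const t)]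
  | succ n ih =>
    rw [pow_succ', mul_assoc, ← ih, ← lintegral_siteBound hh]
    let F₁ : ℝ × (Fin k → Vertex (k + 1) → ℝ) → ℝ≥0∞ := fun p =>
      1 + (‖lam‖ₑ * ‖p.1‖ₑ + e) ^ t + ∑ j : Fin k, h (p.2 j) ^ t
    have hF₁ : Measurable F₁ := by
      have : ∀ j : Fin k, Measurable fun p : ℝ × (Fin k → Vertex (k + 1) → ℝ) =>
        h (p.2 j) ^ t := fun j => (hh.comp (by fun_prop)).pow_const t
      fun_prop
    have hP := measurable_pathBound (k := k) (lam := lam) (t := t) (e := e) hh n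
    have e1 := lintegral_root_children (k := k) ν 0
      (F := fun p => F₁ (p.1, p.2.2) * pathBound lam t e h n p.2.1)
      ((hF₁.comp (by fun_prop)).mul (hP.comp (by fun_prop)))
    have e2 := lintegral_root_children (k := k) ν 0
      (F := fun p => F₁ (p.1, p.2.2)) (hF₁.comp (by fun_prop))
    have e3 : ∀ v, pathBound lam t e h (n + 1) v = F₁ (v [],
        fun j : Fin k => shiftPot v (Fin.succAbove 0 j)) * pathBound lam t e h n (shiftPot v 0) :=
      fun v => rfl
    have e4 : ∀ v : Vertex (k + 1) → ℝ, siteBound lam t e h v = F₁ (v [],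
        fun j : Fin k => shiftPot v (Fin.succAbove 0 j)) := fun v => rfl
    simp_rw [e3, e4]
    rw [e1, e2]
    set π := Measure.pi fun _ : Fin k => potLaw (k + 1) ν with hπ
    have hm1 : Measurable fun q : (Vertex (k + 1) → ℝ) × (Fin k → Vertex (k + 1) → ℝ) =>
        ∫⁻ x, F₁ (x, q.2) ∂ν := by
      have : Measurable fun q : ((Vertex (k + 1) → ℝ) × (Fin k → Vertex (k + 1) → ℝ)) × ℝ =>
        F₁ (q.2, q.1.2) := hF₁.comp (by fun_prop)
      exact this.lintegral_prod_right'
    have hm2 : Measurable fun q : Fin k → Vertex (k + 1) → ℝ => ∫⁻ x, F₁ (x, q) ∂ν := by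
      have : Measurable fun q : (Fin k → Vertex (k + 1) → ℝ) × ℝ =>
        F₁ (q.2, q.1) := hF₁.comp (by fun_prop)
      exact this.lintegral_prod_right'
    have a1 : ∫⁻ p, F₁ (p.1, p.2.2) * pathBound lam t e h n p.2.1
        ∂(ν.prod ((potLaw (k + 1) ν).prod π))
        = ∫⁻ u, pathBound lam t e h n u * ∫⁻ q, ∫⁻ x, F₁ (x, q) ∂ν ∂π ∂potLaw (k + 1) ν := by
      have b0 : Measurable fun p : ℝ × (Vertex (k + 1) → ℝ) × (Fin k → Vertex (k + 1) → ℝ) =>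
          F₁ (p.1, p.2.2) * pathBound lam t e h n p.2.1 :=
        (hF₁.comp (by fun_prop)).mul (hP.comp (by fun_prop))
      rw [lintegral_prod_symm _ b0.aemeasurable]
      have b1 : ∀ q : (Vertex (k + 1) → ℝ) × (Fin k → Vertex (k + 1) → ℝ),
          ∫⁻ x, F₁ (x, q.2) * pathBound lam t e h n q.1 ∂ν
          = pathBound lam t e h n q.1 * ∫⁻ x, F₁ (x, q.2) ∂ν := fun q => by
        have c : Measurable fun x : ℝ => F₁ (x, q.2) := hF₁.comp (by fun_prop)
        rw [lintegral_mul_const _ c, mul_comm]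
      simp_rw [b1]
      have b2 : Measurable fun q : (Vertex (k + 1) → ℝ) × (Fin k → Vertex (k + 1) → ℝ) =>
          pathBound lam t e h n q.1 * ∫⁻ x, F₁ (x, q.2) ∂ν := (hP.comp measurable_fst).mul hm1
      rw [lintegral_prod _ b2.aemeasurable]
      refine lintegral_congr fun u => ?_
      change ∫⁻ q, pathBound lam t e h n u * ∫⁻ x, F₁ (x, q) ∂ν ∂π = _
      rw [lintegral_const_mul _ hm2]
    have a2 : ∫⁻ p, F₁ (p.1, p.2.2) ∂(ν.prod ((potLaw (k + 1) ν).prod π))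
        = ∫⁻ q, ∫⁻ x, F₁ (x, q) ∂ν ∂π := by
      have b0 : Measurable fun p : ℝ × (Vertex (k + 1) → ℝ) × (Fin k → Vertex (k + 1) → ℝ) =>
          F₁ (p.1, p.2.2) := hF₁.comp (by fun_prop)
      rw [lintegral_prod_symm _ b0.aemeasurable, lintegral_prod _ hm1.aemeasurable]
      simp
    rw [a1, a2, lintegral_mul_const _ hP, mul_comm]

theorem enorm_inv_rootGreen_le {ζ : ℂ} (hζ : 0 < ζ.im) (v : Vertex (k + 1) → ℝ) :
    ‖rootGreen lam v ζ‖ₑ⁻¹ ≤ (‖lam‖ₑ * ‖v []‖ₑ + ‖ζ‖ₑ)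
      + ∑ j : Fin k, ‖rootGreen lam (shiftPot v (Fin.succAbove 0 j)) ζ‖ₑ
      + ‖rootGreen lam (shiftPot v 0) ζ‖ₑ := by
  have h0 : rootGreen lam v ζ ≠ 0 := rootGreen_ne_zero hζ
  rw [← enorm_inv h0, rootGreen_eq_inv hζ v 0, inv_inv]
  refine enorm_sub_le.trans ?_
  gcongr
  refine enorm_sub_le.trans ?_
  gcongr
  · refine enorm_sub_le.trans ?_
    gcongr
    rw [enorm_mul]
    gcongr <;> rw [← ofReal_norm, ← ofReal_norm] <;> simp
  · exact enorm_sum_le _ _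

theorem sum_rpow_le {ι : Type*} (s : Finset ι) (f : ι → ℝ≥0∞) {t : ℝ} (ht0 : 0 < t) (ht : t ≤ 1) :
    (∑ i ∈ s, f i) ^ t ≤ ∑ i ∈ s, f i ^ t := by
  classical
  induction s using Finset.induction_on with
  | empty => simp [ht0]
  | insert a s ha ih =>
    rw [Finset.sum_insert ha, Finset.sum_insert ha]
    exact (ENNReal.rpow_add_le_add_rpow _ _ ht0.le ht).trans (by gcongr)

/-- By the recursion, |Γ|^{-t} is at most the contribution of the site plus |Γ'|^t for the next site
on the path. The latter would destroy independence, but it is absorbed by the factor |Γ'|^{-t} of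
that next site. -/
theorem enorm_branchKernel_rpow_neg_le {ζ : ℂ} (hζ : 0 < ζ.im) (ht0 : 0 < t) (ht : t ≤ 1) (n : ℕ)
    (v : Vertex (k + 1) → ℝ) :
    ‖branchKernel k lam ζ n v‖ₑ ^ (-t)
      ≤ pathBound lam t ‖ζ‖ₑ (fun v => ‖rootGreen lam v ζ‖ₑ) n v := by
  set h : (Vertex (k + 1) → ℝ) → ℝ≥0∞ := fun v => ‖rootGreen lam v ζ‖ₑ with hh
  set a : (Vertex (k + 1) → ℝ) → ℝ≥0∞ := fun v => (‖lam‖ₑ * ‖v []‖ₑ + ‖ζ‖ₑ) ^ t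
    + ∑ j : Fin k, h (shiftPot v (Fin.succAbove 0 j)) ^ t with ha
  have hsite : ∀ v, siteBound lam t ‖ζ‖ₑ h v = 1 + a v := fun v => add_assoc _ _ _
  have hinv : ∀ v : Vertex (k + 1) → ℝ, (h v)⁻¹ ^ t ≤ a v + h (shiftPot v 0) ^ t := by
    intro v
    refine (ENNReal.rpow_le_rpow (enorm_inv_rootGreen_le (lam := lam) hζ v) ht0.le).trans ?_
    refine (ENNReal.rpow_add_le_add_rpow _ _ ht0.le ht).trans ?_
    gcongr
    refine (ENNReal.rpow_add_le_add_rpow _ _ ht0.le ht).trans ?_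
    simp only [ha]
    gcongr
    exact sum_rpow_le _ _ ht0 ht
  have hne : ∀ v : Vertex (k + 1) → ℝ, h v ≠ 0 := fun v => by
    simpa [hh] using rootGreen_ne_zero (lam := lam) (v := v) hζ
  have hcancel : ∀ v : Vertex (k + 1) → ℝ, h v ^ t * (h v)⁻¹ ^ t = 1 := fun v => by
    rw [← ENNReal.mul_rpow_of_nonneg _ _ ht0.le, ENNReal.mul_inv_cancel (hne v) enorm_ne_top,
      ENNReal.one_rpow]
  -- The second inequality is the absorbed form, in which the first factor of the path has been
  -- cancelled; the induction needs both.
  have key : ∀ n, ∀ v, ‖branchKernel k lam ζ n v‖ₑ ^ (-t) ≤ pathBound lam t ‖ζ‖ₑ h n v ∧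
      h v ^ t * ‖branchKernel k lam ζ n v‖ₑ ^ (-t) ≤ pathBound lam t ‖ζ‖ₑ h n v := by
    intro n
    induction n with
    | zero =>
      intro v
      rw [branchKernel_zero, ENNReal.rpow_neg, ← ENNReal.inv_rpow]
      refine ⟨(hinv v).trans ?_, ?_⟩
      · rw [pathBound, hsite]
        gcongr
        exact le_add_self
      · exact (hcancel v).le.trans (one_le_pathBound 0 v)
    | succ n ih =>
      intro v
      have h1 : ‖branchKernel k lam ζ (n + 1) v‖ₑ ^ (-t)
          = (h v)⁻¹ ^ t * ‖branchKernel k lam ζ n (shiftPot v 0)‖ₑ ^ (-t) := by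
        rw [branchKernel_succ hζ, enorm_mul, enorm_neg,
          ENNReal.mul_rpow_of_ne_top enorm_ne_top enorm_ne_top, ENNReal.rpow_neg,
          ENNReal.inv_rpow]
      obtain ⟨i1, i2⟩ := ih (shiftPot v 0)
      refine ⟨?_, ?_⟩
      · rw [h1, pathBound, hsite]
        calc _ ≤ (a v + h (shiftPot v 0) ^ t)
              * ‖branchKernel k lam ζ n (shiftPot v 0)‖ₑ ^ (-t) := by gcongr; exact hinv v
          _ = h (shiftPot v 0) ^ t * ‖branchKernel k lam ζ n (shiftPot v 0)‖ₑ ^ (-t)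
              + a v * ‖branchKernel k lam ζ n (shiftPot v 0)‖ₑ ^ (-t) := by ring
          _ ≤ pathBound lam t ‖ζ‖ₑ h n (shiftPot v 0)
              + a v * pathBound lam t ‖ζ‖ₑ h n (shiftPot v 0) := by gcongr
          _ = _ := by ring
      · rw [h1, ← mul_assoc, hcancel, one_mul]
        exact i1.trans (le_mul_of_one_le_left' (one_le_siteBound v))
  exact (key n v).1

end Majorant

/-! ### Convergence of the moments at the boundary -/

section BoundaryMoments

variable {k : ℕ} {ν : Measure ℝ} [IsProbabilityMeasure ν] {lam ς E : ℝ} {B : ℝ → ℝ≥0∞}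

/-- The boundary value of the kernel along the leftmost branch. -/
noncomputable def boundaryBranch (k : ℕ) (lam E : ℝ) (n : ℕ) (v : Vertex (k + 1) → ℝ) : ℂ :=
  green lam v E (root (k + 1)) (branch k n)

theorem eventually_im_pos (E : ℝ) :
    ∀ᶠ η : ℝ in 𝓝[>] 0, 0 < ((E : ℂ) + (η : ℂ) * Complex.I).im := by
  filter_upwards [self_mem_nhdsWithin] with η hη
  simpa using hη

theorem HasBoundaryValues.ae_tendsto_branchKernel (h : HasBoundaryValues k ν lam E) (n : ℕ) :
    ∀ᵐ v ∂potLaw (k + 1) ν, boundaryBranch k lam E n v ≠ 0 ∧ Tendsto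
      (fun η : ℝ => branchKernel k lam ((E : ℂ) + (η : ℂ) * Complex.I) n v)
      (𝓝[>] 0) (𝓝 (boundaryBranch k lam E n v)) := by
  filter_upwards [h.ae_tendsto_green] with v hv using hv (branch k n)

theorem HasBoundaryValues.aemeasurable_green (h : HasBoundaryValues k ν lam E)
    (x : Vertex (k + 1)) :
    AEMeasurable (fun v => green lam v E (root (k + 1)) x) (potLaw (k + 1) ν) := by
  have hlim : Tendsto (fun n : ℕ => 1 / ((n : ℝ) + 1)) atTop (𝓝[>] 0) :=
    tendsto_nhdsWithin_iff.2 ⟨tendsto_one_div_add_atTop_nhds_zero_nat,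
      Eventually.of_forall fun n => by
        have : (0 : ℝ) < 1 / ((n : ℝ) + 1) := by positivity
        exact this⟩
  refine aemeasurable_of_tendsto_metrizable_ae atTop (f := fun (n : ℕ) v =>
    resolventKernel lam v ((E : ℂ) + ((1 / ((n : ℝ) + 1) : ℝ) : ℂ) * Complex.I)
      (root (k + 1)) x) (fun n => ?_) ?_
  · refine (measurable_resolventKernel ?_ _ _).aemeasurable
    rw [im_add_mul_I]
    positivity
  · filter_upwards [h.ae_tendsto_green] with v hv
    exact (hv x).2.comp hlim

theorem UniformBounds.exists_moment_le (hB : UniformBounds k ν lam ς B) (hς : 0 < ς) {r : ℝ}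
    (hr : r ∈ Set.Ioo (0 : ℝ) 1) (n : ℕ) :
    ∃ C : ℝ≥0∞, C ≠ ∞ ∧ ∀ ζ : ℂ, 0 < ζ.im →
      ∫⁻ v, ‖branchKernel k lam ζ n v‖ₑ ^ r ∂potLaw (k + 1) ν ≤ C := by
  set D := B (orderBound r) ^ (|r| / orderBound r) with hD
  have hDt : D ≠ ∞ := ENNReal.rpow_ne_top_of_nonneg
    (div_nonneg (abs_nonneg _) (orderBound_pos r).le) (hB.ne_top _)
  induction n with
  | zero => exact ⟨B r, hB.ne_top r, fun ζ hζ => hB.moment_le r hr ζ hζ⟩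
  | succ n ih =>
    obtain ⟨C, hC, H⟩ := ih
    refine ⟨D * (C * B r), ENNReal.mul_ne_top hDt (ENNReal.mul_ne_top hC (hB.ne_top r)),
      fun ζ hζ => ?_⟩
    refine (hB.quasiMul r ⟨by linarith [hr.1], hr.2⟩ ζ hζ n 0).1.trans ?_
    gcongr
    · exact H ζ hζ
    · exact hB.moment_le r hr ζ hζ

/-- An exponent r strictly between s and 1 has moments bounded uniformly in η, which gives uniform
integrability. -/
theorem UniformBounds.tendsto_moment_of_pos (hB : UniformBounds k ν lam ς B) (hς : 0 < ς)
    (h : HasBoundaryValues k ν lam E) {s : ℝ} (hs : s ∈ Set.Ioo (0 : ℝ) 1) (n : ℕ) :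
    Tendsto (fun η : ℝ => ∫⁻ v, ‖branchKernel k lam ((E : ℂ) + (η : ℂ) * Complex.I) n v‖ₑ ^ s
        ∂potLaw (k + 1) ν) (𝓝[>] 0)
      (𝓝 (∫⁻ v, ‖boundaryBranch k lam E n v‖ₑ ^ s ∂potLaw (k + 1) ν)) := by
  obtain ⟨r, hsr, hr⟩ := exists_between hs.2
  have hr' : r ∈ Set.Ioo (0 : ℝ) 1 := ⟨hs.1.trans hsr, hr⟩
  obtain ⟨C, hC, H⟩ := hB.exists_moment_le hς hr' n
  refine tendsto_lintegral_of_rpow_le (p := r / s) (C := C) ?_ ?_ ?_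
    ((one_lt_div hs.1).2 hsr) hC ?_
  · filter_upwards [eventually_im_pos E] with η hη
    exact ((measurable_branchKernel hη n).enorm.pow_const s).aemeasurable
  · exact (h.aemeasurable_green _).enorm.pow_const s
  · filter_upwards [h.ae_tendsto_branchKernel n] with v hv
    exact (ENNReal.continuous_rpow_const.tendsto _).comp hv.2.enorm
  · filter_upwards [eventually_im_pos E] with η hη
    refine le_trans (le_of_eq (lintegral_congr fun v => ?_)) (H _ hη)
    rw [← ENNReal.rpow_mul, mul_div_cancel₀ _ hs.1.ne']

theorem tendsto_enorm_add_mul_I (E : ℝ) :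
    Tendsto (fun η : ℝ => ‖(E : ℂ) + (η : ℂ) * Complex.I‖ₑ) (𝓝[>] 0) (𝓝 ‖(E : ℂ)‖ₑ) := by
  have : Continuous fun η : ℝ => ‖(E : ℂ) + (η : ℂ) * Complex.I‖ₑ := by fun_prop
  have h := this.tendsto 0
  simp only [Complex.ofReal_zero, zero_mul, add_zero] at h
  exact h.mono_left nhdsWithin_le_nhds

theorem UniformBounds.tendsto_siteMean (hB : UniformBounds k ν lam ς B)
    (hς : ς ∈ Set.Ioo (0 : ℝ) 1) (hν : ∫⁻ v, ‖v‖ₑ ^ ς ∂ν ≠ ∞) (h : HasBoundaryValues k ν lam E)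
    {t : ℝ} (ht0 : 0 < t) (ht : t ≤ ς) :
    Tendsto (fun η : ℝ => siteMean k ν lam t ‖(E : ℂ) + (η : ℂ) * Complex.I‖ₑ
        (∫⁻ v, ‖rootGreen lam v ((E : ℂ) + (η : ℂ) * Complex.I)‖ₑ ^ t ∂potLaw (k + 1) ν))
      (𝓝[>] 0) (𝓝 (siteMean k ν lam t ‖(E : ℂ)‖ₑ
        (∫⁻ v, ‖boundaryBranch k lam E 0 v‖ₑ ^ t ∂potLaw (k + 1) ν))) := by
  have h1 := hB.tendsto_moment_of_pos hς.1 h (s := t) ⟨ht0, ht.trans_lt hς.2⟩ 0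
  have he := tendsto_enorm_add_mul_I E
  refine (tendsto_const_nhds.add ?_).add (ENNReal.Tendsto.const_mul h1 (Or.inr (by simp)))
  refine tendsto_lintegral_filter_of_dominated_convergence'
    (fun v => (‖lam‖ₑ * ‖v‖ₑ + (‖(E : ℂ)‖ₑ + 1)) ^ t) ?_ ?_ ?_ ?_
  · exact Eventually.of_forall fun η => Measurable.aemeasurable (by fun_prop)
  · have hlt : ‖(E : ℂ)‖ₑ < ‖(E : ℂ)‖ₑ + 1 := ENNReal.lt_add_right enorm_ne_top one_ne_zero
    filter_upwards [he.eventually_lt_const hlt] with η hη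
    refine Eventually.of_forall fun v => ?_
    gcongr
  · have := lintegral_add_mul_rpow_ne_top hς hν ht0.le ht (A := ‖(E : ℂ)‖ₑ + 1) (B := ‖lam‖ₑ)
      (by finiteness) enorm_ne_top
    simpa only [add_comm] using this
  · refine Eventually.of_forall fun v => ?_
    exact (ENNReal.continuous_rpow_const.tendsto _).comp (tendsto_const_nhds.add he)

theorem siteMean_ne_top (hς : ς ∈ Set.Ioo (0 : ℝ) 1) (hν : ∫⁻ v, ‖v‖ₑ ^ ς ∂ν ≠ ∞)
    {t : ℝ} (ht0 : 0 ≤ t) (ht : t ≤ ς) {e m : ℝ≥0∞} (he : e ≠ ∞) (hm : m ≠ ∞) :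
    siteMean k ν lam t e m ≠ ∞ := by
  have := lintegral_add_mul_rpow_ne_top hς hν ht0 ht (A := e) (B := ‖lam‖ₑ) he enorm_ne_top
  simp_rw [add_comm e] at this
  rw [siteMean]
  finiteness

theorem UniformBounds.boundary_moment_ne_top_of_pos (hB : UniformBounds k ν lam ς B) (hς : 0 < ς)
    (h : HasBoundaryValues k ν lam E) {s : ℝ} (hs : s ∈ Set.Ioo (0 : ℝ) 1) (n : ℕ) :
    ∫⁻ v, ‖boundaryBranch k lam E n v‖ₑ ^ s ∂potLaw (k + 1) ν ≠ ∞ := by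
  obtain ⟨C, hC, H⟩ := hB.exists_moment_le hς hs n
  refine ne_top_of_le_ne_top hC (le_of_tendsto (hB.tendsto_moment_of_pos hς h hs n) ?_)
  filter_upwards [eventually_im_pos E] with η hη using H _ hη

/-- At t = ς no moment of higher order is available, so uniform integrability by a larger exponent
fails. The path majorant converges almost surely, and its mean, a polynomial in means already known
to converge, converges as well. -/
theorem UniformBounds.tendsto_moment_of_neg (hB : UniformBounds k ν lam ς B)
    (hς : ς ∈ Set.Ioo (0 : ℝ) 1) (hν : ∫⁻ v, ‖v‖ₑ ^ ς ∂ν ≠ ∞) (h : HasBoundaryValues k ν lam E)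
    {t : ℝ} (ht0 : 0 < t) (ht : t ≤ ς) (n : ℕ) :
    Tendsto (fun η : ℝ => ∫⁻ v, ‖branchKernel k lam ((E : ℂ) + (η : ℂ) * Complex.I) n v‖ₑ ^ (-t)
        ∂potLaw (k + 1) ν) (𝓝[>] 0)
      (𝓝 (∫⁻ v, ‖boundaryBranch k lam E n v‖ₑ ^ (-t) ∂potLaw (k + 1) ν)) ∧
    ∫⁻ v, ‖boundaryBranch k lam E n v‖ₑ ^ (-t) ∂potLaw (k + 1) ν ≠ ∞ := by
  have ht1 : t ≤ 1 := ht.trans hς.2.le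
  have htmem : t ∈ Set.Ioo (0 : ℝ) 1 := ⟨ht0, ht.trans_lt hς.2⟩
  have hae := h.aemeasurable_green (root (k + 1))
  -- The product formula for the majorant requires a measurable function, whereas boundary values
  -- are only almost everywhere measurable; a measurable version is used.
  set g : (Vertex (k + 1) → ℝ) → ℝ≥0∞ := fun v => ‖hae.mk _ v‖ₑ with hg
  have hgm : Measurable g := hae.measurable_mk.enorm
  have hgeq : ∀ᵐ v ∂potLaw (k + 1) ν, ‖boundaryBranch k lam E 0 v‖ₑ = g v := by
    filter_upwards [hae.ae_eq_mk] with v hv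
    simp only [hg, ← hv]
    rfl
  have hmom : ∫⁻ v, ‖boundaryBranch k lam E 0 v‖ₑ ^ t ∂potLaw (k + 1) ν
      = ∫⁻ v, g v ^ t ∂potLaw (k + 1) ν := by
    refine lintegral_congr_ae ?_
    filter_upwards [hgeq] with v hv
    rw [hv]
  have hmt : ∫⁻ v, g v ^ t ∂potLaw (k + 1) ν ≠ ∞ :=
    hmom ▸ hB.boundary_moment_ne_top_of_pos hς.1 h htmem 0
  have hlim0 : ∀ᵐ v ∂potLaw (k + 1) ν, Tendsto
      (fun η : ℝ => ‖rootGreen lam v ((E : ℂ) + (η : ℂ) * Complex.I)‖ₑ) (𝓝[>] 0) (𝓝 (g v)) := by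
    filter_upwards [hgeq, h.ae_tendsto_branchKernel 0] with v h1 h2
    rw [← h1]
    exact h2.2.enorm
  have hlimsh : ∀ i, ∀ᵐ v ∂potLaw (k + 1) ν, Tendsto
      (fun η : ℝ => ‖rootGreen lam (shiftPot v i) ((E : ℂ) + (η : ℂ) * Complex.I)‖ₑ ^ t)
      (𝓝[>] 0) (𝓝 (g (shiftPot v i) ^ t)) := by
    intro i
    filter_upwards [(measurePreserving_shiftPot i).quasiMeasurePreserving.ae hlim0] with v hv
    exact (ENNReal.continuous_rpow_const.tendsto _).comp hv
  have he := tendsto_enorm_add_mul_I E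
  have hsite : ∀ᵐ v ∂potLaw (k + 1) ν, Tendsto
      (fun η : ℝ => siteBound lam t ‖(E : ℂ) + (η : ℂ) * Complex.I‖ₑ
        (fun v => ‖rootGreen lam v ((E : ℂ) + (η : ℂ) * Complex.I)‖ₑ) v) (𝓝[>] 0)
      (𝓝 (siteBound lam t ‖(E : ℂ)‖ₑ g v)) := by
    filter_upwards [ae_all_iff.2 hlimsh] with v hv
    refine (tendsto_const_nhds.add ?_).add (tendsto_finsetSum _ fun j _ => hv _)
    exact (ENNReal.continuous_rpow_const.tendsto _).comp (tendsto_const_nhds.add he)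
  have hpath : ∀ n, ∀ᵐ v ∂potLaw (k + 1) ν, Tendsto
      (fun η : ℝ => pathBound lam t ‖(E : ℂ) + (η : ℂ) * Complex.I‖ₑ
        (fun v => ‖rootGreen lam v ((E : ℂ) + (η : ℂ) * Complex.I)‖ₑ) n v) (𝓝[>] 0)
      (𝓝 (pathBound lam t ‖(E : ℂ)‖ₑ g n v)) := by
    intro n
    induction n with
    | zero =>
      filter_upwards [hsite, hlimsh 0] with v h1 h2 using h1.add h2
    | succ n ih =>
      filter_upwards [hsite, (measurePreserving_shiftPot 0).quasiMeasurePreserving.ae ih]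
        with v h1 h2
      exact ENNReal.Tendsto.mul h1
        (Or.inl (zero_lt_one.trans_le (one_le_siteBound v)).ne') h2
        (Or.inl (zero_lt_one.trans_le (one_le_pathBound n _)).ne')
  have hmean := hB.tendsto_siteMean hς hν h ht0 ht
  rw [hmom] at hmean
  have hmean_ne := siteMean_ne_top (k := k) (lam := lam) hς hν ht0.le ht
    (e := ‖(E : ℂ)‖ₑ) enorm_ne_top hmt
  have hgt := hB.tendsto_moment_of_pos hς.1 h htmem 0
  rw [hmom] at hgt
  have hpathint : Tendsto (fun η : ℝ => ∫⁻ v, pathBound lam t ‖(E : ℂ) + (η : ℂ) * Complex.I‖ₑ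
        (fun v => ‖rootGreen lam v ((E : ℂ) + (η : ℂ) * Complex.I)‖ₑ) n v ∂potLaw (k + 1) ν)
      (𝓝[>] 0) (𝓝 (∫⁻ v, pathBound lam t ‖(E : ℂ)‖ₑ g n v ∂potLaw (k + 1) ν)) := by
    rw [lintegral_pathBound hgm]
    have hpow_ne : siteMean k ν lam t ‖(E : ℂ)‖ₑ (∫⁻ v, g v ^ t ∂potLaw (k + 1) ν) ^ n ≠ ∞ :=
      ENNReal.pow_ne_top hmean_ne
    refine Tendsto.congr' ?_ (ENNReal.Tendsto.mul (ENNReal.Tendsto.pow (n := n) hmean)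
      (Or.inr (ENNReal.add_ne_top.2 ⟨hmean_ne, hmt⟩)) (hmean.add hgt) (Or.inr hpow_ne))
    filter_upwards [eventually_im_pos E] with η hη
    rw [lintegral_pathBound (measurable_rootGreen hη).enorm]
    rfl
  have hpath_ne : ∫⁻ v, pathBound lam t ‖(E : ℂ)‖ₑ g n v ∂potLaw (k + 1) ν ≠ ∞ := by
    rw [lintegral_pathBound hgm]
    exact ENNReal.mul_ne_top (ENNReal.pow_ne_top hmean_ne) (ENNReal.add_ne_top.2 ⟨hmean_ne, hmt⟩)
  have hflim : ∀ᵐ v ∂potLaw (k + 1) ν, Tendsto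
      (fun η : ℝ => ‖branchKernel k lam ((E : ℂ) + (η : ℂ) * Complex.I) n v‖ₑ ^ (-t))
      (𝓝[>] 0) (𝓝 (‖boundaryBranch k lam E n v‖ₑ ^ (-t))) := by
    filter_upwards [h.ae_tendsto_branchKernel n] with v hv
    exact (ENNReal.continuous_rpow_const.tendsto _).comp hv.2.enorm
  have hle : ∀ᶠ η : ℝ in 𝓝[>] 0, ∀ v,
      ‖branchKernel k lam ((E : ℂ) + (η : ℂ) * Complex.I) n v‖ₑ ^ (-t)
      ≤ pathBound lam t ‖(E : ℂ) + (η : ℂ) * Complex.I‖ₑ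
        (fun v => ‖rootGreen lam v ((E : ℂ) + (η : ℂ) * Complex.I)‖ₑ) n v := by
    filter_upwards [eventually_im_pos E] with η hη v
    exact enorm_branchKernel_rpow_neg_le hη ht0 ht1 n v
  have hle0 : ∀ᵐ v ∂potLaw (k + 1) ν, ‖boundaryBranch k lam E n v‖ₑ ^ (-t)
      ≤ pathBound lam t ‖(E : ℂ)‖ₑ g n v := by
    filter_upwards [hflim, hpath n] with v h1 h2
    exact le_of_tendsto_of_tendsto h1 h2 (hle.mono fun η hη => hη v)
  refine ⟨tendsto_lintegral_of_le_tendsto ?_ ?_ (measurable_pathBound hgm n).aemeasurable hflim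
    (hpath n) hle hle0 hpath_ne hpathint, ne_top_of_le_ne_top hpath_ne (lintegral_mono_ae hle0)⟩
  · filter_upwards [eventually_im_pos E] with η hη
    exact ((measurable_branchKernel hη n).enorm.pow_const _).aemeasurable
  · filter_upwards [eventually_im_pos E] with η hη
    exact (measurable_pathBound (measurable_rootGreen hη).enorm n).aemeasurable

/-- The moments converge at the boundary, and the limits are finite. -/
theorem UniformBounds.tendsto_moment (hB : UniformBounds k ν lam ς B)
    (hς : ς ∈ Set.Ioo (0 : ℝ) 1) (hν : ∫⁻ v, ‖v‖ₑ ^ ς ∂ν ≠ ∞) (h : HasBoundaryValues k ν lam E)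
    {s : ℝ} (hs : s ∈ Set.Ico (-ς) 1) (n : ℕ) :
    Tendsto (fun η : ℝ => ∫⁻ v, ‖branchKernel k lam ((E : ℂ) + (η : ℂ) * Complex.I) n v‖ₑ ^ s
        ∂potLaw (k + 1) ν) (𝓝[>] 0)
      (𝓝 (∫⁻ v, ‖boundaryBranch k lam E n v‖ₑ ^ s ∂potLaw (k + 1) ν)) ∧
    ∫⁻ v, ‖boundaryBranch k lam E n v‖ₑ ^ s ∂potLaw (k + 1) ν ≠ ∞ := by
  rcases lt_trichotomy s 0 with h0 | rfl | h0
  · have := hB.tendsto_moment_of_neg hς hν h (t := -s) (by linarith) (by linarith [hs.1]) n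
    simpa using this
  · simp
  · exact ⟨hB.tendsto_moment_of_pos hς.1 h ⟨h0, hs.2⟩ n,
      hB.boundary_moment_ne_top_of_pos hς.1 h ⟨h0, hs.2⟩ n⟩

end BoundaryMoments

/-! ### All vertices of a level -/

section Levels

variable {k : ℕ} {ν : Measure ℝ} [IsProbabilityMeasure ν] {lam ς E : ℝ} {ζ : ℂ} {B : ℝ → ℝ≥0∞}

/-- The joint law of the Green functions at the root and at `x` depends only on the level. -/
theorem lintegral_pair_eq (hζ : 0 < ζ.im) (x : Vertex (k + 1)) {F : ℂ × ℂ → ℝ≥0∞}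
    (hF : Measurable F) :
    ∫⁻ v, F (rootGreen lam v ζ, resolventKernel lam v ζ (root (k + 1)) x) ∂potLaw (k + 1) ν
      = ∫⁻ v, F (rootGreen lam v ζ, branchKernel k lam ζ x.length v) ∂potLaw (k + 1) ν := by
  have := isProbabilityMeasure_stepLaw (k := k) ν (lam := lam) hζ
  induction x using List.reverseRecOn generalizing F with
  | nil => rfl
  | append_singleton y i ih =>
    have hH : Measurable fun q : ℂ × ℂ =>
        ∫⁻ W, F ((W - q.1)⁻¹, -(W - q.1)⁻¹ * q.2) ∂stepLaw k ν lam ζ := by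
      have h1 : Measurable fun q : (ℂ × ℂ) × ℂ =>
          F ((q.2 - q.1.1)⁻¹, -(q.2 - q.1.1)⁻¹ * q.1.2) := hF.comp (by fun_prop)
      exact h1.lintegral_prod_right'
    have hstep : ∀ (j : Fin (k + 1)) (φ : (Vertex (k + 1) → ℝ) → ℂ), Measurable φ →
        ∫⁻ v, F (rootGreen lam v ζ, -rootGreen lam v ζ * φ (shiftPot v j)) ∂potLaw (k + 1) ν
          = ∫⁻ u, ∫⁻ W, F ((W - rootGreen lam u ζ)⁻¹, -(W - rootGreen lam u ζ)⁻¹ * φ u)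
              ∂stepLaw k ν lam ζ ∂potLaw (k + 1) ν := by
      intro j φ hφ
      have h1 : Measurable (Function.uncurry fun (g : ℂ) (u : Vertex (k + 1) → ℝ) =>
          F (g, -g * φ u)) :=
        hF.comp (measurable_fst.prodMk (measurable_fst.neg.mul (hφ.comp measurable_snd)))
      exact lintegral_step ν hζ j h1
    simp only [resolventKernel_root_append hζ, List.length_append, List.length_singleton,
      branchKernel_succ hζ]
    rw [hstep i _ (measurable_resolventKernel hζ _ _), hstep 0 _ (measurable_branchKernel hζ _)]
    exact ih hH

theorem lintegral_resolventKernel_eq (hζ : 0 < ζ.im) (x : Vertex (k + 1)) {F : ℂ → ℝ≥0∞}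
    (hF : Measurable F) :
    ∫⁻ v, F (resolventKernel lam v ζ (root (k + 1)) x) ∂potLaw (k + 1) ν
      = ∫⁻ v, F (branchKernel k lam ζ x.length v) ∂potLaw (k + 1) ν :=
  lintegral_pair_eq hζ x (F := fun q => F q.2) (hF.comp measurable_snd)

/-- Equality of the laws is inherited from the upper half-plane. The truncations at R make bounded
convergence available for every real s, with no moment assumption, and are then removed by monotone
convergence. -/
theorem HasBoundaryValues.lintegral_green_eq (h : HasBoundaryValues k ν lam E) (s : ℝ)
    (x : Vertex (k + 1)) :
    ∫⁻ v, ‖green lam v E (root (k + 1)) x‖ₑ ^ s ∂potLaw (k + 1) ν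
      = ∫⁻ v, ‖boundaryBranch k lam E x.length v‖ₑ ^ s ∂potLaw (k + 1) ν := by
  have h1 : ∀ R : ℕ, ∫⁻ v, min (‖green lam v E (root (k + 1)) x‖ₑ ^ s) R ∂potLaw (k + 1) ν
      = ∫⁻ v, min (‖boundaryBranch k lam E x.length v‖ₑ ^ s) R ∂potLaw (k + 1) ν := by
    intro R
    have l1 := tendsto_lintegral_min (μ := potLaw (k + 1) ν) (l := 𝓝[>] (0 : ℝ))
      (f := fun η v => ‖resolventKernel lam v ((E : ℂ) + (η : ℂ) * Complex.I)
        (root (k + 1)) x‖ₑ ^ s) (g := fun v => ‖green lam v E (root (k + 1)) x‖ₑ ^ s) (by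
        filter_upwards [eventually_im_pos E] with η hη
        exact ((measurable_resolventKernel hη _ _).enorm.pow_const s).aemeasurable) (by
        filter_upwards [h.ae_tendsto_green] with v hv
        exact (ENNReal.continuous_rpow_const.tendsto _).comp (hv x).2.enorm) R
    have l2 := tendsto_lintegral_min (μ := potLaw (k + 1) ν) (l := 𝓝[>] (0 : ℝ))
      (f := fun η v => ‖branchKernel k lam ((E : ℂ) + (η : ℂ) * Complex.I) x.length v‖ₑ ^ s)
      (g := fun v => ‖boundaryBranch k lam E x.length v‖ₑ ^ s) (by
        filter_upwards [eventually_im_pos E] with η hη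
        exact ((measurable_branchKernel hη _).enorm.pow_const s).aemeasurable) (by
        filter_upwards [h.ae_tendsto_branchKernel x.length] with v hv
        exact (ENNReal.continuous_rpow_const.tendsto _).comp hv.2.enorm) R
    refine tendsto_nhds_unique l1 (l2.congr' ?_)
    filter_upwards [eventually_im_pos E] with η hη
    exact (lintegral_resolventKernel_eq hη x (F := fun z => min (‖z‖ₑ ^ s) R) (by fun_prop)).symm
  have l1 := tendsto_lintegral_min_natCast (μ := potLaw (k + 1) ν)
    ((h.aemeasurable_green x).enorm.pow_const s)
  have l2 := tendsto_lintegral_min_natCast (μ := potLaw (k + 1) ν)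
    ((h.aemeasurable_green (branch k x.length)).enorm.pow_const s)
  exact tendsto_nhds_unique l1 (l2.congr fun R => (h1 R).symm)

end Levels

/-! ### Energies on the real axis -/

section RealEnergy

open ProbabilityTheory

variable {k : ℕ} {ν : Measure ℝ} [IsProbabilityMeasure ν] {lam ς E : ℝ} {B : ℝ → ℝ≥0∞}

theorem UniformBounds.quasiMul_boundary (hB : UniformBounds k ν lam ς B)
    (hς : ς ∈ Set.Ioo (0 : ℝ) 1) (hν : ∫⁻ v, ‖v‖ₑ ^ ς ∂ν ≠ ∞) (h : HasBoundaryValues k ν lam E)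
    {s : ℝ} (hs : s ∈ Set.Ico (-ς) 1) :
    QuasiMul (boundaryBranch k lam E) (potLaw (k + 1) ν) B s := by
  intro n m
  have hD : B (orderBound s) ^ (|s| / orderBound s) ≠ ∞ := ENNReal.rpow_ne_top_of_nonneg
    (div_nonneg (abs_nonneg _) (orderBound_pos s).le) (hB.ne_top _)
  have t := fun n => hB.tendsto_moment hς hν h hs n
  have tm := ENNReal.Tendsto.mul (t n).1 (Or.inr (t m).2) (t m).1 (Or.inr (t n).2)
  constructor
  · refine le_of_tendsto_of_tendsto (t (n + m + 1)).1 (ENNReal.Tendsto.const_mul tm (Or.inr hD)) ?_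
    filter_upwards [eventually_im_pos E] with η hη
    exact (hB.quasiMul s hs _ hη n m).1
  · refine le_of_tendsto_of_tendsto tm
      (ENNReal.Tendsto.const_mul (t (n + m + 1)).1 (Or.inr hD)) ?_
    filter_upwards [eventually_im_pos E] with η hη
    exact (hB.quasiMul s hs _ hη n m).2

theorem HasBoundaryValues.norm_boundaryBranch_succ (h : HasBoundaryValues k ν lam E) (n : ℕ) :
    ∀ᵐ v ∂potLaw (k + 1) ν, ‖boundaryBranch k lam E (n + 1) v‖
      = ‖boundaryBranch k lam E 0 v‖ * ‖boundaryBranch k lam E n (shiftPot v 0)‖ := by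
  filter_upwards [h.ae_tendsto_branchKernel (n + 1), h.ae_tendsto_branchKernel 0,
    (measurePreserving_shiftPot 0).quasiMeasurePreserving.ae (h.ae_tendsto_branchKernel n)]
    with v h1 h2 h3
  refine tendsto_nhds_unique h1.2.norm ((h2.2.norm.mul h3.2.norm).congr' ?_)
  filter_upwards [eventually_im_pos E] with η hη
  rw [branchKernel_succ hη, norm_mul, norm_neg, branchKernel_zero]

theorem zero_mem_interior_Ico (hς : ς ∈ Set.Ioo (0 : ℝ) 1) :
    (0 : ℝ) ∈ interior (Set.Ico (-ς) 1) := by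
  rw [interior_Ico]
  exact ⟨by linarith [hς.1], one_pos⟩

theorem UniformBounds.isAlmostAdditive_boundary (hB : UniformBounds k ν lam ς B)
    (hς : ς ∈ Set.Ioo (0 : ℝ) 1) (hν : ∫⁻ v, ‖v‖ₑ ^ ς ∂ν ≠ ∞) (h : HasBoundaryValues k ν lam E) :
    IsAlmostAdditive (fun n v => Real.log ‖boundaryBranch k lam E n v‖) (potLaw (k + 1) ν)
      (Set.Ico (-ς) 1) (defect B) (2 * Real.log (B (1 / 2)).toReal) :=
  isAlmostAdditive_of_quasiMul (fun _ => h.aemeasurable_green _)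
    (fun n => (h.ae_tendsto_branchKernel n).mono fun _ hv => hv.1) (convex_Ico _ _)
    (zero_mem_interior_Ico hς) (fun _ hs n => (hB.tendsto_moment hς hν h hs n).2) hB.one_le hB.ne_top
    (fun _ hs => hB.quasiMul_boundary hς hν h hs) (measurePreserving_shiftPot 0)
    h.norm_boundaryBranch_succ

theorem UniformBounds.isAlmostAdditive (hB : UniformBounds k ν lam ς B)
    (hς : ς ∈ Set.Ioo (0 : ℝ) 1) (hν : ∫⁻ v, ‖v‖ₑ ^ ς ∂ν ≠ ∞) {ζ : ℂ} (hζ : 0 < ζ.im) :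
    IsAlmostAdditive (fun n v => Real.log ‖branchKernel k lam ζ n v‖) (potLaw (k + 1) ν)
      (Set.Ico (-ς) 1) (defect B) (2 * Real.log (B (1 / 2)).toReal) :=
  isAlmostAdditive_branchKernel hς hν hζ hB.one_le hB.ne_top (convex_Ico _ _)
    (zero_mem_interior_Ico hς) Set.Ico_subset_Ici_self fun _ hs => hB.quasiMul _ hs _ hζ

theorem UniformBounds.tendsto_cgf (hB : UniformBounds k ν lam ς B)
    (hς : ς ∈ Set.Ioo (0 : ℝ) 1) (hν : ∫⁻ v, ‖v‖ₑ ^ ς ∂ν ≠ ∞) (h : HasBoundaryValues k ν lam E)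
    {s : ℝ} (hs : s ∈ Set.Ico (-ς) 1) (n : ℕ) :
    Tendsto (fun η : ℝ => cgf (fun v => Real.log
        ‖branchKernel k lam ((E : ℂ) + (η : ℂ) * Complex.I) n v‖) (potLaw (k + 1) ν) s) (𝓝[>] 0)
      (𝓝 (cgf (fun v => Real.log ‖boundaryBranch k lam E n v‖) (potLaw (k + 1) ν) s)) := by
  obtain ⟨h1, h2⟩ := hB.tendsto_moment hς hν h hs n
  have h0 : ∀ᵐ v ∂potLaw (k + 1) ν, boundaryBranch k lam E n v ≠ 0 :=
    (h.ae_tendsto_branchKernel n).mono fun _ hv => hv.1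
  have hm : AEMeasurable (boundaryBranch k lam E n) (potLaw (k + 1) ν) := h.aemeasurable_green _
  have h3 := (ENNReal.tendsto_toReal h2).comp h1
  have hpos : (∫⁻ v, ‖boundaryBranch k lam E n v‖ₑ ^ s ∂potLaw (k + 1) ν).toReal ≠ 0 := by
    rw [lintegral_eq_ofReal_exp_cgf hm h0 h2,
      ENNReal.toReal_ofReal (Real.exp_pos _).le]
    exact (Real.exp_pos _).ne'
  have h4 := h3.log hpos
  rw [log_toReal_lintegral hm h0 h2] at h4
  refine h4.congr' ?_
  filter_upwards [eventually_im_pos E] with η hη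
  exact log_toReal_lintegral (measurable_branchKernel hη n).aemeasurable
    (Eventually.of_forall (branchKernel_ne_zero hη n))
    (lintegral_branchKernel_ne_top hς hν hη hs.1 n)

/-- The n-th quotient determines the rate up to d/(n+1) with the same d for all members of the
family. Convergence of the single term a(n), for one large n, therefore suffices. -/
theorem tendsto_rate {ι : Type*} {l : Filter ι} {a : ι → ℕ → ℝ} {a₀ : ℕ → ℝ} {d : ℝ}
    (ha : ∀ᶠ i in l, AlmostAdditive (a i) d) (ha₀ : AlmostAdditive a₀ d)
    (hlim : ∀ n, Tendsto (fun i => a i n) l (𝓝 (a₀ n))) :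
    Tendsto (fun i => rate (a i)) l (𝓝 (rate a₀)) := by
  rw [Metric.tendsto_nhds]
  intro ε hε
  obtain ⟨n, hn⟩ := exists_nat_gt ((2 * d + 1) / ε)
  have hn1 : (0 : ℝ) < n + 1 := by positivity
  have hd : 2 * d + 1 < ε * (n + 1) := by
    rw [div_lt_iff₀ hε] at hn
    linarith
  filter_upwards [ha, Metric.tendsto_nhds.1 (hlim n) 1 one_pos] with i h1 h2
  have h3 := h1.abs_sub_rate_le n
  have h4 := ha₀.abs_sub_rate_le n
  rw [Real.dist_eq] at h2 ⊢
  rw [abs_le] at h3 h4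
  rw [abs_lt] at h2
  have h5 : |(n + 1) * (rate (a i) - rate a₀)| < ε * (n + 1) := by
    rw [abs_lt]
    constructor <;> nlinarith
  rw [abs_mul, abs_of_pos hn1, mul_comm] at h5
  exact lt_of_mul_lt_mul_right h5 hn1.le

/-- The distance of the n-th quotient to its rate is O(1/n) uniformly along the family. This
uniformity gives the joint limit. -/
theorem tendsto_div_prod {ι κ : Type*} {l : Filter ι} {l' : Filter κ} {a : ι → ℕ → ℝ} {a₀ : ℕ → ℝ}
    {d : ℝ} {N : κ → ℕ} (ha : ∀ᶠ i in l, AlmostAdditive (a i) d) (ha₀ : AlmostAdditive a₀ d)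
    (hlim : ∀ n, Tendsto (fun i => a i n) l (𝓝 (a₀ n))) (hN : Tendsto N l' atTop) :
    Tendsto (fun p : κ × ι => a p.2 (N p.1) / N p.1) (l' ×ˢ l) (𝓝 (rate a₀)) := by
  have h1 : Tendsto (fun p : κ × ι => rate (a p.2)) (l' ×ˢ l) (𝓝 (rate a₀)) :=
    (tendsto_rate ha ha₀ hlim).comp tendsto_snd
  have h2 : Tendsto (fun p : κ × ι => (2 * d + (|a₀ 0| + 1)) / (N p.1 : ℝ)) (l' ×ˢ l) (𝓝 0) :=
    ((tendsto_const_div_atTop_nhds_zero_nat _).comp hN).comp tendsto_fst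
  have h3 : Tendsto (fun p : κ × ι => a p.2 (N p.1) / N p.1 - rate (a p.2)) (l' ×ˢ l) (𝓝 0) := by
    refine squeeze_zero_norm' ?_ h2
    have e1 : ∀ᶠ p : κ × ι in l' ×ˢ l, AlmostAdditive (a p.2) d := tendsto_snd.eventually ha
    have e2 : ∀ᶠ p : κ × ι in l' ×ˢ l, |a p.2 0| < |a₀ 0| + 1 :=
      tendsto_snd.eventually ((hlim 0).abs.eventually_lt_const (by linarith))
    have e3 : ∀ᶠ p : κ × ι in l' ×ˢ l, 0 < N p.1 :=
      tendsto_fst.eventually (hN.eventually_gt_atTop 0)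
    filter_upwards [e1, e2, e3] with p p1 p2 p3
    have hn' : (0 : ℝ) < N p.1 := by exact_mod_cast p3
    have h4 := p1.abs_sub_mul_rate_le (N p.1)
    rw [Real.norm_eq_abs, show a p.2 (N p.1) / N p.1 - rate (a p.2)
      = (a p.2 (N p.1) - N p.1 * rate (a p.2)) / N p.1 by field_simp, abs_div, abs_of_pos hn']
    gcongr
    linarith
  simpa using h3.add h1

theorem UniformBounds.tendsto_cgfRate (hB : UniformBounds k ν lam ς B)
    (hς : ς ∈ Set.Ioo (0 : ℝ) 1) (hν : ∫⁻ v, ‖v‖ₑ ^ ς ∂ν ≠ ∞) (h : HasBoundaryValues k ν lam E)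
    {s : ℝ} (hs : s ∈ Set.Ico (-ς) 1) :
    Tendsto (fun η : ℝ => cgfRate (fun n v => Real.log
        ‖branchKernel k lam ((E : ℂ) + (η : ℂ) * Complex.I) n v‖) (potLaw (k + 1) ν) s) (𝓝[>] 0)
      (𝓝 (cgfRate (fun n v => Real.log ‖boundaryBranch k lam E n v‖) (potLaw (k + 1) ν) s)) := by
  refine tendsto_rate (d := defect B s) ?_
    ((hB.isAlmostAdditive_boundary hς hν h).almostAdditive s hs)
    (hB.tendsto_cgf hς hν h hs)
  filter_upwards [eventually_im_pos E] with η hη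
  exact (hB.isAlmostAdditive hς hν hη).almostAdditive s hs

/-- On the axis the kernel has no deterministic upper bound, so monotonicity is obtained as a limit
from the upper half-plane. -/
theorem UniformBounds.antitoneOn_boundary (hB : UniformBounds k ν lam ς B)
    (hς : ς ∈ Set.Ioo (0 : ℝ) 1) (hν : ∫⁻ v, ‖v‖ₑ ^ ς ∂ν ≠ ∞) (h : HasBoundaryValues k ν lam E) :
    AntitoneOn (cgfRate (fun n v => Real.log ‖boundaryBranch k lam E n v‖) (potLaw (k + 1) ν))
      (Set.Ico (-ς) 1) := by
  intro s hs t ht hst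
  refine le_of_tendsto_of_tendsto (hB.tendsto_cgfRate hς hν h ht) (hB.tendsto_cgfRate hς hν h hs) ?_
  filter_upwards [eventually_im_pos E] with η hη
  exact antitoneOn_cgfRate_branchKernel hη (hB.isAlmostAdditive hς hν hη) hs ht hst

theorem exists_isAlmostAdditive_Ici (hς : ς ∈ Set.Ioo (0 : ℝ) 1)
    (hν : ∫⁻ v, ‖v‖ₑ ^ ς ∂ν ≠ ∞) {ζ : ℂ} (hζ : 0 < ζ.im) :
    ∃ d c, IsAlmostAdditive (fun n v => Real.log ‖branchKernel k lam ζ n v‖) (potLaw (k + 1) ν)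
      (Set.Ici (-ς)) d c := by
  obtain ⟨B', h1, h2, h3⟩ := exists_quasiMul (k := k) (lam := lam) hς hν hζ
  refine ⟨_, _, isAlmostAdditive_branchKernel hς hν hζ h1 h2 (convex_Ici _) ?_ subset_rfl h3⟩
  rw [interior_Ici]
  exact neg_lt_zero.2 hς.1

/-- For each η > 0 the orders up to 2 are accessible, with constants that depend on η. These do not
enter the resulting inequality, which passes to the limit. -/
theorem UniformBounds.boundary_rate_le (hB : UniformBounds k ν lam ς B)
    (hς : ς ∈ Set.Ioo (0 : ℝ) 1) (hν : ∫⁻ v, ‖v‖ₑ ^ ς ∂ν ≠ ∞) (h : HasBoundaryValues k ν lam E)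
    {s : ℝ} (hs : s ∈ Set.Ico (0 : ℝ) 1) :
    cgfRate (fun n v => Real.log ‖boundaryBranch k lam E n v‖) (potLaw (k + 1) ν) s
      ≤ -s * Real.log (Real.sqrt (k + 1 : ℕ)) := by
  have hs' : s ∈ Set.Ico (-ς) 1 := ⟨by linarith [hs.1, hς.1], hs.2⟩
  refine le_of_tendsto (hB.tendsto_cgfRate hς hν h hs') ?_
  filter_upwards [eventually_im_pos E] with η hη
  obtain ⟨d, c, hdc⟩ := exists_isAlmostAdditive_Ici (k := k) (lam := lam) hς hν hη
  exact cgfRate_le_of_le_two hς hν hη hdc (by rw [Set.mem_Ici]; linarith [hς.1])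
    ⟨hs.1, by linarith [hs.2]⟩

end RealEnergy

/-! ### Bounds on the moments at the root -/

section RootMoments

open ProbabilityTheory

variable {k : ℕ} {ν : Measure ℝ} [IsProbabilityMeasure ν] {lam ς E : ℝ} {B : ℝ → ℝ≥0∞}

/-- An upper bound for the moments of the Green function at the root. -/
noncomputable def rootBound (k : ℕ) (ν : Measure ℝ) (lam : ℝ) (B : ℝ → ℝ≥0∞) (u : ℝ) (e : ℝ≥0∞) :
    ℝ≥0∞ :=
  if 0 ≤ u then 1 + B u else siteMean k ν lam (-u) e (B (-u)) + B (-u)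

theorem one_le_rootBound (u : ℝ) (e : ℝ≥0∞) : 1 ≤ rootBound k ν lam B u e := by
  rw [rootBound]
  split_ifs
  · exact le_self_add
  · rw [siteMean, add_assoc, add_assoc]
    exact le_self_add

theorem rootBound_mono (u : ℝ) : Monotone (rootBound k ν lam B u) := by
  intro e e' h
  simp only [rootBound]
  split_ifs with hu
  · exact le_rfl
  · simp only [siteMean]
    have : 0 ≤ -u := by linarith
    gcongr

theorem UniformBounds.rootBound_ne_top (hB : UniformBounds k ν lam ς B)
    (hς : ς ∈ Set.Ioo (0 : ℝ) 1) (hν : ∫⁻ v, ‖v‖ₑ ^ ς ∂ν ≠ ∞) {u : ℝ} (hu : -ς ≤ u) {e : ℝ≥0∞}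
    (he : e ≠ ∞) : rootBound k ν lam B u e ≠ ∞ := by
  have h1 := hB.ne_top u
  have h2 := hB.ne_top (-u)
  rw [rootBound]
  split_ifs with hu0
  · finiteness
  · have := siteMean_ne_top (k := k) (lam := lam) hς hν (t := -u) (by linarith) (by linarith) he h2
    finiteness

theorem UniformBounds.root_moment_le (hB : UniformBounds k ν lam ς B)
    (hς : ς ∈ Set.Ioo (0 : ℝ) 1) {ζ : ℂ} (hζ : 0 < ζ.im) {u : ℝ} (hu : u ∈ Set.Ico (-ς) 1) :
    ∫⁻ v, ‖branchKernel k lam ζ 0 v‖ₑ ^ u ∂potLaw (k + 1) ν ≤ rootBound k ν lam B u ‖ζ‖ₑ := by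
  rw [rootBound]
  rcases lt_trichotomy u 0 with h0 | rfl | h0
  · rw [if_neg (not_le.2 h0)]
    have ht0 : 0 < -u := by linarith
    have ht1 : -u < 1 := by linarith [hu.1, hς.2]
    have hm := hB.moment_le (-u) ⟨ht0, ht1⟩ ζ hζ
    calc _ = ∫⁻ v, ‖branchKernel k lam ζ 0 v‖ₑ ^ (-(-u)) ∂potLaw (k + 1) ν := by rw [neg_neg]
      _ ≤ ∫⁻ v, pathBound lam (-u) ‖ζ‖ₑ (fun v => ‖rootGreen lam v ζ‖ₑ) 0 v ∂potLaw (k + 1) ν :=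
          lintegral_mono fun v => enorm_branchKernel_rpow_neg_le hζ ht0 ht1.le 0 v
      _ ≤ _ := by
          rw [lintegral_pathBound (measurable_rootGreen hζ).enorm, pow_zero, one_mul]
          simp only [siteMean]
          gcongr
  · simp
  · rw [if_pos h0.le]
    exact (hB.moment_le u ⟨h0, hu.2⟩ ζ hζ).trans le_add_self

/-- The added 1 leaves room for |E + iη|, which is slightly larger than |E| during the limit. -/
theorem UniformBounds.boundary_root_moment_le (hB : UniformBounds k ν lam ς B)
    (hς : ς ∈ Set.Ioo (0 : ℝ) 1) (hν : ∫⁻ v, ‖v‖ₑ ^ ς ∂ν ≠ ∞) (h : HasBoundaryValues k ν lam E)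
    {u : ℝ} (hu : u ∈ Set.Ico (-ς) 1) :
    ∫⁻ v, ‖boundaryBranch k lam E 0 v‖ₑ ^ u ∂potLaw (k + 1) ν
      ≤ rootBound k ν lam B u (‖(E : ℂ)‖ₑ + 1) := by
  refine le_of_tendsto (hB.tendsto_moment hς hν h hu 0).1 ?_
  have hlt : ‖(E : ℂ)‖ₑ < ‖(E : ℂ)‖ₑ + 1 := ENNReal.lt_add_right enorm_ne_top one_ne_zero
  filter_upwards [eventually_im_pos E, (tendsto_enorm_add_mul_I E).eventually_lt_const hlt]
    with η hη h2
  exact (hB.root_moment_le hς hη hu).trans (rootBound_mono u h2.le)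

/-- A bound for the logarithms of the moments at the root, of order below one. -/
noncomputable def logBound (k : ℕ) (ν : Measure ℝ) (lam ς : ℝ) (B : ℝ → ℝ≥0∞) (s : ℝ) (e : ℝ≥0∞) :
    ℝ :=
  (1 + |s| / ς) * (Real.log (rootBound k ν lam B s e).toReal
    + Real.log (rootBound k ν lam B ς e).toReal + Real.log (rootBound k ν lam B (-ς) e).toReal)

/-- A cumulant generating function is convex and vanishes at 0. Since 0 is a convex combination of s
and of whichever of ±ς has the opposite sign, the upper bound at that point forces a lower bound at
s. -/
theorem abs_cgf_le {α : Type*} [MeasurableSpace α] {μ : Measure α} [IsProbabilityMeasure μ]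
    {X : α → ℝ} (hς : 0 < ς) {s a : ℝ} (hs : s ∈ integrableExpSet X μ)
    (h₁ : ς ∈ integrableExpSet X μ) (h₂ : -ς ∈ integrableExpSet X μ) (ha : cgf X μ s ≤ a)
    (ha₁ : cgf X μ ς ≤ a) (ha₂ : cgf X μ (-ς) ≤ a) : |cgf X μ s| ≤ (1 + |s| / ς) * a := by
  have hconv := (convexOn_cgf (X := X) (μ := μ)).2
  have ha0 : 0 ≤ a := by
    have := hconv h₁ h₂ (show (0 : ℝ) ≤ 1 / 2 by norm_num) (show (0 : ℝ) ≤ 1 / 2 by norm_num)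
      (by norm_num)
    simp only [smul_eq_mul] at this
    rw [show 1 / 2 * ς + 1 / 2 * -ς = 0 by ring, cgf_zero] at this
    linarith
  have hr : 0 ≤ |s| / ς := by positivity
  rw [abs_le]
  refine ⟨?_, ha.trans (by nlinarith)⟩
  have hlow : -(|s| / ς * a) ≤ cgf X μ s := by
    have hden : 0 < |s| + ς := by positivity
    obtain ⟨w, hw, haw, hsw⟩ : ∃ w ∈ integrableExpSet X μ, cgf X μ w ≤ a ∧
        ς * s + |s| * w = 0 := by
      rcases le_total 0 s with h | h
      · exact ⟨-ς, h₂, ha₂, by rw [abs_of_nonneg h]; ring⟩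
      · exact ⟨ς, h₁, ha₁, by rw [abs_of_nonpos h]; ring⟩
    have := hconv hs hw (show 0 ≤ ς / (|s| + ς) by positivity)
      (show 0 ≤ |s| / (|s| + ς) by positivity) (by field_simp; ring)
    simp only [smul_eq_mul] at this
    rw [show ς / (|s| + ς) * s + |s| / (|s| + ς) * w = (ς * s + |s| * w) / (|s| + ς) by
      field_simp, hsw, zero_div, cgf_zero] at this
    have h3 : 0 ≤ ς * cgf X μ s + |s| * cgf X μ w := by
      have e : ς / (|s| + ς) * cgf X μ s + |s| / (|s| + ς) * cgf X μ w
        = (ς * cgf X μ s + |s| * cgf X μ w) / (|s| + ς) := by field_simp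
      rw [e] at this
      by_contra hcon
      push Not at hcon
      have := div_neg_of_neg_of_pos hcon hden
      linarith
    have h4 : |s| * cgf X μ w ≤ |s| * a := by gcongr
    have h5 : -(|s| * a) / ς ≤ cgf X μ s := by
      rw [div_le_iff₀ hς]
      linarith
    calc -(|s| / ς * a) = -(|s| * a) / ς := by ring
      _ ≤ _ := h5
  nlinarith

theorem UniformBounds.abs_cgf_le_logBound (hB : UniformBounds k ν lam ς B)
    (hς : ς ∈ Set.Ioo (0 : ℝ) 1) (hν : ∫⁻ v, ‖v‖ₑ ^ ς ∂ν ≠ ∞) {f : (Vertex (k + 1) → ℝ) → ℂ}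
    (hf : AEMeasurable f (potLaw (k + 1) ν)) (h0 : ∀ᵐ v ∂potLaw (k + 1) ν, f v ≠ 0) {e : ℝ≥0∞}
    (he : e ≠ ∞) (hle : ∀ u ∈ Set.Ico (-ς) 1, ∫⁻ v, ‖f v‖ₑ ^ u ∂potLaw (k + 1) ν
      ≤ rootBound k ν lam B u e) {s : ℝ} (hs : s ∈ Set.Ico (-ς) 1) :
    |cgf (fun v => Real.log ‖f v‖) (potLaw (k + 1) ν) s| ≤ logBound k ν lam ς B s e := by
  have hfin : ∀ u ∈ Set.Ico (-ς) 1, ∫⁻ v, ‖f v‖ₑ ^ u ∂potLaw (k + 1) ν ≠ ∞ := fun u hu =>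
    ne_top_of_le_ne_top (hB.rootBound_ne_top hς hν hu.1 he) (hle u hu)
  have hmem : ∀ u ∈ Set.Ico (-ς) 1, u ∈ integrableExpSet (fun v => Real.log ‖f v‖)
      (potLaw (k + 1) ν) := fun u hu => mem_integrableExpSet_of_lintegral hf h0 (hfin u hu)
  have hlog : ∀ u ∈ Set.Ico (-ς) 1, cgf (fun v => Real.log ‖f v‖) (potLaw (k + 1) ν) u
      ≤ Real.log (rootBound k ν lam B u e).toReal := by
    intro u hu
    rw [← log_toReal_lintegral hf h0 (hfin u hu)]
    have hpos : 0 < (∫⁻ v, ‖f v‖ₑ ^ u ∂potLaw (k + 1) ν).toReal := by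
      rw [lintegral_eq_ofReal_exp_cgf hf h0 (hfin u hu), ENNReal.toReal_ofReal (Real.exp_pos _).le]
      exact Real.exp_pos _
    exact Real.log_le_log hpos (ENNReal.toReal_mono (hB.rootBound_ne_top hς hν hu.1 he) (hle u hu))
  have hnn : ∀ u ∈ Set.Ico (-ς) 1, 0 ≤ Real.log (rootBound k ν lam B u e).toReal := by
    intro u hu
    refine Real.log_nonneg ?_
    have := ENNReal.toReal_mono (hB.rootBound_ne_top hς hν hu.1 he)
      (one_le_rootBound (k := k) (ν := ν) (lam := lam) (B := B) u e)
    simpa using this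
  have m1 : ς ∈ Set.Ico (-ς) 1 := ⟨by linarith [hς.1], hς.2⟩
  have m2 : -ς ∈ Set.Ico (-ς) 1 := ⟨le_rfl, by linarith [hς.1]⟩
  have b0 := hlog s hs
  have b1 := hlog _ m1
  have b2 := hlog _ m2
  have c0 := hnn s hs
  have c1 := hnn _ m1
  have c2 := hnn _ m2
  exact abs_cgf_le hς.1 (hmem s hs) (hmem _ m1) (hmem _ m2) (by linarith) (by linarith)
    (by linarith)

end RootMoments

/-! ### Green function moments of the random potential -/

section FreeEnergy

open ProbabilityTheory

variable {k : ℕ} {Ω : Type*} [MeasurableSpace Ω] {P : Measure Ω} {V : Vertex (k + 1) → Ω → ℝ}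
  {lam s : ℝ} {ζ : ℂ}

theorem tendsto_level_levelAtTop (K : ℕ) : Tendsto (level (K := K)) (levelAtTop K) atTop :=
  tendsto_comap

/-- Nontriviality of the filter makes the limit defining the free energy unique. -/
instance levelAtTop_neBot : (levelAtTop (k + 1)).NeBot :=
  comap_neBot_iff_frequently.2 (Eventually.frequently (Eventually.of_forall fun n =>
    ⟨branch k n, by rw [level_eq_length, List.length_replicate]⟩))

theorem logMomentRate_eq {a : ℕ → ℝ} {x : Vertex (k + 1)}
    (h : greenMoment P V lam s ζ x = ENNReal.ofReal (Real.exp (a x.length))) :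
    logMomentRate P V lam s ζ x = a (level x) / level x := by
  rw [logMomentRate, h, ENNReal.toReal_ofReal (Real.exp_pos _).le, Real.log_exp, level_eq_length]

theorem tendsto_logMomentRate {a : ℕ → ℝ} {d : ℝ} (ha : AlmostAdditive a d)
    (h : ∀ x, greenMoment P V lam s ζ x = ENNReal.ofReal (Real.exp (a x.length))) :
    Tendsto (logMomentRate P V lam s ζ) (levelAtTop (k + 1)) (𝓝 (rate a)) :=
  (ha.tendsto_rate.comp (tendsto_level_levelAtTop _)).congr fun x => (logMomentRate_eq (h x)).symm

theorem freeEnergy_eq {a : ℕ → ℝ} {d : ℝ} (ha : AlmostAdditive a d)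
    (h : ∀ x, greenMoment P V lam s ζ x = ENNReal.ofReal (Real.exp (a x.length))) :
    freeEnergy P V lam s ζ = rate a :=
  (tendsto_logMomentRate ha h).limUnder_eq

theorem greenMoment_bounds {a : ℕ → ℝ} {d b : ℝ} (ha : AlmostAdditive a d)
    (h : ∀ x, greenMoment P V lam s ζ x = ENNReal.ofReal (Real.exp (a x.length)))
    (hb : 2 * d + |a 0| ≤ b) (x : Vertex (k + 1)) :
    ENNReal.ofReal ((Real.exp (b / 2) ^ 2)⁻¹
        * Real.exp ((level x : ℝ) * freeEnergy P V lam s ζ)) ≤ greenMoment P V lam s ζ x ∧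
      greenMoment P V lam s ζ x ≤ ENNReal.ofReal (Real.exp (b / 2) ^ 2
        * Real.exp ((level x : ℝ) * freeEnergy P V lam s ζ)) := by
  have h1 := abs_le.1 ((ha.abs_sub_mul_rate_le x.length).trans hb)
  have h2 : Real.exp (b / 2) ^ 2 = Real.exp b := by
    rw [← Real.exp_nat_mul]
    congr 1
    push_cast
    ring
  rw [freeEnergy_eq ha h, h x, h2, ← Real.exp_neg, ← Real.exp_add, ← Real.exp_add,
    level_eq_length]
  constructor <;>
  · gcongr
    linarith [h1.1, h1.2]

variable {ν : Measure ℝ} [IsProbabilityMeasure ν] {X : ℕ → (Vertex (k + 1) → ℝ) → ℝ} {I : Set ℝ}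
  {d : ℝ → ℝ} {c : ℝ}

theorem IsAlmostAdditive.tendsto_logMomentRate (hX : IsAlmostAdditive X (potLaw (k + 1) ν) I d c)
    (h : ∀ s ∈ I, ∀ x, greenMoment P V lam s ζ x
      = ENNReal.ofReal (Real.exp (cgf (X x.length) (potLaw (k + 1) ν) s))) (hs : s ∈ I) :
    Tendsto (logMomentRate P V lam s ζ) (levelAtTop (k + 1))
      (𝓝 (freeEnergy P V lam s ζ)) := by
  rw [freeEnergy_eq (hX.almostAdditive s hs) (h s hs)]
  exact TreeAnderson.tendsto_logMomentRate (hX.almostAdditive s hs) (h s hs)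

theorem IsAlmostAdditive.eqOn_freeEnergy (hX : IsAlmostAdditive X (potLaw (k + 1) ν) I d c)
    (h : ∀ s ∈ I, ∀ x, greenMoment P V lam s ζ x
      = ENNReal.ofReal (Real.exp (cgf (X x.length) (potLaw (k + 1) ν) s))) :
    Set.EqOn (cgfRate X (potLaw (k + 1) ν)) (fun s => freeEnergy P V lam s ζ) I :=
  fun s hs => (freeEnergy_eq (hX.almostAdditive s hs) (h s hs)).symm

theorem IsAlmostAdditive.integrable_log_green (hX : IsAlmostAdditive X (potLaw (k + 1) ν) I d c)
    (hV : MeasurePreserving (fun ω x => V x ω) P (potLaw (k + 1) ν))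
    (h0 : ∀ v, Real.log ‖green lam v ζ (root (k + 1)) (root (k + 1))‖ = X 0 v) :
    Integrable (fun ω => Real.log ‖green lam (fun y => V y ω) ζ (root (k + 1)) (root (k + 1))‖)
      P := by
  simp only [h0]
  exact hV.integrable_comp_of_integrable hX.integrable_zero

theorem IsAlmostAdditive.neg_lyapunov_eq (hX : IsAlmostAdditive X (potLaw (k + 1) ν) I d c)
    (hV : MeasurePreserving (fun ω x => V x ω) P (potLaw (k + 1) ν))
    (h0 : ∀ v, Real.log ‖green lam v ζ (root (k + 1)) (root (k + 1))‖ = X 0 v) :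
    -lyapunov P V lam ζ = ∫ v, X 0 v ∂potLaw (k + 1) ν := by
  simp only [lyapunov, neg_neg, h0]
  rw [← hV.map_eq, integral_map hV.aemeasurable]
  rw [hV.map_eq]
  exact hX.integrable_zero.1

theorem IsAlmostAdditive.hasDerivAt_freeEnergy
    (hX : IsAlmostAdditive X (potLaw (k + 1) ν) I d c)
    (hV : MeasurePreserving (fun ω x => V x ω) P (potLaw (k + 1) ν))
    (h : ∀ s ∈ I, ∀ x, greenMoment P V lam s ζ x
      = ENNReal.ofReal (Real.exp (cgf (X x.length) (potLaw (k + 1) ν) s)))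
    (h0 : ∀ v, Real.log ‖green lam v ζ (root (k + 1)) (root (k + 1))‖ = X 0 v) :
    HasDerivAt (fun s => freeEnergy P V lam s ζ) (-lyapunov P V lam ζ) 0 := by
  rw [hX.neg_lyapunov_eq hV h0]
  refine hX.hasDerivAt.congr_of_eventuallyEq ?_
  filter_upwards [mem_interior_iff_mem_nhds.1 hX.mem_interior] with s hs
  exact (hX.eqOn_freeEnergy h hs).symm

theorem IsAlmostAdditive.neg_mul_lyapunov_le (hX : IsAlmostAdditive X (potLaw (k + 1) ν) I d c)
    (hV : MeasurePreserving (fun ω x => V x ω) P (potLaw (k + 1) ν))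
    (h : ∀ s ∈ I, ∀ x, greenMoment P V lam s ζ x
      = ENNReal.ofReal (Real.exp (cgf (X x.length) (potLaw (k + 1) ν) s)))
    (h0 : ∀ v, Real.log ‖green lam v ζ (root (k + 1)) (root (k + 1))‖ = X 0 v) (hs0 : 0 ≤ s)
    (hs : s ∈ I) : -s * lyapunov P V lam ζ ≤ freeEnergy P V lam s ζ := by
  have := hX.mul_le_rate hs0 hs
  rw [← hX.neg_lyapunov_eq hV h0, hX.eqOn_freeEnergy h hs] at this
  linarith

theorem log_norm_green_of_pos (hζ : 0 < ζ.im) (v : Vertex (k + 1) → ℝ) :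
    Real.log ‖green lam v ζ (root (k + 1)) (root (k + 1))‖
      = Real.log ‖branchKernel k lam ζ 0 v‖ := by
  rw [green_of_pos hζ]
  rfl

variable {ς E : ℝ} {B : ℝ → ℝ≥0∞}

theorem greenMoment_eq_lintegral_branchKernel
    (hV : MeasurePreserving (fun ω x => V x ω) P (potLaw (k + 1) ν)) (hζ : 0 < ζ.im) (s : ℝ)
    (x : Vertex (k + 1)) :
    greenMoment P V lam s ζ x
      = ∫⁻ v, ‖branchKernel k lam ζ x.length v‖ₑ ^ s ∂potLaw (k + 1) ν := by
  have hm : Measurable fun v : Vertex (k + 1) → ℝ =>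
      ‖resolventKernel lam v ζ (root (k + 1)) x‖ₑ ^ s :=
    (measurable_resolventKernel hζ _ _).enorm.pow_const s
  rw [← lintegral_resolventKernel_eq hζ x (F := fun z => ‖z‖ₑ ^ s) (by fun_prop),
    ← hV.lintegral_comp hm]
  simp only [greenMoment, green_of_pos hζ]

theorem greenMoment_eq_of_pos
    (hV : MeasurePreserving (fun ω x => V x ω) P (potLaw (k + 1) ν))
    (hς : ς ∈ Set.Ioo (0 : ℝ) 1) (hν : ∫⁻ v, ‖v‖ₑ ^ ς ∂ν ≠ ∞) (hζ : 0 < ζ.im)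
    (hs : s ∈ Set.Ici (-ς)) (x : Vertex (k + 1)) :
    greenMoment P V lam s ζ x = ENNReal.ofReal (Real.exp
      (cgf (fun v => Real.log ‖branchKernel k lam ζ x.length v‖) (potLaw (k + 1) ν) s)) := by
  rw [greenMoment_eq_lintegral_branchKernel hV hζ]
  exact lintegral_eq_ofReal_exp_cgf (measurable_branchKernel hζ _).aemeasurable
    (Eventually.of_forall (branchKernel_ne_zero hζ _)) (lintegral_branchKernel_ne_top hς hν hζ hs _)

theorem HasBoundaryValues.greenMoment_eq_lintegral (h : HasBoundaryValues k ν lam E)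
    (hV : MeasurePreserving (fun ω x => V x ω) P (potLaw (k + 1) ν)) (s : ℝ)
    (x : Vertex (k + 1)) :
    greenMoment P V lam s E x
      = ∫⁻ v, ‖boundaryBranch k lam E x.length v‖ₑ ^ s ∂potLaw (k + 1) ν := by
  have hm : AEMeasurable (fun v : Vertex (k + 1) → ℝ => ‖green lam v E (root (k + 1)) x‖ₑ ^ s)
      (P.map fun ω x => V x ω) := by
    rw [hV.map_eq]
    exact (h.aemeasurable_green x).enorm.pow_const s
  rw [← h.lintegral_green_eq, ← hV.map_eq, lintegral_map' hm hV.aemeasurable]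
  rfl

theorem UniformBounds.greenMoment_eq_boundary (hB : UniformBounds k ν lam ς B)
    (hV : MeasurePreserving (fun ω x => V x ω) P (potLaw (k + 1) ν))
    (hς : ς ∈ Set.Ioo (0 : ℝ) 1) (hν : ∫⁻ v, ‖v‖ₑ ^ ς ∂ν ≠ ∞) (h : HasBoundaryValues k ν lam E)
    (hs : s ∈ Set.Ico (-ς) 1) (x : Vertex (k + 1)) :
    greenMoment P V lam s E x = ENNReal.ofReal (Real.exp
      (cgf (fun v => Real.log ‖boundaryBranch k lam E x.length v‖) (potLaw (k + 1) ν) s)) := by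
  have hm : AEMeasurable (boundaryBranch k lam E x.length) (potLaw (k + 1) ν) :=
    h.aemeasurable_green _
  rw [h.greenMoment_eq_lintegral hV]
  exact lintegral_eq_ofReal_exp_cgf hm ((h.ae_tendsto_branchKernel _).mono fun _ hv => hv.1)
    (hB.tendsto_moment hς hν h hs _).2

/-! ### The constants -/

theorem UniformBounds.logBound_mono (hB : UniformBounds k ν lam ς B)
    (hς : ς ∈ Set.Ioo (0 : ℝ) 1) (hν : ∫⁻ v, ‖v‖ₑ ^ ς ∂ν ≠ ∞) (hs : -ς ≤ s) {e e' : ℝ≥0∞}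
    (he : e ≤ e') (he' : e' ≠ ∞) : logBound k ν lam ς B s e ≤ logBound k ν lam ς B s e' := by
  have h : ∀ u, -ς ≤ u → Real.log (rootBound k ν lam B u e).toReal
      ≤ Real.log (rootBound k ν lam B u e').toReal := by
    intro u hu
    have h1 := hB.rootBound_ne_top hς hν hu he'
    have h2 : rootBound k ν lam B u e ≤ rootBound k ν lam B u e' := rootBound_mono u he
    refine Real.log_le_log (ENNReal.toReal_pos ?_ (ne_top_of_le_ne_top h1 h2))
      (ENNReal.toReal_mono h1 h2)
    exact (zero_lt_one.trans_le (one_le_rootBound u e)).ne'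
  have := hς.1
  simp only [logBound]
  exact mul_le_mul_of_nonneg_left
    (add_le_add (add_le_add (h s hs) (h ς (by linarith))) (h (-ς) le_rfl)) (by positivity)

/-- The argument ‖ζ‖ + 1 is larger than necessary here; it makes the formula for the constant the
same on the real axis. -/
theorem UniformBounds.abs_cgf_branchKernel_le (hB : UniformBounds k ν lam ς B)
    (hς : ς ∈ Set.Ioo (0 : ℝ) 1) (hν : ∫⁻ v, ‖v‖ₑ ^ ς ∂ν ≠ ∞) (hζ : 0 < ζ.im)
    (hs : s ∈ Set.Ico (-ς) 1) :
    |cgf (fun v => Real.log ‖branchKernel k lam ζ 0 v‖) (potLaw (k + 1) ν) s|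
      ≤ logBound k ν lam ς B s (‖ζ‖ₑ + 1) :=
  (hB.abs_cgf_le_logBound hς hν (measurable_branchKernel hζ 0).aemeasurable
    (Eventually.of_forall (branchKernel_ne_zero hζ 0)) enorm_ne_top
    (fun _ hu => hB.root_moment_le hς hζ hu) hs).trans
    (hB.logBound_mono hς hν hs.1 le_self_add (by finiteness))

theorem UniformBounds.abs_cgf_boundaryBranch_le (hB : UniformBounds k ν lam ς B)
    (hς : ς ∈ Set.Ioo (0 : ℝ) 1) (hν : ∫⁻ v, ‖v‖ₑ ^ ς ∂ν ≠ ∞) (h : HasBoundaryValues k ν lam E)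
    (hs : s ∈ Set.Ico (-ς) 1) :
    |cgf (fun v => Real.log ‖boundaryBranch k lam E 0 v‖) (potLaw (k + 1) ν) s|
      ≤ logBound k ν lam ς B s (‖(E : ℂ)‖ₑ + 1) :=
  hB.abs_cgf_le_logBound hς hν (h.aemeasurable_green _)
    ((h.ae_tendsto_branchKernel 0).mono fun _ hv => hv.1) (by finiteness)
    (fun _ hu => hB.boundary_root_moment_le hς hν h hu) hs

/-- Constants for the moment bounds at any energy in the upper half-plane. -/
theorem exists_moment_constant (hς : ς ∈ Set.Ioo (0 : ℝ) 1) (hν : ∫⁻ v, ‖v‖ₑ ^ ς ∂ν ≠ ∞) :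
    ∃ b : ℝ → ℂ → ℝ, ∀ s ∈ Set.Ici (-ς), ∀ ζ : ℂ, 0 < ζ.im → ∃ d,
      AlmostAdditive (fun n => cgf (fun v => Real.log ‖branchKernel k lam ζ n v‖)
        (potLaw (k + 1) ν) s) d ∧
      2 * d + |cgf (fun v => Real.log ‖branchKernel k lam ζ 0 v‖) (potLaw (k + 1) ν) s| ≤ b s ζ := by
  have : ∀ (s : ℝ) (ζ : ℂ), ∃ b : ℝ, s ∈ Set.Ici (-ς) → 0 < ζ.im → ∃ d,
      AlmostAdditive (fun n => cgf (fun v => Real.log ‖branchKernel k lam ζ n v‖)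
        (potLaw (k + 1) ν) s) d ∧
      2 * d + |cgf (fun v => Real.log ‖branchKernel k lam ζ 0 v‖) (potLaw (k + 1) ν) s| ≤ b := by
    intro s ζ
    by_cases hζ : 0 < ζ.im
    · obtain ⟨d, c, h⟩ := exists_isAlmostAdditive_Ici (k := k) (lam := lam) hς hν hζ
      exact ⟨_, fun hs _ => ⟨d s, h.almostAdditive s hs, le_rfl⟩⟩
    · exact ⟨0, fun _ h => absurd h hζ⟩
  choose b hb using this
  exact ⟨b, fun s hs ζ hζ => hb s ζ hs hζ⟩

/-- The bound for `2 log C`, where `C` is the constant of the theorem. -/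
noncomputable def momentBound (k : ℕ) (ν : Measure ℝ) (lam ς : ℝ) (B : ℝ → ℝ≥0∞)
    (b : ℝ → ℂ → ℝ) (s : ℝ) (ζ : ℂ) : ℝ :=
  if s < 1 then 2 * defect B s + logBound k ν lam ς B s (‖ζ‖ₑ + 1) else b s ζ

theorem UniformBounds.exists_momentBound_le (hB : UniformBounds k ν lam ς B)
    (hς : ς ∈ Set.Ioo (0 : ℝ) 1) (hν : ∫⁻ v, ‖v‖ₑ ^ ς ∂ν ≠ ∞) (b : ℝ → ℂ → ℝ)
    (hs : s ∈ Set.Ico (-ς) 1) {A : Set ℝ} (hA : IsCompact A) :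
    ∃ D, ∀ E ∈ A, ∀ η ∈ Set.Icc (0 : ℝ) 1,
      momentBound k ν lam ς B b s ((E : ℂ) + (η : ℂ) * Complex.I) ≤ D := by
  obtain ⟨R, hR⟩ := hA.isBounded.exists_norm_le
  refine ⟨2 * defect B s + logBound k ν lam ς B s (ENNReal.ofReal (R + 1) + 1),
    fun E hE η hη => ?_⟩
  rw [momentBound, if_pos hs.2]
  have h1 : ‖(E : ℂ) + (η : ℂ) * Complex.I‖ ≤ R + 1 := by
    refine (norm_add_le _ _).trans (add_le_add ?_ ?_)
    · simpa using hR E hE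
    · simpa [abs_of_nonneg hη.1] using hη.2
  gcongr
  refine hB.logBound_mono hς hν hs.1 ?_ (by finiteness)
  rw [← ofReal_norm]
  gcongr

/-- Orders below one use the constants that stay bounded up to the real axis; the remaining orders
use constants chosen separately for each energy. -/
theorem UniformBounds.greenMoment_bounds_of_pos (hB : UniformBounds k ν lam ς B)
    (hV : MeasurePreserving (fun ω x => V x ω) P (potLaw (k + 1) ν))
    (hς : ς ∈ Set.Ioo (0 : ℝ) 1) (hν : ∫⁻ v, ‖v‖ₑ ^ ς ∂ν ≠ ∞) {b : ℝ → ℂ → ℝ}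
    (hb : ∀ s ∈ Set.Ici (-ς), ∀ ζ : ℂ, 0 < ζ.im → ∃ d,
      AlmostAdditive (fun n => cgf (fun v => Real.log ‖branchKernel k lam ζ n v‖)
        (potLaw (k + 1) ν) s) d ∧
      2 * d + |cgf (fun v => Real.log ‖branchKernel k lam ζ 0 v‖) (potLaw (k + 1) ν) s| ≤ b s ζ)
    (hζ : 0 < ζ.im) (hs : s ∈ Set.Ici (-ς)) (x : Vertex (k + 1)) :
    ENNReal.ofReal ((Real.exp (momentBound k ν lam ς B b s ζ / 2) ^ 2)⁻¹
        * Real.exp ((level x : ℝ) * freeEnergy P V lam s ζ)) ≤ greenMoment P V lam s ζ x ∧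
      greenMoment P V lam s ζ x ≤ ENNReal.ofReal
        (Real.exp (momentBound k ν lam ς B b s ζ / 2) ^ 2
          * Real.exp ((level x : ℝ) * freeEnergy P V lam s ζ)) := by
  have hmom := greenMoment_eq_of_pos (lam := lam) hV hς hν hζ hs
  rw [momentBound]
  split_ifs with h1
  · refine greenMoment_bounds ((hB.isAlmostAdditive hς hν hζ).almostAdditive s ⟨hs, h1⟩) hmom ?_ x
    gcongr
    exact hB.abs_cgf_branchKernel_le hς hν hζ ⟨hs, h1⟩
  · obtain ⟨d, hd, hle⟩ := hb s hs ζ hζ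
    exact greenMoment_bounds hd hmom hle x

theorem UniformBounds.greenMoment_bounds_boundary (hB : UniformBounds k ν lam ς B)
    (hV : MeasurePreserving (fun ω x => V x ω) P (potLaw (k + 1) ν))
    (hς : ς ∈ Set.Ioo (0 : ℝ) 1) (hν : ∫⁻ v, ‖v‖ₑ ^ ς ∂ν ≠ ∞) (b : ℝ → ℂ → ℝ)
    (h : HasBoundaryValues k ν lam E) (hs : s ∈ Set.Ico (-ς) 1) (x : Vertex (k + 1)) :
    ENNReal.ofReal ((Real.exp (momentBound k ν lam ς B b s E / 2) ^ 2)⁻¹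
        * Real.exp ((level x : ℝ) * freeEnergy P V lam s E)) ≤ greenMoment P V lam s E x ∧
      greenMoment P V lam s E x ≤ ENNReal.ofReal
        (Real.exp (momentBound k ν lam ς B b s E / 2) ^ 2
          * Real.exp ((level x : ℝ) * freeEnergy P V lam s E)) := by
  rw [momentBound, if_pos hs.2]
  refine greenMoment_bounds ((hB.isAlmostAdditive_boundary hς hν h).almostAdditive s hs)
    (hB.greenMoment_eq_boundary hV hς hν h hs) ?_ x
  gcongr
  exact hB.abs_cgf_boundaryBranch_le hς hν h hs

/-! ### Convergence at the real axis -/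

theorem HasBoundaryValues.ae_tendsto_green_eval (h : HasBoundaryValues k ν lam E)
    (hV : MeasurePreserving (fun ω x => V x ω) P (potLaw (k + 1) ν)) :
    ∀ᵐ ω ∂P, ∀ x, Tendsto (fun η : ℝ => green lam (fun y => V y ω)
      ((E : ℂ) + (η : ℂ) * Complex.I) (root (k + 1)) x) (𝓝[>] 0)
      (𝓝 (green lam (fun y => V y ω) E (root (k + 1)) x)) := by
  filter_upwards [hV.quasiMeasurePreserving.ae h.ae_tendsto_green] with ω hω x
  refine (hω x).2.congr' ?_
  filter_upwards [eventually_im_pos E] with η hη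
  exact (green_of_pos hη _ _).symm

theorem UniformBounds.tendsto_greenMoment (hB : UniformBounds k ν lam ς B)
    (hV : MeasurePreserving (fun ω x => V x ω) P (potLaw (k + 1) ν))
    (hς : ς ∈ Set.Ioo (0 : ℝ) 1) (hν : ∫⁻ v, ‖v‖ₑ ^ ς ∂ν ≠ ∞) (h : HasBoundaryValues k ν lam E)
    (hs : s ∈ Set.Ico (-ς) 1) (x : Vertex (k + 1)) :
    Tendsto (fun η : ℝ => greenMoment P V lam s ((E : ℂ) + (η : ℂ) * Complex.I) x) (𝓝[>] 0)
      (𝓝 (greenMoment P V lam s E x)) := by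
  rw [h.greenMoment_eq_lintegral hV]
  refine (hB.tendsto_moment hς hν h hs x.length).1.congr' ?_
  filter_upwards [eventually_im_pos E] with η hη
  exact (greenMoment_eq_lintegral_branchKernel hV hη s x).symm

theorem UniformBounds.freeEnergy_boundary (hB : UniformBounds k ν lam ς B)
    (hV : MeasurePreserving (fun ω x => V x ω) P (potLaw (k + 1) ν))
    (hς : ς ∈ Set.Ioo (0 : ℝ) 1) (hν : ∫⁻ v, ‖v‖ₑ ^ ς ∂ν ≠ ∞) (h : HasBoundaryValues k ν lam E)
    (hs : s ∈ Set.Ico (-ς) 1) :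
    freeEnergy P V lam s E = cgfRate (fun n v => Real.log ‖boundaryBranch k lam E n v‖)
      (potLaw (k + 1) ν) s :=
  freeEnergy_eq ((hB.isAlmostAdditive_boundary hς hν h).almostAdditive s hs)
    (hB.greenMoment_eq_boundary hV hς hν h hs)

theorem UniformBounds.tendsto_freeEnergy (hB : UniformBounds k ν lam ς B)
    (hV : MeasurePreserving (fun ω x => V x ω) P (potLaw (k + 1) ν))
    (hς : ς ∈ Set.Ioo (0 : ℝ) 1) (hν : ∫⁻ v, ‖v‖ₑ ^ ς ∂ν ≠ ∞) (h : HasBoundaryValues k ν lam E)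
    (hs : s ∈ Set.Ico (-ς) 1) :
    Tendsto (fun η : ℝ => freeEnergy P V lam s ((E : ℂ) + (η : ℂ) * Complex.I)) (𝓝[>] 0)
      (𝓝 (freeEnergy P V lam s E)) := by
  rw [hB.freeEnergy_boundary hV hς hν h hs]
  refine (hB.tendsto_cgfRate hς hν h hs).congr' ?_
  filter_upwards [eventually_im_pos E] with η hη
  exact (freeEnergy_eq ((hB.isAlmostAdditive hς hν hη).almostAdditive s hs)
    (greenMoment_eq_of_pos hV hς hν hη hs.1)).symm

theorem UniformBounds.tendsto_logMomentRate_prod (hB : UniformBounds k ν lam ς B)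
    (hV : MeasurePreserving (fun ω x => V x ω) P (potLaw (k + 1) ν))
    (hς : ς ∈ Set.Ioo (0 : ℝ) 1) (hν : ∫⁻ v, ‖v‖ₑ ^ ς ∂ν ≠ ∞) (h : HasBoundaryValues k ν lam E)
    (hs : s ∈ Set.Ico (-ς) 1) :
    Tendsto (fun p : Vertex (k + 1) × ℝ => logMomentRate P V lam s
        ((E : ℂ) + (p.2 : ℂ) * Complex.I) p.1) (levelAtTop (k + 1) ×ˢ 𝓝[>] 0)
      (𝓝 (freeEnergy P V lam s E)) := by
  rw [hB.freeEnergy_boundary hV hς hν h hs]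
  have hadd : ∀ᶠ η : ℝ in 𝓝[>] 0, AlmostAdditive (fun n => cgf (fun v => Real.log
      ‖branchKernel k lam ((E : ℂ) + (η : ℂ) * Complex.I) n v‖) (potLaw (k + 1) ν) s)
      (defect B s) := by
    filter_upwards [eventually_im_pos E] with η hη
    exact (hB.isAlmostAdditive hς hν hη).almostAdditive s hs
  refine (tendsto_div_prod hadd ((hB.isAlmostAdditive_boundary hς hν h).almostAdditive s hs)
    (hB.tendsto_cgf hς hν h hs) (tendsto_level_levelAtTop (k + 1))).congr' ?_
  have hev : ∀ᶠ p : Vertex (k + 1) × ℝ in levelAtTop (k + 1) ×ˢ 𝓝[>] 0,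
      0 < ((E : ℂ) + (p.2 : ℂ) * Complex.I).im := tendsto_snd.eventually (eventually_im_pos E)
  filter_upwards [hev] with p hp
  exact (logMomentRate_eq (a := fun n => cgf (fun v => Real.log
    ‖branchKernel k lam ((E : ℂ) + (p.2 : ℂ) * Complex.I) n v‖) (potLaw (k + 1) ν) s)
    (greenMoment_eq_of_pos hV hς hν hp hs.1 p.1)).symm

end FreeEnergy

end TreeAnderson

/-! ### From the assumptions on the density to the estimates -/

namespace TreeAnderson

theorem exists_uniformBounds {k : ℕ} {lam ς : ℝ} (hlam : 0 ≤ lam) {ϱ : ℝ → ℝ}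
    (hϱ_meas : Measurable ϱ) (hϱ_nonneg : ∀ v, 0 ≤ ϱ v) (hς : ς ∈ Set.Ioo (0 : ℝ) 1)
    (hϱ_min : ∃ c : ℝ, ∀ᵐ v : ℝ, ϱ v ≤ c * minimalFunction ϱ v)
    [IsProbabilityMeasure (volume.withDensity fun v => ENNReal.ofReal (ϱ v))]
    (hν : ∫⁻ v, ‖v‖ₑ ^ ς ∂(volume.withDensity fun v => ENNReal.ofReal (ϱ v)) ≠ ∞) :
    ∃ B, UniformBounds k (volume.withDensity fun v => ENNReal.ofReal (ϱ v)) lam ς B := by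
  rcases hlam.eq_or_lt with rfl | hlam
  · exact exists_uniformBounds_zero
  · have hint : Integrable ϱ := by
      refine ⟨hϱ_meas.aestronglyMeasurable, ?_⟩
      rw [hasFiniteIntegral_iff_ofReal (Eventually.of_forall hϱ_nonneg)]
      have h1 := measure_univ (μ := volume.withDensity fun v => ENNReal.ofReal (ϱ v))
      rw [withDensity_apply _ MeasurableSet.univ, Measure.restrict_univ] at h1
      rw [h1]
      exact ENNReal.one_lt_top
    exact exists_uniformBounds_of_locallyRegular hς hν fun r hr0 hr =>
      exists_locallyRegular hlam hϱ_meas hϱ_nonneg hint hϱ_min hr0 hr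

theorem lintegral_withDensity_rpow_ne_top {ϱ : ℝ → ℝ} (hϱ_meas : Measurable ϱ)
    {ς : ℝ} (hς : 0 < ς)
    (h : Integrable fun v : ℝ => |v| ^ ς * ϱ v) :
    ∫⁻ v, ‖v‖ₑ ^ ς ∂(volume.withDensity fun v => ENNReal.ofReal (ϱ v)) ≠ ∞ := by
  rw [lintegral_withDensity_eq_lintegral_mul _ hϱ_meas.ennreal_ofReal (by fun_prop)]
  refine ne_top_of_le_ne_top h.lintegral_lt_top.ne (lintegral_mono fun v => le_of_eq ?_)
  rw [Pi.mul_apply, ENNReal.ofReal_mul (by positivity), mul_comm, ← ofReal_norm,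
    ENNReal.ofReal_rpow_of_nonneg (norm_nonneg _) hς.le, Real.norm_eq_abs]

end TreeAnderson

theorem theorem3p2
    (K : ℕ) (hK : 1 < K) (lam : ℝ) (hlam : 0 ≤ lam)
    (ϱ : ℝ → ℝ) (hϱ_meas : Measurable ϱ) (hϱ_nonneg : ∀ v, 0 ≤ ϱ v)
    (hϱ_bdd : ∃ M : ℝ, ∀ᵐ v : ℝ, ϱ v ≤ M)
    (ς : ℝ) (hς : ς ∈ Set.Ioo (0 : ℝ) 1)
    (hϱ_moment : Integrable (fun v : ℝ => |v| ^ ς * ϱ v))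
    (hϱ_min : ∃ c : ℝ, ∀ᵐ v : ℝ, ϱ v ≤ c * minimalFunction ϱ v)
    {Ω : Type*} [MeasurableSpace Ω] (P : Measure Ω) [IsProbabilityMeasure P]
    (V : Vertex K → Ω → ℝ) (hV_meas : ∀ x, Measurable (V x))
    (hV_indep : ProbabilityTheory.iIndepFun V P)
    (hV_law : ∀ x, P.map (V x) = volume.withDensity (fun v => ENNReal.ofReal (ϱ v))) :
    ∃ C : ℝ → ℂ → ℝ,
      (∀ s ζ, 0 < C s ζ) ∧
      -- for fixed `s < 1` the constants are locally uniformly bounded up to the real axis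
      (∀ s ∈ Set.Ico (-ς) 1, ∀ A : Set ℝ, IsCompact A →
        ∃ B : ℝ, ∀ E ∈ A, ∀ η ∈ Set.Icc (0 : ℝ) 1, C s ((E : ℂ) + (η : ℂ) * Complex.I) ≤ B) ∧
      -- energies in the upper half-plane
      (∀ ζ : ℂ, 0 < ζ.im →
        (∀ s ∈ Set.Ici (-ς), Tendsto (logMomentRate P V lam s ζ)
          (levelAtTop K) (𝓝 (freeEnergy P V lam s ζ))) ∧
        ConvexOn ℝ (Set.Ici (-ς)) (fun s => freeEnergy P V lam s ζ) ∧
        AntitoneOn (fun s => freeEnergy P V lam s ζ) (Set.Ici (-ς)) ∧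
        Integrable (fun ω => Real.log ‖green lam (fun y => V y ω) ζ
          (root K) (root K)‖) P ∧
        (∀ s ∈ Set.Icc (0 : ℝ) 2,
          -s * lyapunov P V lam ζ ≤ freeEnergy P V lam s ζ ∧
          freeEnergy P V lam s ζ ≤ -s * Real.log (Real.sqrt K)) ∧
        (∀ s ∈ Set.Ici (-ς), ∀ x : Vertex K,
          ENNReal.ofReal ((C s ζ ^ 2)⁻¹ * Real.exp
              ((level x : ℝ) * freeEnergy P V lam s ζ))
            ≤ greenMoment P V lam s ζ x ∧
          greenMoment P V lam s ζ x ≤ ENNReal.ofReal (C s ζ ^ 2 * Real.exp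
              ((level x : ℝ) * freeEnergy P V lam s ζ))) ∧
        HasDerivAt (fun s => freeEnergy P V lam s ζ)
          (-lyapunov P V lam ζ) 0) ∧
      -- almost every real energy, understood as `E + i0`
      (∀ᵐ E : ℝ,
        (∀ᵐ ω ∂P, ∀ x : Vertex K, Tendsto
          (fun η : ℝ => green lam (fun y => V y ω) ((E : ℂ) + (η : ℂ) * Complex.I)
            (root K) x) (𝓝[>] 0)
          (𝓝 (green lam (fun y => V y ω) (E : ℂ) (root K) x))) ∧
        (∀ s ∈ Set.Ico (-ς) 1, Tendsto (logMomentRate P V lam s (E : ℂ))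
          (levelAtTop K) (𝓝 (freeEnergy P V lam s (E : ℂ)))) ∧
        (∀ s ∈ Set.Ico (-ς) 1, Tendsto
          (fun η : ℝ => freeEnergy P V lam s ((E : ℂ) + (η : ℂ) * Complex.I))
          (𝓝[>] 0) (𝓝 (freeEnergy P V lam s (E : ℂ)))) ∧
        (∀ s ∈ Set.Ico (-ς) 1, Tendsto
          (fun p : Vertex K × ℝ => logMomentRate P V lam s
            ((E : ℂ) + (p.2 : ℂ) * Complex.I) p.1)
          (levelAtTop K ×ˢ 𝓝[>] 0)
          (𝓝 (freeEnergy P V lam s (E : ℂ)))) ∧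
        (∀ s ∈ Set.Ico (-ς) 1, ∀ x : Vertex K, Tendsto
          (fun η : ℝ => greenMoment P V lam s ((E : ℂ) + (η : ℂ) * Complex.I) x)
          (𝓝[>] 0) (𝓝 (greenMoment P V lam s (E : ℂ) x))) ∧
        ConvexOn ℝ (Set.Ico (-ς) 1) (fun s => freeEnergy P V lam s (E : ℂ)) ∧
        AntitoneOn (fun s => freeEnergy P V lam s (E : ℂ)) (Set.Ico (-ς) 1) ∧
        Integrable (fun ω => Real.log ‖green lam (fun y => V y ω) (E : ℂ)
          (root K) (root K)‖) P ∧
        (∀ s ∈ Set.Ico (0 : ℝ) 1,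
          -s * lyapunov P V lam (E : ℂ) ≤
            freeEnergy P V lam s (E : ℂ) ∧
          freeEnergy P V lam s (E : ℂ) ≤ -s * Real.log (Real.sqrt K)) ∧
        (∀ s ∈ Set.Ico (-ς) 1, ∀ x : Vertex K,
          ENNReal.ofReal ((C s (E : ℂ) ^ 2)⁻¹ * Real.exp
              ((level x : ℝ) * freeEnergy P V lam s (E : ℂ)))
            ≤ greenMoment P V lam s (E : ℂ) x ∧
          greenMoment P V lam s (E : ℂ) x ≤ ENNReal.ofReal (C s (E : ℂ) ^ 2 * Real.exp
              ((level x : ℝ) * freeEnergy P V lam s (E : ℂ)))) ∧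
        HasDerivAt (fun s => freeEnergy P V lam s (E : ℂ))
          (-lyapunov P V lam (E : ℂ)) 0) := by
  -- Here k counts the children of a path vertex that lie off the path.
  obtain ⟨k, rfl⟩ : ∃ k, K = k + 1 := ⟨K - 1, by omega⟩
  have hprob : IsProbabilityMeasure (volume.withDensity fun v => ENNReal.ofReal (ϱ v)) := by
    rw [← hV_law (root (k + 1))]
    exact Measure.isProbabilityMeasure_map (hV_meas _).aemeasurable
  have hν := lintegral_withDensity_rpow_ne_top hϱ_meas hς.1 hϱ_moment
  obtain ⟨B, hB⟩ := exists_uniformBounds (k := k) hlam hϱ_meas hϱ_nonneg hς hϱ_min hν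
  generalize hνdef : (volume.withDensity fun v => ENNReal.ofReal (ϱ v)) = ν at *
  have hV : MeasurePreserving (fun ω x => V x ω) P (potLaw (k + 1) ν) :=
    ⟨measurable_pi_iff.2 hV_meas, by
      rw [hV_indep.map_fun_eq_infinitePi_map hV_meas]
      simp only [hV_law]⟩
  obtain ⟨b, hb⟩ := exists_moment_constant (k := k) (lam := lam) hς hν
  -- The constant enters squared, hence the division by 2.
  refine ⟨fun s ζ => Real.exp (momentBound k ν lam ς B b s ζ / 2), fun s ζ => Real.exp_pos _,
    fun s hs A hA => ?_, fun ζ hζ => ?_, ?_⟩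
  · obtain ⟨D, hD⟩ := hB.exists_momentBound_le hς hν b hs hA
    refine ⟨Real.exp (D / 2), fun E hE η hη => ?_⟩
    exact Real.exp_le_exp.2 (by linarith [hD E hE η hη])
  · obtain ⟨d, c, hX⟩ := exists_isAlmostAdditive_Ici (k := k) (lam := lam) hς hν hζ
    have hmom := fun s hs x => greenMoment_eq_of_pos (lam := lam) (s := s) hV hς hν hζ hs x
    have h0 := log_norm_green_of_pos (k := k) (lam := lam) hζ
    have heq := hX.eqOn_freeEnergy hmom
    have hsub : ∀ s ∈ Set.Icc (0 : ℝ) 2, s ∈ Set.Ici (-ς) := fun s hs =>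
      (neg_nonpos.2 hς.1.le).trans hs.1
    refine ⟨fun s hs => hX.tendsto_logMomentRate hmom hs, hX.convexOn.congr heq,
      (antitoneOn_cgfRate_branchKernel hζ hX).congr heq, hX.integrable_log_green hV h0,
      fun s hs => ⟨hX.neg_mul_lyapunov_le hV hmom h0 hs.1 (hsub s hs), ?_⟩,
      fun s hs x => hB.greenMoment_bounds_of_pos hV hς hν hb hζ hs x,
      hX.hasDerivAt_freeEnergy hV hmom h0⟩
    exact (heq (hsub s hs)).symm.trans_le
      (cgfRate_le_of_le_two hς hν hζ hX (hsub 2 (by norm_num)) hs)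
  · filter_upwards [hB.ae_hasBoundaryValues] with E h
    have hX := hB.isAlmostAdditive_boundary hς hν h
    have hmom := fun s hs x => hB.greenMoment_eq_boundary (s := s) hV hς hν h hs x
    have h0 : ∀ v, Real.log ‖green lam v E (root (k + 1)) (root (k + 1))‖
      = Real.log ‖boundaryBranch k lam E 0 v‖ := fun v => rfl
    have heq := hX.eqOn_freeEnergy hmom
    have hsub : ∀ s ∈ Set.Ico (0 : ℝ) 1, s ∈ Set.Ico (-ς) 1 := fun s hs =>
      ⟨(neg_nonpos.2 hς.1.le).trans hs.1, hs.2⟩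
    exact ⟨h.ae_tendsto_green_eval hV, fun s hs => hX.tendsto_logMomentRate hmom hs,
      fun s hs => hB.tendsto_freeEnergy hV hς hν h hs,
      fun s hs => hB.tendsto_logMomentRate_prod hV hς hν h hs,
      fun s hs x => hB.tendsto_greenMoment hV hς hν h hs x, hX.convexOn.congr heq,
      (hB.antitoneOn_boundary hς hν h).congr heq, hX.integrable_log_green hV h0,
      fun s hs => ⟨hX.neg_mul_lyapunov_le hV hmom h0 hs.1 (hsub s hs),
        (heq (hsub s hs)).symm.trans_le (hB.boundary_rate_le hς hν h hs)⟩,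
      fun s hs x => hB.greenMoment_bounds_boundary hV hς hν b h hs x,
      hX.hasDerivAt_freeEnergy hV hmom h0⟩
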